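/- **Precise dyadic representation theorem.** Let $d\ge 1$, let $|\cdot|$ be the $\ell^\infty$ norm on $\mathbb{R}^d$, let the scalars be real or complex, and let $\langle u,v\rangle=\int uv$. *Moduli.* Let $\phi,\psi:[0,1]\to[0,1]$ be strictly increasing with value $0$ at $0$ and $1$ at $1$, with $\phi(t)/t$ and $\psi(t)/t$ non-increasing on $(0,1]$, $\int_0^1\phi(t)\frac{dt}{t}<\infty$, $\int_0^1\psi(t)\frac{dt}{t}<\infty$, and $\lim_{t\to0}\phi(t)/t=\infty$. Put $\Psi(t)=\int_0^t\psi(s)\frac{ds}{s}$ and, with $t=2^{-\max\{i,j\}}$, $$\tau(i,j)=\phi(t)^{-d}\,\psi(t/\phi(t))\ \text{ if }\min\{i,j\}>0,\qquad \tau(i,j)=\Psi(t/\phi(t))\ \text{ if }\min\{i,j\}=0,$$ and assume that $\sum_{i,j\ge0}\tau(i,j)<\infty$. *Operators.* Let $\mathcal{E}$ be the linear span of the indicators of (half-open, axis-parallel) cubes and of $C^1_c(\mathbb{R}^d)$. Let $T$ and its transpose $T^*$ be linear maps from $\mathcal{E}$ to $L^1_{\mathrm{loc}}(\mathbb{R}^d)$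 with $\langle g,Tf\rangle=\langle T^*g,f\rangle$ for $f,g\in\mathcal{E}$, and let $K$ be a kernel such that $Tf(x)=\int K(x,y)f(y)\,dy$ for a.e. $x\notin\operatorname{supp}f$, and, for some finite $C_0,C_\psi$, $$|K(x,y)|\le\frac{C_0}{|x-y|^d}\quad(x\ne y),\qquad |K(x,y)-K(x',y)|+|K(y,x)-K(y,x')|\le\frac{C_\psi}{|x-y|^d}\,\psi\Big(\frac{|x-x'|}{|x-y|}\Big)\quad(|x-y|>2|x-x'|).$$ The smallest such constants are $\|K\|_{CZ_0}$ and $\|K\|_{CZ_\psi}$. Assume that $|\langle 1_Q,T1_Q\rangle|\le C|Q|$ for all cubes $Q$ and some finite $C$, the smallest such constant being $\|T\|_{WBP}$, and that $T1,T^*1\in\mathrm{BMO}(\mathbb{R}^d)$; here $T1=b_1$ and $T^*1=b_2$ mean that $\langle b_1,h\rangle=\int T^*h$ and $\langle b_2,h\rangle=\int Th$ for all $h\in\mathcal{E}$ with $\int h=0$. *Dyadic objects.* For $\omega=(\omega_j)_{j\in\mathbb{Z}}\in\Omega=(\{0,1\}^d)^{\mathbb{Z}}$ let $\mathscr{D}^\omega$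 consist of the cubes $I+\sum_{j:2^{-j}<\ell(I)}2^{-j}\omega_j$, where $I$ runs over the standard dyadic cubes $2^{-k}([0,1)^d+m)$, $k\in\mathbb{Z}$, $m\in\mathbb{Z}^d$; let $\mathbb{E}_\omega$ be the expectation with respect to the product of the uniform measures on $\{0,1\}^d$. For a cube $I=I_1\times\cdots\times I_d$ and $\eta\in\{0,1\}^d$ let $h_I^\eta$ be the product of the functions $h^{\eta_n}_{I_n}$, where $h^0_{I_n}=|I_n|^{-1/2}1_{I_n}$ and $h^1_{I_n}=|I_n|^{-1/2}(1_{\text{left half}}-1_{\text{right half}})$; it is cancellative if $\eta\ne0$. A dyadic shift with parameters $(i,j)$ on $\mathscr{D}^\omega$ is an operator $S=\sum_{K\in\mathscr{D}^\omega}A_K$ on $L^2(\mathbb{R}^d)$, with $$A_Kf=\sum_{\substack{I,J\in\mathscr{D}^\omega;\ I,J\subseteq K\\ \ell(I)=2^{-i}\ell(K),\ \ell(J)=2^{-j}\ell(K)}}\ \sum_{\eta,\eta'}a_{IJK}^{\eta\eta'}\langle f,h_I^\eta\rangle h_J^{\eta'},\qquad |a_{IJK}^{\eta\eta'}|\le\frac{\sqrt{|I||J|}}{|K|},$$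 such that all subshifts $\sum_{K\in\mathscr{Q}}A_K$, $\mathscr{Q}\subseteq\mathscr{D}^\omega$, are operators on $L^2(\mathbb{R}^d)$ of norm at most $1$ (the series converging unconditionally in the strong sense). It is cancellative if only $\eta,\eta'\neq0$ occur. The dyadic paraproduct is $\Pi^\omega_bf=\sum_{K\in\mathscr{D}^\omega}\sum_{\eta\ne0}\langle b,h_K^\eta\rangle\langle f\rangle_Kh_K^\eta$, where $\langle f\rangle_K$ is the average of $f$ over $K$. *Conclusion.* There is a constant $c>0$ that depends only on $d$ such that, for all $\phi,\psi,T,K$ as above, there are cancellative dyadic shifts $S^{ij}_\omega$ with parameters $(i,j)$ on $\mathscr{D}^\omega$ ($i,j\ge0$, $\omega\in\Omega$), the paraproducts $\Pi^\omega_{T1}$ and $\Pi^\omega_{T^*1}$ are bounded operators on $L^2(\mathbb{R}^d)$ (with unconditionally convergent defining series) for every $\omega$, and for all $f,g\in C^1_c(\mathbb{R}^d)$ $$\begin{aligned}\langle g,Tf\rangle&=c\,\big(\|K\|_{CZ_0}+\|K\|_{CZ_\psi}\big)\,\mathbb{E}_\omega\sum_{\substack{i,j=0\\ \max\{i,j\}>0}}^\infty\tau(i,j)\langle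 g,S^{ij}_\omega f\rangle\\&\quad+c\,\big(\|K\|_{CZ_0}+\|T\|_{WBP}\big)\,\mathbb{E}_\omega\langle g,S^{00}_\omega f\rangle+\mathbb{E}_\omega\langle g,\Pi^\omega_{T1}f\rangle+\mathbb{E}_\omega\langle g,(\Pi^\omega_{T^*1})^*f\rangle,\end{aligned}$$ where the series converges absolutely for every $\omega$, the four random variables are integrable, and $\langle g,(\Pi^\omega_b)^*f\rangle=\langle\Pi^\omega_bg,f\rangle$. -/

import Mathlib

open MeasureTheory Set Filter Topology

noncomputable section

namespace DyadicRep

/-! ### Moduli of continuity and the coefficients `τ(i,j)` -/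

/-- A modulus of continuity on `[0,1]`: strictly increasing from `φ(0) = 0` to `φ(1) = 1`, with
`t ↦ φ(t)/t` decreasing (in the wide sense, so that `φ(t) = t` is admitted), and with the Dini
condition `∫₀¹ φ(t) dt/t < ∞`. -/
structure IsModulus (φ : ℝ → ℝ) : Prop where
  strictMono : StrictMonoOn φ (Icc 0 1)
  zero : φ 0 = 0
  one : φ 1 = 1
  ratio_anti : AntitoneOn (fun t => φ t / t) (Ioc 0 1)
  dini : IntegrableOn (fun t => φ t / t) (Ioc 0 1) volume

/-- `Ψ(t) = ∫₀ᵗ ψ(s) ds/s`. -/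
def Psi (ψ : ℝ → ℝ) (t : ℝ) : ℝ := ∫ s in (0 : ℝ)..t, ψ s / s

/-- The coefficients `τ(i,j)`. -/
def tau (d : ℕ) (φ ψ : ℝ → ℝ) (i j : ℕ) : ℝ :=
  let t : ℝ := (1 / 2) ^ max i j
  if 0 < min i j then ((φ t) ^ d)⁻¹ * ψ (t / φ t) else Psi ψ (t / φ t)

/-! ### Cubes, test functions, Calderón–Zygmund operators

`Fin d → ℝ` carries the `ℓ^∞` norm and Lebesgue measure. -/

/-- The half-open cube with lower corner `a` and side length `l`. -/
def cube {d : ℕ} (a : Fin d → ℝ) (l : ℝ) : Set (Fin d → ℝ) :=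
  Set.univ.pi fun n => Ico (a n) (a n + l)

/-- The space of functions on which operators act: the linear span of the indicators of all cubes
and of all compactly supported `C¹` functions. -/
def testSpace (𝕜 : Type*) [RCLike 𝕜] (d : ℕ) : Submodule 𝕜 ((Fin d → ℝ) → 𝕜) :=
  Submodule.span 𝕜
    ({f | ∃ (a : Fin d → ℝ) (l : ℝ), 0 < l ∧ f = (cube a l).indicator 1} ∪
      {f | ContDiff ℝ 1 f ∧ HasCompactSupport f})

/-- The indicator of a cube, as a test function. -/
def cubeInd (𝕜 : Type*) [RCLike 𝕜] {d : ℕ} (a : Fin d → ℝ) {l : ℝ} (hl : 0 < l) :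
    testSpace 𝕜 d :=
  ⟨(cube a l).indicator 1, Submodule.subset_span (Or.inl ⟨a, l, hl, rfl⟩)⟩

/-- A compactly supported `C¹` function, as a test function. -/
def ofC1 {𝕜 : Type*} [RCLike 𝕜] {d : ℕ} (f : (Fin d → ℝ) → 𝕜)
    (hf : ContDiff ℝ 1 f) (hf' : HasCompactSupport f) : testSpace 𝕜 d :=
  ⟨f, Submodule.subset_span (Or.inr ⟨hf, hf'⟩)⟩

/-- The (bilinear) pairing `⟨u, v⟩ = ∫ u v`. -/
def pair {𝕜 : Type*} [RCLike 𝕜] {d : ℕ} (u v : (Fin d → ℝ) → 𝕜) : 𝕜 :=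
  ∫ x, u x * v x

/-- The size estimate `|K(x,y)| ≤ C / |x-y|^d`, off the diagonal. -/
def SizeBound {𝕜 : Type*} [RCLike 𝕜] {d : ℕ} (K : (Fin d → ℝ) → (Fin d → ℝ) → 𝕜)
    (C : ℝ) : Prop :=
  0 ≤ C ∧ ∀ x y, x ≠ y → ‖K x y‖ ≤ C / ‖x - y‖ ^ d

/-- The regularity estimate with modulus `ψ` and constant `C`. -/
def SmoothBound {𝕜 : Type*} [RCLike 𝕜] {d : ℕ} (ψ : ℝ → ℝ)
    (K : (Fin d → ℝ) → (Fin d → ℝ) → 𝕜) (C : ℝ) : Prop :=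
  0 ≤ C ∧ ∀ x x' y, 2 * ‖x - x'‖ < ‖x - y‖ →
    ‖K x y - K x' y‖ + ‖K y x - K y x'‖ ≤ C / ‖x - y‖ ^ d * ψ (‖x - x'‖ / ‖x - y‖)

/-- `‖K‖_{CZ_0}`, the smallest admissible constant in the size estimate. -/
def czZeroNorm {𝕜 : Type*} [RCLike 𝕜] {d : ℕ} (K : (Fin d → ℝ) → (Fin d → ℝ) → 𝕜) : ℝ :=
  sInf {C | SizeBound K C}

/-- `‖K‖_{CZ_ψ}`, the smallest admissible constant in the regularity estimate. -/
def czNorm {𝕜 : Type*} [RCLike 𝕜] {d : ℕ} (ψ : ℝ → ℝ)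
    (K : (Fin d → ℝ) → (Fin d → ℝ) → 𝕜) : ℝ :=
  sInf {C | SmoothBound ψ K C}

/-- `T` is a (not necessarily bounded) Calderón–Zygmund operator with kernel `K` satisfying the
standard estimates with modulus `ψ`, and `Tt` is its transpose (dual operator): `T` and `Tt` map
test functions to (classes of) locally integrable functions, `⟨g, T f⟩ = ⟨Tt g, f⟩`, and
`T f (x) = ∫ K(x,y) f(y) dy` for (almost every) `x` outside the support of `f`. -/
structure IsCZOperator {𝕜 : Type*} [RCLike 𝕜] {d : ℕ} (ψ : ℝ → ℝ)
    (K : (Fin d → ℝ) → (Fin d → ℝ) → 𝕜)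
    (T Tt : testSpace 𝕜 d →ₗ[𝕜] ((Fin d → ℝ) →ₘ[volume] 𝕜)) : Prop where
  locInt : ∀ f, LocallyIntegrable (T f) volume
  locInt_transpose : ∀ f, LocallyIntegrable (Tt f) volume
  transpose : ∀ f g : testSpace 𝕜 d, pair (g : (Fin d → ℝ) → 𝕜) (T f) = pair (Tt g) f
  kernel : ∀ f : testSpace 𝕜 d, ∀ᵐ x, x ∉ tsupport (f : (Fin d → ℝ) → 𝕜) →
    T f x = ∫ y, K x y * (f : (Fin d → ℝ) → 𝕜) y
  size : ∃ C, SizeBound K C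
  smooth : ∃ C, SmoothBound ψ K C

/-- The weak boundedness property with constant `C`: `|⟨1_Q, T 1_Q⟩| ≤ C |Q|` for all cubes. -/
def WeakBound {𝕜 : Type*} [RCLike 𝕜] {d : ℕ}
    (T : testSpace 𝕜 d →ₗ[𝕜] ((Fin d → ℝ) →ₘ[volume] 𝕜)) (C : ℝ) : Prop :=
  0 ≤ C ∧ ∀ (a : Fin d → ℝ) (l : ℝ) (hl : 0 < l),
    ‖pair (cubeInd 𝕜 a hl : (Fin d → ℝ) → 𝕜) (T (cubeInd 𝕜 a hl))‖ ≤ C * l ^ d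

/-- `‖T‖_{WBP}`, the smallest admissible constant in the weak boundedness property. -/
def wbpNorm {𝕜 : Type*} [RCLike 𝕜] {d : ℕ}
    (T : testSpace 𝕜 d →ₗ[𝕜] ((Fin d → ℝ) →ₘ[volume] 𝕜)) : ℝ :=
  sInf {C | WeakBound T C}

/-- The space `BMO(ℝᵈ)`. -/
def IsBMO {𝕜 : Type*} [RCLike 𝕜] {d : ℕ} (b : (Fin d → ℝ) → 𝕜) : Prop :=
  LocallyIntegrable b volume ∧ ∃ C : ℝ, ∀ (a : Fin d → ℝ) (l : ℝ), 0 < l →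
    ⨍ x in cube a l, ‖b x - ⨍ y in cube a l, b y‖ ≤ C

/-- `T 1 = b` (modulo constants), where `Tt` is the transpose of `T`: by definition,
`⟨T 1, h⟩ = ⟨1, Tt h⟩ = ∫ Tt h` for the test functions `h` of vanishing integral. (For these the
kernel estimates make `Tt h` integrable over the whole space.) -/
def IsImageOfOne {𝕜 : Type*} [RCLike 𝕜] {d : ℕ}
    (Tt : testSpace 𝕜 d →ₗ[𝕜] ((Fin d → ℝ) →ₘ[volume] 𝕜)) (b : (Fin d → ℝ) → 𝕜) : Prop :=
  ∀ h : testSpace 𝕜 d, ∫ x, (h : (Fin d → ℝ) → 𝕜) x = 0 → pair b h = ∫ x, Tt h x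

/-! ### Random dyadic systems and Haar functions -/

/-- The parameter space `Ω = ({0,1}^d)^ℤ`. -/
abbrev Grid (d : ℕ) : Type := ℤ → Fin d → Bool

/-- The natural probability measure on `Ω`: the `ω_j` are independent and uniform on `{0,1}^d`. -/
def gridMeasure (d : ℕ) : Measure (Grid d) :=
  Measure.infinitePi fun _ : ℤ => (PMF.uniformOfFintype (Fin d → Bool)).toMeasure

/-- The index `(k,m)` stands for the reference cube `I = 2^{-k}([0,1)^d + m)`, and for its
translate `I ∔ ω` in the system `D^ω`. -/
abbrev Idx (d : ℕ) : Type := ℤ × (Fin d → ℤ)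

/-- The side length `2^{-k}`. -/
def side {d : ℕ} (I : Idx d) : ℝ := (2 : ℝ) ^ (-I.1)

/-- The lower corner of `I ∔ ω = I + ∑_{j : 2^{-j} < ℓ(I)} 2^{-j} ω_j`. -/
def corner {d : ℕ} (ω : Grid d) (I : Idx d) (n : Fin d) : ℝ :=
  side I * (I.2 n : ℝ) +
    ∑' j : ℤ, if I.1 < j then (if ω j n then (2 : ℝ) ^ (-j) else 0) else 0

/-- The cube `I ∔ ω` of the dyadic system `D^ω`. -/
def dcube {d : ℕ} (ω : Grid d) (I : Idx d) : Set (Fin d → ℝ) := cube (corner ω I) (side I)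

/-- The one-dimensional Haar functions on `[a, a + l)`: `true` gives the cancellative one,
`false` the non-cancellative one. -/
def haar1 (a l : ℝ) (η : Bool) (x : ℝ) : ℝ :=
  (√l)⁻¹ * if η then (Ico a (a + l / 2)).indicator 1 x - (Ico (a + l / 2) (a + l)).indicator 1 x
    else (Ico a (a + l)).indicator 1 x

/-- The Haar function `h_I^η` on the cube `I ∔ ω`; it is cancellative if and only if `η ≠ 0`. -/
def haar (𝕜 : Type*) [RCLike 𝕜] {d : ℕ} (ω : Grid d) (I : Idx d) (η : Fin d → Bool)
    (x : Fin d → ℝ) : 𝕜 :=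
  ((∏ n, haar1 (corner ω I n) (side I) (η n) (x n) : ℝ) : 𝕜)

/-- The zero element of `{0,1}^d`. -/
def zeroη (d : ℕ) : Fin d → Bool := fun _ => false

theorem measurableSet_cube {d : ℕ} (a : Fin d → ℝ) (l : ℝ) : MeasurableSet (cube a l) :=
  MeasurableSet.univ_pi fun _ => measurableSet_Ico

theorem memLp_haar (𝕜 : Type*) [RCLike 𝕜] {d : ℕ} (ω : Grid d) (I : Idx d)
    (η : Fin d → Bool) : MemLp (haar 𝕜 ω I η) 2 (volume : Measure (Fin d → ℝ)) := by
  have h1 : ∀ a l η, Measurable (haar1 a l η) := by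
    intro a l η
    unfold haar1
    cases η
    · simpa using ((measurable_one.indicator measurableSet_Ico).const_mul _)
    · simpa using (((measurable_one.indicator measurableSet_Ico).sub
        (measurable_one.indicator measurableSet_Ico)).const_mul _)
  have hm : Measurable (haar 𝕜 ω I η) := by
    unfold haar
    refine RCLike.measurable_ofReal.comp ?_
    exact Finset.measurable_prod _ fun n _ => (h1 _ _ _).comp (measurable_pi_apply n)
  have hb : ∀ a l η x, |haar1 a l η x| ≤ (√l)⁻¹ * (Ico a (a + l)).indicator 1 x := by
    intro a l η x
    unfold haar1
    rw [abs_mul, abs_of_nonneg (by positivity : (0 : ℝ) ≤ (√l)⁻¹)]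
    refine mul_le_mul_of_nonneg_left ?_ (by positivity)
    cases η <;> simp only [Set.indicator_apply, mem_Ico, Pi.one_apply] <;> split_ifs <;>
      simp_all <;> linarith
  have hfin : volume (cube (corner ω I) (side I)) ≠ ⊤ := by
    unfold cube
    rw [Real.volume_pi_Ico]
    exact ENNReal.prod_ne_top fun _ _ => ENNReal.ofReal_ne_top
  refine (memLp_indicator_const 2 (measurableSet_cube (corner ω I) (side I))
    ((√(side I))⁻¹ ^ d : ℝ) (Or.inr hfin)).of_le hm.aestronglyMeasurable
    (Eventually.of_forall fun x => ?_)
  unfold haar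
  rw [RCLike.norm_ofReal, Finset.abs_prod]
  refine (Finset.prod_le_prod (fun _ _ => abs_nonneg _) fun n _ => hb _ _ _ _).trans ?_
  refine le_trans ?_ (le_abs_self _)
  rw [Finset.prod_mul_distrib, Finset.prod_const, Finset.card_univ, Fintype.card_fin]
  by_cases hx : x ∈ cube (corner ω I) (side I)
  · rw [Set.indicator_of_mem hx]
    refine mul_le_of_le_one_right (by positivity) (Finset.prod_le_one ?_ ?_) <;>
    · intro n _
      simp only [Set.indicator_apply]
      split_ifs <;> simp
  · rw [Set.indicator_of_notMem hx]
    have : ∃ n, x n ∉ Ico (corner ω I n) (corner ω I n + side I) := by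
      by_contra! h
      exact hx fun n _ => h n
    obtain ⟨n, hn⟩ := this
    rw [Finset.prod_eq_zero (Finset.mem_univ n) (Set.indicator_of_notMem hn _), mul_zero]

/-- The space `L²(ℝᵈ)`. -/
abbrev L2 (𝕜 : Type*) [RCLike 𝕜] (d : ℕ) : Type _ := Lp 𝕜 2 (volume : Measure (Fin d → ℝ))

/-- The Haar function as an element of `L²`. -/
def haarL2 (𝕜 : Type*) [RCLike 𝕜] {d : ℕ} (ω : Grid d) (I : Idx d) (η : Fin d → Bool) :
    L2 𝕜 d :=
  (memLp_haar 𝕜 ω I η).toLp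

/-- A compactly supported `C¹` function as an element of `L²`. -/
def c1L2 {𝕜 : Type*} [RCLike 𝕜] {d : ℕ} (f : (Fin d → ℝ) → 𝕜)
    (hf : ContDiff ℝ 1 f) (hf' : HasCompactSupport f) : L2 𝕜 d :=
  (hf.continuous.memLp_of_hasCompactSupport (p := 2) hf').toLp

/-! ### Dyadic shifts and paraproducts -/

/-- `I ⊆ K` and `ℓ(I) = 2^{-i} ℓ(K)`, in `D^ω`. -/
def IsSub {d : ℕ} (ω : Grid d) (i : ℕ) (I K : Idx d) : Prop :=
  dcube ω I ⊆ dcube ω K ∧ side I = (1 / 2) ^ i * side K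

/-- Coefficients `a_{IJK}` of a dyadic shift, with the dependence on the types `η`, `η'` of the
Haar functions `h_I = h_I^η` and `h_J = h_J^{η'}` written out: `a I J K η η'`. -/
abbrev Coeffs (𝕜 : Type*) (d : ℕ) : Type _ :=
  Idx d → Idx d → Idx d → (Fin d → Bool) → (Fin d → Bool) → 𝕜

/-- `A_K f = ∑_{I,J} a_{IJK} ⟨f, h_I⟩ h_J`, over the (finitely many) cubes `I, J ⊆ K` of `D^ω`
with `ℓ(I) = 2^{-i} ℓ(K)` and `ℓ(J) = 2^{-j} ℓ(K)`, and over all types of Haar functions. -/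
def avgOp {𝕜 : Type*} [RCLike 𝕜] {d : ℕ} (ω : Grid d) (i j : ℕ) (a : Coeffs 𝕜 d) (K : Idx d)
    (f : L2 𝕜 d) : L2 𝕜 d :=
  ∑ᶠ (I : Idx d) (_ : IsSub ω i I K) (J : Idx d) (_ : IsSub ω j J K),
    ∑ η : Fin d → Bool, ∑ η' : Fin d → Bool,
      (a I J K η η' * pair f (haar 𝕜 ω I η)) • haarL2 𝕜 ω J η'

/-- `S` is the dyadic shift on `D^ω` with parameters `(i,j)` and coefficients `a`: these satisfy
`|a_{IJK}| ≤ √(|I||J|)/|K|`, every subshift `S_𝒬 = ∑_{K ∈ 𝒬} A_K` is an operator on `L²` of norm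
at most one, and `S` is the sum over all cubes `K`. -/
structure IsShiftWith {𝕜 : Type*} [RCLike 𝕜] {d : ℕ} (ω : Grid d) (i j : ℕ) (a : Coeffs 𝕜 d)
    (S : L2 𝕜 d →L[𝕜] L2 𝕜 d) : Prop where
  coeff_bound : ∀ I J K η η', IsSub ω i I K → IsSub ω j J K →
    ‖a I J K η η'‖ ≤ √(side I ^ d * side J ^ d) / side K ^ d
  subshift : ∀ 𝒬 : Set (Idx d), ∃ SQ : L2 𝕜 d →L[𝕜] L2 𝕜 d, ‖SQ‖ ≤ 1 ∧
    ∀ f, HasSum (fun K : 𝒬 => avgOp ω i j a K f) (SQ f)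
  hasSum : ∀ f, HasSum (fun K : Idx d => avgOp ω i j a K f) (S f)

/-- `S` is a cancellative dyadic shift on `D^ω` with parameters `(i,j)`: only cancellative Haar
functions occur. -/
def IsCancellativeShift {𝕜 : Type*} [RCLike 𝕜] {d : ℕ} (ω : Grid d) (i j : ℕ)
    (S : L2 𝕜 d →L[𝕜] L2 𝕜 d) : Prop :=
  ∃ a : Coeffs 𝕜 d, (∀ I J K η η', η = zeroη d ∨ η' = zeroη d → a I J K η η' = 0) ∧
    IsShiftWith ω i j a S

/-- `P` is the dyadic paraproduct `Π_b f = ∑_K ⟨b, h_K⟩ ⟨f⟩_K h_K` on `D^ω` (with the sum over the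
cancellative Haar functions of each cube), as a bounded operator on `L²`. -/
def IsParaproduct {𝕜 : Type*} [RCLike 𝕜] {d : ℕ} (ω : Grid d) (b : (Fin d → ℝ) → 𝕜)
    (P : L2 𝕜 d →L[𝕜] L2 𝕜 d) : Prop :=
  ∀ f : L2 𝕜 d, HasSum (fun K : Idx d => ∑ η with η ≠ zeroη d,
    (pair b (haar 𝕜 ω K η) * ⨍ x in dcube ω K, f x) • haarL2 𝕜 ω K η) (P f)

end DyadicRep

end

/-! Write B(u,v) = ⟨u,Tv⟩. Fix ω, let E_n f be the average of f over the cubes of level n, and put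
D_n = E_{n+1} - E_n. The identity B(g₁,f₁) - B(g₀,f₀) = B((g₀+g₁)/2, f₁-f₀) + B(g₁-g₀, (f₀+f₁)/2),
summed over all levels, writes B(g,f) as a series of terms B((E_n g + E_{n+1} g)/2, D_n f) and of
terms of the same form for the transpose with f and g exchanged (`bform_eq`). Hence only one half
has to be studied. The limits at both ends need care, because T only maps test functions to locally
integrable functions (`tendsto_bform_avT_avT`, `tendsto_bform_avT_avT_neg`).

Expand D_n f in the Haar functions h_I and cut the other argument into the translates I+m of I on
its own level. From the average of g on I+m subtract ⟨g⟩_I; since the numbers ⟨1_{I+m}, T h_I⟩ add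
up to ⟨T*1, h_I⟩, the subtracted terms are exactly the paraproduct (`hasSum_term`). With k = `lev
m`, so that 2^k is comparable to |m| for m ≠ 0, the matrix entries are at most a constant times
|I|^{1/2} 2^{-kd} ψ(2^{-k}). This follows from smoothness and cancellation for distant cubes, from
the size of the kernel for adjacent cubes, and from weak boundedness for m = 0 (`offDiag_bound`,
`norm_entry_self_le`). As f and g are Lipschitz with bounded support, everything converges
absolutely, with bounds independent of ω.

Randomness is used once. Call a pair I, I+m good if the two cubes have the same ancestor k
generations up. After k-1 generations the ancestors coincide or touch, so at least one of the 2^d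
values of the next digit of ω makes the pair good. The quantities attached to the pair depend only
on digits finer than the level of I. Multiplication by 2^d/(number of good values) on the good
event, and by 0 elsewhere, therefore does not change the expectation (`goodCount_pos`,
`integral_weight_mul`). No pair is discarded: each is only restricted to the systems in which it is
good, at the price of a factor of at most 2^d.

For a good pair, both averages of g are telescoped up to the common ancestor (`hasSum_split`). The
martingale difference on the r-th ancestor of I+m belongs to a shift with parameters (k, k-r), and
the one on the r-th ancestor of I to a shift with parameters (r, 0), where all m with k ≥ r
contribute. Counting cubes bounds the coefficients by ψ(2^{-i}) in the first case and by Ψ(2^{-i})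
in the second (`norm_coefJ_le_of_pos`, `norm_coefI_le`). Since t ≤ t/φ(t), both are controlled by τ
(`le_two_mul_tau`, `Psi_le_tau`), and summability of τ gives the summability of kψ(2^{-k}) that
permits the rearrangement.

Cancellative operators with such coefficients are contractive by Cauchy–Schwarz and the
orthogonality of the Haar functions (`exists_subshift`). The paraproducts are bounded by a Carleson
condition for `BMO` symbols, proved by an inductive stopping argument (`treeMean_sq_le_of_bmo`), and
by the Carleson embedding theorem, proved with a Bellman function (`carleson_tree`). -/

noncomputable section

namespace DyadicRep

variable {d : ℕ}

/-! ### The geometry of the dyadic systems -/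

/-- A bit, as an integer. -/
def bit (b : Bool) : ℤ := if b then 1 else 0

lemma bit_cases (b : Bool) : bit b = 0 ∨ bit b = 1 := by cases b <;> simp [bit]

/-- The translation that takes the standard dyadic cubes of side `2^{-k}` to those of `D^ω`. -/
def off (ω : Grid d) (k : ℤ) (n : Fin d) : ℝ :=
  ∑' j : ℤ, if k < j then (if ω j n then (2 : ℝ) ^ (-j) else 0) else 0

lemma corner_eq (ω : Grid d) (I : Idx d) (n : Fin d) :
    corner ω I n = side I * (I.2 n : ℝ) + off ω I.1 n := rfl

lemma side_pos (I : Idx d) : 0 < side I := by unfold side; positivity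

lemma hasSum_two_zpow_tail (k : ℤ) :
    HasSum (fun j : ℤ => if k < j then (2 : ℝ) ^ (-j) else 0) (2 ^ (-k)) := by
  have hi : Function.Injective (fun i : ℕ => k + 1 + (i : ℤ)) := fun a b h => by simpa using h
  rw [← hi.hasSum_iff]
  · have : (fun j : ℤ => if k < j then (2 : ℝ) ^ (-j) else 0) ∘ (fun i : ℕ => k + 1 + (i : ℤ)) =
        fun i : ℕ => (2 : ℝ) ^ (-k) / 2 / 2 ^ i := by
      funext i
      have : k < k + 1 + (i : ℤ) := by omega
      simp only [Function.comp, this, if_true]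
      rw [show -(k + 1 + (i : ℤ)) = -k - 1 - i by ring, zpow_sub₀ two_ne_zero,
        zpow_sub₀ two_ne_zero]
      simp
    rw [this]
    exact hasSum_geometric_two' _
  · intro j hj
    rw [if_neg]
    intro h
    exact hj ⟨(j - k - 1).toNat, by simp; omega⟩

lemma off_term_nonneg (ω : Grid d) (k : ℤ) (n : Fin d) (j : ℤ) :
    0 ≤ (if k < j then (if ω j n then (2 : ℝ) ^ (-j) else 0) else 0) := by
  split_ifs <;> positivity

lemma off_term_le (ω : Grid d) (k : ℤ) (n : Fin d) (j : ℤ) :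
    (if k < j then (if ω j n then (2 : ℝ) ^ (-j) else 0) else 0) ≤
      if k < j then (2 : ℝ) ^ (-j) else 0 := by
  split_ifs <;> first | exact le_rfl | positivity

lemma off_summable (ω : Grid d) (k : ℤ) (n : Fin d) :
    Summable fun j : ℤ => (if k < j then (if ω j n then (2 : ℝ) ^ (-j) else 0) else 0) :=
  Summable.of_nonneg_of_le (off_term_nonneg ω k n) (off_term_le ω k n)
    (hasSum_two_zpow_tail k).summable

lemma off_nonneg (ω : Grid d) (k : ℤ) (n : Fin d) : 0 ≤ off ω k n :=
  tsum_nonneg (off_term_nonneg ω k n)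

lemma off_le (ω : Grid d) (k : ℤ) (n : Fin d) : off ω k n ≤ 2 ^ (-k) := by
  rw [← (hasSum_two_zpow_tail k).tsum_eq]
  exact (off_summable ω k n).tsum_le_tsum (off_term_le ω k n) (hasSum_two_zpow_tail k).summable

/-- Nesting of the levels comes from here: two consecutive translations differ by one digit, a
multiple of the finer side length. -/
lemma off_succ (ω : Grid d) (k : ℤ) (n : Fin d) :
    off ω k n = 2 ^ (-(k + 1)) * (bit (ω (k + 1) n) : ℝ) + off ω (k + 1) n := by
  unfold off
  rw [(off_summable ω k n).tsum_eq_add_tsum_ite (k + 1)]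
  congr 1
  · simp [bit]
  · refine tsum_congr fun j => ?_
    by_cases h : j = k + 1
    · simp [h]
    · have : k < j ↔ k + 1 < j := by omega
      simp [h, this]

/-- Only digits finer than the level move a cube. This is the source of all independence used under
the expectation. -/
lemma off_congr {ω ω' : Grid d} {k : ℤ} (h : ∀ j, k < j → ω j = ω' j) : off ω k = off ω' k := by
  funext n
  refine tsum_congr fun j => ?_
  split_ifs with h1 <;> simp_all

/-- The position at level `k` of the cube of `D^ω` that contains `x`. -/
def cell (ω : Grid d) (k : ℤ) (x : Fin d → ℝ) : Fin d → ℤ :=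
  fun n => ⌊(x n - off ω k n) * 2 ^ k⌋

/-- Rescaling to side length one turns membership into a statement about integer parts. Partition
and nesting of the cubes then become integer arithmetic. -/
lemma mem_dcube_iff (ω : Grid d) (I : Idx d) (x : Fin d → ℝ) :
    x ∈ dcube ω I ↔ cell ω I.1 x = I.2 := by
  have hs : side I * 2 ^ I.1 = 1 := by
    unfold side; rw [← zpow_add₀ two_ne_zero]; simp
  have hp : (0 : ℝ) < 2 ^ I.1 := by positivity
  unfold dcube cube cell
  simp only [mem_univ_pi, mem_Ico, funext_iff, Int.floor_eq_iff, corner_eq]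
  refine forall_congr' fun n => and_congr ?_ ?_
  · rw [← mul_le_mul_iff_left₀ hp, add_mul, mul_right_comm, hs]
    constructor <;> intro h <;> linarith
  · rw [← mul_lt_mul_iff_left₀ hp, add_mul, add_mul, mul_right_comm, hs]
    constructor <;> intro h <;> linarith

lemma mem_dcube_cell (ω : Grid d) (k : ℤ) (x : Fin d → ℝ) : x ∈ dcube ω (k, cell ω k x) :=
  (mem_dcube_iff ω _ x).2 rfl

lemma corner_mem (ω : Grid d) (I : Idx d) : corner ω I ∈ dcube ω I := by
  intro n _
  exact ⟨le_rfl, by linarith [side_pos I]⟩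

lemma eq_of_mem_dcube {ω : Grid d} {I J : Idx d} {x : Fin d → ℝ} (h : I.1 = J.1)
    (hI : x ∈ dcube ω I) (hJ : x ∈ dcube ω J) : I = J := by
  rw [mem_dcube_iff] at hI hJ
  refine Prod.ext h ?_
  rw [← hI, ← hJ, h]

/-- The dyadic children of a cube. -/
def child (ω : Grid d) (I : Idx d) (ε : Fin d → Bool) : Idx d :=
  (I.1 + 1, fun n => 2 * I.2 n + bit (ω (I.1 + 1) n) + bit (ε n))

/-- The dyadic parent of a cube. -/
def par (ω : Grid d) (I : Idx d) : Idx d :=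
  (I.1 - 1, fun n => (I.2 n - bit (ω I.1 n)) / 2)

/-- The `i`-th dyadic ancestor of a cube. -/
def anc (ω : Grid d) : ℕ → Idx d → Idx d
  | 0, I => I
  | i + 1, I => par ω (anc ω i I)

/-- The position of a cube among its siblings. -/
def pos (ω : Grid d) (I : Idx d) : Fin d → Bool :=
  fun n => (I.2 n - bit (ω I.1 n)) % 2 = 1

lemma par_child (ω : Grid d) (I : Idx d) (ε : Fin d → Bool) : par ω (child ω I ε) = I := by
  refine Prod.ext (by simp [par, child]) (funext fun n => ?_)
  simp only [par, child]
  rcases bit_cases (ε n) with h | h <;> omega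

lemma child_par (ω : Grid d) (I : Idx d) : child ω (par ω I) (pos ω I) = I := by
  refine Prod.ext (by simp [par, child]) (funext fun n => ?_)
  simp only [par, child, pos, sub_add_cancel]
  by_cases h : (I.2 n - bit (ω I.1 n)) % 2 = 1
  · have h2 : bit (decide ((I.2 n - bit (ω I.1 n)) % 2 = 1)) = 1 := by
      rw [decide_eq_true h]; rfl
    rw [h2]; omega
  · have h2 : bit (decide ((I.2 n - bit (ω I.1 n)) % 2 = 1)) = 0 := by
      rw [decide_eq_false h]; rfl
    rw [h2]; omega

lemma bit_injective : Function.Injective bit := by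
  intro a b; cases a <;> cases b <;> simp [bit]

lemma child_injective (ω : Grid d) (I : Idx d) : Function.Injective (child ω I) := by
  intro ε ε' h
  funext n
  have := congrFun (congrArg Prod.snd h) n
  simp only [child] at this
  exact bit_injective (by omega)

lemma side_child (ω : Grid d) (I : Idx d) (ε : Fin d → Bool) :
    side (child ω I ε) = side I / 2 := by
  simp only [side, child, neg_add, zpow_add₀ (two_ne_zero' ℝ)]
  norm_num; ring

lemma side_par (ω : Grid d) (I : Idx d) : side (par ω I) = 2 * side I := by
  conv_rhs => rw [← child_par ω I, side_child]
  ring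

lemma corner_child (ω : Grid d) (I : Idx d) (ε : Fin d → Bool) (n : Fin d) :
    corner ω (child ω I ε) n = corner ω I n + (bit (ε n) : ℝ) * (side I / 2) := by
  rw [corner_eq, corner_eq, side_child, off_succ ω I.1]
  simp only [child, side]
  push_cast
  rw [neg_add, zpow_add₀ (two_ne_zero' ℝ)]
  norm_num; ring

lemma dcube_child_subset (ω : Grid d) (I : Idx d) (ε : Fin d → Bool) :
    dcube ω (child ω I ε) ⊆ dcube ω I := by
  intro x hx n hn
  have h : x n ∈ Ico _ _ := hx n hn
  change x n ∈ Ico _ _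
  rw [corner_child, side_child, mem_Ico] at h
  have := side_pos I
  rcases bit_cases (ε n) with h1 | h1 <;> rw [h1] at h <;> push_cast at h <;>
    constructor <;> linarith [h.1, h.2]

lemma dcube_subset_par (ω : Grid d) (I : Idx d) : dcube ω I ⊆ dcube ω (par ω I) := by
  conv_lhs => rw [← child_par ω I]
  exact dcube_child_subset _ _ _

lemma par_cell (ω : Grid d) (k : ℤ) (x : Fin d → ℝ) :
    par ω (k, cell ω k x) = (k - 1, cell ω (k - 1) x) :=
  eq_of_mem_dcube rfl (dcube_subset_par ω _ (mem_dcube_cell ω k x)) (mem_dcube_cell ω _ x)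

lemma anc_fst (ω : Grid d) (i : ℕ) (I : Idx d) : (anc ω i I).1 = I.1 - i := by
  induction i with
  | zero => simp [anc]
  | succ i ih => simp only [anc, par, ih]; push_cast; ring

lemma anc_add (ω : Grid d) (i j : ℕ) (I : Idx d) : anc ω (i + j) I = anc ω i (anc ω j I) := by
  induction i with
  | zero => simp [anc]
  | succ i ih => rw [Nat.succ_add]; simp only [anc, ih]

lemma anc_succ' (ω : Grid d) (i : ℕ) (I : Idx d) : anc ω (i + 1) I = anc ω i (par ω I) :=
  anc_add ω i 1 I

lemma side_anc (ω : Grid d) (i : ℕ) (I : Idx d) : side (anc ω i I) = 2 ^ i * side I := by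
  induction i with
  | zero => simp [anc]
  | succ i ih => rw [anc, side_par, ih]; ring

lemma dcube_subset_anc (ω : Grid d) (i : ℕ) (I : Idx d) : dcube ω I ⊆ dcube ω (anc ω i I) := by
  induction i with
  | zero => exact subset_rfl
  | succ i ih => exact ih.trans (dcube_subset_par ω _)

/-- The side length determines the level, and two cubes of one level that share a point coincide.
The geometric relation in the definition of a shift is thereby replaced by the combinatorial one. -/
lemma isSub_iff (ω : Grid d) (i : ℕ) (I K : Idx d) : IsSub ω i I K ↔ anc ω i I = K := by
  constructor
  · rintro ⟨h1, h2⟩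
    have h3 : I.1 = K.1 + i := by
      unfold side at h2
      have : ((1 : ℝ) / 2) ^ i = 2 ^ (-(i : ℤ)) := by simp
      rw [this, ← zpow_add₀ two_ne_zero] at h2
      have := zpow_right_injective₀ (by norm_num : (0 : ℝ) < 2) (by norm_num) h2
      omega
    refine eq_of_mem_dcube ?_ (dcube_subset_anc ω i I (corner_mem ω I)) (h1 (corner_mem ω I))
    rw [anc_fst]; omega
  · rintro rfl
    refine ⟨dcube_subset_anc ω i I, ?_⟩
    rw [side_anc, ← mul_assoc, ← mul_pow]; norm_num

/-- The `i`-th generation dyadic descendants of a cube. -/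
def desc (ω : Grid d) : ℕ → Idx d → Finset (Idx d)
  | 0, K => {K}
  | i + 1, K => (Finset.univ ×ˢ desc ω i K).image fun p => child ω p.2 p.1

lemma mem_desc {ω : Grid d} {i : ℕ} {I K : Idx d} : I ∈ desc ω i K ↔ anc ω i I = K := by
  induction i generalizing I with
  | zero => simp [desc, anc]
  | succ i ih =>
    simp only [desc, Finset.mem_image, Finset.mem_product, Finset.mem_univ, true_and]
    constructor
    · rintro ⟨⟨ε, L⟩, hL, rfl⟩
      rw [anc_succ', par_child]; exact ih.1 hL
    · intro h
      exact ⟨(pos ω I, par ω I), ih.2 (by rw [← h, anc_succ']), child_par ω I⟩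

lemma sum_desc_succ {M : Type*} [AddCommMonoid M] (ω : Grid d) (i : ℕ) (K : Idx d)
    (f : Idx d → M) :
    ∑ I ∈ desc ω (i + 1) K, f I = ∑ L ∈ desc ω i K, ∑ ε, f (child ω L ε) := by
  rw [desc, Finset.sum_image, Finset.sum_product_right]
  rintro ⟨ε, L⟩ _ ⟨ε', L'⟩ _ h
  simp only at h
  have h1 : L = L' := by rw [← par_child ω L ε, h, par_child]
  subst h1
  rw [child_injective ω L h]

lemma card_desc (ω : Grid d) (i : ℕ) (K : Idx d) : (desc ω i K).card = 2 ^ (i * d) := by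
  induction i with
  | zero => simp [desc]
  | succ i ih =>
    rw [Finset.card_eq_sum_ones, sum_desc_succ]
    simp [ih, Nat.succ_mul, pow_add]

lemma dcube_eq_iUnion_child (ω : Grid d) (I : Idx d) :
    dcube ω I = ⋃ ε, dcube ω (child ω I ε) := by
  refine subset_antisymm (fun x hx => ?_) (iUnion_subset fun ε => dcube_child_subset ω I ε)
  have h1 := mem_dcube_cell ω (I.1 + 1) x
  have h2 : par ω (I.1 + 1, cell ω (I.1 + 1) x) = I :=
    eq_of_mem_dcube (by simp [par]) (dcube_subset_par ω _ h1) hx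
  refine mem_iUnion.2 ⟨pos ω (I.1 + 1, cell ω (I.1 + 1) x), ?_⟩
  have h3 := child_par ω (I.1 + 1, cell ω (I.1 + 1) x)
  rw [h2] at h3
  rw [h3]; exact h1

lemma disjoint_dcube {ω : Grid d} {I J : Idx d} (h : I.1 = J.1) (hne : I ≠ J) :
    Disjoint (dcube ω I) (dcube ω J) :=
  Set.disjoint_left.2 fun _ hI hJ => hne (eq_of_mem_dcube h hI hJ)

lemma iUnion_dcube (ω : Grid d) (k : ℤ) : ⋃ a, dcube ω (k, a) = univ :=
  eq_univ_of_forall fun x => mem_iUnion.2 ⟨_, mem_dcube_cell ω k x⟩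

lemma measurableSet_dcube (ω : Grid d) (I : Idx d) : MeasurableSet (dcube ω I) :=
  measurableSet_cube _ _

lemma volume_cube (a : Fin d → ℝ) {l : ℝ} (hl : 0 ≤ l) :
    volume (cube a l) = ENNReal.ofReal (l ^ d) := by
  rw [cube, Real.volume_pi_Ico]
  simp [ENNReal.ofReal_pow hl]

lemma volume_real_cube (a : Fin d → ℝ) {l : ℝ} (hl : 0 ≤ l) :
    volume.real (cube a l) = l ^ d := by
  rw [measureReal_def, volume_cube a hl, ENNReal.toReal_ofReal (by positivity)]

lemma volume_real_dcube (ω : Grid d) (I : Idx d) : volume.real (dcube ω I) = side I ^ d :=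
  volume_real_cube _ (side_pos I).le

lemma volume_dcube_ne_top (ω : Grid d) (I : Idx d) : volume (dcube ω I) ≠ ⊤ := by
  rw [dcube, volume_cube _ (side_pos I).le]; exact ENNReal.ofReal_ne_top

lemma cube_subset_Icc (a : Fin d → ℝ) (l : ℝ) : cube a l ⊆ Icc a (fun n => a n + l) :=
  fun _ hx => ⟨fun n => (hx n trivial).1, fun n => (hx n trivial).2.le⟩

lemma integrableOn_cube {E : Type*} [NormedAddCommGroup E] {f : (Fin d → ℝ) → E}
    (hf : LocallyIntegrable f volume) (a : Fin d → ℝ) (l : ℝ) : IntegrableOn f (cube a l) :=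
  (hf.integrableOn_isCompact isCompact_Icc).mono_set (cube_subset_Icc a l)

lemma setIntegral_dcube_eq_sum_child {E : Type*} [NormedAddCommGroup E] [NormedSpace ℝ E]
    (ω : Grid d) (I : Idx d) {f : (Fin d → ℝ) → E}
    (hf : IntegrableOn f (dcube ω I)) :
    ∫ x in dcube ω I, f x = ∑ ε, ∫ x in dcube ω (child ω I ε), f x := by
  rw [dcube_eq_iUnion_child ω I, integral_iUnion_fintype]
  · exact fun ε => measurableSet_dcube _ _
  · intro ε ε' h
    exact disjoint_dcube rfl fun h' => h (child_injective ω I h')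
  · exact fun ε => hf.mono_set (dcube_child_subset ω I ε)

/-! ### Dependence on the random parameter -/

/-- The translation is a uniformly convergent series of functions of single digits, hence continuous
on the product space. -/
lemma measurable_off (k : ℤ) : Measurable fun ω : Grid d => off ω k := by
  refine measurable_pi_lambda _ fun n => Continuous.measurable ?_
  unfold off
  refine continuous_tsum (fun j => ?_) (hasSum_two_zpow_tail k).summable fun j ω => ?_
  · split_ifs
    · exact (continuous_of_discreteTopology
        (f := fun b : Bool => if b then (2 : ℝ) ^ (-j) else 0)).comp
        ((continuous_apply n).comp (continuous_apply j))
    · exact continuous_const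
  · rw [Real.norm_of_nonneg (off_term_nonneg ω k n j)]
    exact off_term_le ω k n j

lemma measurable_corner (I : Idx d) : Measurable fun ω : Grid d => corner ω I := by
  refine measurable_pi_lambda _ fun n => ?_
  simp only [corner_eq]
  exact ((measurable_pi_apply n).comp (measurable_off I.1)).const_add _

lemma measurable_par_snd (I : Idx d) : Measurable fun ω : Grid d => par ω I := by
  have : (fun ω : Grid d => par ω I) = (fun v : Fin d → Bool =>
      ((I.1 - 1, fun n => (I.2 n - bit (v n)) / 2) : Idx d)) ∘ fun ω => ω I.1 := rfl
  rw [this]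
  exact (measurable_of_countable _).comp (measurable_pi_apply _)

/-- There are only countably many cubes, so measurability of the parent map for each fixed cube can
be iterated. -/
lemma measurable_anc (i : ℕ) (I : Idx d) : Measurable fun ω : Grid d => anc ω i I := by
  induction i with
  | zero => exact measurable_const
  | succ i ih =>
    simp only [anc]
    exact (measurable_from_prod_countable_left (f := fun p : Grid d × Idx d => par p.1 p.2)
      fun J => measurable_par_snd J).comp (measurable_id.prodMk ih)

lemma corner_congr {ω ω' : Grid d} {I : Idx d} (h : ∀ j, I.1 < j → ω j = ω' j) :
    corner ω I = corner ω' I := by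
  funext n
  rw [corner_eq, corner_eq, off_congr h]

end DyadicRep

end

noncomputable section

namespace DyadicRep

variable {d : ℕ} {𝕜 : Type*} [RCLike 𝕜]

/-! ### Haar functions and averages -/

/-- The sign of the Haar function of type `η` on the child at position `ε`. -/
def sg (η ε : Fin d → Bool) : ℝ := ∏ n, if η n && ε n then -1 else 1

/-- The square root of the volume of a dyadic cube. -/
def rt (I : Idx d) : ℝ := √(side I) ^ d

lemma rt_pos (I : Idx d) : 0 < rt I := pow_pos (Real.sqrt_pos.2 (side_pos I)) _

lemma rt_sq (I : Idx d) : rt I * rt I = side I ^ d := by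
  rw [rt, ← mul_pow, Real.mul_self_sqrt (side_pos I).le]

lemma sg_comm (η ε : Fin d → Bool) : sg η ε = sg ε η := by
  simp only [sg, Bool.and_comm]

lemma abs_sg (η ε : Fin d → Bool) : |sg η ε| = 1 := by
  rw [sg, Finset.abs_prod]
  exact Finset.prod_eq_one fun n _ => by split_ifs <;> simp

lemma sg_zero_left (ε : Fin d → Bool) : sg (zeroη d) ε = 1 := by simp [sg, zeroη]

/-- The sum factors over the coordinates, and a coordinate in which ε and ε' differ contributes the
factor 1 - 1 = 0. This is the orthogonality of the Walsh characters. -/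
lemma sum_sg_mul_sg (ε ε' : Fin d → Bool) :
    ∑ η, sg η ε * sg η ε' = if ε = ε' then (2 : ℝ) ^ d else 0 := by
  have h1 : ∑ η, sg η ε * sg η ε' =
      ∏ n, ∑ b : Bool, ((if b && ε n then (-1 : ℝ) else 1) * if b && ε' n then -1 else 1) := by
    rw [Finset.prod_univ_sum, Fintype.piFinset_univ]
    refine Finset.sum_congr rfl fun η _ => ?_
    rw [sg, sg, Finset.prod_mul_distrib]
  rw [h1]
  split_ifs with h
  · subst h
    rw [Finset.prod_congr rfl (g := fun _ => (2 : ℝ)), Finset.prod_const, Finset.card_univ,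
      Fintype.card_fin]
    intro n _
    cases ε n <;> norm_num
  · obtain ⟨n, hn⟩ := Function.ne_iff.1 h
    refine Finset.prod_eq_zero (Finset.mem_univ n) ?_
    revert hn
    cases ε n <;> cases ε' n <;> norm_num

lemma sum_sg_mul_sg' (η η' : Fin d → Bool) :
    ∑ ε, sg η ε * sg η' ε = if η = η' then (2 : ℝ) ^ d else 0 := by
  simp_rw [sg_comm η, sg_comm η', sum_sg_mul_sg]

lemma sum_sg {η : Fin d → Bool} (hη : η ≠ zeroη d) : ∑ ε, sg η ε = 0 := by
  have := sum_sg_mul_sg' η (zeroη d)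
  simpa [sg_zero_left, hη] using this

lemma haar_of_mem_child (ω : Grid d) {I : Idx d} {η ε : Fin d → Bool} {x : Fin d → ℝ}
    (hx : x ∈ dcube ω (child ω I ε)) :
    haar 𝕜 ω I η x = ((sg η ε * (rt I)⁻¹ : ℝ) : 𝕜) := by
  unfold haar
  congr 1
  have hc : ((√(side I)) ^ d)⁻¹ = ∏ _n : Fin d, (√(side I))⁻¹ := by simp
  rw [sg, rt, hc, ← Finset.prod_mul_distrib]
  refine Finset.prod_congr rfl fun n _ => ?_
  have h : x n ∈ Ico _ _ := hx n trivial
  rw [corner_child, side_child, mem_Ico] at h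
  have hs := side_pos I
  rw [haar1, mul_comm]
  congr 1
  cases hε : ε n <;> rw [hε] at h <;> simp [bit] at h <;> cases η n <;>
    simp only [Bool.and_true, Bool.and_false, if_true, Bool.false_eq_true, if_false,
      Set.indicator_apply, mem_Ico, Pi.one_apply]
  · rw [if_pos ⟨by linarith, by linarith⟩]
  · rw [if_pos ⟨by linarith, by linarith⟩, if_neg (fun h' => by linarith [h'.1]), sub_zero]
  · rw [if_pos ⟨by linarith, by linarith⟩]
  · rw [if_neg (fun h' => by linarith [h'.2]), if_pos ⟨by linarith, by linarith⟩, zero_sub]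

lemma haar_of_notMem (ω : Grid d) {I : Idx d} {η : Fin d → Bool} {x : Fin d → ℝ}
    (hx : x ∉ dcube ω I) : haar 𝕜 ω I η x = 0 := by
  have : ∃ n, x n ∉ Ico (corner ω I n) (corner ω I n + side I) := by
    by_contra! h
    exact hx fun n _ => h n
  obtain ⟨n, hn⟩ := this
  unfold haar
  rw [Finset.prod_eq_zero (Finset.mem_univ n), RCLike.ofReal_zero]
  have hs := side_pos I
  have h1 : x n ∉ Ico (corner ω I n) (corner ω I n + side I / 2) :=
    fun h => hn ⟨h.1, by linarith [h.2]⟩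
  have h2 : x n ∉ Ico (corner ω I n + side I / 2) (corner ω I n + side I) :=
    fun h => hn ⟨by linarith [h.1], h.2⟩
  rw [haar1]
  cases η n <;> simp only [if_true, Bool.false_eq_true, if_false]
  · rw [indicator_of_notMem hn, mul_zero]
  · rw [indicator_of_notMem h1, indicator_of_notMem h2, sub_zero, mul_zero]

lemma exists_mem_child {ω : Grid d} {I : Idx d} {x : Fin d → ℝ} (hx : x ∈ dcube ω I) :
    ∃ ε, x ∈ dcube ω (child ω I ε) := by
  rw [dcube_eq_iUnion_child, mem_iUnion] at hx; exact hx

lemma norm_haar_le (ω : Grid d) (I : Idx d) (η : Fin d → Bool) (x : Fin d → ℝ) :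
    ‖haar 𝕜 ω I η x‖ ≤ (rt I)⁻¹ := by
  have h0 := inv_pos.2 (rt_pos I)
  by_cases hx : x ∈ dcube ω I
  · obtain ⟨ε, hε⟩ := exists_mem_child hx
    rw [haar_of_mem_child ω hε, RCLike.norm_ofReal, abs_mul, abs_sg, one_mul, abs_of_pos h0]
  · rw [haar_of_notMem ω hx, norm_zero]; exact h0.le

lemma measurable_haar (ω : Grid d) (I : Idx d) (η : Fin d → Bool) :
    Measurable (haar 𝕜 ω I η) := by
  have h1 : ∀ a l η, Measurable (haar1 a l η) := by
    intro a l η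
    unfold haar1
    cases η
    · simpa using ((measurable_one.indicator measurableSet_Ico).const_mul _)
    · simpa using (((measurable_one.indicator measurableSet_Ico).sub
        (measurable_one.indicator measurableSet_Ico)).const_mul _)
  unfold haar
  refine RCLike.measurable_ofReal.comp ?_
  exact Finset.measurable_prod _ fun n _ => (h1 _ _ _).comp (measurable_pi_apply n)

lemma pair_comm (u v : (Fin d → ℝ) → 𝕜) : pair u v = pair v u := by
  simp only [pair, mul_comm]

lemma pair_haar_eq (ω : Grid d) (I : Idx d) (η : Fin d → Bool) {f : (Fin d → ℝ) → 𝕜}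
    (hf : IntegrableOn f (dcube ω I)) :
    pair f (haar 𝕜 ω I η) =
      ((rt I)⁻¹ : ℝ) * ∑ ε, (sg η ε : 𝕜) * ∫ x in dcube ω (child ω I ε), f x := by
  have h1 : pair f (haar 𝕜 ω I η) = ∫ x in dcube ω I, f x * haar 𝕜 ω I η x := by
    rw [pair, setIntegral_eq_integral_of_forall_compl_eq_zero]
    intro x hx
    rw [haar_of_notMem ω hx, mul_zero]
  have h2 : IntegrableOn (fun x => f x * haar 𝕜 ω I η x) (dcube ω I) :=
    hf.mul_bdd (c := (rt I)⁻¹) (measurable_haar ω I η).aestronglyMeasurable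
      (Eventually.of_forall fun x => norm_haar_le ω I η x)
  rw [h1, setIntegral_dcube_eq_sum_child ω I h2, Finset.mul_sum]
  refine Finset.sum_congr rfl fun ε _ => ?_
  rw [setIntegral_congr_fun (measurableSet_dcube _ _)
    (g := fun x => f x * ((sg η ε * (rt I)⁻¹ : ℝ) : 𝕜)), integral_mul_const]
  · push_cast; ring
  · intro x hx
    simp only [haar_of_mem_child ω hx]

/-- The average of a function over a dyadic cube. -/
def av (ω : Grid d) (f : (Fin d → ℝ) → 𝕜) (I : Idx d) : 𝕜 := ⨍ x in dcube ω I, f x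

lemma av_eq (ω : Grid d) (f : (Fin d → ℝ) → 𝕜) (I : Idx d) :
    av ω f I = ((side I ^ d)⁻¹ : ℝ) * ∫ x in dcube ω I, f x := by
  rw [av, setAverage_eq, volume_real_dcube, RCLike.real_smul_eq_coe_mul]

lemma setIntegral_eq_av (ω : Grid d) (f : (Fin d → ℝ) → 𝕜) (I : Idx d) :
    ∫ x in dcube ω I, f x = ((side I ^ d : ℝ) : 𝕜) * av ω f I := by
  have := pow_pos (side_pos I) d
  rw [av_eq, ← mul_assoc, ← RCLike.ofReal_mul, mul_inv_cancel₀ this.ne']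
  simp

lemma norm_av_le (ω : Grid d) (f : (Fin d → ℝ) → 𝕜) (I : Idx d) :
    ‖av ω f I‖ ≤ (side I ^ d)⁻¹ * ∫ x in dcube ω I, ‖f x‖ := by
  have := pow_pos (side_pos I) d
  rw [av_eq, norm_mul, RCLike.norm_ofReal, abs_of_pos (inv_pos.2 this)]
  exact mul_le_mul_of_nonneg_left (norm_integral_le_integral_norm _) (inv_pos.2 this).le

lemma norm_av_le_of_bound (ω : Grid d) {f : (Fin d → ℝ) → 𝕜} (I : Idx d) {C : ℝ}
    (hC : ∀ x ∈ dcube ω I, ‖f x‖ ≤ C) : ‖av ω f I‖ ≤ C := by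
  have := pow_pos (side_pos I) d
  rw [av_eq, norm_mul, RCLike.norm_ofReal, abs_of_pos (inv_pos.2 this)]
  have h1 := norm_setIntegral_le_of_norm_le_const (volume_dcube_ne_top ω I).lt_top hC
  rw [volume_real_dcube] at h1
  rw [inv_mul_le_iff₀ this, mul_comm]; exact h1

lemma pair_haar_eq_av (ω : Grid d) (I : Idx d) (η : Fin d → Bool) {f : (Fin d → ℝ) → 𝕜}
    (hf : IntegrableOn f (dcube ω I)) :
    pair f (haar 𝕜 ω I η) =
      ((rt I * ((2 : ℝ) ^ d)⁻¹ : ℝ) : 𝕜) * ∑ ε, (sg η ε : 𝕜) * av ω f (child ω I ε) := by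
  rw [pair_haar_eq ω I η hf]
  simp only [setIntegral_eq_av, side_child, div_pow, ← rt_sq, Finset.mul_sum]
  refine Finset.sum_congr rfl fun ε _ => ?_
  have : (rt I : 𝕜) ≠ 0 := RCLike.ofReal_ne_zero.2 (rt_pos I).ne'
  push_cast
  field_simp

lemma av_eq_sum_child (ω : Grid d) (I : Idx d) {f : (Fin d → ℝ) → 𝕜}
    (hf : IntegrableOn f (dcube ω I)) :
    av ω f I = (((2 : ℝ) ^ d)⁻¹ : ℝ) * ∑ ε, av ω f (child ω I ε) := by
  have h := pow_pos (side_pos I) d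
  have : (side I : 𝕜) ^ d ≠ 0 := by
    rw [← RCLike.ofReal_pow]; exact RCLike.ofReal_ne_zero.2 h.ne'
  rw [av_eq, setIntegral_dcube_eq_sum_child ω I hf]
  simp only [setIntegral_eq_av, side_child, div_pow, Finset.mul_sum]
  refine Finset.sum_congr rfl fun ε _ => ?_
  push_cast
  field_simp

/-- All 2^d Haar functions of I form an orthonormal basis of the functions on I that are constant on
the children. Removing the non-cancellative one removes the average over I, so the cancellative ones
produce the martingale difference. -/
lemma sum_pair_haar_mul (ω : Grid d) (I : Idx d) {f : (Fin d → ℝ) → 𝕜}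
    (hf : IntegrableOn f (dcube ω I)) {ε : Fin d → Bool} {x : Fin d → ℝ}
    (hx : x ∈ dcube ω (child ω I ε)) :
    ∑ η with η ≠ zeroη d, pair f (haar 𝕜 ω I η) * haar 𝕜 ω I η x =
      av ω f (child ω I ε) - av ω f I := by
  have h2 : (2 : 𝕜) ^ d ≠ 0 := pow_ne_zero _ two_ne_zero
  have hr : (rt I : 𝕜) ≠ 0 := RCLike.ofReal_ne_zero.2 (rt_pos I).ne'
  have h1 : ∑ η, pair f (haar 𝕜 ω I η) * haar 𝕜 ω I η x = av ω f (child ω I ε) := by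
    simp only [pair_haar_eq_av ω I _ hf, haar_of_mem_child ω hx, Finset.mul_sum, Finset.sum_mul]
    rw [Finset.sum_comm]
    have : ∀ ε', ∑ η, ((rt I * ((2 : ℝ) ^ d)⁻¹ : ℝ) : 𝕜) * ((sg η ε' : 𝕜) *
        av ω f (child ω I ε')) * ((sg η ε * (rt I)⁻¹ : ℝ) : 𝕜) =
        (((2 : ℝ) ^ d)⁻¹ : ℝ) * ((∑ η, sg η ε' * sg η ε : ℝ) : 𝕜) * av ω f (child ω I ε') := by
      intro ε'
      push_cast
      simp only [Finset.mul_sum, Finset.sum_mul]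
      refine Finset.sum_congr rfl fun η _ => ?_
      field_simp
    simp only [this, sum_sg_mul_sg]
    rw [Finset.sum_eq_single ε]
    · rw [if_pos rfl, ← RCLike.ofReal_mul, inv_mul_cancel₀ (by positivity), RCLike.ofReal_one,
        one_mul]
    · intro ε' _ h; simp [h]
    · simp
  have h0 : pair f (haar 𝕜 ω I (zeroη d)) * haar 𝕜 ω I (zeroη d) x = av ω f I := by
    rw [pair_haar_eq_av ω I _ hf, haar_of_mem_child ω hx, av_eq_sum_child ω I hf]
    simp only [sg_zero_left]
    push_cast
    simp only [one_mul]
    field_simp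
  rw [← h1, ← h0, ← Finset.sum_filter_add_sum_filter_not Finset.univ (fun η => η ≠ zeroη d)]
  simp [Finset.filter_eq']

lemma norm_pair_haar_le (ω : Grid d) (I : Idx d) (η : Fin d → Bool) {f : (Fin d → ℝ) → 𝕜}
    (hf : IntegrableOn f (dcube ω I)) :
    ‖pair f (haar 𝕜 ω I η)‖ ≤ (rt I)⁻¹ * ∫ x in dcube ω I, ‖f x‖ := by
  have h1 : pair f (haar 𝕜 ω I η) = ∫ x in dcube ω I, f x * haar 𝕜 ω I η x := by
    rw [pair, setIntegral_eq_integral_of_forall_compl_eq_zero]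
    intro x hx
    rw [haar_of_notMem ω hx, mul_zero]
  rw [h1, ← integral_const_mul]
  refine norm_integral_le_of_norm_le (hf.norm.const_mul _) (Eventually.of_forall fun x => ?_)
  rw [norm_mul, mul_comm]
  exact mul_le_mul_of_nonneg_right (norm_haar_le ω I η x) (norm_nonneg _)

lemma pair_haar_eq_zero_of_const (ω : Grid d) (I : Idx d) {η : Fin d → Bool} (hη : η ≠ zeroη d)
    {f : (Fin d → ℝ) → 𝕜} {c : 𝕜} (hf : ∀ x ∈ dcube ω I, f x = c) :
    pair f (haar 𝕜 ω I η) = 0 := by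
  have hc : IntegrableOn f (dcube ω I) :=
    (integrableOn_const (C := c) (volume_dcube_ne_top ω I)).congr_fun
      (fun x hx => (hf x hx).symm) (measurableSet_dcube _ _)
  have h1 : ∀ ε, av ω f (child ω I ε) = c := fun ε => by
    rw [av, setAverage_congr_fun (g := fun _ => c) (measurableSet_dcube _ _)
      (Eventually.of_forall fun x hx => hf x (dcube_child_subset ω I ε hx))]
    refine setAverage_const ?_ (volume_dcube_ne_top _ _) c
    rw [dcube, volume_cube _ (side_pos _).le]
    simpa using pow_pos (side_pos (child ω I ε)) d
  rw [pair_haar_eq_av ω I η hc]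
  simp only [h1]
  rw [← Finset.sum_mul, ← RCLike.ofReal_sum, sum_sg hη]
  simp

lemma norm_pair_haar_le_of_osc (ω : Grid d) (I : Idx d) {η : Fin d → Bool} (hη : η ≠ zeroη d)
    {f : (Fin d → ℝ) → 𝕜} (hf : IntegrableOn f (dcube ω I)) {δ : ℝ} (c : 𝕜)
    (hδ : ∀ x ∈ dcube ω I, ‖f x - c‖ ≤ δ) :
    ‖pair f (haar 𝕜 ω I η)‖ ≤ rt I * δ := by
  have hc : IntegrableOn (fun _ : Fin d → ℝ => c) (dcube ω I) :=
    integrableOn_const (volume_dcube_ne_top ω I)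
  have h1 : pair f (haar 𝕜 ω I η) = pair (fun x => f x - c) (haar 𝕜 ω I η) := by
    have h2 := pair_haar_eq_zero_of_const (𝕜 := 𝕜) ω I hη (f := fun _ => c) (c := c)
      fun _ _ => rfl
    rw [pair_haar_eq ω I η hc] at h2
    rw [pair_haar_eq ω I η hf, pair_haar_eq (f := fun x => f x - c) ω I η (hf.sub hc),
      ← sub_zero (_ * _), ← h2, ← mul_sub, ← Finset.sum_sub_distrib]
    congr 1
    refine Finset.sum_congr rfl fun ε _ => ?_
    rw [← mul_sub, integral_sub (hf.mono_set (dcube_child_subset _ _ _))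
      (hc.mono_set (dcube_child_subset _ _ _))]
  rw [h1]
  refine (norm_pair_haar_le ω I η (hf.sub hc)).trans ?_
  have h3 : ∫ x in dcube ω I, ‖f x - c‖ ≤ δ * (rt I * rt I) := by
    rw [rt_sq, ← volume_real_dcube ω I]
    have := norm_setIntegral_le_of_norm_le_const (f := fun x => ‖f x - c‖)
      (volume_dcube_ne_top ω I).lt_top (C := δ) fun x hx => by simpa using hδ x hx
    exact (le_abs_self _).trans this
  calc _ ≤ (rt I)⁻¹ * (δ * (rt I * rt I)) :=
        mul_le_mul_of_nonneg_left h3 (inv_pos.2 (rt_pos I)).le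
    _ = _ := by have := (rt_pos I).ne'; field_simp

/-- A Haar function is constant on strictly smaller dyadic cubes. -/
lemma haar_const (ω : Grid d) {I J : Idx d} (h : I.1 < J.1) (η : Fin d → Bool) {x : Fin d → ℝ}
    (hx : x ∈ dcube ω J) : haar 𝕜 ω I η x = haar 𝕜 ω I η (corner ω J) := by
  -- This is the ancestor of J on the level of the children of I. It is either a child of I, where
  -- the Haar function is constant, or disjoint from I, where it vanishes.
  set J' := anc ω (J.1 - I.1 - 1).toNat J with hJ'
  have hl : J'.1 = I.1 + 1 := by rw [hJ', anc_fst]; omega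
  have h1 : ∀ y ∈ dcube ω J, y ∈ dcube ω (child ω (par ω J') (pos ω J')) := by
    intro y hy
    rw [child_par]; exact dcube_subset_anc ω _ J hy
  by_cases hI : par ω J' = I
  · rw [hI] at h1
    rw [haar_of_mem_child ω (h1 x hx), haar_of_mem_child ω (h1 _ (corner_mem ω J))]
  · have h2 : ∀ y ∈ dcube ω J, y ∉ dcube ω I := fun y hy hy' =>
      hI (eq_of_mem_dcube (by simp [par, hl]) (dcube_child_subset _ _ _ (h1 y hy)) hy')
    rw [haar_of_notMem ω (h2 x hx), haar_of_notMem ω (h2 _ (corner_mem ω J))]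

lemma pair_haar_haar_self (ω : Grid d) (I : Idx d) (η η' : Fin d → Bool) :
    pair (haar 𝕜 ω I η) (haar 𝕜 ω I η') = if η = η' then 1 else 0 := by
  have hr : (rt I : 𝕜) ≠ 0 := RCLike.ofReal_ne_zero.2 (rt_pos I).ne'
  rw [pair_haar_eq ω I η' (IntegrableOn.of_bound (volume_dcube_ne_top ω I).lt_top
    (measurable_haar ω I η).aestronglyMeasurable _
    (Eventually.of_forall fun x => norm_haar_le ω I η x))]
  have : ∀ ε, ∫ x in dcube ω (child ω I ε), haar 𝕜 ω I η x =
      ((sg η ε * (rt I * ((2 : ℝ) ^ d)⁻¹) : ℝ) : 𝕜) := by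
    intro ε
    rw [setIntegral_congr_fun (measurableSet_dcube _ _)
      (g := fun _ => ((sg η ε * (rt I)⁻¹ : ℝ) : 𝕜)) fun x hx => haar_of_mem_child ω hx,
      setIntegral_const, volume_real_dcube, side_child, div_pow, ← rt_sq,
      RCLike.real_smul_eq_coe_mul]
    push_cast
    field_simp
  simp only [this]
  have h2 : ∀ ε, (sg η' ε : 𝕜) * ((sg η ε * (rt I * ((2 : ℝ) ^ d)⁻¹) : ℝ) : 𝕜) =
      ((rt I * ((2 : ℝ) ^ d)⁻¹ : ℝ) : 𝕜) * ((sg η ε * sg η' ε : ℝ) : 𝕜) := by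
    intro ε; push_cast; ring
  simp only [h2]
  rw [← Finset.mul_sum, ← RCLike.ofReal_sum, sum_sg_mul_sg']
  split_ifs
  · push_cast; field_simp
  · simp

/-- On different levels, the coarser function is constant on the cube of the finer one, which has
mean zero. -/
lemma pair_haar_haar (ω : Grid d) {I J : Idx d} {η η' : Fin d → Bool} (hη : η ≠ zeroη d)
    (hη' : η' ≠ zeroη d) (h : (I, η) ≠ (J, η')) :
    pair (haar 𝕜 ω I η) (haar 𝕜 ω J η') = 0 := by
  rcases lt_trichotomy I.1 J.1 with hl | hl | hl
  · exact pair_haar_eq_zero_of_const ω J hη' fun x hx => haar_const ω hl η hx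
  · by_cases hIJ : I = J
    · subst hIJ
      rw [pair_haar_haar_self, if_neg (fun h' => h (by rw [h']))]
    · have : ∀ x, haar 𝕜 ω I η x * haar 𝕜 ω J η' x = 0 := by
        intro x
        by_cases hx : x ∈ dcube ω I
        · rw [haar_of_notMem ω (I := J) fun hx' => hIJ (eq_of_mem_dcube hl hx hx'), mul_zero]
        · rw [haar_of_notMem ω hx, zero_mul]
      simp [pair, this]
  · rw [pair_comm]
    exact pair_haar_eq_zero_of_const ω I hη fun x hx => haar_const ω hl η' hx

/-- The telescoping expansion of a difference of averages. -/
lemma av_sub_av_anc (ω : Grid d) (J : Idx d) (k : ℕ) {f : (Fin d → ℝ) → 𝕜}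
    (hf : LocallyIntegrable f volume) {x : Fin d → ℝ} (hx : x ∈ dcube ω J) :
    av ω f J - av ω f (anc ω k J) = ∑ r ∈ Finset.range k, ∑ η with η ≠ zeroη d,
      pair f (haar 𝕜 ω (anc ω (r + 1) J) η) * haar 𝕜 ω (anc ω (r + 1) J) η x := by
  induction k with
  | zero => simp [anc]
  | succ k ih =>
    rw [Finset.sum_range_succ, ← ih,
      sum_pair_haar_mul ω (anc ω (k + 1) J) (integrableOn_cube hf _ _)
        (ε := pos ω (anc ω k J)) (x := x)]
    · simp only [anc, child_par]; ring
    · simp only [anc, child_par]; exact dcube_subset_anc ω k J hx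

end DyadicRep

end

noncomputable section

namespace DyadicRep

variable {d : ℕ} {𝕜 : Type*} [RCLike 𝕜]

/-! ### Orthogonal expansions in `L²` -/

/-- A series of operators with orthogonal values and square summable norms. -/
lemma exists_clm_of_orthogonal {ι H : Type*} [NormedAddCommGroup H] [InnerProductSpace 𝕜 H]
    [CompleteSpace H] (A : ι → H →ₗ[𝕜] H)
    (horth : ∀ K K' f, K ≠ K' → inner 𝕜 (A K f) (A K' f) = 0) {C : ℝ} (hC : 0 ≤ C)
    (hb : ∀ f (s : Finset ι), ∑ K ∈ s, ‖A K f‖ ^ 2 ≤ C ^ 2 * ‖f‖ ^ 2) :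
    ∃ P : H →L[𝕜] H, ‖P‖ ≤ C ∧ ∀ f, HasSum (fun K => A K f) (P f) := by
  have key : ∀ f, Summable (fun K => A K f) ∧ ‖∑' K, A K f‖ ≤ C * ‖f‖ := by
    intro f
    -- Orthogonality of the one-dimensional spans makes unconditional convergence equivalent to
    -- summability of the squared norms; values that vanish do no harm.
    have hO : OrthogonalFamily 𝕜 (fun K => ↥(𝕜 ∙ A K f)) fun K => (𝕜 ∙ A K f).subtypeₗᵢ := by
      refine OrthogonalFamily.of_pairwise fun K K' h => ?_
      simp only [Function.onFun]
      rw [Submodule.isOrtho_span]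
      rintro u hu v hv
      rw [mem_singleton_iff] at hu hv
      rw [hu, hv]; exact horth K K' f h
    let l : ∀ K, ↥(𝕜 ∙ A K f) := fun K => ⟨A K f, Submodule.mem_span_singleton_self _⟩
    have hs : Summable fun K => ‖A K f‖ ^ 2 :=
      summable_of_sum_le (fun K => by positivity) (hb f)
    have hS : Summable fun K => A K f := (hO.summable_iff_norm_sq_summable l).2 hs
    refine ⟨hS, ?_⟩
    have hn : ∀ s : Finset ι, ‖∑ K ∈ s, A K f‖ ≤ C * ‖f‖ := by
      intro s
      have h1 := hO.norm_sum l s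
      have h2 : ‖∑ K ∈ s, A K f‖ ^ 2 ≤ (C * ‖f‖) ^ 2 := by
        rw [mul_pow]; exact h1.le.trans (hb f s)
      exact le_of_sq_le_sq h2 (by positivity)
    exact le_of_tendsto hS.hasSum.norm (Eventually.of_forall hn)
  let P : H →ₗ[𝕜] H :=
    { toFun := fun f => ∑' K, A K f
      map_add' := fun f g => by simp only [map_add]; exact (key f).1.tsum_add (key g).1
      map_smul' := fun c f => by
        simp only [map_smul, RingHom.id_apply]; exact (key f).1.tsum_const_smul c }
  exact ⟨P.mkContinuous C fun f => (key f).2, P.mkContinuous_norm_le hC _,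
    fun f => (key f).1.hasSum⟩

lemma coeFn_haarL2 (ω : Grid d) (I : Idx d) (η : Fin d → Bool) :
    (haarL2 𝕜 ω I η : (Fin d → ℝ) → 𝕜) =ᵐ[volume] haar 𝕜 ω I η := MemLp.coeFn_toLp _

lemma conj_haar (ω : Grid d) (I : Idx d) (η : Fin d → Bool) (x : Fin d → ℝ) :
    (starRingEnd 𝕜) (haar 𝕜 ω I η x) = haar 𝕜 ω I η x := by
  rw [haar, RCLike.conj_ofReal]

lemma inner_haarL2 (ω : Grid d) (I : Idx d) (η : Fin d → Bool) (f : L2 𝕜 d) :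
    inner 𝕜 (haarL2 𝕜 ω I η) f = pair f (haar 𝕜 ω I η) := by
  rw [L2.inner_def, pair]
  refine integral_congr_ae ?_
  filter_upwards [coeFn_haarL2 (𝕜 := 𝕜) ω I η] with x hx
  rw [hx, RCLike.inner_apply, conj_haar]

/-- The types of cancellative Haar functions. -/
abbrev CType (d : ℕ) : Type := {η : Fin d → Bool // η ≠ zeroη d}

/-- The cancellative Haar functions of a dyadic system. -/
def hv (𝕜 : Type*) [RCLike 𝕜] (ω : Grid d) (p : Idx d × CType d) : L2 𝕜 d :=
  haarL2 𝕜 ω p.1 p.2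

lemma orthonormal_hv (ω : Grid d) : Orthonormal 𝕜 (hv 𝕜 ω) := by
  classical
  rw [orthonormal_iff_ite]
  rintro ⟨I, η, hη⟩ ⟨J, η', hη'⟩
  have h1 : inner 𝕜 (hv 𝕜 ω (I, ⟨η, hη⟩)) (hv 𝕜 ω (J, ⟨η', hη'⟩)) =
      pair (haar 𝕜 ω J η') (haar 𝕜 ω I η) := by
    rw [hv, hv, inner_haarL2, pair, pair]
    refine integral_congr_ae ?_
    filter_upwards [coeFn_haarL2 (𝕜 := 𝕜) ω J η'] with x hx
    rw [hx]
  rw [h1, pair_comm]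
  split_ifs with h
  · obtain ⟨rfl, h2⟩ := Prod.mk.inj h
    obtain rfl := Subtype.mk.inj h2
    rw [pair_haar_haar_self, if_pos rfl]
  · exact pair_haar_haar ω hη hη' fun h' => h (by
      obtain ⟨rfl, rfl⟩ := Prod.mk.inj h'; rfl)

lemma norm_sq_sum_smul_hv (ω : Grid d) (s : Finset (Idx d × CType d))
    (y : Idx d × CType d → 𝕜) :
    ‖∑ q ∈ s, y q • hv 𝕜 ω q‖ ^ 2 = ∑ q ∈ s, ‖y q‖ ^ 2 := by
  have := (orthonormal_hv (𝕜 := 𝕜) ω).orthogonalFamily.norm_sum y s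
  simpa [LinearIsometry.toSpanSingleton_apply] using this

lemma inner_sum_smul_hv_eq_zero (ω : Grid d) {s t : Finset (Idx d × CType d)}
    (hst : Disjoint s t) (y z : Idx d × CType d → 𝕜) :
    inner 𝕜 (∑ q ∈ s, y q • hv 𝕜 ω q) (∑ q ∈ t, z q • hv 𝕜 ω q) = 0 := by
  simp only [sum_inner, inner_sum, inner_smul_left, inner_smul_right]
  refine Finset.sum_eq_zero fun p hp => ?_
  rw [Finset.sum_eq_zero, mul_zero]
  intro q hq
  have hne : q ≠ p := fun h => Finset.disjoint_left.1 hst hq (h ▸ hp)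
  rw [(orthonormal_hv (𝕜 := 𝕜) ω).inner_eq_zero hne, mul_zero]

lemma sum_filter_eq_sum_cType {M : Type*} [AddCommMonoid M] (F : (Fin d → Bool) → M) :
    ∑ η with η ≠ zeroη d, F η = ∑ η : CType d, F η :=
  Finset.sum_subtype _ (by simp) _

lemma sum_eq_sum_cType {M : Type*} [AddCommMonoid M] (F : (Fin d → Bool) → M)
    (h0 : F (zeroη d) = 0) : ∑ η, F η = ∑ η : CType d, F η := by
  rw [← sum_filter_eq_sum_cType]
  refine (Finset.sum_subset (Finset.filter_subset _ _) fun η _ h => ?_).symm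
  simp only [Finset.mem_filter, Finset.mem_univ, true_and, not_not] at h
  rw [h, h0]

lemma sum_sum_eq_sum_cType {M : Type*} [AddCommMonoid M] (F : (Fin d → Bool) → (Fin d → Bool) → M)
    (h0 : ∀ η η', η = zeroη d ∨ η' = zeroη d → F η η' = 0) :
    ∑ η, ∑ η', F η η' = ∑ η : CType d, ∑ η' : CType d, F η η' := by
  rw [sum_eq_sum_cType (fun η => ∑ η', F η η')
    (Finset.sum_eq_zero fun η' _ => h0 _ _ (Or.inl rfl))]
  exact Finset.sum_congr rfl fun η _ => sum_eq_sum_cType _ (h0 _ _ (Or.inr rfl))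

/-! ### Dyadic shifts -/

lemma avgOp_eq_sum (ω : Grid d) (i j : ℕ) (a : Coeffs 𝕜 d) (K : Idx d) (f : L2 𝕜 d) :
    avgOp ω i j a K f = ∑ I ∈ desc ω i K, ∑ J ∈ desc ω j K, ∑ η, ∑ η',
      (a I J K η η' * pair f (haar 𝕜 ω I η)) • haarL2 𝕜 ω J η' := by
  unfold avgOp
  simp only [isSub_iff, ← mem_desc]
  rw [← finsum_mem_coe_finset]
  refine finsum_congr fun I => finsum_congr fun _ => ?_
  rw [← finsum_mem_coe_finset]
  rfl

/-- The condition that only cancellative Haar functions occur. -/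
def CancCoeffs (a : Coeffs 𝕜 d) : Prop :=
  ∀ I J K η η', η = zeroη d ∨ η' = zeroη d → a I J K η η' = 0

/-- The Haar functions of the descendants of a cube. -/
def hdesc (ω : Grid d) (i : ℕ) (K : Idx d) : Finset (Idx d × CType d) :=
  desc ω i K ×ˢ Finset.univ

lemma avgOp_eq_sum_hv (ω : Grid d) (i j : ℕ) {a : Coeffs 𝕜 d} (ha : CancCoeffs a) (K : Idx d)
    (f : L2 𝕜 d) :
    avgOp ω i j a K f = ∑ q ∈ hdesc ω j K, (∑ p ∈ hdesc ω i K,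
      a p.1 q.1 K p.2 q.2 * inner 𝕜 (hv 𝕜 ω p) f) • hv 𝕜 ω q := by
  rw [avgOp_eq_sum]
  unfold hdesc
  simp only [Finset.sum_product, Finset.sum_smul, hv, inner_haarL2]
  rw [Finset.sum_comm]
  refine Finset.sum_congr rfl fun J _ => ?_
  rw [Finset.sum_comm (s := (Finset.univ : Finset (CType d)))]
  refine Finset.sum_congr rfl fun I _ => ?_
  rw [sum_sum_eq_sum_cType _ fun η η' h => by rw [ha _ _ _ _ _ h, zero_mul, zero_smul],
    Finset.sum_comm]

lemma disjoint_hdesc (ω : Grid d) (i : ℕ) {K K' : Idx d} (h : K ≠ K') :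
    Disjoint (hdesc ω i K) (hdesc ω i K') := by
  rw [Finset.disjoint_left]
  rintro ⟨I, η⟩ h1 h2
  simp only [hdesc, Finset.mem_product, mem_desc] at h1 h2
  exact h (h1.1.symm.trans h2.1)

lemma card_hdesc_le (ω : Grid d) (i : ℕ) (K : Idx d) :
    ((hdesc ω i K).card : ℝ) ≤ 2 ^ (i * d) * 2 ^ d := by
  rw [hdesc, Finset.card_product, card_desc]
  push_cast
  refine mul_le_mul_of_nonneg_left ?_ (by positivity)
  have : Fintype.card (CType d) ≤ Fintype.card (Fin d → Bool) := Fintype.card_subtype_le _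
  rw [Finset.card_univ]
  calc ((Fintype.card (CType d) : ℕ) : ℝ) ≤ (Fintype.card (Fin d → Bool) : ℕ) := by
        exact_mod_cast this
    _ = _ := by simp

lemma sqrt_side_eq (I J : Idx d) : √(side I ^ d * side J ^ d) = rt I * rt J := by
  rw [← rt_sq, ← rt_sq, show rt I * rt I * (rt J * rt J) = (rt I * rt J) ^ 2 by ring]
  exact Real.sqrt_sq (mul_pos (rt_pos I) (rt_pos J)).le

lemma side_of_mem_desc {ω : Grid d} {i : ℕ} {I K : Idx d} (h : I ∈ desc ω i K) :
    side K = 2 ^ i * side I := by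
  rw [← mem_desc.1 h, side_anc]

/-- The coefficient bound, with the constant that makes the subshifts contractive. -/
def CoeffBound (ω : Grid d) (i j : ℕ) (a : Coeffs 𝕜 d) : Prop :=
  ∀ K, ∀ I ∈ desc ω i K, ∀ J ∈ desc ω j K, ∀ η η',
    ‖a I J K η η'‖ ≤ ((2 : ℝ) ^ d)⁻¹ * (rt I * rt J / side K ^ d)

/-- A Hilbert–Schmidt bound: in the Haar basis the operator is a matrix of size at most 2^{jd}2^d by
2^{id}2^d. The factor 2^{-d} in `CoeffBound` pays for the numbers of types of Haar functions on both
sides, which gives norm at most one. -/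
lemma norm_avgOp_sq_le (ω : Grid d) (i j : ℕ) {a : Coeffs 𝕜 d} (ha : CancCoeffs a)
    (hb : CoeffBound ω i j a) (K : Idx d) (f : L2 𝕜 d) :
    ‖avgOp ω i j a K f‖ ^ 2 ≤ ∑ p ∈ hdesc ω i K, ‖inner 𝕜 (hv 𝕜 ω p) f‖ ^ 2 := by
  rw [avgOp_eq_sum_hv ω i j ha, norm_sq_sum_smul_hv]
  set X := ∑ p ∈ hdesc ω i K, ‖inner 𝕜 (hv 𝕜 ω p) f‖ ^ 2 with hX
  have hX0 : 0 ≤ X := Finset.sum_nonneg fun _ _ => by positivity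
  have hs := pow_pos (side_pos K) d
  have hd2 : (0 : ℝ) < 2 ^ d := by positivity
  -- The right side is the product of the reciprocals of the two bounds for the numbers of Haar
  -- functions, so that Cauchy–Schwarz and the sum over q leave no constant.
  have hco : ∀ q ∈ hdesc ω j K, ∀ p ∈ hdesc ω i K, ‖a p.1 q.1 K p.2 q.2‖ ^ 2 ≤
      ((2 : ℝ) ^ (i * d) * 2 ^ d)⁻¹ * ((2 : ℝ) ^ (j * d) * 2 ^ d)⁻¹ := by
    intro q hq p hp
    have hq := (Finset.mem_product.1 hq).1
    have hp := (Finset.mem_product.1 hp).1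
    have h1 : side K ^ d = 2 ^ (i * d) * (rt p.1 * rt p.1) := by
      rw [rt_sq, side_of_mem_desc hp, mul_pow, pow_mul]
    have h2 : side K ^ d = 2 ^ (j * d) * (rt q.1 * rt q.1) := by
      rw [rt_sq, side_of_mem_desc hq, mul_pow, pow_mul]
    refine (pow_le_pow_left₀ (norm_nonneg _) (hb K _ hp _ hq _ _) 2).trans (le_of_eq ?_)
    have h3 : rt p.1 * rt p.1 = side K ^ d / 2 ^ (i * d) := by rw [h1]; field_simp
    have h4 : rt q.1 * rt q.1 = side K ^ d / 2 ^ (j * d) := by rw [h2]; field_simp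
    calc _ = ((2 : ℝ) ^ d)⁻¹ ^ 2 * ((rt p.1 * rt p.1) * (rt q.1 * rt q.1)) /
          (side K ^ d) ^ 2 := by ring
      _ = _ := by rw [h3, h4]; field_simp
  calc ∑ q ∈ hdesc ω j K, ‖∑ p ∈ hdesc ω i K, a p.1 q.1 K p.2 q.2 * inner 𝕜 (hv 𝕜 ω p) f‖ ^ 2
      ≤ ∑ q ∈ hdesc ω j K, ((2 : ℝ) ^ (j * d) * 2 ^ d)⁻¹ * X := by
        refine Finset.sum_le_sum fun q hq => ?_
        have h1 : ‖∑ p ∈ hdesc ω i K, a p.1 q.1 K p.2 q.2 * inner 𝕜 (hv 𝕜 ω p) f‖ ≤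
            ∑ p ∈ hdesc ω i K, ‖a p.1 q.1 K p.2 q.2‖ * ‖inner 𝕜 (hv 𝕜 ω p) f‖ :=
          (norm_sum_le _ _).trans (Finset.sum_le_sum fun p _ => (norm_mul _ _).le)
        have h2 := Finset.sum_mul_sq_le_sq_mul_sq (hdesc ω i K)
          (fun p => ‖a p.1 q.1 K p.2 q.2‖) (fun p => ‖inner 𝕜 (hv 𝕜 ω p) f‖)
        refine (pow_le_pow_left₀ (norm_nonneg _) h1 2).trans (h2.trans ?_)
        refine mul_le_mul_of_nonneg_right ?_ hX0
        refine (Finset.sum_le_card_nsmul _ _ _ (hco q hq)).trans ?_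
        rw [nsmul_eq_mul, ← mul_assoc]
        refine mul_le_of_le_one_left (by positivity) ?_
        rw [mul_inv_le_iff₀ (by positivity), one_mul]
        exact card_hdesc_le ω i K
    _ ≤ X := by
        rw [Finset.sum_const, nsmul_eq_mul, ← mul_assoc]
        refine mul_le_of_le_one_left hX0 ?_
        rw [mul_inv_le_iff₀ (by positivity), one_mul]
        exact card_hdesc_le ω j K

lemma sum_sum_hdesc_le (ω : Grid d) (i : ℕ) (s : Finset (Idx d)) (f : L2 𝕜 d) :
    ∑ K ∈ s, ∑ p ∈ hdesc ω i K, ‖inner 𝕜 (hv 𝕜 ω p) f‖ ^ 2 ≤ ‖f‖ ^ 2 := by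
  classical
  rw [← Finset.sum_biUnion fun K _ K' _ h => disjoint_hdesc ω i h]
  exact (orthonormal_hv ω).sum_inner_products_le f

/-- The averaging operator as a linear map. -/
def avgLin (ω : Grid d) (i j : ℕ) {a : Coeffs 𝕜 d} (ha : CancCoeffs a) (K : Idx d) :
    L2 𝕜 d →ₗ[𝕜] L2 𝕜 d where
  toFun := avgOp ω i j a K
  map_add' f g := by
    simp only [avgOp_eq_sum_hv ω i j ha, inner_add_right, mul_add, Finset.sum_add_distrib, add_smul]
  map_smul' c f := by
    simp only [avgOp_eq_sum_hv ω i j ha, inner_smul_right, RingHom.id_apply, Finset.smul_sum,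
      smul_smul, Finset.mul_sum]
    refine Finset.sum_congr rfl fun q _ => ?_
    congr 1
    exact Finset.sum_congr rfl fun p _ => by ring

/-- For different cubes K the operators read disjoint sets of Haar functions and write into disjoint
sets, so their norms combine by orthogonality on both sides. The index map `e` is the identity for
the full shift and an inclusion for the subshifts. -/
lemma exists_subshift (ω : Grid d) (i j : ℕ) {a : Coeffs 𝕜 d} (ha : CancCoeffs a)
    (hb : CoeffBound ω i j a) {ι : Type*} {e : ι → Idx d} (he : Function.Injective e) :
    ∃ S : L2 𝕜 d →L[𝕜] L2 𝕜 d, ‖S‖ ≤ 1 ∧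
      ∀ f, HasSum (fun K => avgOp ω i j a (e K) f) (S f) := by
  classical
  refine exists_clm_of_orthogonal (fun K => avgLin ω i j ha (e K)) ?_ zero_le_one ?_
  · intro K K' f h
    change inner 𝕜 (avgOp ω i j a (e K) f) (avgOp ω i j a (e K') f) = 0
    rw [avgOp_eq_sum_hv ω i j ha, avgOp_eq_sum_hv ω i j ha]
    exact inner_sum_smul_hv_eq_zero ω (disjoint_hdesc ω j (he.ne h)) _ _
  · intro f s
    rw [one_pow, one_mul]
    refine le_trans ?_ (sum_sum_hdesc_le ω i (s.image e) f)
    rw [Finset.sum_image fun _ _ _ _ h => he h]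
    exact Finset.sum_le_sum fun K _ => norm_avgOp_sq_le ω i j ha hb (e K) f

lemma exists_isShiftWith (ω : Grid d) (i j : ℕ) {a : Coeffs 𝕜 d} (ha : CancCoeffs a)
    (hb : CoeffBound ω i j a) :
    ∃ S : L2 𝕜 d →L[𝕜] L2 𝕜 d, ‖S‖ ≤ 1 ∧ IsShiftWith ω i j a S := by
  obtain ⟨S, hS, hsum⟩ := exists_subshift ω i j ha hb Function.injective_id
  refine ⟨S, hS, ?_, fun 𝒬 => exists_subshift ω i j ha hb Subtype.val_injective, hsum⟩
  intro I J K η η' hI hJ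
  rw [isSub_iff, ← mem_desc] at hI hJ
  rw [sqrt_side_eq]
  refine (hb K I hI J hJ η η').trans (mul_le_of_le_one_left ?_ ?_)
  · exact div_nonneg (mul_pos (rt_pos I) (rt_pos J)).le (pow_pos (side_pos K) d).le
  · exact inv_le_one_of_one_le₀ (one_le_pow₀ one_le_two)

/-- The pairing with an element of `L²`, as a bounded linear functional. -/
def pairCLM (G : L2 𝕜 d) : L2 𝕜 d →L[𝕜] 𝕜 := innerSL 𝕜 (star G)

lemma pairCLM_apply (G F : L2 𝕜 d) : pairCLM G F = pair G F := by
  rw [pairCLM, innerSL_apply_apply, L2.inner_def, pair]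
  refine integral_congr_ae ?_
  filter_upwards [Lp.coeFn_star G] with x hx
  rw [hx, RCLike.inner_apply]
  simp [mul_comm]

lemma pair_haarL2 (ω : Grid d) (J : Idx d) (η : Fin d → Bool) (G : L2 𝕜 d) :
    pair G (haarL2 𝕜 ω J η) = pair G (haar 𝕜 ω J η) := by
  refine integral_congr_ae ?_
  filter_upwards [coeFn_haarL2 (𝕜 := 𝕜) ω J η] with x hx
  rw [hx]

lemma pair_avgOp (ω : Grid d) (i j : ℕ) (a : Coeffs 𝕜 d) (K : Idx d) (F G : L2 𝕜 d) :
    pair G (avgOp ω i j a K F) = ∑ I ∈ desc ω i K, ∑ J ∈ desc ω j K, ∑ η, ∑ η',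
      a I J K η η' * pair F (haar 𝕜 ω I η) * pair G (haar 𝕜 ω J η') := by
  rw [← pairCLM_apply, avgOp_eq_sum]
  simp only [map_sum, map_smul, pairCLM_apply, pair_haarL2, smul_eq_mul]

lemma pair_c1L2_haar {f : (Fin d → ℝ) → 𝕜} (hf : ContDiff ℝ 1 f) (hf' : HasCompactSupport f)
    (h : (Fin d → ℝ) → 𝕜) : pair (c1L2 f hf hf') h = pair f h := by
  refine integral_congr_ae ?_
  filter_upwards [MemLp.coeFn_toLp (hf.continuous.memLp_of_hasCompactSupport (p := 2) hf')]
    with x hx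
  rw [c1L2, hx]

lemma av_c1L2 (ω : Grid d) {f : (Fin d → ℝ) → 𝕜} (hf : ContDiff ℝ 1 f)
    (hf' : HasCompactSupport f) (I : Idx d) : av ω (c1L2 f hf hf') I = av ω f I := by
  rw [av_eq, av_eq]
  congr 1
  refine setIntegral_congr_ae (measurableSet_dcube _ _) ?_
  filter_upwards [MemLp.coeFn_toLp (hf.continuous.memLp_of_hasCompactSupport (p := 2) hf')]
    with x hx _
  rw [c1L2, hx]

end DyadicRep

end

noncomputable section

namespace DyadicRep

variable {d : ℕ} {𝕜 : Type*} [RCLike 𝕜]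

/-! ### Sums and means over dyadic trees -/

/-- The definition of `desc` adds generations at the leaves, whereas inductions over trees start at
the root and pass to the children. -/
lemma sum_desc_succ' {M : Type*} [AddCommMonoid M] (ω : Grid d) (i : ℕ) (K : Idx d)
    (f : Idx d → M) :
    ∑ I ∈ desc ω (i + 1) K, f I = ∑ ε, ∑ I ∈ desc ω i (child ω K ε), f I := by
  induction i generalizing f with
  | zero => rw [sum_desc_succ]; simp only [desc, Finset.sum_singleton]
  | succ i ih =>
    rw [sum_desc_succ, ih]
    exact Finset.sum_congr rfl fun ε _ => (sum_desc_succ ω i _ f).symm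

/-- The sum over all descendants of fewer than `N` generations. -/
def treeSum (ω : Grid d) (φ : Idx d → ℝ) (N : ℕ) (K : Idx d) : ℝ :=
  ∑ r ∈ Finset.range N, ∑ I ∈ desc ω r K, φ I

lemma treeSum_succ (ω : Grid d) (φ : Idx d → ℝ) (N : ℕ) (K : Idx d) :
    treeSum ω φ (N + 1) K = φ K + ∑ ε, treeSum ω φ N (child ω K ε) := by
  unfold treeSum
  rw [Finset.sum_range_succ', add_comm, Finset.sum_comm]
  congr 1
  · simp [desc]
  · exact Finset.sum_congr rfl fun r _ => sum_desc_succ' ω r K φ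

lemma treeSum_nonneg (ω : Grid d) {φ : Idx d → ℝ} (h : ∀ K, 0 ≤ φ K) (N : ℕ) (K : Idx d) :
    0 ≤ treeSum ω φ N K :=
  Finset.sum_nonneg fun _ _ => Finset.sum_nonneg fun _ _ => h _

/-- The cubes of a finite family have ancestors on one common coarse level. These ancestors are the
roots of trees that contain the family; being of one level, they are disjoint. -/
lemma exists_sum_le_sum_treeSum (ω : Grid d) {φ : Idx d → ℝ} (h : ∀ K, 0 ≤ φ K)
    (s : Finset (Idx d)) : ∃ (n : ℤ) (N : ℕ) (t : Finset (Idx d)), (∀ Q ∈ t, Q.1 = n) ∧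
      ∑ K ∈ s, φ K ≤ ∑ Q ∈ t, treeSum ω φ N Q := by
  classical
  obtain ⟨n, hn⟩ := (s.image Prod.fst).bddBelow
  obtain ⟨n', hn'⟩ := (s.image Prod.fst).bddAbove
  have h1 : ∀ K ∈ s, n ≤ K.1 := fun K hK => hn (Finset.mem_image_of_mem _ hK)
  have h2 : ∀ K ∈ s, K.1 ≤ n' := fun K hK => hn' (Finset.mem_image_of_mem _ hK)
  refine ⟨n, (n' - n + 1).toNat, s.image fun K => anc ω (K.1 - n).toNat K, ?_, ?_⟩
  · intro Q hQ
    obtain ⟨K, hK, rfl⟩ := Finset.mem_image.1 hQ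
    have := h1 K hK
    rw [anc_fst]; omega
  · rw [← Finset.sum_fiberwise_of_maps_to (s := s) (fun K hK => Finset.mem_image_of_mem
      (fun K => anc ω (K.1 - n).toNat K) hK)]
    refine Finset.sum_le_sum fun Q _ => ?_
    rw [← Finset.sum_fiberwise_of_maps_to (t := Finset.range (n' - n + 1).toNat)
      (g := fun K : Idx d => (K.1 - n).toNat)]
    · refine Finset.sum_le_sum fun r _ => Finset.sum_le_sum_of_subset_of_nonneg ?_
        fun _ _ _ => h _
      intro K hK
      simp only [Finset.mem_filter] at hK
      rw [mem_desc, ← hK.2, hK.1.2]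
    · intro K hK
      have hK := (Finset.mem_filter.1 hK).1
      have := h1 K hK
      have := h2 K hK
      rw [Finset.mem_range]; omega

/-- The mean over the descendants of the `N`-th generation. -/
def treeMean (ω : Grid d) (φ : Idx d → ℝ) : ℕ → Idx d → ℝ
  | 0, K => φ K
  | N + 1, K => ((2 : ℝ) ^ d)⁻¹ * ∑ ε, treeMean ω φ N (child ω K ε)

lemma mean_const (c : ℝ) : ((2 : ℝ) ^ d)⁻¹ * ∑ _ε : Fin d → Bool, c = c := by
  rw [Finset.sum_const, Finset.card_univ]
  simp

lemma mean_mono {x y : (Fin d → Bool) → ℝ} (h : ∀ ε, x ε ≤ y ε) :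
    ((2 : ℝ) ^ d)⁻¹ * ∑ ε, x ε ≤ ((2 : ℝ) ^ d)⁻¹ * ∑ ε, y ε :=
  mul_le_mul_of_nonneg_left (Finset.sum_le_sum fun ε _ => h ε) (by positivity)

lemma mean_affine (x : (Fin d → Bool) → ℝ) (a b : ℝ) :
    ((2 : ℝ) ^ d)⁻¹ * ∑ ε, (a + b * x ε) = a + b * (((2 : ℝ) ^ d)⁻¹ * ∑ ε, x ε) := by
  rw [Finset.sum_add_distrib, mul_add, mean_const, ← Finset.mul_sum]; ring

/-! ### The Carleson condition for symbols in `BMO`. -/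

section BMO

variable {ω : Grid d} {b : (Fin d → ℝ) → 𝕜}

lemma norm_av_sub_le (hb : LocallyIntegrable b volume) (K : Idx d) (c : 𝕜) :
    ‖av ω b K - c‖ ≤ (side K ^ d)⁻¹ * ∫ x in dcube ω K, ‖b x - c‖ := by
  have hs := pow_pos (side_pos K) d
  have h1 : av ω b K - c = av ω (fun x => b x - c) K := by
    have h2 : IntegrableOn b (dcube ω K) := integrableOn_cube hb _ _
    rw [av_eq, av_eq, integral_sub h2
      (integrableOn_const (volume_dcube_ne_top ω K)), setIntegral_const, volume_real_dcube,
      RCLike.real_smul_eq_coe_mul, mul_sub, ← mul_assoc (_ : 𝕜) _ c, ← RCLike.ofReal_mul,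
      inv_mul_cancel₀ hs.ne', RCLike.ofReal_one, one_mul]
  rw [h1]
  exact norm_av_le ω _ K

lemma inv_side_mul_sum_child (K : Idx d) (x : (Fin d → Bool) → ℝ) :
    ((2 : ℝ) ^ d)⁻¹ * ∑ ε, (side (child ω K ε) ^ d)⁻¹ * x ε = (side K ^ d)⁻¹ * ∑ ε, x ε := by
  have hs := pow_pos (side_pos K) d
  rw [Finset.mul_sum, Finset.mul_sum]
  refine Finset.sum_congr rfl fun ε _ => ?_
  rw [side_child, div_pow]; field_simp

lemma treeMean_norm_sub_le (hb : LocallyIntegrable b volume) (N : ℕ) (K : Idx d) (c : 𝕜) :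
    treeMean ω (fun I => ‖av ω b I - c‖) N K ≤
      (side K ^ d)⁻¹ * ∫ x in dcube ω K, ‖b x - c‖ := by
  induction N generalizing K with
  | zero => exact norm_av_sub_le hb K c
  | succ N ih =>
    refine (mean_mono fun ε => ih (child ω K ε)).trans (le_of_eq ?_)
    rw [inv_side_mul_sum_child, ← setIntegral_dcube_eq_sum_child ω K]
    exact ((integrableOn_cube hb _ _).sub (integrableOn_const (volume_dcube_ne_top ω K))).norm

lemma norm_av_sub_le_treeMean (hb : LocallyIntegrable b volume) (N : ℕ) (K : Idx d) (c : 𝕜) :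
    ‖av ω b K - c‖ ≤ treeMean ω (fun I => ‖av ω b I - c‖) N K := by
  induction N generalizing K with
  | zero => exact le_rfl
  | succ N ih =>
    refine le_trans ?_ (mean_mono fun ε => ih (child ω K ε))
    have h1 : av ω b K - c = (((2 : ℝ) ^ d)⁻¹ : ℝ) * ∑ ε, (av ω b (child ω K ε) - c) := by
      rw [Finset.sum_sub_distrib, mul_sub, ← av_eq_sum_child ω K (integrableOn_cube hb _ _)]
      congr 1
      have h2 : (((2 : ℝ) ^ d)⁻¹ : ℝ) * (∑ _ε : Fin d → Bool, (1 : 𝕜)) = 1 := by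
        have := mean_const (d := d) 1
        exact_mod_cast congrArg (RCLike.ofReal (K := 𝕜)) this
      rw [← mul_one c, ← Finset.mul_sum, mul_left_comm, h2]
    rw [h1, norm_mul, RCLike.norm_ofReal, abs_of_pos (by positivity)]
    exact mul_le_mul_of_nonneg_left (norm_sum_le _ _) (by positivity)

/-- The cross term is linear in the averages, so the mean over descendants reproduces the average
over the root; only the square term depends on the depth. -/
lemma treeMean_norm_sub_sq (hb : LocallyIntegrable b volume) (N : ℕ) (K : Idx d) (c : 𝕜) :
    treeMean ω (fun I => ‖av ω b I - c‖ ^ 2) N K =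
      treeMean ω (fun I => ‖av ω b I‖ ^ 2) N K - 2 * RCLike.re (inner 𝕜 (av ω b K) c)
        + ‖c‖ ^ 2 := by
  induction N generalizing K with
  | zero => exact norm_sub_sq _ _
  | succ N ih =>
    simp only [treeMean, ih]
    rw [Finset.sum_add_distrib, Finset.sum_sub_distrib, mul_add, mul_sub, mean_const]
    congr 2
    rw [av_eq_sum_child ω K (integrableOn_cube hb _ _), ← Finset.mul_sum, ← map_sum, ← sum_inner,
      ← smul_eq_mul (_ : 𝕜), inner_smul_left, RCLike.conj_ofReal, RCLike.re_ofReal_mul]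
    ring

lemma treeMean_norm_sub_sq_eq (hb : LocallyIntegrable b volume) (N : ℕ) (K : Idx d) (c : 𝕜) :
    treeMean ω (fun I => ‖av ω b I - c‖ ^ 2) N K =
      treeMean ω (fun I => ‖av ω b I - av ω b K‖ ^ 2) N K + ‖av ω b K - c‖ ^ 2 := by
  rw [treeMean_norm_sub_sq hb N K c, treeMean_norm_sub_sq hb N K (av ω b K),
    @norm_sub_sq 𝕜, inner_self_eq_norm_sq]
  ring

/-- A John–Nirenberg argument run as an induction on the depth. Follow the averages down the tree,
compared with a fixed number c, and stop when the deviation exceeds 2A. One more generation changes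
an average by at most J = 2^d A, so at the stopping cube the deviation is at most 2A + J, and below
it the inductive bound for smaller depth applies. The mean deviation is at most A, so stopping
happens on at most half of the cube, and the resulting inequality closes. -/
lemma treeMean_sq_le_of_bmo (hb : LocallyIntegrable b volume) {A : ℝ} (hA : 0 < A)
    (hbmo : ∀ K, (side K ^ d)⁻¹ * ∫ x in dcube ω K, ‖b x - av ω b K‖ ≤ A) (N : ℕ) (K : Idx d) :
    treeMean ω (fun I => ‖av ω b I - av ω b K‖ ^ 2) N K ≤
      8 * A ^ 2 + (2 * A + 2 ^ d * A) ^ 2 := by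
  set J : ℝ := 2 ^ d * A with hJ
  -- The value is the solution of M = (2A)² + B/2 with B = M + (2A+J)². Here B bounds the mean
  -- square below a stopping cube, and the factor 1/2 is A/(2A).
  set M : ℝ := 8 * A ^ 2 + (2 * A + J) ^ 2 with hM
  set B : ℝ := M + (2 * A + J) ^ 2 with hB
  have hJ0 : 0 < J := by positivity
  have hM0 : 0 < M := by positivity
  have hB0 : 0 < B := by positivity
  have hjump : ∀ K ε, ‖av ω b (child ω K ε) - av ω b K‖ ≤ J := by
    intro K ε
    have hs := pow_pos (side_pos K) d
    refine (norm_av_sub_le hb _ _).trans ?_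
    rw [side_child, div_pow, inv_div, hJ, div_mul_eq_mul_div, mul_div_assoc]
    refine mul_le_mul_of_nonneg_left ?_ (by positivity)
    rw [div_eq_inv_mul]
    refine le_trans (mul_le_mul_of_nonneg_left ?_ (inv_pos.2 hs).le) (hbmo K)
    exact setIntegral_mono_set ((integrableOn_cube hb _ _).sub
      (integrableOn_const (volume_dcube_ne_top ω K))).norm
      (Eventually.of_forall fun x => norm_nonneg _) (dcube_child_subset ω K ε).eventuallyLE
  have main : ∀ N : ℕ, (∀ K, treeMean ω (fun I => ‖av ω b I - av ω b K‖ ^ 2) N K ≤ M) ∧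
      ∀ K c, ‖av ω b K - c‖ ≤ 2 * A + J → treeMean ω (fun I => ‖av ω b I - c‖ ^ 2) N K ≤
        (2 * A) ^ 2 + B / (2 * A) * treeMean ω (fun I => ‖av ω b I - c‖) N K := by
    intro N
    -- The stopping case. The mean square is the inner deviation, at most M, plus the squared
    -- distance of the root average to c, so it is at most B. The mean deviation exceeds 2A, which
    -- turns B into a multiple of it and keeps the bound linear for averaging over the cubes.
    have hlarge : ∀ N, (∀ K, treeMean ω (fun I => ‖av ω b I - av ω b K‖ ^ 2) N K ≤ M) →
        ∀ K c, ‖av ω b K - c‖ ≤ 2 * A + J → 2 * A < ‖av ω b K - c‖ →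
        treeMean ω (fun I => ‖av ω b I - c‖ ^ 2) N K ≤
        (2 * A) ^ 2 + B / (2 * A) * treeMean ω (fun I => ‖av ω b I - c‖) N K := by
      intro N hN K c h1 h2
      have h3 : B ≤ B / (2 * A) * treeMean ω (fun I => ‖av ω b I - c‖) N K := by
        have h4 := h2.le.trans (norm_av_sub_le_treeMean (ω := ω) hb N K c)
        calc B = B / (2 * A) * (2 * A) := by field_simp
          _ ≤ _ := mul_le_mul_of_nonneg_left h4 (by positivity)
      rw [treeMean_norm_sub_sq_eq hb]
      have h5 : ‖av ω b K - c‖ ^ 2 ≤ (2 * A + J) ^ 2 := pow_le_pow_left₀ (norm_nonneg _) h1 2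
      have := hN K
      have : 0 ≤ (2 * A) ^ 2 := by positivity
      linarith
    induction N with
    | zero =>
      have h0 : ∀ K, treeMean ω (fun I => ‖av ω b I - av ω b K‖ ^ 2) 0 K ≤ M := fun K => by
        simp only [treeMean, sub_self, norm_zero]; simpa using hM0.le
      refine ⟨h0, fun K c h1 => ?_⟩
      by_cases h2 : 2 * A < ‖av ω b K - c‖
      · exact hlarge 0 h0 K c h1 h2
      · have h3 : ‖av ω b K - c‖ ^ 2 ≤ (2 * A) ^ 2 :=
          pow_le_pow_left₀ (norm_nonneg _) (not_lt.1 h2) 2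
        exact h3.trans (le_add_of_nonneg_right (mul_nonneg (by positivity) (norm_nonneg _)))
    | succ N ih =>
      obtain ⟨ih1, ih2⟩ := ih
      -- Without stopping, the bound is averaged over the children, whose averages lie within 2A + J
      -- of c.
      have hstep : ∀ K c, ‖av ω b K - c‖ ≤ 2 * A →
          treeMean ω (fun I => ‖av ω b I - c‖ ^ 2) (N + 1) K ≤
          (2 * A) ^ 2 + B / (2 * A) * treeMean ω (fun I => ‖av ω b I - c‖) (N + 1) K := by
        intro K c h
        simp only [treeMean]
        rw [← mean_affine]
        refine mean_mono fun ε => ih2 _ _ ?_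
        have : av ω b (child ω K ε) - c =
          (av ω b (child ω K ε) - av ω b K) + (av ω b K - c) := by ring
        rw [this]
        refine (norm_add_le _ _).trans ?_
        linarith [hjump K ε]
      have h0 : ∀ K, treeMean ω (fun I => ‖av ω b I - av ω b K‖ ^ 2) (N + 1) K ≤ M := by
        intro K
        refine (hstep K _ (by simp [hA.le])).trans ?_
        have h1 := (treeMean_norm_sub_le (ω := ω) hb (N + 1) K (av ω b K)).trans (hbmo K)
        have h2 := mul_le_mul_of_nonneg_left h1 (by positivity : 0 ≤ B / (2 * A))
        have h3 : B / (2 * A) * A = B / 2 := by field_simp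
        nlinarith
      refine ⟨h0, fun K c h1 => ?_⟩
      by_cases h2 : 2 * A < ‖av ω b K - c‖
      · exact hlarge (N + 1) h0 K c h1 h2
      · exact hstep K c (not_lt.1 h2)
  exact (main N).1 K

/-- The mass of the Haar coefficients of a function on one cube. -/
def haarMass (ω : Grid d) (b : (Fin d → ℝ) → 𝕜) (K : Idx d) : ℝ :=
  ∑ η : CType d, ‖pair b (haar 𝕜 ω K η)‖ ^ 2

lemma haarMass_nonneg (K : Idx d) : 0 ≤ haarMass ω b K := Finset.sum_nonneg fun _ _ => by positivity

/-- Parseval's identity: the sign matrix is 2^{d/2} times an orthogonal matrix. -/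
lemma sum_norm_sq_sg (y : (Fin d → Bool) → 𝕜) :
    ∑ η, ‖∑ ε, (sg η ε : 𝕜) * y ε‖ ^ 2 = 2 ^ d * ∑ ε, ‖y ε‖ ^ 2 := by
  have h : ((∑ η, ‖∑ ε, (sg η ε : 𝕜) * y ε‖ ^ 2 : ℝ) : 𝕜) =
      ((2 ^ d * ∑ ε, ‖y ε‖ ^ 2 : ℝ) : 𝕜) := by
    push_cast
    simp only [← RCLike.conj_mul, map_sum, map_mul, RCLike.conj_ofReal, Finset.sum_mul_sum]
    rw [Finset.sum_comm, Finset.mul_sum]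
    refine Finset.sum_congr rfl fun ε _ => ?_
    rw [Finset.sum_comm]
    have : ∀ ε', ∑ η, (sg η ε : 𝕜) * (starRingEnd 𝕜) (y ε) * ((sg η ε' : 𝕜) * y ε') =
        ((∑ η, sg η ε * sg η ε' : ℝ) : 𝕜) * ((starRingEnd 𝕜) (y ε) * y ε') := by
      intro ε'
      push_cast
      rw [Finset.sum_mul]
      exact Finset.sum_congr rfl fun η _ => by ring
    simp only [this, sum_sg_mul_sg]
    rw [Finset.sum_eq_single ε]
    · rw [if_pos rfl]; push_cast; rfl
    · intro ε' _ h; simp [Ne.symm h]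
    · simp
  exact_mod_cast h

lemma haarMass_le (hb : LocallyIntegrable b volume) (K : Idx d) :
    haarMass ω b K ≤
      side K ^ d * (((2 : ℝ) ^ d)⁻¹ * ∑ ε, ‖av ω b (child ω K ε) - av ω b K‖ ^ 2) := by
  have hr := rt_pos K
  have h1 : ∀ η : CType d, ‖pair b (haar 𝕜 ω K η)‖ ^ 2 = (rt K * ((2 : ℝ) ^ d)⁻¹) ^ 2 *
      ‖∑ ε, (sg (η : Fin d → Bool) ε : 𝕜) * (av ω b (child ω K ε) - av ω b K)‖ ^ 2 := by
    rintro ⟨η, hη⟩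
    have h2 : ∑ ε, (sg η ε : 𝕜) * (av ω b (child ω K ε) - av ω b K) =
        ∑ ε, (sg η ε : 𝕜) * av ω b (child ω K ε) := by
      simp only [mul_sub, Finset.sum_sub_distrib]
      rw [← Finset.sum_mul, ← RCLike.ofReal_sum, sum_sg hη]
      simp
    rw [h2, pair_haar_eq_av ω K η (integrableOn_cube hb _ _), norm_mul, mul_pow,
      RCLike.norm_ofReal, sq_abs]
  simp only [haarMass, h1]
  rw [← Finset.mul_sum]
  have h3 : ∑ η : CType d, ‖∑ ε, (sg (η : Fin d → Bool) ε : 𝕜) *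
      (av ω b (child ω K ε) - av ω b K)‖ ^ 2 ≤
      2 ^ d * ∑ ε, ‖av ω b (child ω K ε) - av ω b K‖ ^ 2 := by
    rw [← sum_norm_sq_sg, ← sum_filter_eq_sum_cType (fun η => ‖∑ ε, (sg η ε : 𝕜) *
      (av ω b (child ω K ε) - av ω b K)‖ ^ 2)]
    exact Finset.sum_le_sum_of_subset_of_nonneg (Finset.filter_subset _ _)
      fun _ _ _ => by positivity
  refine (mul_le_mul_of_nonneg_left h3 (by positivity)).trans (le_of_eq ?_)
  rw [← rt_sq]
  field_simp

/-- Pythagoras for martingale differences: the Haar mass of one cube is at most the gain in mean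
square deviation when passing from the cube to its children. -/
lemma treeSum_haarMass_le (hb : LocallyIntegrable b volume) (N : ℕ) (K : Idx d) :
    treeSum ω (haarMass ω b) N K ≤
      side K ^ d * treeMean ω (fun I => ‖av ω b I - av ω b K‖ ^ 2) N K := by
  induction N generalizing K with
  | zero => simp [treeSum, treeMean]
  | succ N ih =>
    rw [treeSum_succ]
    simp only [treeMean, treeMean_norm_sub_sq_eq (ω := ω) hb N _ (av ω b K)]
    rw [Finset.sum_add_distrib, mul_add, mul_add, add_comm]
    refine add_le_add ((Finset.sum_le_sum fun ε _ => ih _).trans (le_of_eq ?_)) (haarMass_le hb K)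
    simp only [side_child, div_pow, Finset.mul_sum]
    exact Finset.sum_congr rfl fun ε _ => by ring

/-- The Carleson condition for the Haar coefficients of a `BMO` function. -/
lemma exists_carleson (hb : IsBMO b) : ∃ M : ℝ, 0 < M ∧ ∀ (ω : Grid d) N K,
    treeSum ω (haarMass ω b) N K ≤ M * side K ^ d := by
  obtain ⟨hb1, C, hC⟩ := hb
  set A := max C 1
  have hA : 0 < A := lt_max_of_lt_right one_pos
  refine ⟨8 * A ^ 2 + (2 * A + 2 ^ d * A) ^ 2, by positivity, fun ω N K => ?_⟩
  rw [mul_comm]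
  refine (treeSum_haarMass_le hb1 N K).trans (mul_le_mul_of_nonneg_left ?_
    (pow_pos (side_pos K) d).le)
  refine treeMean_sq_le_of_bmo hb1 hA (fun K => ?_) N K
  have := hC (corner ω K) (side K) (side_pos K)
  rw [setAverage_eq, volume_real_cube _ (side_pos K).le, smul_eq_mul] at this
  exact this.trans (le_max_left _ _)

end BMO

/-! ### The Carleson embedding theorem and paraproducts -/

/-- Joint convexity of (u,a) ↦ u²/(1+a), in the form of the Cauchy–Schwarz inequality. -/
lemma sq_mean_le (u a : (Fin d → Bool) → ℝ) (ha : ∀ ε, 0 ≤ a ε) :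
    (((2 : ℝ) ^ d)⁻¹ * ∑ ε, u ε) ^ 2 / (1 + ((2 : ℝ) ^ d)⁻¹ * ∑ ε, a ε) ≤
      ((2 : ℝ) ^ d)⁻¹ * ∑ ε, u ε ^ 2 / (1 + a ε) := by
  have h1 := Finset.sq_sum_div_le_sum_sq_div Finset.univ u (g := fun ε => 1 + a ε)
    (fun ε _ => by linarith [ha ε])
  refine le_trans (le_of_eq ?_) (mul_le_mul_of_nonneg_left h1
    (by positivity : (0 : ℝ) ≤ ((2 : ℝ) ^ d)⁻¹))
  have h0 : 0 ≤ ∑ ε, a ε := Finset.sum_nonneg fun ε _ => ha ε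
  rw [Finset.sum_add_distrib, Finset.sum_const, Finset.card_univ]
  simp only [Fintype.card_pi, Fintype.card_bool, Finset.prod_const, Finset.card_univ,
    Fintype.card_fin, nsmul_eq_mul, mul_one]
  push_cast
  have h2 : (0 : ℝ) < 2 ^ d + ∑ ε, a ε := by positivity
  have h3 : (1 : ℝ) + ((2 : ℝ) ^ d)⁻¹ * ∑ ε, a ε = ((2 : ℝ) ^ d)⁻¹ * (2 ^ d + ∑ ε, a ε) := by
    rw [mul_add, inv_mul_cancel₀ (by positivity)]
  rw [h3]
  field_simp

/-- Both denominators are at most 2, so their product is at most 4. This is where the constant 4 of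
the embedding theorem comes from. -/
lemma bellman_step {u a s : ℝ} (ha : 0 ≤ a) (hs : 0 ≤ s) (h1 : s + a ≤ 1) :
    s * u ^ 2 + 4 * (u ^ 2 / (1 + (s + a))) ≤ 4 * (u ^ 2 / (1 + a)) := by
  have e1 : 0 < 1 + a := by linarith
  have e2 : 0 < 1 + (s + a) := by linarith
  have h2 : (1 + a) * (1 + (s + a)) ≤ 4 := by nlinarith
  have h3 : 4 * (u ^ 2 / (1 + a)) - 4 * (u ^ 2 / (1 + (s + a))) =
      s * u ^ 2 * (4 / ((1 + a) * (1 + (s + a)))) := by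
    field_simp; ring
  have h4 : 1 ≤ 4 / ((1 + a) * (1 + (s + a))) := by
    rw [le_div_iff₀ (by positivity)]; linarith
  have := mul_le_mul_of_nonneg_left h4 (by positivity : 0 ≤ s * u ^ 2)
  linarith

lemma sq_setIntegral_le {f : (Fin d → ℝ) → ℝ} {s : Set (Fin d → ℝ)} (hf : IntegrableOn f s volume)
    (hf2 : IntegrableOn (fun x => f x ^ 2) s volume) (hs : 0 < volume.real s)
    (hs' : volume s ≠ ⊤) :
    (∫ x in s, f x) ^ 2 ≤ volume.real s * ∫ x in s, f x ^ 2 := by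
  set V := volume.real s
  set m := (∫ x in s, f x) / V with hm
  have h1 : 0 ≤ ∫ x in s, (f x ^ 2 - 2 * m * f x + m ^ 2) := by
    refine integral_nonneg fun x => ?_
    have : f x ^ 2 - 2 * m * f x + m ^ 2 = (f x - m) ^ 2 := by ring
    simp only [Pi.zero_apply, this]; positivity
  have h3 : IntegrableOn (fun x => 2 * m * f x) s := hf.const_mul _
  have h4 : IntegrableOn (fun _ => m ^ 2) s volume := integrableOn_const hs'
  have h5 : IntegrableOn (fun x => f x ^ 2 - 2 * m * f x) s := hf2.sub h3
  rw [integral_add h5 h4, integral_sub hf2 h3, integral_const_mul, setIntegral_const,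
    smul_eq_mul] at h1
  have h2 : ∫ x in s, f x = m * V := by rw [hm]; field_simp
  rw [h2] at h1 ⊢
  nlinarith

/-- The Bellman function is 4(⟨f²⟩ - ⟨f⟩²/(1+a)), where a is the normalized Carleson mass below the
cube. It is nonnegative by Cauchy–Schwarz. Convexity compares the children with the parent, and the
growth of a by the mass of the parent itself releases the new term (`sq_mean_le`, `bellman_step`).
-/
lemma carleson_tree (ω : Grid d) {α : Idx d → ℝ} (hα : ∀ K, 0 ≤ α K)
    (hM : ∀ N K, treeSum ω α N K ≤ side K ^ d) {f : (Fin d → ℝ) → ℝ}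
    (hf : LocallyIntegrable f volume) (hf2 : Integrable (fun x => f x ^ 2) volume)
    (N : ℕ) (K : Idx d) :
    treeSum ω (fun I => α I * av ω f I ^ 2) N K ≤ 4 * (∫ x in dcube ω K, f x ^ 2) -
      4 * (side K ^ d * (av ω f K ^ 2 / (1 + (side K ^ d)⁻¹ * treeSum ω α N K))) := by
  induction N generalizing K with
  | zero =>
    have hs := pow_pos (side_pos K) d
    simp only [treeSum, Finset.range_zero, Finset.sum_empty, mul_zero, add_zero, div_one]
    have h1 : (∫ x in dcube ω K, f x) ^ 2 ≤ side K ^ d * ∫ x in dcube ω K, f x ^ 2 := by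
      have h2 := sq_setIntegral_le (integrableOn_cube hf (corner ω K) (side K)) hf2.integrableOn
        (by rw [volume_real_cube _ (side_pos K).le]; exact hs) (volume_dcube_ne_top ω K)
      rwa [volume_real_cube _ (side_pos K).le] at h2
    rw [av_eq, mul_pow]
    simp only [RCLike.ofReal_real_eq_id, id]
    have : side K ^ d * ((side K ^ d)⁻¹ ^ 2 * (∫ x in dcube ω K, f x) ^ 2) =
        (side K ^ d)⁻¹ * (∫ x in dcube ω K, f x) ^ 2 := by field_simp
    rw [this]
    have h2 : (side K ^ d)⁻¹ * (∫ x in dcube ω K, f x) ^ 2 ≤ ∫ x in dcube ω K, f x ^ 2 := by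
      rwa [inv_mul_le_iff₀ hs]
    linarith
  | succ N ih =>
    have hs := pow_pos (side_pos K) d
    rw [treeSum_succ, treeSum_succ, setIntegral_dcube_eq_sum_child ω K hf2.integrableOn]
    set a : (Fin d → Bool) → ℝ := fun ε =>
      (side (child ω K ε) ^ d)⁻¹ * treeSum ω α N (child ω K ε) with ha
    have ha0 : ∀ ε, 0 ≤ a ε := fun ε => mul_nonneg (inv_pos.2 (pow_pos (side_pos _) d)).le
      (treeSum_nonneg ω hα N _)
    have hmean : (side K ^ d)⁻¹ * ∑ ε, treeSum ω α N (child ω K ε) =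
        ((2 : ℝ) ^ d)⁻¹ * ∑ ε, a ε := (inv_side_mul_sum_child K _).symm
    have h1 : ∑ ε, treeSum ω (fun I => α I * av ω f I ^ 2) N (child ω K ε) ≤
        4 * (∑ ε, ∫ x in dcube ω (child ω K ε), f x ^ 2) -
        4 * (side K ^ d * (((2 : ℝ) ^ d)⁻¹ * ∑ ε, av ω f (child ω K ε) ^ 2 / (1 + a ε))) := by
      refine (Finset.sum_le_sum fun ε _ => ih (child ω K ε)).trans (le_of_eq ?_)
      rw [Finset.sum_sub_distrib]
      simp only [Finset.mul_sum, side_child, div_pow, ha]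
      congr 1
      exact Finset.sum_congr rfl fun ε _ => by ring
    have h2 := sq_mean_le (fun ε => av ω f (child ω K ε)) a ha0
    have h3 : av ω f K = ((2 : ℝ) ^ d)⁻¹ * ∑ ε, av ω f (child ω K ε) := by
      simpa using av_eq_sum_child ω K (integrableOn_cube hf _ _)
    rw [← h3] at h2
    have h4 : (side K ^ d)⁻¹ * (α K + ∑ ε, treeSum ω α N (child ω K ε)) =
        (side K ^ d)⁻¹ * α K + ((2 : ℝ) ^ d)⁻¹ * ∑ ε, a ε := by rw [mul_add, hmean]
    have h5 : (side K ^ d)⁻¹ * α K + ((2 : ℝ) ^ d)⁻¹ * ∑ ε, a ε ≤ 1 := by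
      rw [← h4, inv_mul_le_iff₀ hs, mul_one, ← treeSum_succ]; exact hM _ _
    have h6 := bellman_step (u := av ω f K) (mul_nonneg (by positivity)
      (Finset.sum_nonneg fun ε _ => ha0 ε) : 0 ≤ ((2 : ℝ) ^ d)⁻¹ * ∑ ε, a ε)
      (mul_nonneg (inv_pos.2 hs).le (hα K)) h5
    rw [h4]
    have h7 := mul_le_mul_of_nonneg_left h2 hs.le
    have h8 := mul_le_mul_of_nonneg_left h6 hs.le
    have h9 : side K ^ d * ((side K ^ d)⁻¹ * α K * av ω f K ^ 2) = α K * av ω f K ^ 2 := by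
      field_simp
    rw [mul_add, h9] at h8
    linarith

lemma L2.locallyIntegrable (f : L2 𝕜 d) : LocallyIntegrable f volume :=
  (Lp.memLp f).locallyIntegrable (by norm_num)

lemma L2.integrable_norm_sq (f : L2 𝕜 d) : Integrable (fun x => ‖f x‖ ^ 2) volume :=
  (Lp.memLp f).integrable_norm_pow (by norm_num)

lemma L2.integral_norm_sq (f : L2 𝕜 d) : ∫ x, ‖f x‖ ^ 2 = ‖f‖ ^ 2 := by
  have h : ((∫ x, ‖f x‖ ^ 2 : ℝ) : 𝕜) = ((‖f‖ ^ 2 : ℝ) : 𝕜) := by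
    rw [RCLike.ofReal_pow, ← inner_self_eq_norm_sq_to_K, L2.inner_def, ← integral_ofReal]
    refine integral_congr_ae (Eventually.of_forall fun x => ?_)
    simp only [inner_self_eq_norm_sq_to_K, RCLike.ofReal_pow]
  exact_mod_cast h

/-- The dyadic Carleson embedding theorem. -/
lemma carleson_embedding (ω : Grid d) {α : Idx d → ℝ} (hα : ∀ K, 0 ≤ α K) {M : ℝ} (hM0 : 0 < M)
    (hM : ∀ N K, treeSum ω α N K ≤ M * side K ^ d) (f : L2 𝕜 d) (s : Finset (Idx d)) :
    ∑ K ∈ s, α K * ‖av ω f K‖ ^ 2 ≤ 4 * M * ‖f‖ ^ 2 := by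
  set F : (Fin d → ℝ) → ℝ := fun x => ‖f x‖ with hF
  have hF1 : LocallyIntegrable F volume := fun x =>
    let ⟨s, hs, h⟩ := L2.locallyIntegrable f x
    ⟨s, hs, h.norm⟩
  have hF2 : Integrable (fun x => F x ^ 2) volume := L2.integrable_norm_sq f
  have hav : ∀ K, ‖av ω f K‖ ^ 2 ≤ av ω F K ^ 2 := fun K => by
    refine pow_le_pow_left₀ (norm_nonneg _) ((norm_av_le ω f K).trans (le_of_eq ?_)) 2
    rw [av_eq]; rfl
  have hβ : ∀ K, 0 ≤ α K / M := fun K => div_nonneg (hα K) hM0.le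
  have hβM : ∀ N K, treeSum ω (fun K => α K / M) N K ≤ side K ^ d := by
    intro N K
    have : treeSum ω (fun K => α K / M) N K = treeSum ω α N K / M := by
      simp only [treeSum, Finset.sum_div]
    rw [this, div_le_iff₀ hM0, mul_comm]
    exact hM N K
  have hφ : ∀ K, 0 ≤ α K / M * av ω F K ^ 2 := fun K => mul_nonneg (hβ K) (by positivity)
  -- As the roots are disjoint, the integrals of the squares over them add up to at most the square
  -- of the L² norm.
  obtain ⟨n, N, t, ht, hst⟩ := exists_sum_le_sum_treeSum ω hφ s
  have h1 : ∑ Q ∈ t, treeSum ω (fun K => α K / M * av ω F K ^ 2) N Q ≤ 4 * ‖f‖ ^ 2 := by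
    calc _ ≤ ∑ Q ∈ t, 4 * ∫ x in dcube ω Q, F x ^ 2 := by
          refine Finset.sum_le_sum fun Q _ => (carleson_tree ω hβ hβM hF1 hF2 N Q).trans ?_
          refine sub_le_self _ (mul_nonneg (by norm_num) (mul_nonneg (pow_pos (side_pos Q) d).le
            (div_nonneg (by positivity) ?_)))
          exact add_nonneg zero_le_one (mul_nonneg (inv_pos.2 (pow_pos (side_pos Q) d)).le
            (treeSum_nonneg ω hβ N Q))
      _ = 4 * ∫ x in ⋃ Q ∈ t, dcube ω Q, F x ^ 2 := by
          rw [← Finset.mul_sum, integral_biUnion_finset t (fun Q _ => measurableSet_dcube ω Q) ?_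
            (fun Q _ => hF2.integrableOn)]
          intro Q hQ Q' hQ' h
          exact disjoint_dcube ((ht Q hQ).trans (ht Q' hQ').symm) h
      _ ≤ 4 * ‖f‖ ^ 2 := by
          rw [← L2.integral_norm_sq]
          exact mul_le_mul_of_nonneg_left (setIntegral_le_integral hF2
            (Eventually.of_forall fun x => by positivity)) (by norm_num)
  calc ∑ K ∈ s, α K * ‖av ω f K‖ ^ 2 ≤ ∑ K ∈ s, M * (α K / M * av ω F K ^ 2) := by
        refine Finset.sum_le_sum fun K _ => ?_
        rw [← mul_assoc, mul_div_cancel₀ _ hM0.ne']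
        exact mul_le_mul_of_nonneg_left (hav K) (hα K)
    _ ≤ M * (4 * ‖f‖ ^ 2) := by
        rw [← Finset.mul_sum]
        exact mul_le_mul_of_nonneg_left (hst.trans h1) hM0.le
    _ = _ := by ring

lemma av_L2_add (ω : Grid d) (f g : L2 𝕜 d) (K : Idx d) :
    av ω (f + g : L2 𝕜 d) K = av ω f K + av ω g K := by
  have hf : IntegrableOn f (dcube ω K) := integrableOn_cube (L2.locallyIntegrable f) _ _
  have hg : IntegrableOn g (dcube ω K) := integrableOn_cube (L2.locallyIntegrable g) _ _
  rw [av_eq, av_eq, av_eq, ← mul_add, ← integral_add hf hg]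
  congr 1
  exact integral_congr_ae (ae_restrict_of_ae (Lp.coeFn_add f g))

lemma av_L2_smul (ω : Grid d) (c : 𝕜) (f : L2 𝕜 d) (K : Idx d) :
    av ω (c • f : L2 𝕜 d) K = c * av ω f K := by
  rw [av_eq, av_eq, mul_left_comm]
  congr 1
  rw [← integral_const_mul]
  exact integral_congr_ae (ae_restrict_of_ae (Lp.coeFn_smul c f))

/-- One term of the paraproduct, as a linear map. -/
def paraLin (ω : Grid d) (b : (Fin d → ℝ) → 𝕜) (K : Idx d) : L2 𝕜 d →ₗ[𝕜] L2 𝕜 d where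
  toFun f := ∑ η with η ≠ zeroη d, (pair b (haar 𝕜 ω K η) * av ω f K) • haarL2 𝕜 ω K η
  map_add' f g := by
    simp only [av_L2_add, mul_add, add_smul, Finset.sum_add_distrib]
  map_smul' c f := by
    simp only [av_L2_smul, RingHom.id_apply, Finset.smul_sum, smul_smul]
    exact Finset.sum_congr rfl fun η _ => by rw [mul_left_comm]

lemma paraLin_eq (ω : Grid d) (b : (Fin d → ℝ) → 𝕜) (K : Idx d) (f : L2 𝕜 d) :
    paraLin ω b K f = ∑ q ∈ ({K} : Finset (Idx d)) ×ˢ (Finset.univ : Finset (CType d)),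
      (pair b (haar 𝕜 ω q.1 q.2) * av ω f q.1) • hv 𝕜 ω q := by
  rw [Finset.sum_product, Finset.sum_singleton]
  exact sum_filter_eq_sum_cType fun η =>
    (pair b (haar 𝕜 ω K η) * av ω f K) • haarL2 𝕜 ω K η

/-- Dyadic paraproducts with `BMO` symbols are bounded on `L²`. -/
lemma exists_isParaproduct {b : (Fin d → ℝ) → 𝕜} (hb : IsBMO b) (ω : Grid d) :
    ∃ P : L2 𝕜 d →L[𝕜] L2 𝕜 d, IsParaproduct ω b P := by
  obtain ⟨M, hM0, hM⟩ := exists_carleson hb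
  suffices h : ∃ P : L2 𝕜 d →L[𝕜] L2 𝕜 d, ‖P‖ ≤ √(4 * M) ∧
      ∀ f, HasSum (fun K => paraLin ω b K f) (P f) from h.imp fun P hP => hP.2
  refine exists_clm_of_orthogonal (paraLin ω b) ?_ (Real.sqrt_nonneg _) ?_
  · intro K K' f h
    rw [paraLin_eq, paraLin_eq]
    refine inner_sum_smul_hv_eq_zero ω ?_ _ _
    rw [Finset.disjoint_left]
    rintro ⟨I, η⟩ h1 h2
    simp only [Finset.mem_product, Finset.mem_singleton] at h1 h2
    exact h (h1.1.symm.trans h2.1)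
  · intro f s
    rw [Real.sq_sqrt (by positivity)]
    refine le_trans (le_of_eq ?_) (carleson_embedding ω (haarMass_nonneg (ω := ω) (b := b)) hM0
      (hM ω) f s)
    refine Finset.sum_congr rfl fun K _ => ?_
    rw [paraLin_eq, norm_sq_sum_smul_hv, Finset.sum_product, Finset.sum_singleton, haarMass,
      Finset.sum_mul]
    simp only [norm_mul, mul_pow]

end DyadicRep

end

noncomputable section

namespace DyadicRep

variable {d : ℕ} {𝕜 : Type*} [RCLike 𝕜]

/-! ### Test functions -/

lemma testSpace_induction {p : ((Fin d → ℝ) → 𝕜) → Prop}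
    (hcube : ∀ (a : Fin d → ℝ) (l : ℝ), 0 < l → p ((cube a l).indicator 1))
    (hc1 : ∀ f, ContDiff ℝ 1 f → HasCompactSupport f → p f) (h0 : p 0)
    (hadd : ∀ f g, p f → p g → p (f + g)) (hsmul : ∀ (c : 𝕜) f, p f → p (c • f))
    (u : testSpace 𝕜 d) : p u := by
  obtain ⟨u, hu⟩ := u
  refine Submodule.span_induction (p := fun f _ => p f) ?_ h0 (fun f g _ _ => hadd f g)
    (fun c f _ => hsmul c f) hu
  rintro f (⟨a, l, hl, rfl⟩ | ⟨h1, h2⟩)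
  · exact hcube a l hl
  · exact hc1 f h1 h2

lemma hasCompactSupport_cube (a : Fin d → ℝ) (l : ℝ) :
    HasCompactSupport ((cube a l).indicator (1 : (Fin d → ℝ) → 𝕜)) := by
  refine HasCompactSupport.intro (K := Icc a fun n => a n + l) isCompact_Icc fun x hx => ?_
  exact indicator_of_notMem (fun h => hx (cube_subset_Icc a l h)) _

lemma testSpace_hasCompactSupport (u : testSpace 𝕜 d) :
    HasCompactSupport (u : (Fin d → ℝ) → 𝕜) := by
  refine testSpace_induction (p := fun f => HasCompactSupport f) ?_ ?_ ?_ ?_ ?_ u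
  · exact fun a l _ => hasCompactSupport_cube a l
  · exact fun _ _ h => h
  · exact HasCompactSupport.zero
  · exact fun _ _ hf hg => hf.add hg
  · exact fun c f hf => hf.comp_left (g := fun y : 𝕜 => c • y) (smul_zero c)

lemma testSpace_measurable (u : testSpace 𝕜 d) : Measurable (u : (Fin d → ℝ) → 𝕜) :=
  testSpace_induction (p := Measurable)
    (fun a l _ => measurable_one.indicator (measurableSet_cube a l))
    (fun _ h _ => h.continuous.measurable) measurable_const (fun _ _ hf hg => hf.add hg)
    (fun c _ hf => hf.const_smul c) u

lemma testSpace_exists_bound (u : testSpace 𝕜 d) :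
    ∃ C, ∀ x, ‖(u : (Fin d → ℝ) → 𝕜) x‖ ≤ C := by
  refine testSpace_induction (p := fun f => ∃ C, ∀ x, ‖f x‖ ≤ C) ?_ ?_ ⟨0, by simp⟩ ?_ ?_ u
  · refine fun a l _ => ⟨1, fun x => ?_⟩
    rw [norm_indicator_eq_indicator_norm]
    exact indicator_le_self' (fun _ _ => norm_nonneg _) x |>.trans (by simp)
  · exact fun f h1 h2 => h2.exists_bound_of_continuous h1.continuous
  · rintro f g ⟨C, hC⟩ ⟨C', hC'⟩
    exact ⟨C + C', fun x => (norm_add_le _ _).trans (add_le_add (hC x) (hC' x))⟩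
  · rintro c f ⟨C, hC⟩
    refine ⟨‖c‖ * C, fun x => ?_⟩
    rw [Pi.smul_apply, norm_smul]
    exact mul_le_mul_of_nonneg_left (hC x) (norm_nonneg c)

lemma testSpace_integrable_mul (u : testSpace 𝕜 d) {v : (Fin d → ℝ) → 𝕜}
    (hv : LocallyIntegrable v volume) :
    Integrable (fun x => (u : (Fin d → ℝ) → 𝕜) x * v x) volume := by
  obtain ⟨C, hC⟩ := testSpace_exists_bound u
  have h1 : IntegrableOn (fun x => (u : (Fin d → ℝ) → 𝕜) x * v x)
      (tsupport (u : (Fin d → ℝ) → 𝕜)) :=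
    Integrable.bdd_mul (hv.integrableOn_isCompact (testSpace_hasCompactSupport u).isCompact)
      (testSpace_measurable u).aestronglyMeasurable (Eventually.of_forall hC)
  refine (integrableOn_iff_integrable_of_support_subset fun x hx => ?_).1 h1
  exact subset_tsupport _ (left_ne_zero_of_mul hx)

lemma testSpace_integrable (u : testSpace 𝕜 d) : Integrable (u : (Fin d → ℝ) → 𝕜) volume := by
  simpa using testSpace_integrable_mul u (v := fun _ => 1) (locallyIntegrable_const 1)

/-- The bilinear form of an operator on test functions. -/
def bform (T : testSpace 𝕜 d →ₗ[𝕜] ((Fin d → ℝ) →ₘ[volume] 𝕜)) (u v : testSpace 𝕜 d) : 𝕜 :=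
  pair (u : (Fin d → ℝ) → 𝕜) (T v)

lemma bform_add_left {T : testSpace 𝕜 d →ₗ[𝕜] ((Fin d → ℝ) →ₘ[volume] 𝕜)}
    (hT : ∀ f, LocallyIntegrable (T f) volume) (u u' v : testSpace 𝕜 d) :
    bform T (u + u') v = bform T u v + bform T u' v := by
  rw [bform, bform, bform, pair, pair, pair, ← integral_add (testSpace_integrable_mul u (hT v))
    (testSpace_integrable_mul u' (hT v))]
  refine integral_congr_ae (Eventually.of_forall fun x => ?_)
  exact add_mul _ _ _

lemma bform_add_right {T : testSpace 𝕜 d →ₗ[𝕜] ((Fin d → ℝ) →ₘ[volume] 𝕜)}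
    (hT : ∀ f, LocallyIntegrable (T f) volume) (u v v' : testSpace 𝕜 d) :
    bform T u (v + v') = bform T u v + bform T u v' := by
  rw [bform, bform, bform, pair, pair, pair, ← integral_add (testSpace_integrable_mul u (hT v))
    (testSpace_integrable_mul u (hT v')), map_add]
  refine integral_congr_ae ?_
  filter_upwards [AEEqFun.coeFn_add (T v) (T v')] with x hx
  rw [hx, Pi.add_apply, mul_add]

lemma bform_smul_left (T : testSpace 𝕜 d →ₗ[𝕜] ((Fin d → ℝ) →ₘ[volume] 𝕜)) (c : 𝕜)
    (u v : testSpace 𝕜 d) : bform T (c • u) v = c * bform T u v := by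
  rw [bform, bform, pair, pair, ← integral_const_mul]
  refine integral_congr_ae (Eventually.of_forall fun x => ?_)
  exact mul_assoc _ _ _

lemma bform_smul_right (T : testSpace 𝕜 d →ₗ[𝕜] ((Fin d → ℝ) →ₘ[volume] 𝕜)) (c : 𝕜)
    (u v : testSpace 𝕜 d) : bform T u (c • v) = c * bform T u v := by
  rw [bform, bform, pair, pair, ← integral_const_mul, map_smul]
  refine integral_congr_ae ?_
  filter_upwards [AEEqFun.coeFn_smul c (T v)] with x hx
  rw [hx, Pi.smul_apply, smul_eq_mul]; ring

/-- The bilinear form of an operator, as a bilinear map. -/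
def blin {T : testSpace 𝕜 d →ₗ[𝕜] ((Fin d → ℝ) →ₘ[volume] 𝕜)}
    (hT : ∀ f, LocallyIntegrable (T f) volume) : testSpace 𝕜 d →ₗ[𝕜] testSpace 𝕜 d →ₗ[𝕜] 𝕜 :=
  LinearMap.mk₂ 𝕜 (bform T) (bform_add_left hT) (bform_smul_left T) (bform_add_right hT)
    (bform_smul_right T)

lemma blin_apply {T : testSpace 𝕜 d →ₗ[𝕜] ((Fin d → ℝ) →ₘ[volume] 𝕜)}
    (hT : ∀ f, LocallyIntegrable (T f) volume) (u v : testSpace 𝕜 d) :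
    blin hT u v = bform T u v := rfl

/-! ### The smallest constants are admissible -/

lemma sizeBound_czZeroNorm {K : (Fin d → ℝ) → (Fin d → ℝ) → 𝕜} (h : ∃ C, SizeBound K C) :
    SizeBound K (czZeroNorm K) := by
  refine ⟨le_csInf h fun C hC => hC.1, fun x y hxy => ?_⟩
  have hp : 0 < ‖x - y‖ ^ d := pow_pos (norm_pos_iff.2 (sub_ne_zero.2 hxy)) d
  rw [le_div_iff₀ hp]
  exact le_csInf h fun C hC => (le_div_iff₀ hp).1 (hC.2 x y hxy)

lemma IsModulus.nonneg {ψ : ℝ → ℝ} (hψ : IsModulus ψ) {t : ℝ} (h0 : 0 ≤ t) (h1 : t ≤ 1) :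
    0 ≤ ψ t := by
  rw [← hψ.zero]
  exact hψ.strictMono.monotoneOn ⟨le_rfl, zero_le_one⟩ ⟨h0, h1⟩ h0

lemma smoothBound_czNorm {ψ : ℝ → ℝ} (hψ : IsModulus ψ)
    {K : (Fin d → ℝ) → (Fin d → ℝ) → 𝕜} (h : ∃ C, SmoothBound ψ K C) :
    SmoothBound ψ K (czNorm ψ K) := by
  refine ⟨le_csInf h fun C hC => hC.1, fun x x' y hxy => ?_⟩
  have hy : 0 < ‖x - y‖ := by linarith [norm_nonneg (x - x')]
  have hp : 0 < ‖x - y‖ ^ d := pow_pos hy d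
  have h1 : ‖x - x'‖ / ‖x - y‖ ≤ 1 := by
    rw [div_le_one hy]; linarith [norm_nonneg (x - x')]
  -- If the modulus vanishes here, division by it is impossible; but then any admissible constant
  -- already shows that the left side is zero.
  rcases (hψ.nonneg (by positivity) h1).eq_or_lt with h0 | h0
  · obtain ⟨C, hC⟩ := h
    have := hC.2 x x' y hxy
    rwa [← h0, mul_zero] at this ⊢
  · have h2 : 0 < ψ (‖x - x'‖ / ‖x - y‖) / ‖x - y‖ ^ d := div_pos h0 hp
    rw [div_mul_eq_mul_div, mul_div_assoc, ← div_le_iff₀ h2]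
    refine le_csInf h fun C hC => ?_
    rw [div_le_iff₀ h2, ← mul_div_assoc, ← div_mul_eq_mul_div]
    exact hC.2 x x' y hxy

lemma weakBound_wbpNorm {T : testSpace 𝕜 d →ₗ[𝕜] ((Fin d → ℝ) →ₘ[volume] 𝕜)}
    (h : ∃ C, WeakBound T C) : WeakBound T (wbpNorm T) := by
  refine ⟨le_csInf h fun C hC => hC.1, fun a l hl => ?_⟩
  have hp : 0 < l ^ d := pow_pos hl d
  rw [← div_le_iff₀ hp]
  exact le_csInf h fun C hC => (div_le_iff₀ hp).2 (hC.2 a l hl)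

/-! ### Weakly singular integrals -/

lemma integrableOn_ball_rpow (hd : 0 < d) (r : ℝ) :
    IntegrableOn (fun z : Fin d → ℝ => ‖z‖ ^ (1 / 2 - d : ℝ)) (Metric.ball 0 r) volume := by
  refine integrableOn_ball_of_norm_le_rpow (C := 1) (α := d - 1 / 2) ?_ ?_ ?_ ?_
  · rw [Module.finrank_fin_fun]; exact hd
  · rw [Module.finrank_fin_fun]; linarith
  · refine Eventually.of_forall fun z => ?_
    rw [Real.norm_of_nonneg (by positivity), one_mul, neg_sub]
  · exact (measurable_norm.pow_const _).aestronglyMeasurable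

lemma setIntegral_ball_rpow {r : ℝ} (hr : 0 < r) :
    ∫ z in Metric.ball (0 : Fin d → ℝ) r, ‖z‖ ^ (1 / 2 - d : ℝ) =
      r ^ (1 / 2 : ℝ) * ∫ z in Metric.ball (0 : Fin d → ℝ) 1, ‖z‖ ^ (1 / 2 - d : ℝ) := by
  have h := Measure.setIntegral_comp_smul_of_pos (volume : Measure (Fin d → ℝ))
    (fun z : Fin d → ℝ => ‖z‖ ^ (1 / 2 - d : ℝ)) (Metric.ball 0 1) hr
  rw [smul_unitBall_of_pos hr, Module.finrank_fin_fun] at h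
  have h1 : ∀ z : Fin d → ℝ, ‖r • z‖ ^ (1 / 2 - d : ℝ) =
      r ^ (1 / 2 - d : ℝ) * ‖z‖ ^ (1 / 2 - d : ℝ) := fun z => by
    rw [norm_smul, Real.norm_of_nonneg hr.le, Real.mul_rpow hr.le (norm_nonneg z)]
  simp only [h1, integral_const_mul, smul_eq_mul] at h
  have hp : (0 : ℝ) < r ^ d := pow_pos hr d
  have h2 : r ^ (1 / 2 : ℝ) = r ^ d * r ^ (1 / 2 - d : ℝ) := by
    rw [← Real.rpow_natCast r d, ← Real.rpow_add hr]; congr 1; ring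
  rw [h2, mul_assoc, h, mul_inv_cancel_left₀ hp.ne']

/-- The part of the cube within distance l of x is handled by scaling of the integrable singularity,
the rest by the constant l^{1/2-d} times the volume. The exponent leaves a factor |x-y|^{-1/2} of
the kernel bound, which is integrable across a hyperplane. -/
lemma exists_cube_singular_bound (hd : 0 < d) : ∃ C : ℝ, 0 < C ∧ ∀ (x a : Fin d → ℝ) (l : ℝ),
    0 < l → IntegrableOn (fun y => ‖x - y‖ ^ (1 / 2 - d : ℝ)) (cube a l) volume ∧
      ∫ y in cube a l, ‖x - y‖ ^ (1 / 2 - d : ℝ) ≤ C * l ^ (1 / 2 : ℝ) := by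
  set κ := ∫ z in Metric.ball (0 : Fin d → ℝ) 1, ‖z‖ ^ (1 / 2 - d : ℝ) with hκ
  have hκ0 : 0 ≤ κ := integral_nonneg fun z => by positivity
  refine ⟨κ + 1, by positivity, fun x a l hl => ?_⟩
  set p : ℝ := 1 / 2 - d with hp
  have hp0 : p ≤ 0 := by
    have : (1 : ℝ) ≤ d := by exact_mod_cast hd
    rw [hp]; linarith
  set F : (Fin d → ℝ) → ℝ := (Metric.ball 0 l).indicator fun z => ‖z‖ ^ p with hF
  have hFi : Integrable F volume :=
    (integrable_indicator_iff measurableSet_ball).2 (integrableOn_ball_rpow hd l)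
  have hFx : Integrable (fun y => F (x - y)) volume := hFi.comp_sub_left x
  have hdom : ∀ y, ‖x - y‖ ^ p ≤ F (x - y) + l ^ p := by
    intro y
    by_cases h : x - y ∈ Metric.ball (0 : Fin d → ℝ) l
    · rw [hF, indicator_of_mem h]
      exact le_add_of_nonneg_right (by positivity)
    · rw [hF, indicator_of_notMem h, zero_add]
      rw [mem_ball_zero_iff, not_lt] at h
      exact Real.rpow_le_rpow_of_nonpos hl h hp0
  have hc : IntegrableOn (fun _ : Fin d → ℝ => l ^ p) (cube a l) volume :=
    integrableOn_const (by rw [volume_cube a hl.le]; exact ENNReal.ofReal_ne_top)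
  have hsum : IntegrableOn (fun y => F (x - y) + l ^ p) (cube a l) volume :=
    hFx.integrableOn.add hc
  have hint : IntegrableOn (fun y => ‖x - y‖ ^ p) (cube a l) volume := by
    refine Integrable.mono' hsum ?_ (Eventually.of_forall fun y => ?_)
    · exact ((measurable_const.sub measurable_id).norm.pow_const _).aestronglyMeasurable
    · rw [Real.norm_of_nonneg (by positivity)]; exact hdom y
  refine ⟨hint, (integral_mono hint hsum hdom).trans ?_⟩
  rw [integral_add hFx.integrableOn hc, setIntegral_const, volume_real_cube a hl.le, add_mul]
  refine add_le_add ?_ (le_of_eq ?_)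
  · have h1 : ∫ y in cube a l, F (x - y) ≤ ∫ y, F (x - y) :=
      setIntegral_le_integral hFx (Eventually.of_forall fun y =>
        indicator_nonneg (fun z _ => by positivity) _)
    rw [integral_sub_left_eq_self (fun y => F y) volume x, hF,
      integral_indicator measurableSet_ball, setIntegral_ball_rpow hl, mul_comm] at h1
    exact h1
  · rw [smul_eq_mul, ← Real.rpow_natCast l d, ← Real.rpow_add hl, one_mul, hp]
    congr 1; ring

/-- The sum of the inverse square roots of the distances to the end points of an interval. -/
def edge (a l t : ℝ) : ℝ := (t - a) ^ (-(1 / 2) : ℝ) + (a + l - t) ^ (-(1 / 2) : ℝ)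

lemma integral_edge (a : ℝ) {l : ℝ} (hl : 0 < l) :
    IntegrableOn (edge a l) (Ico a (a + l)) volume ∧
      ∫ t in Ico a (a + l), edge a l t = 4 * l ^ (1 / 2 : ℝ) := by
  have h0 : IntervalIntegrable (fun t : ℝ => t ^ (-(1 / 2) : ℝ)) volume 0 l :=
    intervalIntegral.intervalIntegrable_rpow' (by norm_num)
  have h1 : IntervalIntegrable (fun t : ℝ => (t - a) ^ (-(1 / 2) : ℝ)) volume a (a + l) := by
    have := h0.comp_sub_right a
    simpa [add_comm] using this
  have h2 : IntervalIntegrable (fun t : ℝ => (a + l - t) ^ (-(1 / 2) : ℝ)) volume a (a + l) := by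
    have := (h0.comp_sub_left (a + l)).symm
    simpa using this
  have e0 : ∫ t in (0 : ℝ)..l, t ^ (-(1 / 2) : ℝ) = 2 * l ^ (1 / 2 : ℝ) := by
    rw [integral_rpow (Or.inl (by norm_num)), Real.zero_rpow (by norm_num)]
    norm_num; ring
  have e1 : ∫ t in a..(a + l), (t - a) ^ (-(1 / 2) : ℝ) = 2 * l ^ (1 / 2 : ℝ) := by
    rw [intervalIntegral.integral_comp_sub_right (fun t : ℝ => t ^ (-(1 / 2) : ℝ)) a]
    simpa using e0
  have e2 : ∫ t in a..(a + l), (a + l - t) ^ (-(1 / 2) : ℝ) = 2 * l ^ (1 / 2 : ℝ) := by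
    rw [intervalIntegral.integral_comp_sub_left (fun t : ℝ => t ^ (-(1 / 2) : ℝ)) (a + l)]
    simpa using e0
  have hle : a ≤ a + l := by linarith
  constructor
  · have := (intervalIntegrable_iff_integrableOn_Ico_of_le hle).1 (h1.add h2)
    exact this
  · rw [integral_Ico_eq_integral_Ioc, ← intervalIntegral.integral_of_le hle]
    unfold edge
    rw [intervalIntegral.integral_add h1 h2, e1, e2]; ring

lemma integral_cube_comp_apply (a : Fin d → ℝ) {l : ℝ} (hl : 0 < l) (n : Fin d) {h : ℝ → ℝ}
    (hh : IntegrableOn h (Ico (a n) (a n + l)) volume) :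
    IntegrableOn (fun x : Fin d → ℝ => h (x n)) (cube a l) volume ∧
      ∫ x in cube a l, h (x n) = (∫ t in Ico (a n) (a n + l), h t) * l ^ (d - 1) := by
  set F : Fin d → ℝ → ℝ := fun m => (Ico (a m) (a m + l)).indicator (if m = n then h else 1)
    with hF
  have hFi : ∀ m, Integrable (F m) volume := by
    intro m
    rw [hF, integrable_indicator_iff measurableSet_Ico]
    split_ifs with hm
    · subst hm; exact hh
    · exact integrableOn_const (by simp)
  have hprod : (fun x : Fin d → ℝ => ∏ m, F m (x m)) =
      (cube a l).indicator fun x => h (x n) := by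
    funext x
    by_cases hx : x ∈ cube a l
    · rw [indicator_of_mem hx, Finset.prod_eq_single n]
      · simp only [hF, if_true]
        rw [indicator_of_mem (hx n trivial)]
      · intro m _ hm
        simp only [hF, hm, if_false]
        rw [indicator_of_mem (hx m trivial)]; rfl
      · simp
    · rw [indicator_of_notMem hx]
      have : ∃ m, x m ∉ Ico (a m) (a m + l) := by
        by_contra! h'
        exact hx fun m _ => h' m
      obtain ⟨m, hm⟩ := this
      exact Finset.prod_eq_zero (Finset.mem_univ m) (indicator_of_notMem hm _)
  constructor
  · rw [← integrable_indicator_iff (measurableSet_cube a l), ← hprod]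
    exact Integrable.fintype_prod hFi
  · rw [← integral_indicator (measurableSet_cube a l), ← hprod,
      integral_fintype_prod_volume_eq_prod, ← Finset.mul_prod_erase _ _ (Finset.mem_univ n)]
    congr 1
    · simp only [hF, if_true]
      rw [integral_indicator measurableSet_Ico]
    · rw [Finset.prod_congr rfl (g := fun _ => l), Finset.prod_const,
        Finset.card_erase_of_mem (Finset.mem_univ n), Finset.card_univ, Fintype.card_fin]
      intro m hm
      simp only [hF, Finset.ne_of_mem_erase hm, if_false]
      rw [integral_indicator measurableSet_Ico]
      simp [hl.le]

end DyadicRep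

end

noncomputable section

namespace DyadicRep

variable {d : ℕ} {𝕜 : Type*} [RCLike 𝕜]

/-! ### Scales of lattice vectors and moduli -/

/-- The `ℓ^∞` norm of a lattice vector. -/
def supAbs (m : Fin d → ℤ) : ℕ := Finset.univ.sup fun n => (m n).natAbs

/-- The scale of a lattice vector: `0` for the zero vector, and otherwise the exponent `k` with
`2^{k-2} ≤ |m| < 2^{k-1}`. -/
def lev (m : Fin d → ℤ) : ℕ := if m = 0 then 0 else Nat.size (supAbs m) + 1

lemma natAbs_le_supAbs (m : Fin d → ℤ) (n : Fin d) : (m n).natAbs ≤ supAbs m :=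
  Finset.le_sup (f := fun n => (m n).natAbs) (Finset.mem_univ n)

lemma exists_natAbs_eq_supAbs {m : Fin d → ℤ} (hm : m ≠ 0) :
    ∃ n, (m n).natAbs = supAbs m ∧ m n ≠ 0 := by
  obtain ⟨n0, hn0⟩ := Function.ne_iff.1 hm
  obtain ⟨n, -, hn⟩ := Finset.exists_mem_eq_sup Finset.univ ⟨n0, Finset.mem_univ n0⟩
    fun n => (m n).natAbs
  have h1 := natAbs_le_supAbs m n0
  refine ⟨n, hn.symm, fun h => ?_⟩
  have h2 : (m n).natAbs = supAbs m := hn.symm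
  rw [h] at h2
  simp only [Pi.zero_apply] at hn0
  omega

lemma supAbs_pos {m : Fin d → ℤ} (hm : m ≠ 0) : 0 < supAbs m := by
  obtain ⟨n, h1, h2⟩ := exists_natAbs_eq_supAbs hm
  omega

lemma lev_zero : lev (0 : Fin d → ℤ) = 0 := if_pos rfl

lemma lev_of_ne {m : Fin d → ℤ} (hm : m ≠ 0) : lev m = Nat.size (supAbs m) + 1 := if_neg hm

lemma two_le_lev {m : Fin d → ℤ} (hm : m ≠ 0) : 2 ≤ lev m := by
  have : 0 < Nat.size (supAbs m) := Nat.size_pos.2 (supAbs_pos hm)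
  rw [lev_of_ne hm]; omega

lemma lev_eq_zero {m : Fin d → ℤ} : lev m = 0 ↔ m = 0 := by
  constructor
  · intro h
    by_contra hm
    have := two_le_lev hm
    omega
  · rintro rfl; exact lev_zero

lemma natAbs_lt_two_pow_lev {m : Fin d → ℤ} (hm : m ≠ 0) (n : Fin d) :
    (m n).natAbs < 2 ^ (lev m - 1) := by
  rw [lev_of_ne hm]
  exact (natAbs_le_supAbs m n).trans_lt (Nat.lt_size_self _)

lemma two_pow_le_supAbs {m : Fin d → ℤ} (hm : m ≠ 0) : 2 ^ (lev m - 2) ≤ supAbs m := by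
  have := two_le_lev hm
  have h2 := lev_of_ne hm
  exact Nat.lt_size.1 (by omega)

/-- The decay of the matrix elements at a given lattice distance. -/
def wt (ψ : ℝ → ℝ) (m : Fin d → ℤ) : ℝ := ((1 / 2 : ℝ) ^ lev m) ^ d * ψ ((1 / 2) ^ lev m)

lemma half_pow_pos (k : ℕ) : (0 : ℝ) < (1 / 2) ^ k := by positivity

lemma half_pow_le_one (k : ℕ) : ((1 : ℝ) / 2) ^ k ≤ 1 := pow_le_one₀ (by norm_num) (by norm_num)

section Modulus

variable {ψ : ℝ → ℝ}

lemma IsModulus.mono (hψ : IsModulus ψ) {s t : ℝ} (hs : 0 ≤ s) (hst : s ≤ t) (ht : t ≤ 1) :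
    ψ s ≤ ψ t :=
  hψ.strictMono.monotoneOn ⟨hs, hst.trans ht⟩ ⟨hs.trans hst, ht⟩ hst

lemma IsModulus.pos (hψ : IsModulus ψ) {t : ℝ} (h0 : 0 < t) (h1 : t ≤ 1) : 0 < ψ t := by
  rw [← hψ.zero]
  exact hψ.strictMono ⟨le_rfl, zero_le_one⟩ ⟨h0.le, h1⟩ h0

lemma IsModulus.le_mul (hψ : IsModulus ψ) {c t : ℝ} (hc : 1 ≤ c) (h0 : 0 < t) (h1 : c * t ≤ 1) :
    ψ (c * t) ≤ c * ψ t := by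
  have h2 : t ≤ c * t := le_mul_of_one_le_left h0.le hc
  have h3 := hψ.ratio_anti ⟨h0, h2.trans h1⟩ ⟨h0.trans_le h2, h1⟩ h2
  simp only at h3
  rw [div_le_div_iff₀ (h0.trans_le h2) h0] at h3
  have h4 : ψ (c * t) * t ≤ (c * ψ t) * t := by linarith
  exact le_of_mul_le_mul_right h4 h0

lemma IsModulus.self_le (hψ : IsModulus ψ) {t : ℝ} (h0 : 0 < t) (h1 : t ≤ 1) : t ≤ ψ t := by
  have h := hψ.le_mul (c := t⁻¹) ((one_le_inv₀ h0).2 h1) h0 (inv_mul_cancel₀ h0.ne').le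
  rw [inv_mul_cancel₀ h0.ne', hψ.one, ← div_eq_inv_mul, le_div_iff₀ h0] at h
  linarith

lemma wt_pos (hψ : IsModulus ψ) (m : Fin d → ℤ) : 0 < wt ψ m :=
  mul_pos (by positivity) (hψ.pos (half_pow_pos _) (half_pow_le_one _))

end Modulus

/-! ### Kernel estimates -/

/-- The constant in the estimate of weakly singular integrals. -/
def singC (hd : 0 < d) : ℝ := (exists_cube_singular_bound hd).choose

lemma singC_pos (hd : 0 < d) : 0 < singC hd := (exists_cube_singular_bound hd).choose_spec.1

lemma tsupport_subset_Icc {u : (Fin d → ℝ) → 𝕜} {a : Fin d → ℝ} {l : ℝ}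
    (hu : ∀ x, x ∉ cube a l → u x = 0) : tsupport u ⊆ Icc a fun n => a n + l := by
  refine closure_minimal (fun x hx => ?_) isClosed_Icc
  by_contra h
  exact hx (hu x fun h' => h (cube_subset_Icc a l h'))

section Kernel

variable {ψ : ℝ → ℝ} {K : (Fin d → ℝ) → (Fin d → ℝ) → 𝕜}
  {T Tt : testSpace 𝕜 d →ₗ[𝕜] ((Fin d → ℝ) →ₘ[volume] 𝕜)}

/-- The kernel bound is split as |x-y|^{-d} = |x-y|^{-1/2}·|x-y|^{1/2-d}. The first factor is at
most q^{-1/2}, and the second is integrable over the cube uniformly in x. -/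
lemma norm_apply_le_of_disjoint (hd : 0 < d) {C₀ : ℝ} (hK : SizeBound K C₀)
    {u : (Fin d → ℝ) → 𝕜} {a : Fin d → ℝ} {l : ℝ} (hl : 0 < l)
    (hu : ∀ x, x ∉ cube a l → u x = 0) {M : ℝ} (hM : ∀ x, ‖u x‖ ≤ M) {x : Fin d → ℝ} {q : ℝ}
    (hq : 0 < q) (hx : ∀ y ∈ cube a l, q ≤ ‖x - y‖) :
    ‖∫ y, K x y * u y‖ ≤ C₀ * M * singC hd * l ^ (1 / 2 : ℝ) * q ^ (-(1 / 2) : ℝ) := by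
  have hM0 : 0 ≤ M := (norm_nonneg _).trans (hM 0)
  obtain ⟨h1, h2⟩ := (exists_cube_singular_bound hd).choose_spec.2 x a l hl
  have e : ∫ y, K x y * u y = ∫ y in cube a l, K x y * u y := by
    rw [setIntegral_eq_integral_of_forall_compl_eq_zero]
    intro y hy
    rw [hu y hy, mul_zero]
  rw [e]
  have h3 : ∀ y ∈ cube a l, ‖K x y * u y‖ ≤
      C₀ * M * q ^ (-(1 / 2) : ℝ) * ‖x - y‖ ^ (1 / 2 - d : ℝ) := by
    intro y hy
    have hxy : 0 < ‖x - y‖ := hq.trans_le (hx y hy)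
    have hne : x ≠ y := fun h => by simp [h] at hxy
    have e1 : (‖x - y‖ ^ d)⁻¹ = ‖x - y‖ ^ (-(1 / 2) : ℝ) * ‖x - y‖ ^ (1 / 2 - d : ℝ) := by
      rw [← Real.rpow_natCast, ← Real.rpow_neg hxy.le, ← Real.rpow_add hxy]
      congr 1; ring
    have e2 : ‖x - y‖ ^ (-(1 / 2) : ℝ) ≤ q ^ (-(1 / 2) : ℝ) :=
      Real.rpow_le_rpow_of_nonpos hq (hx y hy) (by norm_num)
    calc ‖K x y * u y‖ ≤ C₀ / ‖x - y‖ ^ d * M := by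
          rw [norm_mul]
          exact mul_le_mul (hK.2 x y hne) (hM y) (norm_nonneg _)
            (div_nonneg hK.1 (by positivity))
      _ = C₀ * M * (‖x - y‖ ^ (-(1 / 2) : ℝ) * ‖x - y‖ ^ (1 / 2 - d : ℝ)) := by
          rw [div_eq_mul_inv, e1]; ring
      _ ≤ C₀ * M * (q ^ (-(1 / 2) : ℝ) * ‖x - y‖ ^ (1 / 2 - d : ℝ)) := by
          refine mul_le_mul_of_nonneg_left ?_ (mul_nonneg hK.1 hM0)
          exact mul_le_mul_of_nonneg_right e2 (by positivity)
      _ = _ := by ring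
  refine (norm_integral_le_of_norm_le (h1.const_mul (C₀ * M * q ^ (-(1 / 2) : ℝ)))
    ((ae_restrict_iff' (measurableSet_cube a l)).2 (Eventually.of_forall h3))).trans ?_
  rw [integral_const_mul]
  refine (mul_le_mul_of_nonneg_left h2 (mul_nonneg (mul_nonneg hK.1 hM0)
    (by positivity))).trans (le_of_eq ?_)
  rw [singC]; ring

/-- Two cubes of equal size that are separated by a hyperplane may touch. The pointwise bound for T
u then blows up like the inverse square root of the distance to the separating face, which is
integrable; no cancellation of u is required. -/
lemma near_bound (hd : 0 < d) (h : IsCZOperator ψ K T Tt) {C₀ : ℝ} (hK : SizeBound K C₀)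
    (u : testSpace 𝕜 d) {a a' : Fin d → ℝ} {l : ℝ} (hl : 0 < l)
    (hu : ∀ x, x ∉ cube a l → (u : (Fin d → ℝ) → 𝕜) x = 0) {M : ℝ}
    (hM : ∀ x, ‖(u : (Fin d → ℝ) → 𝕜) x‖ ≤ M) {n : Fin d}
    (hn : a n + l ≤ a' n ∨ a' n + l ≤ a n) :
    ∫ x in cube a' l, ‖T u x‖ ≤ 4 * singC hd * C₀ * M * l ^ d := by
  have hM0 : 0 ≤ M := (norm_nonneg _).trans (hM 0)
  have hC := (singC_pos hd).le
  set A := C₀ * M * singC hd * l ^ (1 / 2 : ℝ) with hA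
  have hA0 : 0 ≤ A := by have := hK.1; positivity
  obtain ⟨i1, i2⟩ := integral_edge (a' n) hl
  obtain ⟨j1, j2⟩ := integral_cube_comp_apply a' hl n i1
  have hae : ∀ᵐ x ∂(volume.restrict (cube a' l)), ‖T u x‖ ≤ A * edge (a' n) l (x n) := by
    rw [ae_restrict_iff' (measurableSet_cube a' l)]
    -- The face itself has distance zero and must be removed; the opposite face does not belong to
    -- the half-open cube.
    have hnull : ∀ᵐ x : Fin d → ℝ ∂volume, x n ≠ a' n := by
      rw [ae_iff]
      simp only [not_not]
      exact Measure.pi_hyperplane (fun _ => (volume : Measure ℝ)) n (a' n)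
    filter_upwards [h.kernel u, hnull] with x hx hxn hxQ
    have hxn' := hxQ n trivial
    rw [mem_Ico] at hxn'
    have hlo : 0 < x n - a' n := sub_pos.2 (lt_of_le_of_ne hxn'.1 (Ne.symm hxn))
    have hhi : 0 < a' n + l - x n := by linarith [hxn'.2]
    have hts : x ∉ tsupport (u : (Fin d → ℝ) → 𝕜) := by
      intro hx'
      have h1 := tsupport_subset_Icc hu hx'
      have h2 := h1.1 n
      have h3 := h1.2 n
      simp only at h3
      rcases hn with hn | hn <;> linarith
    rw [hx hts]
    have hdist : ∀ y : Fin d → ℝ, |x n - y n| ≤ ‖x - y‖ := fun y => norm_le_pi_norm (x - y) n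
    rcases hn with hn | hn
    · refine (norm_apply_le_of_disjoint hd hK hl hu hM hlo fun y hy => ?_).trans ?_
      · have := (hy n trivial).2
        refine le_trans ?_ (hdist y)
        exact le_trans (by linarith) (le_abs_self _)
      · exact mul_le_mul_of_nonneg_left (le_add_of_nonneg_right (by positivity)) hA0
    · refine (norm_apply_le_of_disjoint hd hK hl hu hM hhi fun y hy => ?_).trans ?_
      · have := (hy n trivial).1
        refine le_trans ?_ (hdist y)
        exact le_trans (by linarith) (neg_le_abs _)
      · exact mul_le_mul_of_nonneg_left (le_add_of_nonneg_left (by positivity)) hA0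
  refine (integral_mono_ae (integrableOn_cube (h.locInt u) _ _).norm (j1.const_mul A)
    hae).trans (le_of_eq ?_)
  rw [integral_const_mul, j2, i2, hA]
  have e1 : l ^ (1 / 2 : ℝ) * l ^ (1 / 2 : ℝ) = l := by
    rw [← Real.rpow_add hl]; norm_num
  have e2 : l ^ d = l * l ^ (d - 1) := by
    rw [← pow_succ']; congr 1; omega
  rw [e2]
  calc _ = 4 * singC hd * C₀ * M * ((l ^ (1 / 2 : ℝ) * l ^ (1 / 2 : ℝ)) * l ^ (d - 1)) := by ring
    _ = _ := by rw [e1]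

/-- As u has integral zero, K(x,y) may be replaced by K(x,y) - K(x,c) with c the centre of the cube.
Then |c-y| ≤ l/2, which is less than half the distance from c to x, so the regularity estimate
applies. -/
lemma far_pointwise (hψ : IsModulus ψ) {C₁ : ℝ} (hK : SmoothBound ψ K C₁)
    {u : (Fin d → ℝ) → 𝕜} (hui : Integrable u volume) {a : Fin d → ℝ} {l : ℝ} (hl : 0 < l)
    (hu : ∀ x, x ∉ cube a l → u x = 0) {M : ℝ} (hM : ∀ x, ‖u x‖ ≤ M) (hu0 : ∫ x, u x = 0)
    {x : Fin d → ℝ} {ρ : ℝ} (hρ : l < ρ) (hx : ρ ≤ ‖(fun n => a n + l / 2) - x‖) :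
    ‖∫ y, K x y * u y‖ ≤ C₁ / ρ ^ d * ψ (l / (2 * ρ)) * M * l ^ d := by
  set c : Fin d → ℝ := fun n => a n + l / 2 with hc
  have hM0 : 0 ≤ M := (norm_nonneg _).trans (hM 0)
  have hρ0 : 0 < ρ := hl.trans hρ
  have hr1 : l / (2 * ρ) ≤ 1 := by rw [div_le_one (by positivity)]; linarith
  have hψ0 := hψ.nonneg (by positivity : 0 ≤ l / (2 * ρ)) hr1
  have hA0 : 0 ≤ C₁ / ρ ^ d * ψ (l / (2 * ρ)) * M :=
    mul_nonneg (mul_nonneg (div_nonneg hK.1 (by positivity)) hψ0) hM0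
  -- For a non-integrable integrand the integral is zero by convention, and the bound is trivial.
  by_cases hint : Integrable (fun y => K x y * u y) volume
  swap
  · rw [integral_undef hint, norm_zero]; positivity
  have e : ∫ y, K x y * u y = ∫ y in cube a l, (K x y - K x c) * u y := by
    have e1 : ∫ y, K x y * u y = ∫ y, (K x y - K x c) * u y := by
      simp only [sub_mul]
      rw [integral_sub hint (hui.const_mul _), integral_const_mul, hu0, mul_zero, sub_zero]
    rw [e1, setIntegral_eq_integral_of_forall_compl_eq_zero]
    intro y hy
    rw [hu y hy, mul_zero]
  rw [e, ← volume_real_cube a hl.le]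
  refine norm_setIntegral_le_of_norm_le_const
    (by rw [volume_cube a hl.le]; exact ENNReal.ofReal_lt_top) fun y hy => ?_
  have hcy : ‖c - y‖ ≤ l / 2 := by
    refine (pi_norm_le_iff_of_nonneg (by positivity)).2 fun n => ?_
    have := hy n trivial
    rw [mem_Ico] at this
    rw [Pi.sub_apply, Real.norm_eq_abs, abs_le, hc]
    constructor <;> simp only <;> linarith [this.1, this.2]
  have hcx : ρ ≤ ‖c - x‖ := hx
  have h1 := hK.2 c y x (by linarith)
  have h2 : ‖K x y - K x c‖ ≤ C₁ / ‖c - x‖ ^ d * ψ (‖c - y‖ / ‖c - x‖) := by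
    rw [norm_sub_rev]
    exact (le_add_of_nonneg_left (norm_nonneg _)).trans h1
  rw [norm_mul]
  refine mul_le_mul (h2.trans ?_) (hM y) (norm_nonneg _)
    (mul_nonneg (div_nonneg hK.1 (by positivity)) hψ0)
  refine mul_le_mul ?_ ?_ ?_ (div_nonneg hK.1 (by positivity))
  · exact div_le_div_of_nonneg_left hK.1 (by positivity) (pow_le_pow_left₀ hρ0.le hcx d)
  · refine hψ.mono (by positivity) ?_ hr1
    rw [div_le_div_iff₀ (hρ0.trans_le hcx) (by positivity)]
    nlinarith [norm_nonneg (c - y)]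
  · refine hψ.nonneg (by positivity) ?_
    rw [div_le_one (hρ0.trans_le hcx)]; linarith

/-- The constant in the off-diagonal estimate. -/
def offC (hd : 0 < d) : ℝ := 16 * 4 ^ d * singC hd + 4 * 8 ^ d

lemma offC_pos (hd : 0 < d) : 0 < offC hd := by have := singC_pos hd; unfold offC; positivity

/-- For adjacent cubes, where `lev m = 2`, the weight is bounded below and the size estimate
suffices. For all others the distance is comparable to 2^k l, and cancellation gives the factor ψ.
-/
lemma offDiag_bound (hd : 0 < d) (hψ : IsModulus ψ) (h : IsCZOperator ψ K T Tt)
    (u : testSpace 𝕜 d) {a : Fin d → ℝ} {l : ℝ} (hl : 0 < l)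
    (hu : ∀ x, x ∉ cube a l → (u : (Fin d → ℝ) → 𝕜) x = 0) {M : ℝ}
    (hM : ∀ x, ‖(u : (Fin d → ℝ) → 𝕜) x‖ ≤ M) (hu0 : ∫ x, (u : (Fin d → ℝ) → 𝕜) x = 0)
    {m : Fin d → ℤ} (hm : m ≠ 0) :
    ∫ x in cube (fun n => a n + l * m n) l, ‖T u x‖ ≤
      offC hd * (czZeroNorm K + czNorm ψ K) * (M * l ^ d) * wt ψ m := by
  have hK0 := sizeBound_czZeroNorm h.size
  have hK1 := smoothBound_czNorm hψ h.smooth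
  have hM0 : 0 ≤ M := (norm_nonneg _).trans (hM 0)
  have hC := (singC_pos hd).le
  have hw := (wt_pos hψ m).le
  have h0 := hK0.1
  have h1 := hK1.1
  obtain ⟨n, hn, hmn⟩ := exists_natAbs_eq_supAbs hm
  have hlev := two_pow_le_supAbs hm
  have hl2 := two_le_lev hm
  have habs : ((supAbs m : ℕ) : ℝ) = |(m n : ℝ)| := by
    rw [← hn, Nat.cast_natAbs]; push_cast; rfl
  by_cases hk : lev m = 2
  · have hsep : a n + l ≤ a n + l * m n ∨ (a n + l * m n) + l ≤ a n := by
      rcases lt_or_gt_of_ne hmn with h' | h'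
      · right
        have : (m n : ℝ) ≤ -1 := by exact_mod_cast (by omega : m n ≤ -1)
        nlinarith
      · left
        have : (1 : ℝ) ≤ m n := by exact_mod_cast (by omega : 1 ≤ m n)
        nlinarith
    refine (near_bound hd h hK0 u hl hu hM (a' := fun n => a n + l * m n) hsep).trans ?_
    -- Here ψ(1/4) ≥ 1/4 because ψ(t)/t is non-increasing with value 1 at t = 1.
    have hwt : ((4 : ℝ) ^ d)⁻¹ * (1 / 4) ≤ wt ψ m := by
      rw [wt, hk, show ((1 : ℝ) / 2) ^ 2 = 1 / 4 by norm_num, one_div, inv_pow]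
      refine mul_le_mul_of_nonneg_left ?_ (by positivity)
      exact hψ.self_le (by norm_num) (by norm_num)
    have h4 : (1 : ℝ) ≤ 4 * 4 ^ d * wt ψ m := by
      calc (1 : ℝ) = 4 * 4 ^ d * (((4 : ℝ) ^ d)⁻¹ * (1 / 4)) := by field_simp
        _ ≤ _ := mul_le_mul_of_nonneg_left hwt (by positivity)
    have hX : 0 ≤ 4 * singC hd * czZeroNorm K * M * l ^ d := by positivity
    calc _ ≤ 4 * singC hd * czZeroNorm K * M * l ^ d * (4 * 4 ^ d * wt ψ m) :=
          le_mul_of_one_le_right hX h4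
      _ = 16 * 4 ^ d * singC hd * czZeroNorm K * (M * l ^ d) * wt ψ m := by ring
      _ ≤ _ := by
          unfold offC
          gcongr
          · have : (0 : ℝ) ≤ 4 * 8 ^ d := by positivity
            linarith
          · linarith
  · have hk3 : 3 ≤ lev m := by omega
    set k := lev m with hkdef
    set P : ℝ := 2 ^ (k - 2) with hP
    have hP2 : 2 ≤ P := by
      calc (2 : ℝ) = 2 ^ 1 := by norm_num
        _ ≤ _ := pow_le_pow_right₀ one_le_two (by omega)
    have hPm : P ≤ |(m n : ℝ)| := by
      rw [← habs, hP]; exact_mod_cast hlev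
    -- The centre of the cube has distance at least (|m| - 1/2)l from the translate, and P ≤ |m|
    -- together with P ≥ 2 makes this at least (3/4)Pl, which is larger than l.
    set ρ : ℝ := 3 / 4 * P * l with hρ
    have hlρ : l < ρ := by nlinarith
    have hρ0 : 0 < ρ := hl.trans hlρ
    have hhalf : (1 / 2 : ℝ) ^ k = 1 / (4 * P) := by
      have : (2 : ℝ) ^ k = 4 * P := by
        rw [hP, show (4 : ℝ) = 2 ^ 2 by norm_num, ← pow_add]; congr 1; omega
      rw [one_div_pow, this]
    have hdist : ∀ x ∈ cube (fun n => a n + l * m n) l, ρ ≤ ‖(fun n => a n + l / 2) - x‖ := by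
      intro x hx
      have hxn := hx n trivial
      rw [mem_Ico] at hxn
      refine le_trans ?_ (norm_le_pi_norm _ n)
      rw [Pi.sub_apply, Real.norm_eq_abs]
      rcases lt_or_gt_of_ne hmn with h' | h'
      · have h'' : (m n : ℝ) < 0 := by exact_mod_cast h'
        rw [abs_of_neg h''] at hPm
        refine le_trans ?_ (le_abs_self _)
        nlinarith [hxn.2]
      · have h'' : (0 : ℝ) < m n := by exact_mod_cast h'
        rw [abs_of_pos h''] at hPm
        refine le_trans ?_ (neg_le_abs _)
        nlinarith [hxn.1]
    have hψb : ψ (l / (2 * ρ)) ≤ 4 * ψ ((1 / 2) ^ k) := by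
      have e1 : 4 * (1 / 2 : ℝ) ^ k ≤ 1 := by
        rw [hhalf, mul_one_div, div_le_one (by positivity)]; linarith
      refine le_trans (hψ.mono (by positivity) ?_ e1) (hψ.le_mul (by norm_num) (half_pow_pos k) e1)
      rw [hhalf, hρ, mul_one_div, div_le_div_iff₀ (by positivity) (by positivity)]
      nlinarith [mul_pos hl (by linarith : 0 < P)]
    have hρd : (ρ ^ d)⁻¹ ≤ 8 ^ d * ((1 / 2 : ℝ) ^ k) ^ d * (l ^ d)⁻¹ := by
      rw [← mul_pow, ← inv_pow, ← inv_pow, ← mul_pow]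
      refine pow_le_pow_left₀ (by positivity) ?_ d
      rw [hhalf, hρ, inv_le_iff_one_le_mul₀ (by positivity)]
      have : 8 * (1 / (4 * P)) * l⁻¹ * (3 / 4 * P * l) = 3 / 2 := by field_simp; norm_num
      rw [this]; norm_num
    have hpt : ∀ᵐ x ∂volume, x ∈ cube (fun n => a n + l * m n) l → ‖T u x‖ ≤
        czNorm ψ K / ρ ^ d * ψ (l / (2 * ρ)) * M * l ^ d := by
      filter_upwards [h.kernel u] with x hx hxQ
      have hts : x ∉ tsupport (u : (Fin d → ℝ) → 𝕜) := by
        intro hx'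
        have h3 := tsupport_subset_Icc hu hx'
        have h4 : ‖(fun n => a n + l / 2) - x‖ ≤ l / 2 := by
          refine (pi_norm_le_iff_of_nonneg (by positivity)).2 fun n => ?_
          have e1 := h3.1 n
          have e2 := h3.2 n
          simp only at e2
          rw [Pi.sub_apply, Real.norm_eq_abs, abs_le]
          constructor <;> linarith
        linarith [hdist x hxQ]
      rw [hx hts]
      exact far_pointwise hψ hK1 (testSpace_integrable u) hl hu hM hu0 hlρ (hdist x hxQ)
    have hvol : volume (cube (fun n => a n + l * m n) l) < ⊤ := by
      rw [volume_cube _ hl.le]; exact ENNReal.ofReal_lt_top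
    have hfin := norm_setIntegral_le_of_norm_le_const_ae' (f := fun x => ‖T u x‖) hvol
      (C := czNorm ψ K / ρ ^ d * ψ (l / (2 * ρ)) * M * l ^ d)
      (by filter_upwards [hpt] with x hx hxQ; rw [norm_norm]; exact hx hxQ)
    rw [volume_real_cube _ hl.le] at hfin
    refine (le_abs_self _).trans (hfin.trans ?_)
    have hψ0 := hψ.nonneg (half_pow_pos k).le (half_pow_le_one k)
    have hld : (0 : ℝ) < l ^ d := by positivity
    calc czNorm ψ K / ρ ^ d * ψ (l / (2 * ρ)) * M * l ^ d * l ^ d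
        ≤ czNorm ψ K * (8 ^ d * ((1 / 2 : ℝ) ^ k) ^ d * (l ^ d)⁻¹) * (4 * ψ ((1 / 2) ^ k)) * M *
          l ^ d * l ^ d := by
          rw [div_eq_mul_inv]
          gcongr
          exact hψ.nonneg (by positivity) (by rw [div_le_one (by positivity)]; linarith)
      _ = 4 * 8 ^ d * czNorm ψ K * (M * l ^ d) * wt ψ m := by
          rw [wt, ← hkdef]; field_simp
      _ ≤ _ := by
          unfold offC
          gcongr
          · have : (0 : ℝ) ≤ 16 * 4 ^ d * singC hd := by positivity
            linarith
          · linarith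

end Kernel

end DyadicRep

end

noncomputable section

namespace DyadicRep

variable {d : ℕ} {𝕜 : Type*} [RCLike 𝕜] {ψ : ℝ → ℝ}

/-! ### Dini moduli on dyadic scales -/

lemma IsModulus.intervalIntegrable (hψ : IsModulus ψ) {a b : ℝ} (ha : 0 ≤ a) (hab : a ≤ b)
    (hb : b ≤ 1) : IntervalIntegrable (fun s => ψ s / s) volume a b := by
  rw [intervalIntegrable_iff_integrableOn_Ioc_of_le hab]
  exact hψ.dini.mono_set (Ioc_subset_Ioc ha hb)

lemma Psi_nonneg (hψ : IsModulus ψ) {t : ℝ} (h0 : 0 ≤ t) (h1 : t ≤ 1) : 0 ≤ Psi ψ t :=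
  intervalIntegral.integral_nonneg h0 fun _ hs =>
    div_nonneg (hψ.nonneg hs.1 (hs.2.trans h1)) hs.1

lemma Psi_mono (hψ : IsModulus ψ) {s t : ℝ} (h0 : 0 ≤ s) (hst : s ≤ t) (h1 : t ≤ 1) :
    Psi ψ s ≤ Psi ψ t := by
  have h := intervalIntegral.integral_add_adjacent_intervals
    (hψ.intervalIntegrable le_rfl h0 (hst.trans h1)) (hψ.intervalIntegrable h0 hst h1)
  have h2 : 0 ≤ ∫ x in s..t, ψ x / x := intervalIntegral.integral_nonneg hst fun x hx =>
    div_nonneg (hψ.nonneg (h0.trans hx.1) (hx.2.trans h1)) (h0.trans hx.1)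
  unfold Psi
  linarith

/-- On [t/2, t] the integrand ψ(s)/s is at least ψ(t)/t. Iteration over dyadic scales compares the
Dini integral with a series (`sum_psi_le`). -/
lemma Psi_half_add_le (hψ : IsModulus ψ) {t : ℝ} (h0 : 0 < t) (h1 : t ≤ 1) :
    1 / 2 * ψ t + Psi ψ (t / 2) ≤ Psi ψ t := by
  have h2 : t / 2 ≤ t := by linarith
  have h := intervalIntegral.integral_add_adjacent_intervals
    (hψ.intervalIntegrable le_rfl (by positivity : 0 ≤ t / 2) (h2.trans h1))
    (hψ.intervalIntegrable (by positivity) h2 h1)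
  have h3 : ∫ _x in (t / 2)..t, ψ t / t ≤ ∫ x in (t / 2)..t, ψ x / x := by
    refine intervalIntegral.integral_mono_on h2 (by simp)
      (hψ.intervalIntegrable (by positivity) h2 h1) fun x hx => ?_
    have hx0 : 0 < x := lt_of_lt_of_le (by positivity) hx.1
    exact hψ.ratio_anti ⟨hx0, hx.2.trans h1⟩ ⟨h0, h1⟩ hx.2
  rw [intervalIntegral.integral_const, smul_eq_mul] at h3
  have h4 : (t - t / 2) * (ψ t / t) = 1 / 2 * ψ t := by field_simp; ring
  unfold Psi
  linarith

lemma sum_psi_le (hψ : IsModulus ψ) (i N : ℕ) :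
    ∑ k ∈ Finset.range N, ψ ((1 / 2) ^ (i + k)) ≤ 2 * Psi ψ ((1 / 2) ^ i) := by
  have h : 1 / 2 * ∑ k ∈ Finset.range N, ψ ((1 / 2) ^ (i + k)) + Psi ψ ((1 / 2) ^ (i + N)) ≤
      Psi ψ ((1 / 2) ^ i) := by
    induction N with
    | zero => simp
    | succ N ih =>
      have := Psi_half_add_le hψ (half_pow_pos (i + N)) (half_pow_le_one _)
      rw [show ((1 : ℝ) / 2) ^ (i + N) / 2 = (1 / 2) ^ (i + (N + 1)) by ring] at this
      rw [Finset.sum_range_succ, mul_add]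
      linarith
  have := Psi_nonneg hψ (half_pow_pos (i + N)).le (half_pow_le_one _)
  linarith

lemma summable_psi (hψ : IsModulus ψ) : Summable fun k : ℕ => ψ ((1 / 2) ^ k) := by
  refine summable_of_sum_range_le (c := 2 * Psi ψ ((1 / 2) ^ 0))
    (fun k => hψ.nonneg (half_pow_pos k).le (half_pow_le_one k)) fun N => ?_
  simpa using sum_psi_le hψ 0 N

/-- Continuity at 0 is not part of the definition of a modulus. It follows from the Dini condition,
which makes the values at dyadic points summable. -/
lemma exists_psi_le (hψ : IsModulus ψ) {ε : ℝ} (hε : 0 < ε) :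
    ∃ δ : ℝ, 0 < δ ∧ δ ≤ 1 ∧ ∀ t, 0 ≤ t → t ≤ δ → ψ t ≤ ε := by
  obtain ⟨k, hk⟩ := ((summable_psi hψ).tendsto_atTop_zero.eventually (gt_mem_nhds hε)).exists
  exact ⟨(1 / 2) ^ k, half_pow_pos k, half_pow_le_one k,
    fun t h0 h1 => (hψ.mono h0 h1 (half_pow_le_one k)).trans hk.le⟩

/-! ### The transpose of a Calderón–Zygmund operator -/

/-- Continuity off the diagonal supplies the measurability and local boundedness of the kernel that
Fubini's theorem needs below. -/
lemma SmoothBound.continuousOn (hψ : IsModulus ψ) {K : (Fin d → ℝ) → (Fin d → ℝ) → 𝕜} {C : ℝ}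
    (hK : SmoothBound ψ K C) :
    ContinuousOn (fun p : (Fin d → ℝ) × (Fin d → ℝ) => K p.1 p.2) {p | p.1 ≠ p.2} := by
  rintro ⟨x₀, y₀⟩ hne
  refine ContinuousAt.continuousWithinAt ?_
  have hr : 0 < ‖x₀ - y₀‖ := norm_pos_iff.2 (sub_ne_zero.2 hne)
  set r := ‖x₀ - y₀‖ with hrdef
  have hC := hK.1
  rw [Metric.continuousAt_iff]
  intro ε hε
  set A : ℝ := C / (r / 2) ^ d + 1 with hA
  have hA0 : 0 < A := by positivity
  obtain ⟨δ, hδ0, hδ1, hδ⟩ := exists_psi_le hψ (by positivity : 0 < ε / (4 * A))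
  refine ⟨min (r / 8) (δ * r / 2), by positivity, ?_⟩
  rintro ⟨x, y⟩ hxy
  rw [Prod.dist_eq, max_lt_iff, lt_min_iff, lt_min_iff, dist_eq_norm, dist_eq_norm] at hxy
  obtain ⟨⟨hx1, hx2⟩, hy1, hy2⟩ := hxy
  simp only at hx1 hx2 hy1 hy2
  have hx₀y : r / 2 ≤ ‖x₀ - y‖ := by
    have h1 : ‖x₀ - y₀‖ ≤ ‖x₀ - y‖ + ‖y - y₀‖ := by
      simpa using norm_add_le (x₀ - y) (y - y₀)
    linarith
  have hx₀y0 : 0 < ‖x₀ - y‖ := lt_of_lt_of_le (by positivity) hx₀y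
  rw [norm_sub_rev] at hx1 hx2 hy1 hy2
  have b1 := hK.2 x₀ x y (by linarith)
  have b2 := hK.2 y₀ y x₀ (by rw [norm_sub_rev y₀ x₀]; linarith)
  rw [norm_sub_rev y₀ x₀, ← hrdef] at b2
  have c1 : ‖K x₀ y - K x y‖ ≤ A * (ε / (4 * A)) := by
    refine ((le_add_of_nonneg_right (norm_nonneg _)).trans b1).trans ?_
    refine mul_le_mul ?_ (hδ _ (by positivity) ?_) (hψ.nonneg (by positivity) ?_) hA0.le
    · rw [hA]
      have := div_le_div_of_nonneg_left hC (by positivity)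
        (pow_le_pow_left₀ (by positivity) hx₀y d)
      linarith
    · rw [div_le_iff₀ hx₀y0]; nlinarith
    · rw [div_le_one hx₀y0]; linarith
  have c2 : ‖K x₀ y₀ - K x₀ y‖ ≤ A * (ε / (4 * A)) := by
    refine ((le_add_of_nonneg_left (norm_nonneg _)).trans b2).trans ?_
    refine mul_le_mul ?_ (hδ _ (by positivity) ?_) (hψ.nonneg (by positivity) ?_) hA0.le
    · rw [hA]
      have := div_le_div_of_nonneg_left hC (by positivity)
        (pow_le_pow_left₀ (by positivity) (by linarith : r / 2 ≤ r) d)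
      linarith
    · rw [div_le_iff₀ hr]; nlinarith
    · rw [div_le_one hr]; linarith
  have e1 : A * (ε / (4 * A)) = ε / 4 := by field_simp
  rw [dist_eq_norm]
  have e2 : K x y - K x₀ y₀ = -(K x₀ y - K x y) - (K x₀ y₀ - K x₀ y) := by ring
  simp only
  rw [e2]
  refine (norm_sub_le _ _).trans_lt ?_
  rw [norm_neg]
  linarith

variable {K : (Fin d → ℝ) → (Fin d → ℝ) → 𝕜}
  {T Tt : testSpace 𝕜 d →ₗ[𝕜] ((Fin d → ℝ) →ₘ[volume] 𝕜)}

lemma integrableOn_kernel_mul (hψ : IsModulus ψ) (h : IsCZOperator ψ K T Tt)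
    (f : testSpace 𝕜 d) {k : Set (Fin d → ℝ)} (hk : IsCompact k)
    (hkf : Disjoint k (tsupport (f : (Fin d → ℝ) → 𝕜))) :
    IntegrableOn (fun p : (Fin d → ℝ) × (Fin d → ℝ) => K p.2 p.1 * (f : (Fin d → ℝ) → 𝕜) p.2)
      (k ×ˢ tsupport (f : (Fin d → ℝ) → 𝕜)) (volume.prod volume) := by
  obtain ⟨C, hC⟩ := h.smooth
  obtain ⟨M, hM⟩ := testSpace_exists_bound f
  have hc : ContinuousOn (fun p : (Fin d → ℝ) × (Fin d → ℝ) => K p.2 p.1)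
      (k ×ˢ tsupport (f : (Fin d → ℝ) → 𝕜)) := by
    have h1 := hC.continuousOn hψ
    exact h1.comp (f := fun p : (Fin d → ℝ) × (Fin d → ℝ) => (p.2, p.1))
      (continuous_swap.continuousOn) fun p hp heq =>
        Set.disjoint_left.1 hkf hp.1 (by simp only at heq; rw [← heq]; exact hp.2)
  have hi : IntegrableOn (fun p : (Fin d → ℝ) × (Fin d → ℝ) => K p.2 p.1)
      (k ×ˢ tsupport (f : (Fin d → ℝ) → 𝕜)) (volume.prod volume) :=
    hc.integrableOn_compact (hk.prod (testSpace_hasCompactSupport f).isCompact)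
  exact Integrable.mul_bdd (c := M) hi
    ((testSpace_measurable f).comp measurable_snd).aestronglyMeasurable
    (Eventually.of_forall fun p => hM p.2)

/-- The kernel representation is given for T only. For the transpose, test against smooth functions
supported away from the support of f; by duality and Fubini both candidates have the same integrals,
so they agree almost everywhere there. -/
lemma kernel_transpose (hψ : IsModulus ψ) (h : IsCZOperator ψ K T Tt) (f : testSpace 𝕜 d) :
    ∀ᵐ x, x ∉ tsupport (f : (Fin d → ℝ) → 𝕜) →
      Tt f x = ∫ y, K y x * (f : (Fin d → ℝ) → 𝕜) y := by
  set S := tsupport (f : (Fin d → ℝ) → 𝕜) with hS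
  have hSm : MeasurableSet S := (isClosed_tsupport _).measurableSet
  have hU : IsOpen Sᶜ := (isClosed_tsupport _).isOpen_compl
  set P : (Fin d → ℝ) → 𝕜 := fun x => ∫ y, K y x * (f : (Fin d → ℝ) → 𝕜) y with hP
  have hf0 : ∀ y, y ∉ S → (f : (Fin d → ℝ) → 𝕜) y = 0 := fun y hy => image_eq_zero_of_notMem_tsupport hy
  have hPS : P = fun x => ∫ y in S, K y x * (f : (Fin d → ℝ) → 𝕜) y := by
    funext x
    rw [setIntegral_eq_integral_of_forall_compl_eq_zero]
    intro y hy
    rw [hf0 y hy, mul_zero]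
  have hPint : ∀ k ⊆ Sᶜ, IsCompact k → IntegrableOn P k := by
    intro k hkU hk
    have h1 := integrableOn_kernel_mul hψ h f hk (disjoint_compl_left.mono_left hkU)
    rw [IntegrableOn, ← Measure.prod_restrict] at h1
    have h2 := h1.integral_prod_left
    rw [hPS]
    exact h2
  have hloc : LocallyIntegrableOn (fun x => Tt f x - P x) Sᶜ volume := by
    rw [locallyIntegrableOn_iff hU.isLocallyClosed]
    intro k hkU hk
    exact ((h.locInt_transpose f).integrableOn_isCompact hk).sub (hPint k hkU hk)
  have key := hU.ae_eq_zero_of_integral_contDiff_smul_eq_zero hloc ?_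
  · filter_upwards [key] with x hx hxS
    exact sub_eq_zero.1 (hx hxS)
  intro φ hφ hφc hφU
  set g0 : (Fin d → ℝ) → 𝕜 := fun x => (φ x : 𝕜) with hg0
  have hg1 : ContDiff ℝ 1 g0 :=
    (RCLike.ofRealCLM (K := 𝕜)).contDiff.comp (n := 1) (contDiff_infty.1 hφ 1)
  have hg2 : HasCompactSupport g0 := hφc.comp_left (g := fun r : ℝ => (r : 𝕜)) (by simp)
  set g := ofC1 g0 hg1 hg2 with hg
  have hgts : tsupport g0 ⊆ tsupport φ := by
    refine closure_mono fun x hx hx' => hx ?_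
    simp only [hg0, hx', RCLike.ofReal_zero]
  have hkU : tsupport g0 ⊆ Sᶜ := hgts.trans hφU
  have hdisj : Disjoint (tsupport g0) S := disjoint_compl_left.mono_left hkU
  have hgf : (g : (Fin d → ℝ) → 𝕜) = g0 := rfl
  obtain ⟨M, hM⟩ := testSpace_exists_bound g
  -- The supports of the two functions are disjoint compact sets, so the kernel is bounded on their
  -- product.
  have hH : Integrable (Function.uncurry fun x y => g0 x * (K y x * (f : (Fin d → ℝ) → 𝕜) y))
      (volume.prod volume) := by
    have h1 := integrableOn_kernel_mul hψ h f hg2.isCompact hdisj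
    have h2 : IntegrableOn (Function.uncurry fun x y =>
        g0 x * (K y x * (f : (Fin d → ℝ) → 𝕜) y)) (tsupport g0 ×ˢ S) (volume.prod volume) :=
      Integrable.bdd_mul (c := M) h1
        ((testSpace_measurable g).comp measurable_fst).aestronglyMeasurable
        (Eventually.of_forall fun p => hM p.1)
    refine (integrableOn_iff_integrable_of_support_subset fun p hp => ?_).1 h2
    refine ⟨subset_tsupport _ (left_ne_zero_of_mul hp), ?_⟩
    exact subset_tsupport _ (right_ne_zero_of_mul (right_ne_zero_of_mul hp))
  have e1 : ∫ x, g0 x * P x = ∫ y, (f : (Fin d → ℝ) → 𝕜) y * T g y := by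
    calc ∫ x, g0 x * P x = ∫ x, ∫ y, g0 x * (K y x * (f : (Fin d → ℝ) → 𝕜) y) := by
          simp only [hP, integral_const_mul]
      _ = ∫ y, ∫ x, g0 x * (K y x * (f : (Fin d → ℝ) → 𝕜) y) := integral_integral_swap hH
      _ = ∫ y, (f : (Fin d → ℝ) → 𝕜) y * T g y := by
          refine integral_congr_ae ?_
          filter_upwards [h.kernel g] with y hy
          by_cases hyS : y ∈ S
          · rw [hy fun h' => Set.disjoint_left.1 hdisj h' hyS, ← integral_const_mul]
            refine integral_congr_ae (Eventually.of_forall fun x => ?_)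
            simp only [hgf]; ring
          · simp [hf0 y hyS]
  have e2 : ∫ x, g0 x * Tt f x = ∫ y, (f : (Fin d → ℝ) → 𝕜) y * T g y := by
    have := h.transpose g f
    simp only [pair] at this
    rw [this]
    exact integral_congr_ae (Eventually.of_forall fun x => mul_comm _ _)
  have i1 : Integrable (fun x => g0 x * Tt f x) volume :=
    testSpace_integrable_mul g (h.locInt_transpose f)
  have i2 : Integrable (fun x => g0 x * P x) volume := by
    have := hH.integral_prod_left
    simpa only [Function.uncurry, hP, integral_const_mul] using this
  have e3 : ∀ x, φ x • (Tt f x - P x) = g0 x * Tt f x - g0 x * P x := fun x => by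
    rw [RCLike.real_smul_eq_coe_mul, mul_sub]
  simp only [e3]
  rw [integral_sub i1 i2, e1, e2, sub_self]

lemma sizeBound_swap {C : ℝ} (hK : SizeBound K C) : SizeBound (fun x y => K y x) C :=
  ⟨hK.1, fun x y hxy => by rw [norm_sub_rev]; exact hK.2 y x hxy.symm⟩

lemma smoothBound_swap {C : ℝ} (hK : SmoothBound ψ K C) : SmoothBound ψ (fun x y => K y x) C :=
  ⟨hK.1, fun x x' y hxy => by rw [add_comm]; exact hK.2 x x' y hxy⟩

/-- All hypotheses are symmetric under transposition, with the same constants; hence each estimate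
for T yields the one for the other half of the expansion. -/
lemma IsCZOperator.swap (hψ : IsModulus ψ) (h : IsCZOperator ψ K T Tt) :
    IsCZOperator ψ (fun x y => K y x) Tt T where
  locInt := h.locInt_transpose
  locInt_transpose := h.locInt
  transpose f g := by rw [pair_comm, pair_comm (T g) f]; exact (h.transpose g f).symm
  kernel := kernel_transpose hψ h
  size := h.size.imp fun _ => sizeBound_swap
  smooth := h.smooth.imp fun _ => smoothBound_swap

lemma czZeroNorm_swap : czZeroNorm (fun x y => K y x) = czZeroNorm K := by
  unfold czZeroNorm
  congr 1
  ext C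
  exact ⟨fun h => sizeBound_swap h, fun h => sizeBound_swap h⟩

lemma czNorm_swap : czNorm ψ (fun x y => K y x) = czNorm ψ K := by
  unfold czNorm
  congr 1
  ext C
  exact ⟨fun h => smoothBound_swap h, fun h => smoothBound_swap h⟩

lemma IsCZOperator.bform_swap (h : IsCZOperator ψ K T Tt) (u v : testSpace 𝕜 d) :
    bform Tt u v = bform T v u := by
  rw [bform, bform, pair_comm]
  exact (h.transpose u v).symm

lemma weakBound_swap (h : IsCZOperator ψ K T Tt) {C : ℝ} (hT : WeakBound T C) : WeakBound Tt C :=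
  ⟨hT.1, fun a l hl => by
    have := hT.2 a l hl
    have e := h.bform_swap (cubeInd 𝕜 a hl) (cubeInd 𝕜 a hl)
    rw [bform, bform] at e
    rwa [e]⟩

lemma wbpNorm_swap (hψ : IsModulus ψ) (h : IsCZOperator ψ K T Tt) : wbpNorm Tt = wbpNorm T := by
  unfold wbpNorm
  congr 1
  ext C
  exact ⟨fun h' => weakBound_swap (h.swap hψ) h', fun h' => weakBound_swap h h'⟩

end DyadicRep

end

noncomputable section

namespace DyadicRep

variable {d : ℕ} {𝕜 : Type*} [RCLike 𝕜]

/-! ### Translates of a cube on its own level -/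

/-- The translate of a cube by `m` times its side length. -/
def tr (I : Idx d) (m : Fin d → ℤ) : Idx d := (I.1, I.2 + m)

lemma tr_zero (I : Idx d) : tr I 0 = I := by simp [tr]

lemma side_tr (I : Idx d) (m : Fin d → ℤ) : side (tr I m) = side I := rfl

lemma tr_injective (I : Idx d) : Function.Injective (tr I) := fun m m' h => by
  simpa [tr] using h

lemma corner_tr (ω : Grid d) (I : Idx d) (m : Fin d → ℤ) :
    corner ω (tr I m) = fun n => corner ω I n + side I * m n := by
  funext n
  rw [corner_eq, corner_eq, side_tr]
  simp only [tr, Pi.add_apply, Int.cast_add]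
  ring

lemma iUnion_dcube_tr (ω : Grid d) (I : Idx d) : ⋃ m, dcube ω (tr I m) = univ := by
  rw [← iUnion_dcube ω I.1]
  refine subset_antisymm (iUnion_subset fun m => ?_) (iUnion_subset fun a => ?_)
  · exact subset_iUnion (fun a => dcube ω (I.1, a)) (I.2 + m)
  · refine (subset_of_eq ?_).trans (subset_iUnion (fun m => dcube ω (tr I m)) (a - I.2))
    simp [tr]

lemma pairwise_disjoint_dcube_tr (ω : Grid d) (I : Idx d) :
    Pairwise (Function.onFun Disjoint fun m => dcube ω (tr I m)) := fun _ _ h =>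
  disjoint_dcube rfl fun h' => h (tr_injective I h')

/-- The finite set of the `m` with `lev m = k`. -/
def levSet (d : ℕ) (k : ℕ) : Finset (Fin d → ℤ) :=
  (Fintype.piFinset fun _ => Finset.Ioo (-2 ^ (k - 1) : ℤ) (2 ^ (k - 1))).filter fun m => lev m = k

lemma mem_levSet {k : ℕ} {m : Fin d → ℤ} : m ∈ levSet d k ↔ lev m = k := by
  simp only [levSet, Finset.mem_filter, Fintype.mem_piFinset, Finset.mem_Ioo, and_iff_right_iff_imp]
  rintro rfl n
  by_cases hm : m = 0
  · simp [hm]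
  · have h := natAbs_lt_two_pow_lev hm n
    zify at h
    exact abs_lt.1 h

lemma card_levSet_le (k : ℕ) : ((levSet d k).card : ℝ) ≤ (2 ^ k) ^ d := by
  have h1 : (levSet d k).card ≤ (2 * 2 ^ (k - 1) - 1) ^ d := by
    refine (Finset.card_filter_le _ _).trans (le_of_eq ?_)
    rw [Fintype.card_piFinset]
    simp only [Int.card_Ioo, Finset.prod_const, Finset.card_univ, Fintype.card_fin]
    congr 1
    have : (1 : ℤ) ≤ 2 ^ (k - 1) := one_le_pow₀ (by norm_num)
    zify
    rw [Int.toNat_of_nonneg (by linarith), Nat.cast_sub]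
    · push_cast; ring
    · have : 1 ≤ 2 ^ (k - 1) := Nat.one_le_two_pow
      omega
  -- For k = 0 the subtraction is truncated and the bound reads 1 ≤ 1, which is the right count for
  -- the zero vector.
  have h2 : 2 * 2 ^ (k - 1) - 1 ≤ 2 ^ k := by
    cases k with
    | zero => simp
    | succ k => simp only [Nat.add_sub_cancel, pow_succ]; omega
  exact_mod_cast h1.trans (Nat.pow_le_pow_left h2 d)

lemma sum_levSet_le (k : ℕ) {c : ℝ} (hc : 0 ≤ c) :
    ∑ _m ∈ levSet d k, ((1 / 2 : ℝ) ^ k) ^ d * c ≤ c := by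
  rw [Finset.sum_const, nsmul_eq_mul]
  refine (mul_le_mul_of_nonneg_right (card_levSet_le k) (by positivity)).trans (le_of_eq ?_)
  rw [← mul_assoc, ← mul_pow, ← mul_pow]
  norm_num

/-- There are at most 2^{kd} lattice vectors of scale k, so the factor 2^{-kd} reduces a sum over
the lattice to a sum over scales. -/
lemma sum_lev_le {a : ℕ → ℝ} (ha : ∀ k, 0 ≤ a k) (s : Finset (Fin d → ℤ)) :
    ∑ m ∈ s, ((1 / 2 : ℝ) ^ lev m) ^ d * a (lev m) ≤ ∑ k ∈ s.image lev, a k := by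
  rw [← Finset.sum_fiberwise_of_maps_to (g := lev) (t := s.image lev)
    fun m hm => Finset.mem_image_of_mem _ hm]
  refine Finset.sum_le_sum fun k _ => ?_
  refine le_trans ?_ (sum_levSet_le (d := d) k (ha k))
  rw [Finset.sum_congr rfl (g := fun _ => ((1 / 2 : ℝ) ^ k) ^ d * a k)
    fun m hm => by rw [(Finset.mem_filter.1 hm).2]]
  refine Finset.sum_le_sum_of_subset_of_nonneg (fun m hm => ?_) fun _ _ _ =>
    mul_nonneg (by positivity) (ha k)
  exact mem_levSet.2 (Finset.mem_filter.1 hm).2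

lemma summable_lev {a : ℕ → ℝ} (ha : ∀ k, 0 ≤ a k) (hs : Summable a) :
    Summable fun m : Fin d → ℤ => ((1 / 2 : ℝ) ^ lev m) ^ d * a (lev m) :=
  summable_of_sum_le (fun m => mul_nonneg (by positivity) (ha _)) fun s =>
    (sum_lev_le ha s).trans (hs.sum_le_tsum _ fun k _ => ha k)

lemma summable_wt {ψ : ℝ → ℝ} (hψ : IsModulus ψ) : Summable fun m : Fin d → ℤ => wt ψ m :=
  summable_lev (a := fun k => ψ ((1 / 2) ^ k))
    (fun k => hψ.nonneg (half_pow_pos k).le (half_pow_le_one k)) (summable_psi hψ)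

/-! ### Dyadic cubes and Haar functions as test functions -/

/-- The indicator of a dyadic cube, as a test function. -/
def cubeT (𝕜 : Type*) [RCLike 𝕜] (ω : Grid d) (I : Idx d) : testSpace 𝕜 d :=
  cubeInd 𝕜 (corner ω I) (side_pos I)

lemma coe_cubeT (ω : Grid d) (I : Idx d) :
    (cubeT 𝕜 ω I : (Fin d → ℝ) → 𝕜) = (dcube ω I).indicator 1 := rfl

lemma cubeT_eq_sum (ω : Grid d) (I : Idx d) : cubeT 𝕜 ω I = ∑ ε, cubeT 𝕜 ω (child ω I ε) := by
  refine Subtype.ext (funext fun x => ?_)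
  rw [Submodule.coe_sum, Finset.sum_apply]
  simp only [coe_cubeT]
  by_cases hx : x ∈ dcube ω I
  · obtain ⟨ε, hε⟩ := mem_iUnion.1 (dcube_eq_iUnion_child ω I ▸ hx)
    rw [indicator_of_mem hx, Finset.sum_eq_single ε, indicator_of_mem hε]
    · intro ε' _ hne
      refine indicator_of_notMem (fun h' => hne ?_) _
      exact child_injective ω I (eq_of_mem_dcube rfl h' hε)
    · simp
  · rw [indicator_of_notMem hx, Finset.sum_eq_zero]
    exact fun ε _ => indicator_of_notMem (fun h' => hx (dcube_child_subset ω I ε h')) _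

/-- A Haar function, as a test function. -/
def haarT (𝕜 : Type*) [RCLike 𝕜] (ω : Grid d) (I : Idx d) (η : Fin d → Bool) : testSpace 𝕜 d :=
  ∑ ε, ((sg η ε * (rt I)⁻¹ : ℝ) : 𝕜) • cubeT 𝕜 ω (child ω I ε)

lemma coe_haarT (ω : Grid d) (I : Idx d) (η : Fin d → Bool) :
    (haarT 𝕜 ω I η : (Fin d → ℝ) → 𝕜) = haar 𝕜 ω I η := by
  funext x
  rw [haarT, Submodule.coe_sum, Finset.sum_apply]
  simp only [Submodule.coe_smul, Pi.smul_apply, coe_cubeT, smul_eq_mul]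
  by_cases hx : x ∈ dcube ω I
  · obtain ⟨ε, hε⟩ := mem_iUnion.1 (dcube_eq_iUnion_child ω I ▸ hx)
    rw [Finset.sum_eq_single ε, indicator_of_mem hε, Pi.one_apply, mul_one,
      haar_of_mem_child ω hε]
    · intro ε' _ hne
      rw [indicator_of_notMem (fun h' => hne ?_) _, mul_zero]
      exact child_injective ω I (eq_of_mem_dcube rfl h' hε)
    · simp
  · rw [haar_of_notMem ω hx, Finset.sum_eq_zero]
    intro ε _
    rw [indicator_of_notMem (fun h' => hx (dcube_child_subset ω I ε h')) _, mul_zero]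

lemma integral_haarT (ω : Grid d) (I : Idx d) {η : Fin d → Bool} (hη : η ≠ zeroη d) :
    ∫ x, (haarT 𝕜 ω I η : (Fin d → ℝ) → 𝕜) x = 0 := by
  have := pair_haar_eq_zero_of_const (𝕜 := 𝕜) ω I hη (f := fun _ => 1) fun _ _ => rfl
  rw [coe_haarT]
  simpa [pair] using this

/-! ### Matrix entries of the operator between cubes and Haar functions. -/

section

variable {ψ : ℝ → ℝ} {K : (Fin d → ℝ) → (Fin d → ℝ) → 𝕜}
  {T Tt : testSpace 𝕜 d →ₗ[𝕜] ((Fin d → ℝ) →ₘ[volume] 𝕜)}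

lemma bform_cubeT (T : testSpace 𝕜 d →ₗ[𝕜] ((Fin d → ℝ) →ₘ[volume] 𝕜)) (ω : Grid d) (J : Idx d)
    (v : testSpace 𝕜 d) : bform T (cubeT 𝕜 ω J) v = ∫ x in dcube ω J, T v x := by
  rw [bform, pair, coe_cubeT, ← integral_indicator (measurableSet_dcube ω J)]
  refine integral_congr_ae (Eventually.of_forall fun x => ?_)
  by_cases hx : x ∈ dcube ω J <;> simp [hx]

lemma norm_bform_cubeT_le (T : testSpace 𝕜 d →ₗ[𝕜] ((Fin d → ℝ) →ₘ[volume] 𝕜)) (ω : Grid d)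
    (J : Idx d) (v : testSpace 𝕜 d) :
    ‖bform T (cubeT 𝕜 ω J) v‖ ≤ ∫ x in dcube ω J, ‖T v x‖ := by
  rw [bform_cubeT]; exact norm_integral_le_integral_norm _

lemma norm_bform_child_le (h : IsCZOperator ψ K T Tt) (ω : Grid d)
    (J : Idx d) (ε : Fin d → Bool) (v : testSpace 𝕜 d) :
    ‖bform T (cubeT 𝕜 ω (child ω J ε)) v‖ ≤ ∫ x in dcube ω J, ‖T v x‖ :=
  (norm_bform_cubeT_le _ _ _ _).trans <|
    setIntegral_mono_set (integrableOn_cube (h.locInt v) _ _).norm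
      (Eventually.of_forall fun _ => norm_nonneg _) (dcube_child_subset ω J ε).eventuallyLE

lemma setIntegral_norm_haarT_le (hd : 0 < d) (hψ : IsModulus ψ) (h : IsCZOperator ψ K T Tt)
    (ω : Grid d) (I : Idx d) {η : Fin d → Bool} (hη : η ≠ zeroη d) {m : Fin d → ℤ} (hm : m ≠ 0) :
    ∫ x in dcube ω (tr I m), ‖T (haarT 𝕜 ω I η) x‖ ≤
      offC hd * (czZeroNorm K + czNorm ψ K) * rt I * wt ψ m := by
  have := offDiag_bound hd hψ h (haarT 𝕜 ω I η) (a := corner ω I) (side_pos I)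
    (fun x hx => by rw [coe_haarT]; exact haar_of_notMem ω hx) (M := (rt I)⁻¹)
    (fun x => by rw [coe_haarT]; exact norm_haar_le ω I η x) (integral_haarT ω I hη) hm
  rw [← corner_tr, ← rt_sq, inv_mul_cancel_left₀ (rt_pos I).ne'] at this
  exact this

lemma norm_entry_le (hd : 0 < d) (hψ : IsModulus ψ) (h : IsCZOperator ψ K T Tt)
    (ω : Grid d) (I : Idx d) {η : Fin d → Bool} (hη : η ≠ zeroη d) {m : Fin d → ℤ} (hm : m ≠ 0)
    (ε : Fin d → Bool) :
    ‖bform T (cubeT 𝕜 ω (child ω (tr I m) ε)) (haarT 𝕜 ω I η)‖ ≤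
      offC hd * (czZeroNorm K + czNorm ψ K) * rt I * wt ψ m :=
  (norm_bform_child_le h ω _ ε _).trans (setIntegral_norm_haarT_le hd hψ h ω I hη hm)

/-- The weak boundedness property treats a cube with itself. Two different cubes of one level are
separated by a hyperplane, so the size of the kernel is enough. -/
lemma norm_bform_level_le (hd : 0 < d) (h : IsCZOperator ψ K T Tt) (hw : ∃ C, WeakBound T C)
    (ω : Grid d) {I J : Idx d} (hIJ : I.1 = J.1) :
    ‖bform T (cubeT 𝕜 ω J) (cubeT 𝕜 ω I)‖ ≤
      (1 + 4 * singC hd) * (czZeroNorm K + wbpNorm T) * side I ^ d := by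
  have h0 := (sizeBound_czZeroNorm h.size).1
  have h1 := (weakBound_wbpNorm hw).1
  have hC := (singC_pos hd).le
  have hs : 0 ≤ side I ^ d := by have := side_pos I; positivity
  have hsJ : side J = side I := by rw [side, side, hIJ]
  by_cases he : I = J
  · subst he
    refine ((weakBound_wbpNorm hw).2 _ _ (side_pos I)).trans ?_
    refine mul_le_mul_of_nonneg_right ?_ hs
    nlinarith [mul_nonneg hC h0, mul_nonneg hC h1]
  · have he' : I.2 ≠ J.2 := fun h' => he (Prod.ext hIJ h')
    obtain ⟨n, hn⟩ := Function.ne_iff.1 he'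
    refine (norm_bform_cubeT_le _ _ _ _).trans ?_
    have key := near_bound hd h (sizeBound_czZeroNorm h.size) (cubeT 𝕜 ω I)
      (a := corner ω I) (a' := corner ω J) (l := side I)
      (side_pos I) (fun x hx => ?_) (M := 1) (fun x => ?_) (n := n) ?_
    · rw [dcube, hsJ]
      refine key.trans (mul_le_mul_of_nonneg_right ?_ hs)
      nlinarith [mul_nonneg hC h0, mul_nonneg hC h1]
    · rw [coe_cubeT]
      exact indicator_of_notMem hx _
    · rw [coe_cubeT]
      refine (norm_indicator_le_norm_self _ _).trans ?_
      simp
    · rw [corner_eq, corner_eq, hsJ, hIJ]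
      have hp := side_pos I
      rcases lt_or_gt_of_ne hn with h' | h'
      · left
        have : (I.2 n : ℝ) + 1 ≤ J.2 n := by exact_mod_cast h'
        nlinarith
      · right
        have : (J.2 n : ℝ) + 1 ≤ I.2 n := by exact_mod_cast h'
        nlinarith

lemma norm_bform_children_le (hd : 0 < d) (h : IsCZOperator ψ K T Tt) (hw : ∃ C, WeakBound T C)
    (ω : Grid d) (I : Idx d) (ε ε' : Fin d → Bool) :
    ‖bform T (cubeT 𝕜 ω (child ω I ε)) (cubeT 𝕜 ω (child ω I ε'))‖ ≤
      (1 + 4 * singC hd) * (czZeroNorm K + wbpNorm T) * (side I / 2) ^ d := by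
  rw [← side_child ω I ε']
  exact norm_bform_level_le hd h hw ω rfl

lemma norm_entry_self_le (hd : 0 < d) (h : IsCZOperator ψ K T Tt) (hw : ∃ C, WeakBound T C)
    (ω : Grid d) (I : Idx d) (η ε : Fin d → Bool) :
    ‖bform T (cubeT 𝕜 ω (child ω I ε)) (haarT 𝕜 ω I η)‖ ≤
      (1 + 4 * singC hd) * (czZeroNorm K + wbpNorm T) * rt I := by
  have e : bform T (cubeT 𝕜 ω (child ω I ε)) (haarT 𝕜 ω I η) = ∑ ε',
      ((sg η ε' * (rt I)⁻¹ : ℝ) : 𝕜) *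
        bform T (cubeT 𝕜 ω (child ω I ε)) (cubeT 𝕜 ω (child ω I ε')) := by
    change blin h.locInt _ _ = _
    rw [haarT, map_sum]
    exact Finset.sum_congr rfl fun ε' _ => by rw [map_smul]; rfl
  rw [e]
  refine (norm_sum_le _ _).trans ?_
  refine (Finset.sum_le_sum (g := fun _ => (rt I)⁻¹ *
    ((1 + 4 * singC hd) * (czZeroNorm K + wbpNorm T) * (side I / 2) ^ d)) fun ε' _ => ?_).trans ?_
  · rw [norm_mul, RCLike.norm_ofReal, abs_mul, abs_sg, one_mul,
      abs_of_pos (inv_pos.2 (rt_pos I))]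
    exact mul_le_mul_of_nonneg_left (norm_bform_children_le hd h hw ω I ε ε')
      (inv_pos.2 (rt_pos I)).le
  · rw [Finset.sum_const, Finset.card_univ, Fintype.card_fun, Fintype.card_bool, Fintype.card_fin,
      nsmul_eq_mul, div_pow, ← rt_sq]
    have := rt_pos I
    push_cast
    field_simp
    exact le_rfl

/-- A common bound for the operator. -/
def kerC (hd : 0 < d) (ψ : ℝ → ℝ) (K : (Fin d → ℝ) → (Fin d → ℝ) → 𝕜)
    (T : testSpace 𝕜 d →ₗ[𝕜] ((Fin d → ℝ) →ₘ[volume] 𝕜)) : ℝ :=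
  (1 + 4 * singC hd) * (czZeroNorm K + wbpNorm T) + offC hd * (czZeroNorm K + czNorm ψ K)

lemma kerC_parts_nonneg (hd : 0 < d) (hψ : IsModulus ψ) (h : IsCZOperator ψ K T Tt)
    (hw : ∃ C, WeakBound T C) : 0 ≤ (1 + 4 * singC hd) * (czZeroNorm K + wbpNorm T) ∧
      0 ≤ offC hd * (czZeroNorm K + czNorm ψ K) := by
  have h0 := (sizeBound_czZeroNorm h.size).1
  have h1 := (weakBound_wbpNorm hw).1
  have h2 := (smoothBound_czNorm hψ h.smooth).1
  have hC := (singC_pos hd).le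
  have hO := (offC_pos hd).le
  exact ⟨by positivity, by positivity⟩

lemma kerC_nonneg (hd : 0 < d) (hψ : IsModulus ψ) (h : IsCZOperator ψ K T Tt)
    (hw : ∃ C, WeakBound T C) : 0 ≤ kerC hd ψ K T :=
  add_nonneg (kerC_parts_nonneg hd hψ h hw).1 (kerC_parts_nonneg hd hψ h hw).2

lemma norm_entry_le_kerC (hd : 0 < d) (hψ : IsModulus ψ) (h : IsCZOperator ψ K T Tt)
    (hw : ∃ C, WeakBound T C) (ω : Grid d) (I : Idx d) {η : Fin d → Bool} (hη : η ≠ zeroη d)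
    (m : Fin d → ℤ) (ε : Fin d → Bool) :
    ‖bform T (cubeT 𝕜 ω (child ω (tr I m) ε)) (haarT 𝕜 ω I η)‖ ≤
      kerC hd ψ K T * rt I * wt ψ m := by
  obtain ⟨p1, p2⟩ := kerC_parts_nonneg hd hψ h hw
  have hr := (rt_pos I).le
  have hm' := (wt_pos hψ m).le
  by_cases hm : m = 0
  · subst hm
    have : wt ψ (0 : Fin d → ℤ) = 1 := by simp [wt, lev_zero, hψ.one]
    rw [this, mul_one, tr_zero]
    refine (norm_entry_self_le hd h hw ω I η ε).trans (mul_le_mul_of_nonneg_right ?_ hr)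
    exact le_add_of_nonneg_right p2
  · refine (norm_entry_le hd hψ h ω I hη hm ε).trans (mul_le_mul_of_nonneg_right
      (mul_le_mul_of_nonneg_right ?_ hr) hm')
    exact le_add_of_nonneg_left p1

/-- Near the cube, constancy of u on the children allows the use of the individual entries. On the
other translates absolute values suffice, and the Dini condition sums them. No L² bound for T is
involved; the lemma serves for the convergence of the truncated forms. -/
lemma norm_bform_haarT_le (hd : 0 < d) (hψ : IsModulus ψ) (h : IsCZOperator ψ K T Tt)
    (hw : ∃ C, WeakBound T C) (ω : Grid d) (I : Idx d) {η : Fin d → Bool} (hη : η ≠ zeroη d)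
    (hint : Integrable (T (haarT 𝕜 ω I η))) (u : testSpace 𝕜 d) {M : ℝ}
    (hM : ∀ x, ‖(u : (Fin d → ℝ) → 𝕜) x‖ ≤ M) {c : (Fin d → Bool) → 𝕜}
    (hc : ∀ ε, ∀ x ∈ dcube ω (child ω I ε), (u : (Fin d → ℝ) → 𝕜) x = c ε) :
    ‖bform T u (haarT 𝕜 ω I η)‖ ≤ M * (2 ^ d * kerC hd ψ K T * ∑' m : Fin d → ℤ, wt ψ m) * rt I := by
  have hM0 : 0 ≤ M := (norm_nonneg _).trans (hM 0)
  have hr := (rt_pos I).le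
  obtain ⟨p1, p2⟩ := kerC_parts_nonneg hd hψ h hw
  have hC := kerC_nonneg hd hψ h hw
  have hint' : Integrable fun x => (u : (Fin d → ℝ) → 𝕜) x * T (haarT 𝕜 ω I η) x :=
    hint.bdd_mul (testSpace_measurable u).aestronglyMeasurable (Eventually.of_forall hM)
  have hs : HasSum (fun m => ∫ x in dcube ω (tr I m), (u : (Fin d → ℝ) → 𝕜) x *
      T (haarT 𝕜 ω I η) x) (bform T u (haarT 𝕜 ω I η)) := by
    rw [bform, pair, ← setIntegral_univ, ← iUnion_dcube_tr ω I]
    exact hasSum_integral_iUnion (fun m => measurableSet_dcube _ _)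
      (pairwise_disjoint_dcube_tr ω I) hint'.integrableOn
  have hbd : ∀ m, ‖∫ x in dcube ω (tr I m), (u : (Fin d → ℝ) → 𝕜) x * T (haarT 𝕜 ω I η) x‖ ≤
      M * (2 ^ d * kerC hd ψ K T) * rt I * wt ψ m := by
    intro m
    have hm' := (wt_pos hψ m).le
    by_cases hm : m = 0
    · subst hm
      have hw0 : wt ψ (0 : Fin d → ℤ) = 1 := by simp [wt, lev_zero, hψ.one]
      rw [hw0, mul_one, tr_zero, setIntegral_dcube_eq_sum_child ω I hint'.integrableOn]
      refine (norm_sum_le _ _).trans ((Finset.sum_le_sum (g := fun _ =>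
        M * (kerC hd ψ K T * rt I)) fun ε _ => ?_).trans (le_of_eq ?_))
      · rw [setIntegral_congr_fun (measurableSet_dcube _ _)
          (g := fun x => c ε * T (haarT 𝕜 ω I η) x) fun x hx => by simp only [hc ε x hx],
          integral_const_mul, ← bform_cubeT, norm_mul]
        refine mul_le_mul ?_ ?_ (norm_nonneg _) hM0
        · rw [← hc ε _ (corner_mem ω _)]; exact hM _
        · have := norm_entry_le_kerC hd hψ h hw ω I hη 0 ε
          rwa [hw0, mul_one, tr_zero] at this
      · rw [Finset.sum_const, Finset.card_univ, Fintype.card_fun, Fintype.card_bool,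
          Fintype.card_fin, nsmul_eq_mul]
        push_cast; ring
    · refine (norm_integral_le_of_norm_le (g := fun x => M * ‖T (haarT 𝕜 ω I η) x‖)
        (hint.norm.const_mul M).integrableOn (Eventually.of_forall fun x => ?_)).trans ?_
      · rw [norm_mul]
        exact mul_le_mul_of_nonneg_right (hM x) (norm_nonneg _)
      · rw [integral_const_mul, mul_assoc M, mul_assoc M]
        refine mul_le_mul_of_nonneg_left ?_ hM0
        refine (setIntegral_norm_haarT_le hd hψ h ω I hη hm).trans ?_
        refine mul_le_mul_of_nonneg_right (mul_le_mul_of_nonneg_right ?_ hr) hm'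
        refine (le_add_of_nonneg_left p1 : _ ≤ kerC hd ψ K T).trans ?_
        exact le_mul_of_one_le_left hC (one_le_pow₀ one_le_two)
  have hsw := (summable_wt (d := d) hψ).hasSum.mul_left (M * (2 ^ d * kerC hd ψ K T) * rt I)
  refine (hs.norm_le_of_bounded hsw hbd).trans (le_of_eq ?_)
  ring

lemma integrable_apply_haarT (hd : 0 < d) (hψ : IsModulus ψ) (h : IsCZOperator ψ K T Tt)
    (ω : Grid d) (I : Idx d) {η : Fin d → Bool} (hη : η ≠ zeroη d) :
    Integrable (T (haarT 𝕜 ω I η)) := by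
  rw [← integrableOn_univ, ← iUnion_dcube_tr ω I]
  refine integrableOn_iUnion_of_summable_integral_norm (fun m => integrableOn_cube (h.locInt _) _ _) ?_
  have hs := (summable_wt (d := d) hψ).mul_left (offC hd * (czZeroNorm K + czNorm ψ K) * rt I)
  -- The cube itself is left out: the off-diagonal estimate does not cover it, and a single term
  -- does not matter for summability.
  rw [← Set.Finite.summable_compl_iff (Set.finite_singleton (0 : Fin d → ℤ))] at hs ⊢
  refine Summable.of_nonneg_of_le (fun m => integral_nonneg fun _ => norm_nonneg _)
    (fun m => ?_) hs
  exact setIntegral_norm_haarT_le hd hψ h ω I hη m.2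

/-- Here b stands for T*1, whose pairing with h_I is by definition the integral of T h_I; this
function is integrable over the whole space and may be integrated cube by cube. -/
lemma hasSum_entry (hd : 0 < d) (hψ : IsModulus ψ) (h : IsCZOperator ψ K T Tt)
    {b : (Fin d → ℝ) → 𝕜} (hb : IsImageOfOne T b)
    (ω : Grid d) (I : Idx d) {η : Fin d → Bool} (hη : η ≠ zeroη d) :
    HasSum (fun m => bform T (cubeT 𝕜 ω (tr I m)) (haarT 𝕜 ω I η)) (pair b (haar 𝕜 ω I η)) := by
  rw [← coe_haarT, hb _ (integral_haarT ω I hη), ← setIntegral_univ, ← iUnion_dcube_tr ω I]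
  simp_rw [bform_cubeT]
  exact hasSum_integral_iUnion (fun m => measurableSet_dcube _ _) (pairwise_disjoint_dcube_tr ω I)
    (integrable_apply_haarT hd hψ h ω I hη).integrableOn

lemma bform_cubeT_eq_sum (hT : ∀ f, LocallyIntegrable (T f) volume) (ω : Grid d) (J : Idx d)
    (v : testSpace 𝕜 d) :
    bform T (cubeT 𝕜 ω J) v = ∑ ε, bform T (cubeT 𝕜 ω (child ω J ε)) v := by
  change blin hT _ _ = ∑ ε, blin hT _ _
  rw [cubeT_eq_sum, map_sum, LinearMap.sum_apply]

end

end DyadicRep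

end

noncomputable section

namespace DyadicRep

variable {d : ℕ} {𝕜 : Type*} [RCLike 𝕜]

/-! ### Lipschitz functions of bounded support -/

/-- A bounded Lipschitz function of bounded support, with one constant for everything. -/
structure Nice (R : ℝ) (f : (Fin d → ℝ) → 𝕜) : Prop where
  one_le : 1 ≤ R
  bound : ∀ x, ‖f x‖ ≤ R
  lip : ∀ x y, ‖f x - f y‖ ≤ R * ‖x - y‖
  supp : ∀ x, R < ‖x‖ → f x = 0

lemma exists_nice {f g : (Fin d → ℝ) → 𝕜} (hf : ContDiff ℝ 1 f) (hf' : HasCompactSupport f)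
    (hg : ContDiff ℝ 1 g) (hg' : HasCompactSupport g) : ∃ R : ℝ, Nice R f ∧ Nice R g := by
  have key : ∀ f : (Fin d → ℝ) → 𝕜, ContDiff ℝ 1 f → HasCompactSupport f →
      ∃ R₀ : ℝ, ∀ R, R₀ ≤ R → Nice R f := by
    intro f hf hf'
    obtain ⟨C, hC⟩ := hf'.exists_bound_of_continuous hf.continuous
    obtain ⟨L, hL⟩ := ContDiff.lipschitzWith_of_hasCompactSupport hf' hf one_ne_zero
    obtain ⟨r, hr⟩ := hf'.isCompact.isBounded.subset_closedBall (0 : Fin d → ℝ)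
    refine ⟨max (max 1 C) (max L r), fun R hR => ?_⟩
    simp only [max_le_iff] at hR
    refine ⟨hR.1.1, fun x => (hC x).trans hR.1.2, fun x y => ?_, fun x hx => ?_⟩
    · refine (hL.norm_sub_le x y).trans ?_
      exact mul_le_mul_of_nonneg_right hR.2.1 (norm_nonneg _)
    · by_contra h
      have := hr (subset_tsupport f h)
      rw [mem_closedBall_zero_iff] at this
      linarith [hR.2.2]
  obtain ⟨R₁, h1⟩ := key f hf hf'
  obtain ⟨R₂, h2⟩ := key g hg hg'
  exact ⟨max R₁ R₂, h1 _ (le_max_left _ _), h2 _ (le_max_right _ _)⟩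

/-- A bound for the integral of a nice function. -/
def vol1 (d : ℕ) (R : ℝ) : ℝ := R * (2 * R) ^ d

lemma le_vol1 {R : ℝ} (hR : 1 ≤ R) : R ≤ vol1 d R :=
  le_mul_of_one_le_right (by linarith) (one_le_pow₀ (by linarith))

lemma vol1_pos {R : ℝ} (hR : 1 ≤ R) : 0 < vol1 d R := by linarith [le_vol1 (d := d) hR]

/-- A bound for the averages of nice functions over the cubes of level `n`. -/
def avB (d : ℕ) (R : ℝ) (n : ℤ) : ℝ := vol1 d R * (min 1 (2 ^ n)) ^ d

/-- A bound for the Haar coefficients of nice functions on level `n`. -/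
def haB (d : ℕ) (R : ℝ) (n : ℤ) : ℝ := vol1 d R * (min 1 (2 ^ (-n))) ^ (d + 1)

/-- The positions of the cubes of level `n` that can meet the ball of radius `R`. -/
def bx (d : ℕ) (R : ℝ) (n : ℤ) : Finset (Fin d → ℤ) :=
  Fintype.piFinset fun _ => Finset.Icc (-(⌈R * 2 ^ n⌉ + 2)) (⌈R * 2 ^ n⌉ + 2)

lemma min_zpow_pos (n : ℤ) : (0 : ℝ) < min 1 (2 ^ n) := lt_min one_pos (by positivity)

lemma avB_pos {R : ℝ} (hR : 1 ≤ R) (n : ℤ) : 0 < avB d R n :=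
  mul_pos (vol1_pos hR) (pow_pos (min_zpow_pos n) _)

lemma haB_pos {R : ℝ} (hR : 1 ≤ R) (n : ℤ) : 0 < haB d R n :=
  mul_pos (vol1_pos hR) (pow_pos (min_zpow_pos (-n)) _)

lemma avB_mono {R : ℝ} (hR : 1 ≤ R) : Monotone (avB d R) := fun n n' h => by
  refine mul_le_mul_of_nonneg_left (pow_le_pow_left₀ (min_zpow_pos n).le ?_ d) (vol1_pos hR).le
  exact min_le_min_left _ (zpow_le_zpow_right₀ one_le_two h)

lemma avB_add_one_le {R : ℝ} (hR : 1 ≤ R) (n : ℤ) : avB d R (n + 1) ≤ 2 ^ d * avB d R n := by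
  have h : min 1 ((2 : ℝ) ^ (n + 1)) ≤ 2 * min 1 (2 ^ n) := by
    rw [zpow_add_one₀ two_ne_zero, mul_min_of_nonneg _ _ zero_le_two, mul_comm (2 : ℝ) (2 ^ n)]
    exact min_le_min (by norm_num) le_rfl
  have h2 := pow_le_pow_left₀ (min_zpow_pos (n + 1)).le h d
  rw [mul_pow] at h2
  calc avB d R (n + 1) ≤ vol1 d R * (2 ^ d * (min 1 (2 ^ n)) ^ d) :=
        mul_le_mul_of_nonneg_left h2 (vol1_pos hR).le
    _ = _ := by rw [avB]; ring

lemma side_eq_inv (I : Idx d) : side I = ((2 : ℝ) ^ I.1)⁻¹ := zpow_neg _ _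

/-- The random translation lies between 0 and the side length, so enlarging the box by a fixed
number of positions serves all ω at once. -/
lemma mem_bx {R : ℝ} {ω : Grid d} {I : Idx d} {x : Fin d → ℝ} (hx : x ∈ dcube ω I)
    (hR : ‖x‖ ≤ R) : I.2 ∈ bx d R I.1 := by
  refine Fintype.mem_piFinset.2 fun n => ?_
  have h1 : x n ∈ Ico _ _ := hx n trivial
  have h2 := off_nonneg ω I.1 n
  have h3 := off_le ω I.1 n
  have h4 := abs_le.1 ((norm_le_pi_norm x n).trans hR)
  rw [corner_eq, mem_Ico] at h1
  have hp : (0 : ℝ) < 2 ^ I.1 := by positivity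
  have hs : side I * 2 ^ I.1 = 1 := by rw [side_eq_inv, inv_mul_cancel₀ hp.ne']
  change off ω I.1 n ≤ side I at h3
  have h5 := Int.le_ceil (R * (2 : ℝ) ^ I.1)
  have e : (I.2 n : ℝ) = side I * I.2 n * 2 ^ I.1 := by
    rw [mul_right_comm, hs, one_mul]
  have h6 : side I * I.2 n * 2 ^ I.1 ≤ R * 2 ^ I.1 :=
    mul_le_mul_of_nonneg_right (by linarith) hp.le
  have h7 : (-R - 2 * side I) * 2 ^ I.1 ≤ side I * I.2 n * 2 ^ I.1 :=
    mul_le_mul_of_nonneg_right (by linarith) hp.le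
  have h8 : (-R - 2 * side I) * 2 ^ I.1 = - (R * 2 ^ I.1) - 2 := by linear_combination -2 * hs
  rw [Finset.mem_Icc]
  constructor
  · have : ((-(⌈R * 2 ^ I.1⌉ + 2) : ℤ) : ℝ) ≤ I.2 n := by push_cast; linarith
    exact_mod_cast this
  · have : (I.2 n : ℝ) ≤ ((⌈R * 2 ^ I.1⌉ + 2 : ℤ) : ℝ) := by push_cast; linarith
    exact_mod_cast this

lemma card_bx_le {R : ℝ} (hR : 1 ≤ R) (n : ℤ) :
    ((bx d R n).card : ℝ) ≤ (2 * R + 7) ^ d * (max 1 (2 ^ n)) ^ d := by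
  rw [bx, Fintype.card_piFinset]
  simp only [Int.card_Icc, Finset.prod_const, Finset.card_univ, Fintype.card_fin]
  rw [← mul_pow]
  push_cast
  refine pow_le_pow_left₀ (by positivity) ?_ d
  have hp : (0 : ℝ) < 2 ^ n := by positivity
  have h0 : 0 ≤ ⌈R * (2 : ℝ) ^ n⌉ := Int.ceil_nonneg (by positivity)
  have h1 := Int.ceil_lt_add_one (R * (2 : ℝ) ^ n)
  have h2 : (((⌈R * (2 : ℝ) ^ n⌉ + 2 + 1 - -(⌈R * (2 : ℝ) ^ n⌉ + 2)).toNat : ℕ) : ℝ) =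
      2 * (⌈R * (2 : ℝ) ^ n⌉ : ℝ) + 5 := by
    have : ((⌈R * (2 : ℝ) ^ n⌉ + 2 + 1 - -(⌈R * (2 : ℝ) ^ n⌉ + 2)).toNat : ℤ) =
      2 * ⌈R * (2 : ℝ) ^ n⌉ + 5 := by omega
    exact_mod_cast this
  rw [h2]
  have h3 := le_max_left 1 ((2 : ℝ) ^ n)
  have h4 := le_max_right 1 ((2 : ℝ) ^ n)
  nlinarith [mul_le_mul_of_nonneg_left h4 (by linarith : 0 ≤ R)]

namespace Nice

variable {R : ℝ} {f : (Fin d → ℝ) → 𝕜}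

lemma continuous (hf : Nice R f) : Continuous f :=
  (LipschitzWith.of_dist_le_mul (K := ⟨R, by linarith [hf.one_le]⟩) fun x y => by
    rw [dist_eq_norm, dist_eq_norm]; exact hf.lip x y).continuous

lemma hasCompactSupport (hf : Nice R f) : HasCompactSupport f :=
  HasCompactSupport.intro (isCompact_closedBall (0 : Fin d → ℝ) R) fun x hx =>
    hf.supp x (by simpa using hx)

lemma integrable (hf : Nice R f) : Integrable f :=
  hf.continuous.integrable_of_hasCompactSupport hf.hasCompactSupport

lemma locallyIntegrable (hf : Nice R f) : LocallyIntegrable f volume := hf.integrable.locallyIntegrable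

lemma integral_norm_le (hf : Nice R f) : ∫ x, ‖f x‖ ≤ vol1 d R := by
  have hR := hf.one_le
  rw [← setIntegral_eq_integral_of_forall_compl_eq_zero (s := Metric.closedBall 0 R)]
  · have h := norm_setIntegral_le_of_norm_le_const (μ := volume) (s := Metric.closedBall (0 : Fin d → ℝ) R)
      (f := fun x => ‖f x‖) (C := R) (isCompact_closedBall _ _).measure_lt_top
      (fun x _ => by rw [norm_norm]; exact hf.bound x)
    rw [measureReal_def, Real.volume_pi_closedBall _ (by linarith), Fintype.card_fin,
      ENNReal.toReal_ofReal (by positivity)] at h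
    exact (le_abs_self _).trans h
  · intro x hx
    rw [hf.supp x (by simpa using hx), norm_zero]

lemma setIntegral_norm_le (hf : Nice R f) (s : Set (Fin d → ℝ)) : ∫ x in s, ‖f x‖ ≤ vol1 d R :=
  (setIntegral_le_integral hf.integrable.norm (Eventually.of_forall fun _ => norm_nonneg _)).trans
    hf.integral_norm_le

lemma norm_av_le (hf : Nice R f) (ω : Grid d) (I : Idx d) : ‖av ω f I‖ ≤ avB d R I.1 := by
  rw [avB]
  rcases min_choice 1 ((2 : ℝ) ^ I.1) with h | h
  · rw [h, one_pow, mul_one]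
    exact (norm_av_le_of_bound ω I fun x _ => hf.bound x).trans (le_vol1 hf.one_le)
  · rw [h, mul_comm]
    refine (DyadicRep.norm_av_le ω f I).trans ?_
    rw [side_eq_inv, inv_pow, inv_inv]
    exact mul_le_mul_of_nonneg_left (hf.setIntegral_norm_le _) (by positivity)

lemma norm_av_le_const (hf : Nice R f) (ω : Grid d) (I : Idx d) : ‖av ω f I‖ ≤ R :=
  norm_av_le_of_bound ω I fun x _ => hf.bound x

lemma norm_av_child_le (hf : Nice R f) (ω : Grid d) (I : Idx d) (ε : Fin d → Bool) :
    ‖av ω f (child ω I ε)‖ ≤ 2 ^ d * avB d R I.1 :=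
  (hf.norm_av_le ω _).trans (avB_add_one_le hf.one_le I.1)

lemma eq_zero_of_notMem (hf : Nice R f) {ω : Grid d} {I : Idx d} (hI : I.2 ∉ bx d R I.1)
    {x : Fin d → ℝ} (hx : x ∈ dcube ω I) : f x = 0 :=
  hf.supp x (lt_of_not_ge fun h => hI (mem_bx hx h))

lemma av_eq_zero (hf : Nice R f) (ω : Grid d) {I : Idx d} (hI : I.2 ∉ bx d R I.1) :
    av ω f I = 0 := by
  rw [av_eq, setIntegral_congr_fun (measurableSet_dcube ω I) (g := fun _ => 0)
    fun x hx => hf.eq_zero_of_notMem hI hx]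
  simp

lemma av_child_eq_zero (hf : Nice R f) (ω : Grid d) {I : Idx d} (hI : I.2 ∉ bx d R I.1)
    (ε : Fin d → Bool) : av ω f (child ω I ε) = 0 := by
  rw [av_eq, setIntegral_congr_fun (measurableSet_dcube ω _) (g := fun _ => 0)
    fun x hx => hf.eq_zero_of_notMem hI (dcube_child_subset ω I ε hx)]
  simp

lemma pair_haar_eq_zero (hf : Nice R f) (ω : Grid d) {I : Idx d} (hI : I.2 ∉ bx d R I.1)
    {η : Fin d → Bool} (hη : η ≠ zeroη d) : pair f (haar 𝕜 ω I η) = 0 :=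
  pair_haar_eq_zero_of_const ω I hη fun _ hx => hf.eq_zero_of_notMem hI hx

lemma norm_sub_le_of_mem (hf : Nice R f) {ω : Grid d} {I : Idx d} {x y : Fin d → ℝ}
    (hx : x ∈ dcube ω I) (hy : y ∈ dcube ω I) : ‖f x - f y‖ ≤ R * side I := by
  refine (hf.lip x y).trans (mul_le_mul_of_nonneg_left ?_ (by linarith [hf.one_le]))
  refine (pi_norm_le_iff_of_nonneg (side_pos I).le).2 fun n => ?_
  have h1 : x n ∈ Ico _ _ := hx n trivial
  have h2 : y n ∈ Ico _ _ := hy n trivial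
  rw [mem_Ico] at h1 h2
  rw [Pi.sub_apply, Real.norm_eq_abs, abs_le]
  constructor <;> linarith [h1.1, h1.2, h2.1, h2.2]

lemma norm_sub_av_le (hf : Nice R f) {ω : Grid d} {I : Idx d} {x : Fin d → ℝ}
    (hx : x ∈ dcube ω I) : ‖f x - av ω f I‖ ≤ R * side I := by
  have h : f x - av ω f I = av ω (fun y => f x - f y) I := by
    have hv := volume_dcube_ne_top ω I
    have h1 : IntegrableOn (fun _ : Fin d → ℝ => f x) (dcube ω I) := integrableOn_const hv
    have h2 : av ω (fun _ : Fin d → ℝ => f x) I = f x := by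
      have := pow_pos (side_pos I) d
      rw [av_eq, setIntegral_const, volume_real_dcube, RCLike.real_smul_eq_coe_mul, ← mul_assoc,
        ← RCLike.ofReal_mul, inv_mul_cancel₀ this.ne', RCLike.ofReal_one, one_mul]
    conv_lhs => rw [← h2]
    rw [av_eq, av_eq, av_eq, integral_sub h1 hf.integrable.integrableOn, mul_sub]
  rw [h]
  exact norm_av_le_of_bound ω I fun y hy => hf.norm_sub_le_of_mem hx hy

/-- Large cubes use the L¹ norm of f. Small cubes use the Lipschitz bound, whose extra factor ℓ(I)
makes the sum over fine levels converge. -/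
lemma norm_pair_haar_mul_le (hf : Nice R f) (ω : Grid d) (I : Idx d)
    {η : Fin d → Bool} (hη : η ≠ zeroη d) :
    ‖pair f (haar 𝕜 ω I η)‖ * rt I ≤ haB d R I.1 := by
  have hr := rt_pos I
  have hp : (0 : ℝ) < 2 ^ I.1 := by positivity
  rw [haB]
  rcases min_choice 1 ((2 : ℝ) ^ (-I.1)) with h | h
  · rw [h, one_pow, mul_one]
    refine (mul_le_mul_of_nonneg_right (norm_pair_haar_le ω I η hf.integrable.integrableOn)
      hr.le).trans ?_
    rw [mul_right_comm, inv_mul_cancel₀ hr.ne', one_mul]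
    exact hf.setIntegral_norm_le _
  · rw [h]
    refine (mul_le_mul_of_nonneg_right (norm_pair_haar_le_of_osc ω I hη hf.integrable.integrableOn
      (f (corner ω I)) fun x hx => hf.norm_sub_le_of_mem hx (corner_mem ω I)) hr.le).trans ?_
    rw [mul_right_comm, rt_sq]
    change side I ^ d * (R * side I) ≤ vol1 d R * side I ^ (d + 1)
    rw [pow_succ, mul_comm R, ← mul_assoc, mul_comm (vol1 d R)]
    exact mul_le_mul_of_nonneg_left (le_vol1 hf.one_le)
      (mul_nonneg (pow_nonneg (side_pos I).le _) (side_pos I).le)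

end Nice

/-- A summable bound for the products of averages and Haar coefficients of nice functions. -/
def domB (R : ℝ) (I : Idx d) : ℝ := if I.2 ∈ bx d R I.1 then avB d R I.1 * haB d R I.1 else 0

lemma domB_nonneg {R : ℝ} (hR : 1 ≤ R) (I : Idx d) : 0 ≤ domB R I := by
  unfold domB
  split_ifs
  · exact (mul_pos (avB_pos hR _) (haB_pos hR _)).le
  · exact le_rfl

lemma Nice.norm_pair_haar_mul_le_domB {R : ℝ} {f : (Fin d → ℝ) → 𝕜} (hf : Nice R f) (ω : Grid d)
    (I : Idx d) {η : Fin d → Bool} (hη : η ≠ zeroη d) :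
    ‖pair f (haar 𝕜 ω I η)‖ * rt I * avB d R I.1 ≤ domB R I := by
  unfold domB
  split_ifs with h
  · rw [mul_comm]
    exact mul_le_mul_of_nonneg_left (hf.norm_pair_haar_mul_le ω I hη) (avB_pos hf.one_le _).le
  · rw [hf.pair_haar_eq_zero ω h hη]; simp

lemma summable_min_zpow : Summable fun n : ℤ => min ((2 : ℝ) ^ n) (2 ^ (-n)) := by
  have h : Summable fun n : ℕ => ((1 : ℝ) / 2) ^ n := summable_geometric_two
  refine Summable.of_nat_of_neg (h.of_nonneg_of_le (fun n => by positivity) fun n => ?_)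
    (h.of_nonneg_of_le (fun n => by positivity) fun n => ?_)
  · refine (min_le_right _ _).trans (le_of_eq ?_)
    simp
  · refine (min_le_left _ _).trans (le_of_eq ?_)
    simp

/-- On fine levels n ≥ 0 there are about 2^{nd} cubes with coefficients of size 2^{-n(d+1)}. On
coarse levels the number of cubes is bounded and the averages decay like 2^{nd} ≤ 2^n. Both ends are
geometric, which makes `domB` a summable majorant independent of ω. -/
lemma card_bx_mul_le (hd : 0 < d) {R : ℝ} (hR : 1 ≤ R) (n : ℤ) :
    ((bx d R n).card : ℝ) * (avB d R n * haB d R n) ≤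
      (2 * R + 7) ^ d * vol1 d R ^ 2 * min (2 ^ n) (2 ^ (-n)) := by
  have hp : (0 : ℝ) < 2 ^ n := by positivity
  have hV := vol1_pos (d := d) hR
  have hpos := mul_pos (avB_pos (d := d) hR n) (haB_pos (d := d) hR n)
  refine (mul_le_mul_of_nonneg_right (card_bx_le hR n) hpos.le).trans ?_
  have key : (max 1 ((2 : ℝ) ^ n)) ^ d * ((min 1 (2 ^ n)) ^ d * (min 1 (2 ^ (-n))) ^ (d + 1)) ≤
      min (2 ^ n) (2 ^ (-n)) := by
    rw [zpow_neg]
    set x : ℝ := 2 ^ n with hx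
    rcases le_total 1 x with h | h
    · have hi : x⁻¹ ≤ 1 := inv_le_one_of_one_le₀ h
      rw [max_eq_right h, min_eq_left h, min_eq_right hi, min_eq_right (hi.trans h), one_pow,
        one_mul, pow_succ, ← mul_assoc, ← mul_pow, mul_inv_cancel₀ hp.ne', one_pow, one_mul]
    · have hi : 1 ≤ x⁻¹ := one_le_inv_iff₀.2 ⟨hp, h⟩
      rw [max_eq_left h, min_eq_right h, min_eq_left hi, min_eq_left (h.trans hi), one_pow,
        one_pow, one_mul, mul_one]
      exact pow_le_of_le_one hp.le h hd.ne'
  have hc : 0 ≤ (2 * R + 7) ^ d * vol1 d R ^ 2 := by positivity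
  calc _ = (2 * R + 7) ^ d * vol1 d R ^ 2 * ((max 1 ((2 : ℝ) ^ n)) ^ d * ((min 1 (2 ^ n)) ^ d *
        (min 1 (2 ^ (-n))) ^ (d + 1))) := by rw [avB, haB]; ring
    _ ≤ _ := mul_le_mul_of_nonneg_left key hc

lemma summable_domB (hd : 0 < d) {R : ℝ} (hR : 1 ≤ R) : Summable (domB (d := d) R) := by
  have hsum : ∀ n, HasSum (fun a => domB (d := d) R (n, a))
      ((bx d R n).card * (avB d R n * haB d R n)) := fun n => by
    have h := hasSum_sum_of_ne_finset_zero (L := SummationFilter.unconditional _)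
      (f := fun a => domB (d := d) R (n, a)) (s := bx d R n) fun a ha => if_neg ha
    have e : ∑ a ∈ bx d R n, domB (d := d) R (n, a) = (bx d R n).card * (avB d R n * haB d R n) := by
      rw [← nsmul_eq_mul, ← Finset.sum_const]
      exact Finset.sum_congr rfl fun a ha => if_pos ha
    rwa [e] at h
  refine (summable_prod_of_nonneg (f := domB (d := d) R) (domB_nonneg hR)).2 ⟨fun n => (hsum n).summable, ?_⟩
  have e : (fun n => ∑' a, domB (d := d) R (n, a)) =
    fun n => ((bx d R n).card : ℝ) * (avB d R n * haB d R n) := funext fun n => (hsum n).tsum_eq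
  rw [e]
  refine (summable_min_zpow.mul_left ((2 * R + 7) ^ d * vol1 d R ^ 2)).of_nonneg_of_le
    (fun n => ?_) (card_bx_mul_le hd hR)
  exact mul_nonneg (Nat.cast_nonneg _) (mul_pos (avB_pos hR n) (haB_pos hR n)).le

end DyadicRep

end

noncomputable section

namespace DyadicRep

variable {d : ℕ} {𝕜 : Type*} [RCLike 𝕜]

/-! ### Averaging operators -/

/-- The average of `f` over the cubes of level `n`, as a test function. -/
def avT (ω : Grid d) (R : ℝ) (f : (Fin d → ℝ) → 𝕜) (n : ℤ) : testSpace 𝕜 d :=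
  ∑ a ∈ bx d R n, av ω f (n, a) • cubeT 𝕜 ω (n, a)

/-- The Haar coefficients of `f`, set to zero for the non-cancellative Haar function. -/
def hcf (ω : Grid d) (f : (Fin d → ℝ) → 𝕜) (I : Idx d) (η : Fin d → Bool) : 𝕜 :=
  if η = zeroη d then 0 else pair f (haar 𝕜 ω I η)

lemma hcf_zero (ω : Grid d) (f : (Fin d → ℝ) → 𝕜) (I : Idx d) : hcf ω f I (zeroη d) = 0 := if_pos rfl

lemma hcf_of_ne (ω : Grid d) (f : (Fin d → ℝ) → 𝕜) (I : Idx d) {η : Fin d → Bool}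
    (hη : η ≠ zeroη d) : hcf ω f I η = pair f (haar 𝕜 ω I η) := if_neg hη

lemma sum_hcf_mul (ω : Grid d) (f : (Fin d → ℝ) → 𝕜) (I : Idx d) (c : (Fin d → Bool) → 𝕜) :
    ∑ η, hcf ω f I η * c η = ∑ η with η ≠ zeroη d, pair f (haar 𝕜 ω I η) * c η := by
  rw [Finset.sum_filter]
  refine Finset.sum_congr rfl fun η _ => ?_
  by_cases h : η = zeroη d
  · simp [h, hcf_zero]
  · rw [if_pos h, hcf_of_ne ω f I h]

lemma cell_eq_of_mem {ω : Grid d} {J : Idx d} {n : ℤ} (hn : n ≤ J.1) {x y : Fin d → ℝ}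
    (hx : x ∈ dcube ω J) (hy : y ∈ dcube ω J) : cell ω n x = cell ω n y := by
  have h : (anc ω (J.1 - n).toNat J).1 = n := by rw [anc_fst]; omega
  have h1 := (mem_dcube_iff ω _ x).1 (dcube_subset_anc ω (J.1 - n).toNat J hx)
  have h2 := (mem_dcube_iff ω _ y).1 (dcube_subset_anc ω (J.1 - n).toNat J hy)
  rw [h] at h1 h2
  rw [h1, h2]

namespace Nice

variable {R : ℝ} {f g : (Fin d → ℝ) → 𝕜}

lemma hcf_eq_zero (hf : Nice R f) (ω : Grid d) {I : Idx d} (hI : I.2 ∉ bx d R I.1)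
    (η : Fin d → Bool) : hcf ω f I η = 0 := by
  by_cases h : η = zeroη d
  · rw [h, hcf_zero]
  · rw [hcf_of_ne ω f I h, hf.pair_haar_eq_zero ω hI h]

lemma norm_hcf_mul_le_domB (hf : Nice R f) (ω : Grid d) (I : Idx d) (η : Fin d → Bool) :
    ‖hcf ω f I η‖ * rt I * avB d R I.1 ≤ domB R I := by
  by_cases h : η = zeroη d
  · rw [h, hcf_zero, norm_zero, zero_mul, zero_mul]
    exact domB_nonneg hf.one_le I
  · rw [hcf_of_ne ω f I h]; exact hf.norm_pair_haar_mul_le_domB ω I h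

lemma sum_bx_apply {ω : Grid d} {n : ℤ} {c : Idx d → testSpace 𝕜 d}
    (hc : ∀ a x, x ∉ dcube ω (n, a) → (c (n, a) : (Fin d → ℝ) → 𝕜) x = 0)
    (hc' : ∀ a ∉ bx d R n, (c (n, a) : (Fin d → ℝ) → 𝕜) = 0) (x : Fin d → ℝ) :
    ((∑ a ∈ bx d R n, c (n, a) : testSpace 𝕜 d) : (Fin d → ℝ) → 𝕜) x =
      (c (n, cell ω n x) : (Fin d → ℝ) → 𝕜) x := by
  rw [Submodule.coe_sum, Finset.sum_apply, Finset.sum_eq_single (cell ω n x)]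
  · intro a _ ha
    refine hc a x fun h => ha ?_
    exact ((mem_dcube_iff ω _ x).1 h).symm
  · intro h
    rw [hc' _ h, Pi.zero_apply]

lemma avT_apply (hf : Nice R f) (ω : Grid d) (n : ℤ) (x : Fin d → ℝ) :
    (avT ω R f n : (Fin d → ℝ) → 𝕜) x = av ω f (n, cell ω n x) := by
  rw [avT, sum_bx_apply (c := fun I => av ω f I • cubeT 𝕜 ω I)]
  · simp only [Submodule.coe_smul, Pi.smul_apply, coe_cubeT, smul_eq_mul]
    rw [indicator_of_mem (mem_dcube_cell ω n x), Pi.one_apply, mul_one]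
  · intro a y hy
    simp only [Submodule.coe_smul, Pi.smul_apply, coe_cubeT, smul_eq_mul]
    rw [indicator_of_notMem hy, mul_zero]
  · intro a ha
    rw [hf.av_eq_zero ω (I := (n, a)) ha, zero_smul]; rfl

lemma child_cell (ω : Grid d) (n : ℤ) (x : Fin d → ℝ) :
    child ω (n, cell ω n x) (pos ω (n + 1, cell ω (n + 1) x)) = (n + 1, cell ω (n + 1) x) := by
  have := par_cell ω (n + 1) x
  rw [add_sub_cancel_right] at this
  rw [← this, child_par]

lemma avT_succ_eq (hf : Nice R f) (ω : Grid d) (n : ℤ) :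
    avT ω R f (n + 1) =
      ∑ a ∈ bx d R n, ∑ ε, av ω f (child ω (n, a) ε) • cubeT 𝕜 ω (child ω (n, a) ε) := by
  refine Subtype.ext (funext fun x => ?_)
  rw [hf.avT_apply, sum_bx_apply (c := fun I => ∑ ε, av ω f (child ω I ε) • cubeT 𝕜 ω (child ω I ε))]
  · have hx := mem_dcube_cell ω (n + 1) x
    rw [← child_cell] at hx ⊢
    rw [Submodule.coe_sum, Finset.sum_apply, Finset.sum_eq_single (pos ω (n + 1, cell ω (n + 1) x))]
    · simp only [Submodule.coe_smul, Pi.smul_apply, coe_cubeT, smul_eq_mul]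
      rw [indicator_of_mem hx, Pi.one_apply, mul_one]
    · intro ε _ hε
      simp only [Submodule.coe_smul, Pi.smul_apply, coe_cubeT, smul_eq_mul]
      rw [indicator_of_notMem (fun h => hε (child_injective ω _ (eq_of_mem_dcube rfl h hx))),
        mul_zero]
    · simp
  · intro a y hy
    rw [Submodule.coe_sum, Finset.sum_apply]
    refine Finset.sum_eq_zero fun ε _ => ?_
    simp only [Submodule.coe_smul, Pi.smul_apply, coe_cubeT, smul_eq_mul]
    rw [indicator_of_notMem (fun h => hy (dcube_child_subset ω _ ε h)), mul_zero]
  · intro a ha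
    simp only [hf.av_child_eq_zero ω (I := (n, a)) ha, zero_smul, Finset.sum_const_zero]; rfl

lemma avT_add_succ_eq (hf : Nice R f) (ω : Grid d) (n : ℤ) :
    avT ω R f n + avT ω R f (n + 1) = ∑ a ∈ bx d R n, ∑ ε,
      (av ω f (n, a) + av ω f (child ω (n, a) ε)) • cubeT 𝕜 ω (child ω (n, a) ε) := by
  rw [hf.avT_succ_eq, avT, ← Finset.sum_add_distrib]
  refine Finset.sum_congr rfl fun a _ => ?_
  simp only [add_smul, Finset.sum_add_distrib]
  congr 1
  rw [cubeT_eq_sum, Finset.smul_sum]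

lemma avT_sub_eq (hf : Nice R f) (ω : Grid d) (n : ℤ) :
    avT ω R f (n + 1) - avT ω R f n =
      ∑ a ∈ bx d R n, ∑ η, hcf ω f (n, a) η • haarT 𝕜 ω (n, a) η := by
  refine Subtype.ext (funext fun x => ?_)
  rw [sum_bx_apply (c := fun I => ∑ η, hcf ω f I η • haarT 𝕜 ω I η)]
  · have hx := mem_dcube_cell ω (n + 1) x
    rw [← child_cell] at hx
    rw [Submodule.coe_sub, Pi.sub_apply, hf.avT_apply, hf.avT_apply, ← child_cell,
      ← sum_pair_haar_mul ω (n, cell ω n x) hf.integrable.integrableOn hx, Submodule.coe_sum,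
      Finset.sum_apply]
    simp only [Submodule.coe_smul, Pi.smul_apply, coe_haarT, smul_eq_mul]
    rw [sum_hcf_mul]
  · intro a y hy
    rw [Submodule.coe_sum, Finset.sum_apply]
    refine Finset.sum_eq_zero fun ε _ => ?_
    simp only [Submodule.coe_smul, Pi.smul_apply, coe_haarT, smul_eq_mul]
    rw [haar_of_notMem ω hy, mul_zero]
  · intro a ha
    simp only [hf.hcf_eq_zero ω (I := (n, a)) ha, zero_smul, Finset.sum_const_zero]; rfl

lemma norm_avT_le (hf : Nice R f) (ω : Grid d) (n : ℤ) (x : Fin d → ℝ) :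
    ‖(avT ω R f n : (Fin d → ℝ) → 𝕜) x‖ ≤ R := by
  rw [hf.avT_apply]; exact hf.norm_av_le_const ω _

/-- For n ≥ 0 the cubes have side at most one, so a cube that meets the ball of radius R stays in
the ball of radius R + 1, and the difference vanishes outside. -/
lemma norm_avT_sub_le (hf : Nice R f) (ω : Grid d) {n : ℤ} (hn : 0 ≤ n) (x : Fin d → ℝ) :
    ‖(avT ω R f n : (Fin d → ℝ) → 𝕜) x - f x‖ ≤
      (Metric.closedBall (0 : Fin d → ℝ) (R + 1)).indicator (fun _ => R * 2 ^ (-n)) x := by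
  rw [hf.avT_apply]
  have hx := mem_dcube_cell ω n x
  have hs : side ((n, cell ω n x) : Idx d) ≤ 1 := zpow_le_one_of_nonpos₀ one_le_two (by simpa using hn)
  by_cases h : x ∈ Metric.closedBall (0 : Fin d → ℝ) (R + 1)
  · rw [indicator_of_mem h, norm_sub_rev]
    exact hf.norm_sub_av_le hx
  · rw [indicator_of_notMem h]
    rw [mem_closedBall_zero_iff, not_le] at h
    have h0 : ∀ y ∈ dcube ω (n, cell ω n x), f y = 0 := fun y hy => by
      refine hf.supp y ?_
      have h1 : ‖x - y‖ ≤ side ((n, cell ω n x) : Idx d) := by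
        refine (pi_norm_le_iff_of_nonneg (side_pos _).le).2 fun i => ?_
        have h1 : x i ∈ Ico _ _ := hx i trivial
        have h2 : y i ∈ Ico _ _ := hy i trivial
        rw [mem_Ico] at h1 h2
        rw [Pi.sub_apply, Real.norm_eq_abs, abs_le]
        constructor <;> linarith [h1.1, h1.2, h2.1, h2.2]
      have h2 := norm_sub_norm_le x y
      linarith
    rw [h0 x hx, av_eq, setIntegral_congr_fun (measurableSet_dcube ω _) (g := fun _ => 0) h0]
    simp

end Nice

/-! ### Convergence of the truncated bilinear forms. -/

section

variable {ψ : ℝ → ℝ} {K : (Fin d → ℝ) → (Fin d → ℝ) → 𝕜}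
  {T Tt : testSpace 𝕜 d →ₗ[𝕜] ((Fin d → ℝ) →ₘ[volume] 𝕜)} {R : ℝ} {f g : testSpace 𝕜 d}

lemma tendsto_two_zpow_neg_nat : Tendsto (fun N : ℕ => (2 : ℝ) ^ (-(N : ℤ))) atTop (𝓝 0) := by
  simp only [zpow_neg, zpow_natCast]
  exact tendsto_inv_atTop_zero.comp (tendsto_pow_atTop_atTop_of_one_lt one_lt_two)

/-- With the second argument fixed, uniform convergence on one compact set is enough, because T v is
integrable there. -/
lemma tendsto_bform_avT (hT : ∀ f, LocallyIntegrable (T f) volume)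
    (hg : Nice R (g : (Fin d → ℝ) → 𝕜)) (ω : Grid d) (v : testSpace 𝕜 d) :
    ∃ C, ∀ N : ℕ, ‖bform T (avT ω R g N) v - bform T g v‖ ≤ C * 2 ^ (-(N : ℤ)) := by
  set B := Metric.closedBall (0 : Fin d → ℝ) (R + 1) with hB
  have hi : IntegrableOn (T v) B := (hT v).integrableOn_isCompact (isCompact_closedBall _ _)
  refine ⟨R * ∫ x in B, ‖T v x‖, fun N => ?_⟩
  rw [bform, bform, pair, pair, ← integral_sub (testSpace_integrable_mul _ (hT v))
    (testSpace_integrable_mul _ (hT v))]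
  refine (norm_integral_le_of_norm_le
    (g := fun x => B.indicator (fun x => R * 2 ^ (-(N : ℤ)) * ‖T v x‖) x) ?_
    (Eventually.of_forall fun x => ?_)).trans (le_of_eq ?_)
  · exact (integrable_indicator_iff measurableSet_closedBall).2 (hi.norm.const_mul _)
  · rw [← sub_mul, norm_mul]
    refine (mul_le_mul_of_nonneg_right (hg.norm_avT_sub_le ω (Nat.cast_nonneg N) x)
      (norm_nonneg _)).trans (le_of_eq ?_)
    by_cases h : x ∈ B
    · rw [indicator_of_mem h, indicator_of_mem h]
    · rw [indicator_of_notMem h, indicator_of_notMem h, zero_mul]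
  · rw [integral_indicator measurableSet_closedBall, integral_const_mul]; ring

/-- The condition N ≤ k makes the average of g constant on all children of cubes of level k, so
`norm_bform_haarT_le` applies with a bound that does not depend on N. -/
lemma exists_bform_avT_step (hd : 0 < d) (hψ : IsModulus ψ) (h : IsCZOperator ψ K T Tt)
    (hw : ∃ C, WeakBound T C) (hf : Nice R (f : (Fin d → ℝ) → 𝕜))
    (hg : Nice R (g : (Fin d → ℝ) → 𝕜)) (ω : Grid d) :
    ∃ C, 0 ≤ C ∧ ∀ N k : ℕ, N ≤ k →
      ‖bform T (avT ω R g N) (avT ω R f (k + 1) - avT ω R f k)‖ ≤ C * 2 ^ (-(k : ℤ)) := by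
  have hR := hf.one_le
  set A := 2 ^ d * kerC hd ψ K T * ∑' m : Fin d → ℤ, wt ψ m with hA
  have hA0 : 0 ≤ A := mul_nonneg (mul_nonneg (by positivity) (kerC_nonneg hd hψ h hw))
    (tsum_nonneg fun m => (wt_pos hψ m).le)
  have hV := vol1_pos (d := d) hR
  refine ⟨2 ^ d * A * ((2 * R + 7) ^ d * vol1 d R ^ 2), by positivity, fun N k hNk => ?_⟩
  have hterm : ∀ a ∈ bx d R k, ∀ η, ‖hcf ω (f : (Fin d → ℝ) → 𝕜) (k, a) η *
      bform T (avT ω R g N) (haarT 𝕜 ω (k, a) η)‖ ≤ A * (avB d R k * haB d R k) := by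
    intro a ha η
    by_cases hη : η = zeroη d
    · rw [hη, hcf_zero, zero_mul, norm_zero]
      exact mul_nonneg hA0 (mul_pos (avB_pos hR _) (haB_pos hR _)).le
    have h1 := norm_bform_haarT_le hd hψ h hw ω (k, a) hη (integrable_apply_haarT hd hψ h ω _ hη)
      (avT ω R g N) (M := avB d R k) (fun x => (hg.norm_avT_le ω N x).trans ?_)
      (c := fun ε => av ω g (N, cell ω N (corner ω (child ω (k, a) ε)))) (fun ε x hx => ?_)
    · rw [norm_mul]
      have h2 := hf.norm_hcf_mul_le_domB ω (k, a) η
      rw [domB, if_pos ha] at h2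
      calc _ ≤ ‖hcf ω (f : (Fin d → ℝ) → 𝕜) (k, a) η‖ * (avB d R k * A * rt ((k, a) : Idx d)) :=
            mul_le_mul_of_nonneg_left h1 (norm_nonneg _)
        _ = A * (‖hcf ω (f : (Fin d → ℝ) → 𝕜) (k, a) η‖ * rt ((k, a) : Idx d) * avB d R k) := by ring
        _ ≤ _ := mul_le_mul_of_nonneg_left h2 hA0
    · rw [avB, min_eq_left (one_le_zpow₀ one_le_two (Nat.cast_nonneg k)), one_pow, mul_one]
      exact le_vol1 hR
    · rw [hg.avT_apply, cell_eq_of_mem (J := child ω (k, a) ε) (n := N) _ hx (corner_mem ω _)]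
      simp only [child]; omega
  have e : bform T (avT ω R g N) (avT ω R f (k + 1) - avT ω R f k) =
      ∑ a ∈ bx d R k, ∑ η, hcf ω (f : (Fin d → ℝ) → 𝕜) (k, a) η *
        bform T (avT ω R g N) (haarT 𝕜 ω (k, a) η) := by
    rw [hf.avT_sub_eq]
    change blin h.locInt _ _ = _
    simp only [map_sum, map_smul, smul_eq_mul]
    rfl
  rw [e]
  refine (norm_sum_le _ _).trans ((Finset.sum_le_sum fun a ha => (norm_sum_le _ _).trans
    (Finset.sum_le_sum fun η _ => hterm a ha η)).trans ?_)
  simp only [Finset.sum_const, Finset.card_univ, Fintype.card_fun, Fintype.card_bool,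
    Fintype.card_fin, nsmul_eq_mul]
  push_cast
  have h3 := card_bx_mul_le hd hR (k : ℤ)
  have h4 : min ((2 : ℝ) ^ (k : ℤ)) (2 ^ (-(k : ℤ))) ≤ 2 ^ (-(k : ℤ)) := min_le_right _ _
  calc _ = 2 ^ d * A * ((bx d R k).card * (avB d R k * haB d R k)) := by ring
    _ ≤ 2 ^ d * A * ((2 * R + 7) ^ d * vol1 d R ^ 2 * 2 ^ (-(k : ℤ))) :=
      mul_le_mul_of_nonneg_left (h3.trans (mul_le_mul_of_nonneg_left h4 (by positivity)))
        (by positivity)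
    _ = _ := by ring

/-- The form is not known to be jointly continuous, so the two arguments are approximated in turn: g
by its average with f fixed, and then f by its average with the average of g fixed. The error of the
second step is a sum of the increments of levels k ≥ N, uniformly of order 2^{-N}. -/
lemma tendsto_bform_avT_avT (hd : 0 < d) (hψ : IsModulus ψ) (h : IsCZOperator ψ K T Tt)
    (hw : ∃ C, WeakBound T C) (hf : Nice R (f : (Fin d → ℝ) → 𝕜))
    (hg : Nice R (g : (Fin d → ℝ) → 𝕜)) (ω : Grid d) :
    Tendsto (fun N : ℕ => bform T (avT ω R g N) (avT ω R f N)) atTop (𝓝 (bform T g f)) := by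
  obtain ⟨C₁, h1⟩ := tendsto_bform_avT h.locInt hg ω f
  obtain ⟨C₂, hC₂, h2⟩ := exists_bform_avT_step hd hψ h hw hf hg ω
  have hstep : ∀ N j : ℕ, ‖bform T (avT ω R g N) (avT ω R f (N + j : ℕ)) -
      bform T (avT ω R g N) (avT ω R f N)‖ ≤ C₂ * 2 * (2 ^ (-(N : ℤ)) - 2 ^ (-((N + j : ℕ) : ℤ))) := by
    intro N j
    induction j with
    | zero => simp
    | succ j ih =>
      have h3 := h2 N (N + j) (by omega)
      have e : bform T (avT ω R g N) (avT ω R f (((N + j : ℕ) : ℤ) + 1) - avT ω R f (N + j : ℕ)) =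
          bform T (avT ω R g N) (avT ω R f (N + (j + 1) : ℕ)) -
            bform T (avT ω R g N) (avT ω R f (N + j : ℕ)) := by
        change blin h.locInt _ _ = blin h.locInt _ _ - blin h.locInt _ _
        rw [map_sub]; push_cast; rw [add_assoc]
      rw [e] at h3
      have e2 : (2 : ℝ) ^ (-((N + (j + 1) : ℕ) : ℤ)) = 2 ^ (-((N + j : ℕ) : ℤ)) / 2 := by
        have e3 : -((N + (j + 1) : ℕ) : ℤ) = -((N + j : ℕ) : ℤ) - 1 := by push_cast; ring
        rw [e3, zpow_sub_one₀ two_ne_zero, div_eq_mul_inv]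
      rw [e2]
      calc _ = ‖(bform T (avT ω R g N) (avT ω R f (N + (j + 1) : ℕ)) -
            bform T (avT ω R g N) (avT ω R f (N + j : ℕ))) +
            (bform T (avT ω R g N) (avT ω R f (N + j : ℕ)) -
              bform T (avT ω R g N) (avT ω R f N))‖ := by rw [sub_add_sub_cancel]
        _ ≤ _ := (norm_add_le _ _).trans (add_le_add h3 ih)
        _ = _ := by ring
  -- With the average of g fixed, this is the first convergence lemma for the transpose.
  have hlim : ∀ N : ℕ, Tendsto (fun M : ℕ => bform T (avT ω R g N) (avT ω R f M)) atTop
      (𝓝 (bform T (avT ω R g N) f)) := by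
    intro N
    obtain ⟨C, hC⟩ := tendsto_bform_avT h.locInt_transpose hf ω (avT ω R g N)
    simp only [← h.bform_swap]
    rw [tendsto_iff_norm_sub_tendsto_zero]
    refine squeeze_zero (fun _ => norm_nonneg _) hC ?_
    simpa using tendsto_two_zpow_neg_nat.const_mul C
  have h3 : ∀ N : ℕ, ‖bform T (avT ω R g N) f - bform T (avT ω R g N) (avT ω R f N)‖ ≤
      C₂ * 2 * 2 ^ (-(N : ℤ)) := by
    intro N
    refine le_of_tendsto ((hlim N).sub_const _).norm ?_
    filter_upwards [eventually_ge_atTop N] with M hM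
    obtain ⟨j, rfl⟩ := Nat.exists_eq_add_of_le hM
    refine (hstep N j).trans (mul_le_mul_of_nonneg_left ?_ (by positivity))
    exact sub_le_self _ (by positivity)
  rw [tendsto_iff_norm_sub_tendsto_zero]
  refine squeeze_zero (g := fun N : ℕ => (C₁ + C₂ * 2) * 2 ^ (-(N : ℤ))) (fun _ => norm_nonneg _)
    (fun N => ?_) ?_
  · calc _ = ‖(bform T (avT ω R g N) f - bform T g f) - (bform T (avT ω R g N) f -
          bform T (avT ω R g N) (avT ω R f N))‖ := by congr 1; ring
      _ ≤ _ := (norm_sub_le _ _).trans (add_le_add (h1 N) (h3 N))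
      _ = _ := by ring
  · simpa using tendsto_two_zpow_neg_nat.const_mul (C₁ + C₂ * 2)

/-- At scale 2^N boundedly many cubes matter, each average is of order 2^{-Nd}, and the form on two
cubes is at most of order 2^{Nd}. What remains is 2^{-Nd}. -/
lemma tendsto_bform_avT_avT_neg (hd : 0 < d) (h : IsCZOperator ψ K T Tt)
    (hw : ∃ C, WeakBound T C) (hf : Nice R (f : (Fin d → ℝ) → 𝕜))
    (hg : Nice R (g : (Fin d → ℝ) → 𝕜)) (ω : Grid d) :
    Tendsto (fun N : ℕ => bform T (avT ω R g (-N)) (avT ω R f (-N))) atTop (𝓝 0) := by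
  have hR := hf.one_le
  have hV := vol1_pos (d := d) hR
  have h0 := (sizeBound_czZeroNorm h.size).1
  have h1 := (weakBound_wbpNorm hw).1
  have hC := (singC_pos hd).le
  set A := (1 + 4 * singC hd) * (czZeroNorm K + wbpNorm T) with hA
  have hA0 : 0 ≤ A := by positivity
  refine squeeze_zero_norm (a := fun N : ℕ => (((2 * R + 7) ^ d * vol1 d R) ^ 2 * A) *
    2 ^ (-(N : ℤ))) (fun N => ?_) (by
      simpa using tendsto_two_zpow_neg_nat.const_mul (((2 * R + 7) ^ d * vol1 d R) ^ 2 * A))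
  set x : ℝ := 2 ^ (-(N : ℤ)) with hx
  have hx0 : 0 < x := by positivity
  have hx1 : x ≤ 1 := zpow_le_one_of_nonpos₀ one_le_two (by simp)
  have hav : avB d R (-N) = vol1 d R * x ^ d := by rw [avB, min_eq_right hx1]
  have hcard : ((bx d R (-N)).card : ℝ) ≤ (2 * R + 7) ^ d := by
    refine (card_bx_le hR _).trans (le_of_eq ?_)
    rw [max_eq_left hx1, one_pow, mul_one]
  have hside : ∀ a, side ((-(N : ℤ), a) : Idx d) = x⁻¹ := fun a => by
    rw [side_eq_inv]
  have hterm : ∀ a a', ‖av ω (f : (Fin d → ℝ) → 𝕜) (-N, a) * (av ω (g : (Fin d → ℝ) → 𝕜) (-N, a') *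
      bform T (cubeT 𝕜 ω (-N, a')) (cubeT 𝕜 ω (-N, a)))‖ ≤ vol1 d R ^ 2 * A * x := by
    intro a a'
    rw [norm_mul, norm_mul]
    have h2 := hf.norm_av_le ω (-N, a)
    have h3 := hg.norm_av_le ω (-N, a')
    have h4 := norm_bform_level_le hd h hw ω (I := (-(N : ℤ), a)) (J := (-(N : ℤ), a')) rfl
    simp only [hav] at h2 h3
    rw [hside] at h4
    have hxd : 0 ≤ vol1 d R * x ^ d := by positivity
    calc _ ≤ vol1 d R * x ^ d * (vol1 d R * x ^ d * (A * x⁻¹ ^ d)) :=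
          mul_le_mul h2 (mul_le_mul h3 h4 (norm_nonneg _) hxd) (by positivity) hxd
      _ = vol1 d R ^ 2 * A * x ^ d * (x * x⁻¹) ^ d := by rw [mul_pow]; ring
      _ = vol1 d R ^ 2 * A * x ^ d := by rw [mul_inv_cancel₀ hx0.ne', one_pow, mul_one]
      _ ≤ _ := mul_le_mul_of_nonneg_left (pow_le_of_le_one hx0.le hx1 hd.ne') (by positivity)
  have e : bform T (avT ω R g (-N)) (avT ω R f (-N)) = ∑ a ∈ bx d R (-N), ∑ a' ∈ bx d R (-N),
      av ω (f : (Fin d → ℝ) → 𝕜) (-N, a) * (av ω (g : (Fin d → ℝ) → 𝕜) (-N, a') *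
        bform T (cubeT 𝕜 ω (-N, a')) (cubeT 𝕜 ω (-N, a))) := by
    change blin h.locInt _ _ = _
    rw [avT, avT]
    simp only [map_sum, map_smul, smul_eq_mul, LinearMap.sum_apply, LinearMap.smul_apply,
      Finset.mul_sum]
    rfl
  rw [e]
  refine (norm_sum_le _ _).trans ((Finset.sum_le_sum fun a _ => (norm_sum_le _ _).trans
    (Finset.sum_le_sum fun a' _ => hterm a a')).trans ?_)
  simp only [Finset.sum_const, nsmul_eq_mul]
  calc _ = ((bx d R (-N)).card : ℝ) ^ 2 * (vol1 d R ^ 2 * A * x) := by ring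
    _ ≤ ((2 * R + 7) ^ d) ^ 2 * (vol1 d R ^ 2 * A * x) :=
      mul_le_mul_of_nonneg_right (pow_le_pow_left₀ (Nat.cast_nonneg _) hcard 2) (by positivity)
    _ = _ := by ring

end

end DyadicRep

end

noncomputable section

namespace DyadicRep

variable {d : ℕ} {𝕜 : Type*} [RCLike 𝕜]

/-! ### The expansion of the bilinear form in a dyadic system -/

/-- The index set of the expansion: a cube, the type of a Haar function, and a translation. -/
abbrev QIdx (d : ℕ) : Type := (Idx d × (Fin d → Bool)) × (Fin d → ℤ)

/-- The terms of the expansion of the bilinear form, except for the paraproduct. -/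
def term (T : testSpace 𝕜 d →ₗ[𝕜] ((Fin d → ℝ) →ₘ[volume] 𝕜)) (ω : Grid d)
    (f g : (Fin d → ℝ) → 𝕜) (q : QIdx d) : 𝕜 :=
  (∑ ε, ((av ω g (tr q.1.1 q.2) + av ω g (child ω (tr q.1.1 q.2) ε)) / 2 - av ω g q.1.1) *
    bform T (cubeT 𝕜 ω (child ω (tr q.1.1 q.2) ε)) (haarT 𝕜 ω q.1.1 q.1.2)) * hcf ω f q.1.1 q.1.2

/-- The terms of the paraproduct. -/
def paraTerm (b : (Fin d → ℝ) → 𝕜) (ω : Grid d) (f g : (Fin d → ℝ) → 𝕜)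
    (p : Idx d × (Fin d → Bool)) : 𝕜 :=
  pair b (haar 𝕜 ω p.1 p.2) * av ω g p.1 * hcf ω f p.1 p.2

/-- A summable bound for the terms of the expansion, up to a constant. -/
def termB (ψ : ℝ → ℝ) (R : ℝ) (q : QIdx d) : ℝ := domB R q.1.1 * wt ψ q.2

section

variable {ψ : ℝ → ℝ} {K : (Fin d → ℝ) → (Fin d → ℝ) → 𝕜}
  {T Tt : testSpace 𝕜 d →ₗ[𝕜] ((Fin d → ℝ) →ₘ[volume] 𝕜)} {R : ℝ} {f g : (Fin d → ℝ) → 𝕜}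

lemma termB_nonneg (hψ : IsModulus ψ) (hR : 1 ≤ R) (q : QIdx d) : 0 ≤ termB ψ R q :=
  mul_nonneg (domB_nonneg hR _) (wt_pos hψ _).le

lemma summable_mul_domB (hd : 0 < d) (hR : 1 ≤ R) {w : (Fin d → ℤ) → ℝ} (hw : Summable w)
    (hw0 : ∀ m, 0 ≤ w m) : Summable fun q : QIdx d => domB R q.1.1 * w q.2 := by
  have h1 : Summable fun p : Idx d × (Fin d → Bool) => domB R p.1 := by
    have := (summable_domB hd hR).mul_of_nonneg (g := fun _ : Fin d → Bool => (1 : ℝ))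
      (Summable.of_finite) (domB_nonneg hR) fun _ => zero_le_one
    simpa using this
  exact h1.mul_of_nonneg hw (fun p => domB_nonneg hR p.1) hw0

lemma summable_termB (hd : 0 < d) (hψ : IsModulus ψ) (hR : 1 ≤ R) :
    Summable (termB (d := d) ψ R) :=
  summable_mul_domB hd hR (summable_wt hψ) fun m => (wt_pos hψ m).le

/-- The entry carries the factor |I|^{1/2}, which together with the Haar coefficient and the bound
for averages is dominated by `domB`. The coefficients c are left general because the same bound
serves the full terms and their telescoped parts. -/
lemma norm_sum_entry_mul_hcf_le (hd : 0 < d) (hψ : IsModulus ψ) (h : IsCZOperator ψ K T Tt)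
    (hw : ∃ C, WeakBound T C) (hf : Nice R f) (ω : Grid d) (I : Idx d) (η : Fin d → Bool)
    (m : Fin d → ℤ) {c : (Fin d → Bool) → 𝕜} {A : ℝ} (hA : 0 ≤ A)
    (hc : ∀ ε, ‖c ε‖ ≤ A * avB d R I.1) :
    ‖(∑ ε, c ε * bform T (cubeT 𝕜 ω (child ω (tr I m) ε)) (haarT 𝕜 ω I η)) * hcf ω f I η‖ ≤
      2 ^ d * A * kerC hd ψ K T * termB ψ R ((I, η), m) := by
  have hR := hf.one_le
  have hC := kerC_nonneg hd hψ h hw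
  have hm := (wt_pos hψ m).le
  by_cases hη : η = zeroη d
  · rw [hη, hcf_zero, mul_zero, norm_zero]
    have := termB_nonneg hψ hR ((I, zeroη d), m)
    positivity
  rw [norm_mul]
  have h1 : ‖∑ ε, c ε * bform T (cubeT 𝕜 ω (child ω (tr I m) ε)) (haarT 𝕜 ω I η)‖ ≤
      2 ^ d * (A * avB d R I.1 * (kerC hd ψ K T * rt I * wt ψ m)) := by
    refine (norm_sum_le _ _).trans ((Finset.sum_le_sum (g := fun _ => A * avB d R I.1 *
      (kerC hd ψ K T * rt I * wt ψ m)) fun ε _ => ?_).trans (le_of_eq ?_))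
    · rw [norm_mul]
      exact mul_le_mul (hc ε) (norm_entry_le_kerC hd hψ h hw ω I hη m ε) (norm_nonneg _)
        (mul_nonneg hA (avB_pos hR _).le)
    · simp only [Finset.sum_const, Finset.card_univ, Fintype.card_fun, Fintype.card_bool,
        Fintype.card_fin, nsmul_eq_mul]
      push_cast; ring
  calc _ ≤ 2 ^ d * (A * avB d R I.1 * (kerC hd ψ K T * rt I * wt ψ m)) * ‖hcf ω f I η‖ :=
        mul_le_mul_of_nonneg_right h1 (norm_nonneg _)
    _ = 2 ^ d * A * kerC hd ψ K T * wt ψ m * (‖hcf ω f I η‖ * rt I * avB d R I.1) := by ring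
    _ ≤ 2 ^ d * A * kerC hd ψ K T * wt ψ m * domB R I :=
        mul_le_mul_of_nonneg_left (hf.norm_hcf_mul_le_domB ω I η) (by positivity)
    _ = _ := by rw [termB]; ring

lemma Nice.norm_av_tr_le (hg : Nice R g) (ω : Grid d) (I : Idx d) (m : Fin d → ℤ) :
    ‖av ω g (tr I m)‖ ≤ 2 ^ d * avB d R I.1 :=
  (hg.norm_av_le ω (tr I m)).trans (le_mul_of_one_le_left (avB_pos hg.one_le _).le
    (one_le_pow₀ one_le_two))

lemma norm_term_le (hd : 0 < d) (hψ : IsModulus ψ) (h : IsCZOperator ψ K T Tt)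
    (hw : ∃ C, WeakBound T C) (hf : Nice R f) (hg : Nice R g) (ω : Grid d) (q : QIdx d) :
    ‖term T ω f g q‖ ≤ 2 ^ d * (2 * 2 ^ d) * kerC hd ψ K T * termB ψ R q := by
  refine norm_sum_entry_mul_hcf_le hd hψ h hw hf ω q.1.1 q.1.2 q.2 (by positivity) fun ε => ?_
  have h1 := hg.norm_av_tr_le ω q.1.1 q.2
  have h2 : ‖av ω g (child ω (tr q.1.1 q.2) ε)‖ ≤ 2 ^ d * avB d R q.1.1.1 :=
    hg.norm_av_child_le ω (tr q.1.1 q.2) ε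
  have h3 := hg.norm_av_tr_le ω q.1.1 0
  rw [tr_zero] at h3
  refine (norm_sub_le _ _).trans ?_
  have h4 : ‖(av ω g (tr q.1.1 q.2) + av ω g (child ω (tr q.1.1 q.2) ε)) / 2‖ ≤
      2 ^ d * avB d R q.1.1.1 := by
    rw [norm_div, RCLike.norm_ofNat, div_le_iff₀ two_pos]
    linarith [norm_add_le (av ω g (tr q.1.1 q.2)) (av ω g (child ω (tr q.1.1 q.2) ε))]
  linarith

lemma summable_norm_term (hd : 0 < d) (hψ : IsModulus ψ) (h : IsCZOperator ψ K T Tt)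
    (hw : ∃ C, WeakBound T C) (hf : Nice R f) (hg : Nice R g) (ω : Grid d) :
    Summable fun q => ‖term T ω f g q‖ :=
  ((summable_termB hd hψ hf.one_le).mul_left _).of_nonneg_of_le (fun _ => norm_nonneg _)
    (norm_term_le hd hψ h hw hf hg ω)

/-- The mean of two successive averages, as a test function. -/
def midT (ω : Grid d) (R : ℝ) (g : (Fin d → ℝ) → 𝕜) (n : ℤ) : testSpace 𝕜 d :=
  (2 : 𝕜)⁻¹ • (avT ω R g n + avT ω R g (n + 1))

lemma hasSum_bform_midT (hT : ∀ f, LocallyIntegrable (T f) volume) (hg : Nice R g) (ω : Grid d)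
    (I : Idx d) (v : testSpace 𝕜 d) :
    HasSum (fun m => ∑ ε, (av ω g (tr I m) + av ω g (child ω (tr I m) ε)) / 2 *
      bform T (cubeT 𝕜 ω (child ω (tr I m) ε)) v) (bform T (midT ω R g I.1) v) := by
  have h1 : HasSum (fun a => ∑ ε, (av ω g (I.1, a) + av ω g (child ω (I.1, a) ε)) / 2 *
      bform T (cubeT 𝕜 ω (child ω (I.1, a) ε)) v) (bform T (midT ω R g I.1) v) := by
    have e : bform T (midT ω R g I.1) v = ∑ a ∈ bx d R I.1, ∑ ε,
        (av ω g (I.1, a) + av ω g (child ω (I.1, a) ε)) / 2 *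
          bform T (cubeT 𝕜 ω (child ω (I.1, a) ε)) v := by
      rw [← blin_apply hT, midT, hg.avT_add_succ_eq]
      simp only [map_sum, map_smul, smul_eq_mul, LinearMap.sum_apply, LinearMap.smul_apply,
        Finset.mul_sum, blin_apply]
      refine Finset.sum_congr rfl fun a _ => Finset.sum_congr rfl fun ε _ => ?_
      rw [← mul_assoc, div_eq_inv_mul]
    rw [e]
    refine hasSum_sum_of_ne_finset_zero fun a ha => Finset.sum_eq_zero fun ε _ => ?_
    rw [hg.av_eq_zero ω (I := (I.1, a)) ha, hg.av_child_eq_zero ω (I := (I.1, a)) ha]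
    simp
  have h2 := (Equiv.addLeft I.2).hasSum_iff.2 h1
  simp only [Function.comp_def, Equiv.coe_addLeft] at h2
  simp only [tr]
  exact h2

/-- The subtracted constant ⟨g⟩_I multiplies the sum of all entries of h_I, which is ⟨T*1, h_I⟩. The
paraproduct arises in this way. -/
lemma hasSum_term (hd : 0 < d) (hψ : IsModulus ψ) (h : IsCZOperator ψ K T Tt)
    {b : (Fin d → ℝ) → 𝕜} (hb : IsImageOfOne T b) (hg : Nice R g) (ω : Grid d)
    (p : Idx d × (Fin d → Bool)) :
    HasSum (fun m => term T ω f g (p, m)) (hcf ω f p.1 p.2 *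
      bform T (midT ω R g p.1.1) (haarT 𝕜 ω p.1 p.2) - paraTerm b ω f g p) := by
  obtain ⟨I, η⟩ := p
  by_cases hη : η = zeroη d
  · simp only [term, paraTerm, hη, hcf_zero, mul_zero, zero_mul, sub_zero]
    exact hasSum_zero
  have h1 := hasSum_bform_midT h.locInt hg ω I (haarT 𝕜 ω I η)
  have h2 := (hasSum_entry hd hψ h hb ω I hη).mul_left (av ω g I)
  have h3 := (h1.sub h2).mul_right (hcf ω f I η)
  have e : hcf ω f I η * bform T (midT ω R g I.1) (haarT 𝕜 ω I η) - paraTerm b ω f g (I, η) =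
      (bform T (midT ω R g I.1) (haarT 𝕜 ω I η) - av ω g I * pair b (haar 𝕜 ω I η)) *
        hcf ω f I η := by simp only [paraTerm]; ring
  rw [e]
  refine h3.congr_fun fun m => ?_
  simp only [term, sub_mul, Finset.sum_sub_distrib]
  rw [bform_cubeT_eq_sum h.locInt, Finset.mul_sum]

lemma hasSum_level (hd : 0 < d) (hψ : IsModulus ψ) (h : IsCZOperator ψ K T Tt)
    (hw : ∃ C, WeakBound T C) {b : (Fin d → ℝ) → 𝕜} (hb : IsImageOfOne T b)
    (hf : Nice R f) (hg : Nice R g) (ω : Grid d) (hp : Summable (paraTerm b ω f g)) :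
    HasSum (fun n : ℤ => bform T (midT ω R g n) (avT ω R f (n + 1) - avT ω R f n))
      (∑' q, term T ω f g q + ∑' p, paraTerm b ω f g p) := by
  have h1 := (summable_norm_term hd hψ h hw hf hg ω).of_norm.hasSum.prod_fiberwise
    (hasSum_term hd hψ h hb hg ω)
  have h2 : HasSum (fun p : Idx d × (Fin d → Bool) => hcf ω f p.1 p.2 *
      bform T (midT ω R g p.1.1) (haarT 𝕜 ω p.1 p.2))
      (∑' q, term T ω f g q + ∑' p, paraTerm b ω f g p) := by
    refine (h1.add hp.hasSum).congr_fun ?_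
    intro p; ring
  have h3 := (Equiv.prodAssoc ℤ (Fin d → ℤ) (Fin d → Bool)).symm.hasSum_iff.2 h2
  refine h3.prod_fiberwise fun n => ?_
  have e : bform T (midT ω R g n) (avT ω R f (n + 1) - avT ω R f n) =
      ∑ x ∈ bx d R n ×ˢ Finset.univ, hcf ω f (n, x.1) x.2 *
        bform T (midT ω R g n) (haarT 𝕜 ω (n, x.1) x.2) := by
    rw [hf.avT_sub_eq, Finset.sum_product, ← blin_apply h.locInt]
    simp only [map_sum, map_smul, smul_eq_mul, blin_apply]
  rw [e]
  refine hasSum_sum_of_ne_finset_zero fun x hx => ?_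
  have hx' : x.1 ∉ bx d R n := fun h' => hx (Finset.mem_product.2 ⟨h', Finset.mem_univ _⟩)
  change hcf ω f (n, x.1) x.2 * _ = 0
  rw [hf.hcf_eq_zero ω (I := (n, x.1)) hx', zero_mul]

end

lemma hasSum_int_telescope {E : Type*} [AddCommGroup E] [TopologicalSpace E] [IsTopologicalAddGroup E]
    [T2Space E] {u : ℤ → E} {S a b : E} (h : HasSum (fun n : ℤ => u (n + 1) - u n) S)
    (ha : Tendsto (fun N : ℕ => u (-N)) atTop (𝓝 a)) (hb : Tendsto (fun N : ℕ => u N) atTop (𝓝 b)) :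
    S = b - a := by
  have key : ∀ N : ℕ, ∑ n ∈ Finset.Ico (-N : ℤ) N, (u (n + 1) - u n) = u N - u (-N) := by
    intro N
    induction N with
    | zero => simp
    | succ N ih =>
      have e : Finset.Ico (-(N + 1 : ℕ) : ℤ) (N + 1 : ℕ) =
          insert (N : ℤ) (insert (-(N : ℤ) - 1) (Finset.Ico (-N : ℤ) N)) := by
        ext x; simp only [Finset.mem_Ico, Finset.mem_insert]; push_cast; omega
      rw [e, Finset.sum_insert, Finset.sum_insert, ih, sub_add_cancel]
      · push_cast
        rw [neg_add, ← sub_eq_add_neg]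
        abel
      · simp
      · simp only [Finset.mem_insert, Finset.mem_Ico]; omega
  have hI : Tendsto (fun N : ℕ => Finset.Ico (-N : ℤ) N) atTop atTop := by
    refine tendsto_atTop_finset_of_monotone (fun m n hmn x hx => ?_) fun x => ⟨x.natAbs + 1, ?_⟩
    · simp only [Finset.mem_Ico] at hx ⊢; omega
    · simp only [Finset.mem_Ico]; omega
  have h1 := Tendsto.comp h hI
  refine tendsto_nhds_unique h1 ?_
  simp only [Function.comp_def, key]
  exact hb.sub ha

/-- Telescoping of the forms of the averages, with each increment written symmetrically by means of
the mean of two successive averages. By this symmetry the second half is the first one for the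
transpose, with f and g exchanged. -/
theorem bform_eq {ψ : ℝ → ℝ} {K : (Fin d → ℝ) → (Fin d → ℝ) → 𝕜}
    {T Tt : testSpace 𝕜 d →ₗ[𝕜] ((Fin d → ℝ) →ₘ[volume] 𝕜)} {R : ℝ} {f g : testSpace 𝕜 d}
    (hd : 0 < d) (hψ : IsModulus ψ) (h : IsCZOperator ψ K T Tt)
    (hw : ∃ C, WeakBound T C) {b₁ b₂ : (Fin d → ℝ) → 𝕜} (hb₁ : IsImageOfOne Tt b₁)
    (hb₂ : IsImageOfOne T b₂)
    (hf : Nice R (f : (Fin d → ℝ) → 𝕜)) (hg : Nice R (g : (Fin d → ℝ) → 𝕜)) (ω : Grid d)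
    (hp₁ : Summable (paraTerm b₁ ω (g : (Fin d → ℝ) → 𝕜) f))
    (hp₂ : Summable (paraTerm b₂ ω (f : (Fin d → ℝ) → 𝕜) g)) :
    bform T g f = (∑' q, term T ω f g q + ∑' p, paraTerm b₂ ω (f : (Fin d → ℝ) → 𝕜) g p) +
      (∑' q, term Tt ω g f q + ∑' p, paraTerm b₁ ω (g : (Fin d → ℝ) → 𝕜) f p) := by
  have h1 := hasSum_level hd hψ h hw hb₂ hf hg ω hp₂
  obtain ⟨C, hC⟩ := hw
  have h2 := hasSum_level hd hψ (h.swap hψ) ⟨C, weakBound_swap h hC⟩ hb₁ hg hf ω hp₁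
  have h3 := hasSum_int_telescope (u := fun n => bform T (avT ω R g n) (avT ω R f n)) (S := _)
    ((h1.add h2).congr_fun ?_) (tendsto_bform_avT_avT_neg hd h ⟨C, hC⟩ hf hg ω)
    (tendsto_bform_avT_avT hd hψ h ⟨C, hC⟩ hf hg ω)
  · rw [h3, sub_zero]
  · intro n
    rw [h.bform_swap, midT, midT]
    simp only [← blin_apply h.locInt]
    simp only [map_add, map_sub, map_smul, LinearMap.add_apply, LinearMap.sub_apply,
      LinearMap.smul_apply, smul_eq_mul]
    ring

end DyadicRep

end

noncomputable section

namespace DyadicRep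

variable {d : ℕ} {𝕜 : Type*} [RCLike 𝕜]

/-! ### The random dyadic system -/

instance : IsProbabilityMeasure (gridMeasure d) := by unfold gridMeasure; infer_instance

lemma map_uniformOfFintype {α : Type*} [Fintype α] [Nonempty α] [MeasurableSpace α]
    [MeasurableSingletonClass α] (e : α ≃ α) :
    ((PMF.uniformOfFintype α).toMeasure).map e = (PMF.uniformOfFintype α).toMeasure := by
  rw [PMF.toMeasure_map e _ (measurable_of_finite e)]
  congr 1
  ext b
  rw [PMF.map_apply, tsum_eq_single (e.symm b)]
  · simp
  · intro a ha
    rw [if_neg]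
    rintro rfl
    exact ha (e.symm_apply_apply a).symm

/-- The bits of `v` flip the bits of another element of `{0,1}^d`. -/
def flipEquiv (v : Fin d → Bool) : (Fin d → Bool) ≃ (Fin d → Bool) where
  toFun w n := xor (w n) (v n)
  invFun w n := xor (w n) (v n)
  left_inv w := by funext n; simp
  right_inv w := by funext n; simp

/-- The system with the digit number `j` flipped by `v`. -/
def flipDigit (j : ℤ) (v : Fin d → Bool) (ω : Grid d) : Grid d :=
  Function.update ω j (flipEquiv v (ω j))

lemma flipDigit_eq (j : ℤ) (v : Fin d → Bool) : (flipDigit j v : Grid d → Grid d) =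
    fun ω i => (if i = j then flipEquiv v else Equiv.refl _) (ω i) := by
  funext ω i
  unfold flipDigit
  by_cases h : i = j
  · subst h; simp
  · simp [h]

lemma measurable_flipDigit (j : ℤ) (v : Fin d → Bool) :
    Measurable (flipDigit j v : Grid d → Grid d) := by
  rw [flipDigit_eq]
  exact measurable_pi_lambda _ fun i => (measurable_of_finite _).comp (measurable_pi_apply i)

lemma map_flipDigit (j : ℤ) (v : Fin d → Bool) :
    (gridMeasure d).map (flipDigit j v) = gridMeasure d := by
  rw [flipDigit_eq, gridMeasure,
    Measure.infinitePi_map_pi _ (f := fun i => ⇑(if i = j then flipEquiv v else Equiv.refl _))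
      fun i => measurable_of_finite _]
  congr 1
  funext i
  exact map_uniformOfFintype _

lemma integral_flipDigit (j : ℤ) (v : Fin d → Bool) {F : Grid d → 𝕜} (hF : Measurable F) :
    ∫ ω, F (flipDigit j v ω) ∂(gridMeasure d) = ∫ ω, F ω ∂(gridMeasure d) := by
  conv_rhs => rw [← map_flipDigit j v]
  rw [integral_map (measurable_flipDigit j v).aemeasurable hF.aestronglyMeasurable]

lemma sum_flipDigit {E : Type*} [AddCommMonoid E] (j : ℤ) (ω : Grid d) (F : Grid d → E) :
    ∑ v, F (flipDigit j v ω) = ∑ v, F (Function.update ω j v) := by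
  have e : ∀ v, flipDigit j v ω = Function.update ω j (flipEquiv (ω j) v) := fun v => by
    unfold flipDigit
    congr 1
    funext n
    exact Bool.xor_comm _ _
  simp_rw [e]
  exact (flipEquiv (ω j)).sum_comp fun v => F (Function.update ω j v)

/-- The common dyadic ancestor of two cubes is as close as possible to their distance. -/
def good (I : Idx d) (m : Fin d → ℤ) (ω : Grid d) : Prop :=
  anc ω (lev m) I = anc ω (lev m) (tr I m)

/-- The number of the digit that decides whether a pair of cubes is good. -/
def digit (I : Idx d) (m : Fin d → ℤ) : ℤ := I.1 - lev m + 1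

instance (I : Idx d) (m : Fin d → ℤ) (ω : Grid d) : Decidable (good I m ω) := by
  unfold good; infer_instance

/-- The number of the values of the decisive digit that make a pair of cubes good. -/
def goodCount (I : Idx d) (m : Fin d → ℤ) (ω : Grid d) : ℕ :=
  (Finset.univ.filter fun v => good I m (Function.update ω (digit I m) v)).card

/-- The weight that compensates for the restriction to good pairs. -/
def weight (I : Idx d) (m : Fin d → ℤ) (ω : Grid d) : ℝ :=
  if good I m ω then 2 ^ d / goodCount I m ω else 0

lemma good_zero (I : Idx d) (ω : Grid d) : good I 0 ω := by rw [good, tr_zero]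

lemma weight_of_not_good {I : Idx d} {m : Fin d → ℤ} {ω : Grid d} (h : ¬ good I m ω) :
    weight I m ω = 0 := if_neg h

lemma weight_zero (I : Idx d) (ω : Grid d) : weight I 0 ω = 1 := by
  have : goodCount I 0 ω = 2 ^ d := by
    simp [goodCount, good_zero]
  rw [weight, if_pos (good_zero I ω), this]
  push_cast
  exact div_self (by positivity)

lemma weight_nonneg (I : Idx d) (m : Fin d → ℤ) (ω : Grid d) : 0 ≤ weight I m ω := by
  unfold weight; split_ifs <;> positivity

lemma weight_le (I : Idx d) (m : Fin d → ℤ) (ω : Grid d) : weight I m ω ≤ 2 ^ d := by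
  unfold weight
  split_ifs with h
  · have : 0 < goodCount I m ω := by
      refine Finset.card_pos.2 ⟨ω (digit I m), Finset.mem_filter.2 ⟨Finset.mem_univ _, ?_⟩⟩
      rwa [Function.update_eq_self]
    refine div_le_self (by positivity) ?_
    exact_mod_cast this
  · positivity

lemma goodCount_update (I : Idx d) (m : Fin d → ℤ) (ω : Grid d) (v : Fin d → Bool) :
    goodCount I m (Function.update ω (digit I m) v) = goodCount I m ω := by
  simp only [goodCount, Function.update_idem]

lemma anc_congr {ω ω' : Grid d} {i : ℕ} {I : Idx d} (h : ∀ j, I.1 - i < j → ω j = ω' j) :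
    anc ω i I = anc ω' i I := by
  induction i with
  | zero => rfl
  | succ i ih =>
    have h1 := ih fun j hj => h j (by push_cast; omega)
    rw [anc, anc, h1, par, par, h]
    rw [anc_fst]; push_cast; omega

/-- Each passage to the parent halves the difference of the positions up to rounding, whatever the
digits are. -/
lemma anc_snd_sub_le (ω : Grid d) (I : Idx d) (m : Fin d → ℤ) {i s : ℕ} (n : Fin d)
    (hm : (m n).natAbs ≤ 2 ^ (i + s)) :
    ((anc ω i (tr I m)).2 n - (anc ω i I).2 n).natAbs ≤ 2 ^ s := by
  induction i generalizing s with
  | zero => simpa [anc, tr] using hm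
  | succ i ih =>
    have h1 := ih (s := s + 1) (by rwa [← Nat.add_right_comm, Nat.add_assoc] at hm)
    simp only [anc, par, anc_fst, tr]
    simp only [tr] at h1
    rw [pow_succ] at h1
    omega

/-- Since |m| < 2^{k-1} for k = `lev m` and m ≠ 0, the ancestors after k - 1 generations differ by
at most one in every coordinate. The next digit decides, coordinate by coordinate, which neighbours
are joined in a parent. -/
lemma goodCount_pos (I : Idx d) (m : Fin d → ℤ) (ω : Grid d) : 0 < goodCount I m ω := by
  by_cases hm : m = 0
  · subst hm
    exact Finset.card_pos.2 ⟨fun _ => false, Finset.mem_filter.2 ⟨Finset.mem_univ _, good_zero _ _⟩⟩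
  set k := lev m - 1 with hk
  have hl := two_le_lev hm
  have hlk : lev m = k + 1 := by omega
  set a := (anc ω k I).2 with ha
  set b := (anc ω k (tr I m)).2 with hb
  have hab : ∀ n, (b n - a n).natAbs ≤ 1 := fun n =>
    anc_snd_sub_le (s := 0) ω I m n (natAbs_lt_two_pow_lev hm n).le
  -- The parity of the smaller position: subtracting it makes that position even, so an equal or
  -- consecutive position has the same half, rounded down.
  refine Finset.card_pos.2 ⟨fun n => decide (min (a n) (b n) % 2 = 1),
    Finset.mem_filter.2 ⟨Finset.mem_univ _, ?_⟩⟩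
  set v : Fin d → Bool := fun n => decide (min (a n) (b n) % 2 = 1) with hv
  set ω' := Function.update ω (digit I m) v with hω'
  have hdig : digit I m = I.1 - k := by rw [digit, hlk]; push_cast; ring
  have h1 : anc ω' k I = anc ω k I := anc_congr fun j hj => by
    rw [hω', Function.update_of_ne]; omega
  have h2 : anc ω' k (tr I m) = anc ω k (tr I m) := anc_congr fun j hj => by
    rw [hω', Function.update_of_ne]
    have : (tr I m).1 = I.1 := rfl
    omega
  rw [good, hlk, anc, anc, h1, h2, par, par, anc_fst, anc_fst]
  refine Prod.ext rfl (funext fun n => ?_)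
  have e : ω' (I.1 - k) = v := by rw [hω', hdig, Function.update_self]
  change (a n - bit (ω' (I.1 - k) n)) / 2 = (b n - bit (ω' (I.1 - k) n)) / 2
  rw [e]
  have h3 := hab n
  have h4 : bit (v n) = min (a n) (b n) % 2 := by
    simp only [hv, bit]
    rcases Int.emod_two_eq_zero_or_one (min (a n) (b n)) with h | h <;> simp [h]
  rw [h4]
  omega

/-- The count of good values does not depend on the decisive digit. Exactly that many summands are
nonzero, and each is 2^d divided by the count. -/
lemma sum_weight_update (I : Idx d) (m : Fin d → ℤ) (ω : Grid d) :
    ∑ v, weight I m (Function.update ω (digit I m) v) = 2 ^ d := by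
  have h := goodCount_pos I m ω
  simp only [weight, goodCount_update]
  rw [← Finset.sum_filter, Finset.sum_const, nsmul_eq_mul]
  change (goodCount I m ω : ℝ) * _ = _
  field_simp

lemma measurable_weight (I : Idx d) (m : Fin d → ℤ) : Measurable (weight I m) := by
  classical
  have h1 : MeasurableSet {ω | good I m ω} :=
    measurableSet_eq_fun (measurable_anc _ _) (measurable_anc _ _)
  have h2 : ∀ v, MeasurableSet {ω | good I m (Function.update ω (digit I m) v)} := fun v =>
    (measurable_pi_lambda _ fun i => by
      by_cases h : i = digit I m
      · subst h; simp
      · simpa [Function.update_of_ne h] using measurable_pi_apply i :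
      Measurable fun ω : Grid d => Function.update ω (digit I m) v) h1
  have h3 : (goodCount I m : Grid d → ℕ) =
      fun ω => ∑ v, if good I m (Function.update ω (digit I m) v) then 1 else 0 := by
    funext ω
    rw [goodCount, Finset.card_filter]
  have h4 : Measurable (goodCount I m : Grid d → ℕ) := by
    rw [h3]
    exact Finset.measurable_sum _ fun v _ => Measurable.ite (h2 v) measurable_const measurable_const
  exact Measurable.ite h1 (measurable_const.div ((measurable_of_countable _).comp h4)) measurable_const

/-- The weight of a pair of cubes has mean one, independently of the finer digits. -/
lemma integral_weight_mul (I : Idx d) (m : Fin d → ℤ) {F : Grid d → 𝕜} (hF : Measurable F) {C : ℝ}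
    (hC : ∀ ω, ‖F ω‖ ≤ C) (hinv : ∀ ω v, F (Function.update ω (digit I m) v) = F ω) :
    ∫ ω, (weight I m ω : 𝕜) * F ω ∂(gridMeasure d) = ∫ ω, F ω ∂(gridMeasure d) := by
  set G : Grid d → 𝕜 := fun ω => (weight I m ω : 𝕜) * F ω with hG
  have hm : Measurable G := (RCLike.measurable_ofReal.comp (measurable_weight I m)).mul hF
  have hi : Integrable G (gridMeasure d) := by
    refine Integrable.of_bound hm.aestronglyMeasurable (2 ^ d * C) (Eventually.of_forall fun ω => ?_)
    rw [hG, norm_mul, RCLike.norm_ofReal, abs_of_nonneg (weight_nonneg _ _ _)]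
    exact mul_le_mul (weight_le _ _ _) (hC ω) (norm_nonneg _) (by positivity)
  -- The measure is invariant under flipping one digit, so the integral may be averaged over all 2^d
  -- flips of the decisive digit. Pointwise, this average of the weight is one.
  have h1 : (2 : 𝕜) ^ d * ∫ ω, G ω ∂(gridMeasure d) =
      ∑ v, ∫ ω, G (flipDigit (digit I m) v ω) ∂(gridMeasure d) := by
    rw [Finset.sum_congr rfl fun v _ => integral_flipDigit (digit I m) v hm, Finset.sum_const,
      nsmul_eq_mul, Finset.card_univ, Fintype.card_fun, Fintype.card_bool, Fintype.card_fin]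
    push_cast; rfl
  have hi' : ∀ v, Integrable (fun ω => G (flipDigit (digit I m) v ω)) (gridMeasure d) := fun v =>
    Integrable.comp_measurable (g := G) (by rwa [map_flipDigit]) (measurable_flipDigit _ v)
  rw [← integral_finsetSum _ fun v _ => hi' v] at h1
  have h2 : ∀ ω, ∑ v, G (flipDigit (digit I m) v ω) =
      (2 : 𝕜) ^ d * F ω := fun ω => by
    rw [sum_flipDigit]
    simp only [hG, hinv]
    rw [← Finset.sum_mul, ← RCLike.ofReal_sum, sum_weight_update]
    push_cast; rfl
  simp only [h2, integral_const_mul] at h1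
  exact mul_left_cancel₀ (pow_ne_zero d two_ne_zero) h1

end DyadicRep

end

noncomputable section

namespace DyadicRep

variable {d : ℕ} {𝕜 : Type*} [RCLike 𝕜]

/-! ### Dependence of the expansion on the dyadic system -/

/-- The indicator of a moving cube converges off the boundary, a null set, so dominated convergence
applies. This gives measurability in ω of everything built from integrals over the cubes. -/
lemma continuous_setIntegral_cube {u : (Fin d → ℝ) → 𝕜} (hu : LocallyIntegrable u volume) {l : ℝ}
    : Continuous fun s : Fin d → ℝ => ∫ x in cube s l, u x := by
  simp_rw [← integral_indicator (measurableSet_cube _ l)]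
  refine continuous_iff_continuousAt.2 fun s₀ => ?_
  set B := Icc (fun n => s₀ n - 1) (fun n => s₀ n + l + 1) with hB
  have hi : IntegrableOn u B := hu.integrableOn_isCompact isCompact_Icc
  refine continuousAt_of_dominated (bound := B.indicator fun x => ‖u x‖)
    (Eventually.of_forall fun s => hu.aestronglyMeasurable.indicator (measurableSet_cube s l)) ?_
    ((integrable_indicator_iff measurableSet_Icc).2 hi.norm) ?_
  · filter_upwards [Metric.ball_mem_nhds s₀ one_pos] with s hs
    refine Eventually.of_forall fun x => ?_
    by_cases hx : x ∈ cube s l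
    · have hxB : x ∈ B := by
        have h1 : ∀ n, |s n - s₀ n| ≤ 1 := fun n => by
          have := norm_le_pi_norm (s - s₀) n
          rw [Metric.mem_ball, dist_eq_norm] at hs
          exact this.trans hs.le
        constructor
        · intro n
          have := abs_le.1 (h1 n)
          have h2 : x n ∈ Ico _ _ := hx n trivial
          rw [mem_Ico] at h2
          change s₀ n - 1 ≤ x n
          linarith
        · intro n
          have := abs_le.1 (h1 n)
          have h2 : x n ∈ Ico _ _ := hx n trivial
          rw [mem_Ico] at h2
          change x n ≤ s₀ n + l + 1
          linarith
      rw [indicator_of_mem hx, indicator_of_mem hxB]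
    · rw [indicator_of_notMem hx, norm_zero]
      exact indicator_nonneg (fun _ _ => norm_nonneg _) x
  · have h1 : ∀ᵐ x : Fin d → ℝ, ∀ n, x n ≠ s₀ n ∧ x n ≠ s₀ n + l := by
      rw [ae_all_iff]
      intro n
      filter_upwards [Measure.ae_eval_ne (fun _ : Fin d => (volume : Measure ℝ)) n (s₀ n),
        Measure.ae_eval_ne (fun _ : Fin d => (volume : Measure ℝ)) n (s₀ n + l)] with x h1 h2
      exact ⟨h1, h2⟩
    filter_upwards [h1] with x hx
    have key : ∀ᶠ s in 𝓝 s₀, (x ∈ cube s l ↔ x ∈ cube s₀ l) := by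
      have h2 : ∀ n, ∀ᶠ s in 𝓝 s₀, (x n ∈ Ico (s n) (s n + l) ↔ x n ∈ Ico (s₀ n) (s₀ n + l)) := by
        intro n
        have hc : Tendsto (fun s : Fin d → ℝ => s n) (𝓝 s₀) (𝓝 (s₀ n)) :=
          (continuous_apply n).continuousAt
        obtain ⟨h3, h4⟩ := hx n
        simp only [mem_Ico]
        rcases lt_or_gt_of_ne h3 with h5 | h5
        · filter_upwards [hc.eventually (lt_mem_nhds h5)] with s hs
          constructor <;> intro h <;> linarith [h.1]
        · rcases lt_or_gt_of_ne h4 with h6 | h6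
          · filter_upwards [hc.eventually (gt_mem_nhds h5),
              (hc.add_const l).eventually (lt_mem_nhds h6)] with s hs hs'
            exact ⟨fun _ => ⟨h5.le, h6⟩, fun _ => ⟨hs.le, hs'⟩⟩
          · filter_upwards [(hc.add_const l).eventually (gt_mem_nhds h6)] with s hs
            constructor <;> intro h <;> linarith [h.2]
      filter_upwards [eventually_all.2 h2] with s hs
      simp only [cube, mem_univ_pi]
      exact forall_congr' hs
    refine (continuousAt_const (y := (cube s₀ l).indicator u x)).congr ?_
    filter_upwards [key] with s hs
    by_cases hxs : x ∈ cube s₀ l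
    · rw [indicator_of_mem hxs, indicator_of_mem (hs.2 hxs)]
    · rw [indicator_of_notMem hxs, indicator_of_notMem fun h' => hxs (hs.1 h')]

lemma cubeInd_congr {a a' : Fin d → ℝ} {l l' : ℝ} (ha : a = a') (hl : l = l') (h : 0 < l)
    (h' : 0 < l') : cubeInd 𝕜 a h = cubeInd 𝕜 a' h' := by
  subst ha; subst hl; rfl

lemma child_congr {ω ω' : Grid d} {I : Idx d} (h : ∀ j, I.1 < j → ω j = ω' j) (ε : Fin d → Bool) :
    child ω I ε = child ω' I ε := by
  simp only [child, h (I.1 + 1) (by omega)]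

lemma dcube_congr {ω ω' : Grid d} {I : Idx d} (h : ∀ j, I.1 < j → ω j = ω' j) :
    dcube ω I = dcube ω' I := by
  rw [dcube, dcube, corner_congr h]

lemma av_congr {ω ω' : Grid d} {I : Idx d} (h : ∀ j, I.1 < j → ω j = ω' j) (f : (Fin d → ℝ) → 𝕜) :
    av ω f I = av ω' f I := by
  rw [av, av, dcube_congr h]

lemma cubeT_congr {ω ω' : Grid d} {I : Idx d} (h : ∀ j, I.1 < j → ω j = ω' j) :
    cubeT 𝕜 ω I = cubeT 𝕜 ω' I := cubeInd_congr (corner_congr h) rfl _ _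

lemma cubeT_child_congr {ω ω' : Grid d} {I : Idx d} (h : ∀ j, I.1 < j → ω j = ω' j)
    (ε : Fin d → Bool) : cubeT 𝕜 ω (child ω I ε) = cubeT 𝕜 ω' (child ω' I ε) := by
  rw [← child_congr h]
  refine cubeT_congr fun j hj => h j ?_
  simp only [child] at hj; omega

lemma av_child_congr {ω ω' : Grid d} {I : Idx d} (h : ∀ j, I.1 < j → ω j = ω' j)
    (f : (Fin d → ℝ) → 𝕜) (ε : Fin d → Bool) :
    av ω f (child ω I ε) = av ω' f (child ω' I ε) := by
  rw [← child_congr h]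
  refine av_congr (fun j hj => h j ?_) f
  simp only [child] at hj; omega

lemma hcf_congr {ω ω' : Grid d} {I : Idx d} (h : ∀ j, I.1 < j → ω j = ω' j)
    (f : (Fin d → ℝ) → 𝕜) (η : Fin d → Bool) : hcf ω f I η = hcf ω' f I η := by
  have : haar 𝕜 ω I η = haar 𝕜 ω' I η := by
    funext x
    rw [haar, haar, corner_congr h]
  rw [hcf, hcf, this]

/-- All cubes in the term are of the level of I or children of such cubes, so coarser digits do not
enter. The goodness of the pair, in contrast, is decided by coarser digits. -/
lemma term_congr (T : testSpace 𝕜 d →ₗ[𝕜] ((Fin d → ℝ) →ₘ[volume] 𝕜)) {ω ω' : Grid d}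
    {q : QIdx d} (h : ∀ j, q.1.1.1 < j → ω j = ω' j) (f g : (Fin d → ℝ) → 𝕜) :
    term T ω f g q = term T ω' f g q := by
  have h' : ∀ j, (tr q.1.1 q.2).1 < j → ω j = ω' j := h
  simp only [term, haarT, hcf_congr h, av_congr h, av_congr h', av_child_congr h',
    cubeT_child_congr h, cubeT_child_congr h']

lemma measurable_corner_child (I : Idx d) (ε : Fin d → Bool) :
    Measurable fun ω : Grid d => corner ω (child ω I ε) := by
  refine measurable_pi_lambda _ fun n => ?_
  simp only [corner_child]
  exact ((measurable_pi_apply n).comp (measurable_corner I)).add_const _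

lemma measurable_setIntegral_dcube {u : (Fin d → ℝ) → 𝕜} (hu : LocallyIntegrable u volume)
    (I : Idx d) : Measurable fun ω : Grid d => ∫ x in dcube ω I, u x :=
  (continuous_setIntegral_cube hu).measurable.comp (measurable_corner I)

lemma measurable_setIntegral_child {u : (Fin d → ℝ) → 𝕜} (hu : LocallyIntegrable u volume)
    (I : Idx d) (ε : Fin d → Bool) :
    Measurable fun ω : Grid d => ∫ x in dcube ω (child ω I ε), u x := by
  simp only [dcube, side_child]
  exact (continuous_setIntegral_cube hu).measurable.comp
    (measurable_corner_child I ε)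

lemma measurable_av {u : (Fin d → ℝ) → 𝕜} (hu : LocallyIntegrable u volume)
    (I : Idx d) : Measurable fun ω : Grid d => av ω u I := by
  simp only [av_eq]
  exact (measurable_setIntegral_dcube hu I).const_mul _

lemma measurable_av_child {u : (Fin d → ℝ) → 𝕜} (hu : LocallyIntegrable u volume)
    (I : Idx d) (ε : Fin d → Bool) : Measurable fun ω : Grid d => av ω u (child ω I ε) := by
  simp only [av_eq, side_child]
  exact (measurable_setIntegral_child hu I ε).const_mul _

lemma measurable_pair_haar {u : (Fin d → ℝ) → 𝕜} (hu : LocallyIntegrable u volume)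
    (I : Idx d) (η : Fin d → Bool) : Measurable fun ω : Grid d => pair u (haar 𝕜 ω I η) := by
  simp only [fun ω => pair_haar_eq ω I η (integrableOn_cube hu (corner ω I) (side I))]
  exact (Finset.measurable_sum _ fun ε _ =>
    (measurable_setIntegral_child hu I ε).const_mul _).const_mul _

lemma measurable_hcf {u : (Fin d → ℝ) → 𝕜} (hu : LocallyIntegrable u volume)
    (I : Idx d) (η : Fin d → Bool) : Measurable fun ω : Grid d => hcf ω u I η := by
  unfold hcf
  split_ifs
  · exact measurable_const
  · exact measurable_pair_haar hu I η

/-! ### Measurability of the terms and domination of the paraproduct. -/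

section

variable {ψ : ℝ → ℝ} {K : (Fin d → ℝ) → (Fin d → ℝ) → 𝕜}
  {T Tt : testSpace 𝕜 d →ₗ[𝕜] ((Fin d → ℝ) →ₘ[volume] 𝕜)} {R : ℝ} {f g b : (Fin d → ℝ) → 𝕜}

lemma bform_cubeInd (T : testSpace 𝕜 d →ₗ[𝕜] ((Fin d → ℝ) →ₘ[volume] 𝕜)) (a : Fin d → ℝ) {l : ℝ}
    (hl : 0 < l) (v : testSpace 𝕜 d) : bform T (cubeInd 𝕜 a hl) v = ∫ x in cube a l, T v x := by
  rw [bform, pair, ← integral_indicator (measurableSet_cube a l)]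
  refine integral_congr_ae (Eventually.of_forall fun x => ?_)
  change (cube a l).indicator (1 : (Fin d → ℝ) → 𝕜) x * _ = _
  by_cases hx : x ∈ cube a l <;> simp [hx]

/-- The form is continuous in each corner separately, in the second one by transposition, and
separate continuity implies joint measurability. -/
lemma measurable_bform_cubeInd (h : IsCZOperator ψ K T Tt) {l l' : ℝ} (hl : 0 < l) (hl' : 0 < l') :
    Measurable fun p : (Fin d → ℝ) × (Fin d → ℝ) =>
      bform T (cubeInd 𝕜 p.1 hl) (cubeInd 𝕜 p.2 hl') := by
  have h1 : ∀ v, Continuous fun s => bform T (cubeInd 𝕜 s hl) v := fun v => by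
    simp only [bform_cubeInd]
    exact continuous_setIntegral_cube (h.locInt v)
  have h2 : ∀ u, Continuous fun s => bform T u (cubeInd 𝕜 s hl') := fun u => by
    simp only [← h.bform_swap, bform_cubeInd]
    exact continuous_setIntegral_cube (h.locInt_transpose u)
  exact measurable_uncurry_of_continuous_of_measurable
    (u := fun s s' => bform T (cubeInd 𝕜 s hl) (cubeInd 𝕜 s' hl')) (fun s' => h1 _)
    fun s => (h2 _).measurable

lemma measurable_bform_child (h : IsCZOperator ψ K T Tt) (I J : Idx d) (ε ε' : Fin d → Bool) :
    Measurable fun ω : Grid d =>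
      bform T (cubeT 𝕜 ω (child ω J ε)) (cubeT 𝕜 ω (child ω I ε')) := by
  have e : ∀ (ω : Grid d) (I : Idx d) ε, cubeT 𝕜 ω (child ω I ε) =
      cubeInd 𝕜 (corner ω (child ω I ε)) (half_pos (side_pos I)) := fun ω I ε =>
    cubeInd_congr rfl (side_child ω I ε) _ _
  simp only [e]
  exact (measurable_bform_cubeInd h (half_pos (side_pos J)) (half_pos (side_pos I))).comp
    ((measurable_corner_child J ε).prodMk (measurable_corner_child I ε'))

lemma measurable_entry (h : IsCZOperator ψ K T Tt) (I J : Idx d) (ε η : Fin d → Bool) :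
    Measurable fun ω : Grid d => bform T (cubeT 𝕜 ω (child ω J ε)) (haarT 𝕜 ω I η) := by
  have e : ∀ ω : Grid d, bform T (cubeT 𝕜 ω (child ω J ε)) (haarT 𝕜 ω I η) = ∑ ε',
      ((sg η ε' * (rt I)⁻¹ : ℝ) : 𝕜) *
        bform T (cubeT 𝕜 ω (child ω J ε)) (cubeT 𝕜 ω (child ω I ε')) := fun ω => by
    rw [← blin_apply h.locInt, haarT, map_sum]
    exact Finset.sum_congr rfl fun ε' _ => by rw [map_smul]; rfl
  simp only [e]
  exact Finset.measurable_sum _ fun ε' _ => (measurable_bform_child h I J ε ε').const_mul _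

lemma measurable_term (h : IsCZOperator ψ K T Tt) (hf : Nice R f) (hg : Nice R g) (q : QIdx d) :
    Measurable fun ω : Grid d => term T ω f g q := by
  refine (Finset.measurable_sum _ fun ε _ => ?_).mul (measurable_hcf hf.locallyIntegrable _ _)
  refine Measurable.mul ?_ (measurable_entry h _ _ _ _)
  exact (((measurable_av hg.locallyIntegrable _).add
    (measurable_av_child hg.locallyIntegrable _ ε)).div_const _).sub
    (measurable_av hg.locallyIntegrable _)

lemma measurable_paraTerm (hb : IsBMO b) (hf : Nice R f) (hg : Nice R g)
    (p : Idx d × (Fin d → Bool)) : Measurable fun ω : Grid d => paraTerm b ω f g p :=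
  ((measurable_pair_haar hb.1 _ _).mul (measurable_av hg.locallyIntegrable _)).mul
    (measurable_hcf hf.locallyIntegrable _ _)

lemma exists_norm_paraTerm_le (hb : IsBMO b) : ∃ C : ℝ, 0 ≤ C ∧ ∀ (R : ℝ) (f g : (Fin d → ℝ) → 𝕜),
    Nice R f → Nice R g → ∀ ω p, ‖paraTerm b ω f g p‖ ≤ C * domB R p.1 := by
  obtain ⟨hb1, C, hC⟩ := hb
  refine ⟨max C 0, le_max_right _ _, fun R f g hf hg ω ⟨I, η⟩ => ?_⟩
  have hR := hf.one_le
  by_cases hη : η = zeroη d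
  · simp only [paraTerm, hη, hcf_zero, mul_zero, norm_zero]
    exact mul_nonneg (le_max_right _ _) (domB_nonneg hR I)
  have hr := rt_pos I
  have hbI : IntegrableOn b (dcube ω I) := integrableOn_cube hb1 _ _
  have hcI : IntegrableOn (fun _ : Fin d → ℝ => av ω b I) (dcube ω I) :=
    integrableOn_const (volume_dcube_ne_top ω I)
  have h1 : pair b (haar 𝕜 ω I η) = pair (fun x => b x - av ω b I) (haar 𝕜 ω I η) := by
    have h2 := pair_haar_eq_zero_of_const (𝕜 := 𝕜) ω I hη (f := fun _ => av ω b I)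
      (c := av ω b I) fun _ _ => rfl
    rw [pair_haar_eq ω I η hcI] at h2
    rw [pair_haar_eq ω I η hbI, pair_haar_eq (f := fun x => b x - av ω b I) ω I η (hbI.sub hcI),
      ← sub_zero (_ * _), ← h2, ← mul_sub, ← Finset.sum_sub_distrib]
    congr 1
    refine Finset.sum_congr rfl fun ε _ => ?_
    rw [← mul_sub, integral_sub (hbI.mono_set (dcube_child_subset _ _ _))
      (hcI.mono_set (dcube_child_subset _ _ _))]
  have h2 : ‖pair b (haar 𝕜 ω I η)‖ ≤ max C 0 * rt I := by
    rw [h1]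
    refine (norm_pair_haar_le ω I η (hbI.sub hcI)).trans ?_
    have h3 := hC (corner ω I) (side I) (side_pos I)
    rw [setAverage_eq, volume_real_cube _ (side_pos I).le, smul_eq_mul,
      inv_mul_le_iff₀ (pow_pos (side_pos I) d), ← rt_sq] at h3
    rw [inv_mul_le_iff₀ hr]
    refine h3.trans ?_
    have := mul_le_mul_of_nonneg_left (le_max_left C 0) (mul_pos hr hr).le
    linarith
  simp only [paraTerm]
  rw [norm_mul, norm_mul]
  calc _ ≤ max C 0 * rt I * avB d R I.1 * ‖hcf ω f I η‖ :=
        mul_le_mul_of_nonneg_right (mul_le_mul h2 (hg.norm_av_le ω I) (norm_nonneg _)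
          (mul_nonneg (le_max_right _ _) hr.le)) (norm_nonneg _)
    _ = max C 0 * (‖hcf ω f I η‖ * rt I * avB d R I.1) := by ring
    _ ≤ _ := mul_le_mul_of_nonneg_left (hf.norm_hcf_mul_le_domB ω I η) (le_max_right _ _)

end

/-! ### The expectation of the expansion -/

lemma integral_tsum_of_bound {ι : Type*} [Countable ι] {F : ι → Grid d → 𝕜} {c : ι → ℝ}
    (hF : ∀ i, Measurable (F i)) (hb : ∀ i ω, ‖F i ω‖ ≤ c i) (hc : Summable c) :
    Integrable (fun ω => ∑' i, F i ω) (gridMeasure d) ∧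
      ∫ ω, ∑' i, F i ω ∂(gridMeasure d) = ∑' i, ∫ ω, F i ω ∂(gridMeasure d) := by
  have hi : ∀ i, Integrable (F i) (gridMeasure d) := fun i =>
    Integrable.of_bound (hF i).aestronglyMeasurable (c i) (Eventually.of_forall (hb i))
  constructor
  · refine Integrable.of_bound (Measurable.tsum hF).aestronglyMeasurable (∑' i, c i)
      (Eventually.of_forall fun ω => ?_)
    exact tsum_of_norm_bounded hc.hasSum fun i => hb i ω
  · refine (hasSum_integral_of_summable_integral_norm hi ?_).tsum_eq.symm
    refine hc.of_nonneg_of_le (fun i => integral_nonneg fun _ => norm_nonneg _) fun i => ?_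
    have := integral_mono_of_nonneg (μ := gridMeasure d) (Eventually.of_forall fun ω => norm_nonneg _)
      (integrable_const (c i)) (Eventually.of_forall (hb i))
    simpa using this

section

variable {ψ : ℝ → ℝ} {K : (Fin d → ℝ) → (Fin d → ℝ) → 𝕜}
  {T Tt : testSpace 𝕜 d →ₗ[𝕜] ((Fin d → ℝ) →ₘ[volume] 𝕜)} {R : ℝ} {f g b : (Fin d → ℝ) → 𝕜}

/-- The terms of the expansion, restricted to good pairs of cubes. -/
def wTerm (T : testSpace 𝕜 d →ₗ[𝕜] ((Fin d → ℝ) →ₘ[volume] 𝕜)) (f g : (Fin d → ℝ) → 𝕜)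
    (q : QIdx d) (ω : Grid d) : 𝕜 := (weight q.1.1 q.2 ω : 𝕜) * term T ω f g q

lemma measurable_wTerm (h : IsCZOperator ψ K T Tt) (hf : Nice R f) (hg : Nice R g) (q : QIdx d) :
    Measurable (wTerm T f g q) :=
  (RCLike.measurable_ofReal.comp (measurable_weight _ _)).mul (measurable_term h hf hg q)

lemma norm_wTerm_le (hd : 0 < d) (hψ : IsModulus ψ) (h : IsCZOperator ψ K T Tt)
    (hw : ∃ C, WeakBound T C) (hf : Nice R f) (hg : Nice R g) (q : QIdx d) (ω : Grid d) :
    ‖wTerm T f g q ω‖ ≤ 2 ^ d * (2 ^ d * (2 * 2 ^ d) * kerC hd ψ K T) * termB ψ R q := by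
  rw [wTerm, norm_mul, RCLike.norm_ofReal, abs_of_nonneg (weight_nonneg _ _ _), mul_assoc (2 ^ d)]
  exact mul_le_mul (weight_le _ _ _) (norm_term_le hd hψ h hw hf hg ω q) (norm_nonneg _)
    (by positivity)

lemma integral_tsum_term (hd : 0 < d) (hψ : IsModulus ψ) (h : IsCZOperator ψ K T Tt)
    (hw : ∃ C, WeakBound T C) (hf : Nice R f) (hg : Nice R g) :
    Integrable (fun ω => ∑' q, term T ω f g q) (gridMeasure d) ∧
    ∫ ω, ∑' q, term T ω f g q ∂(gridMeasure d) =
      ∫ ω, ∑' q, wTerm T f g q ω ∂(gridMeasure d) := by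
  have hs := summable_termB (d := d) hd hψ hf.one_le
  have h1 := integral_tsum_of_bound (F := fun q ω => term T ω f g q) (measurable_term h hf hg)
    (fun q ω => norm_term_le hd hψ h hw hf hg ω q) (hs.mul_left _)
  have h2 := integral_tsum_of_bound (F := wTerm T f g) (measurable_wTerm h hf hg)
    (norm_wTerm_le hd hψ h hw hf hg) (hs.mul_left _)
  refine ⟨h1.1, ?_⟩
  rw [h1.2, h2.2]
  refine tsum_congr fun q => ?_
  by_cases hm : q.2 = 0
  · refine integral_congr_ae (Eventually.of_forall fun ω => ?_)
    simp only [wTerm, hm, weight_zero, RCLike.ofReal_one, one_mul]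
  refine (integral_weight_mul q.1.1 q.2 (measurable_term h hf hg q)
    (fun ω => norm_term_le hd hψ h hw hf hg ω q) fun ω v => ?_).symm
  -- For m ≠ 0 the decisive digit has number at most `I.1 - 1`, as `lev m ≥ 2`, while the term
  -- depends only on digits with numbers above `I.1`.
  refine term_congr T (fun j hj => Function.update_of_ne ?_ _ _) f g
  have := two_le_lev hm
  rw [digit]; omega

lemma integral_tsum_paraTerm (hd : 0 < d) (hb : IsBMO b) (hf : Nice R f) (hg : Nice R g) :
    (∀ ω, Summable (paraTerm b ω f g)) ∧
      Integrable (fun ω => ∑' p, paraTerm b ω f g p) (gridMeasure d) := by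
  obtain ⟨C, hC, h⟩ := exists_norm_paraTerm_le hb
  have hs : Summable fun p : Idx d × (Fin d → Bool) => C * domB R p.1 := by
    have := (summable_domB hd hf.one_le).mul_of_nonneg (g := fun _ : Fin d → Bool => (1 : ℝ))
      (Summable.of_finite) (domB_nonneg hf.one_le) fun _ => zero_le_one
    simpa using this.mul_left C
  exact ⟨fun ω => hs.of_norm_bounded (h R f g hf hg ω),
    (integral_tsum_of_bound (F := fun p ω => paraTerm b ω f g p) (measurable_paraTerm hb hf hg)
      (fun p ω => h R f g hf hg ω p) hs).1⟩

end

theorem bform_eq_integral {ψ : ℝ → ℝ} {K : (Fin d → ℝ) → (Fin d → ℝ) → 𝕜}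
    {T Tt : testSpace 𝕜 d →ₗ[𝕜] ((Fin d → ℝ) →ₘ[volume] 𝕜)} {R : ℝ} {f g : testSpace 𝕜 d}
    (hd : 0 < d) (hψ : IsModulus ψ) (h : IsCZOperator ψ K T Tt)
    (hw : ∃ C, WeakBound T C) {b₁ b₂ : (Fin d → ℝ) → 𝕜} (hb₁ : IsImageOfOne Tt b₁)
    (hb₂ : IsImageOfOne T b₂) (hb₁' : IsBMO b₁) (hb₂' : IsBMO b₂)
    (hf : Nice R (f : (Fin d → ℝ) → 𝕜)) (hg : Nice R (g : (Fin d → ℝ) → 𝕜)) :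
    bform T g f = ∫ ω, ∑' q, wTerm T f g q ω ∂(gridMeasure d) +
      ∫ ω, ∑' q, wTerm Tt g f q ω ∂(gridMeasure d) +
      ∫ ω, ∑' p, paraTerm b₁ ω (g : (Fin d → ℝ) → 𝕜) f p ∂(gridMeasure d) +
      ∫ ω, ∑' p, paraTerm b₂ ω (f : (Fin d → ℝ) → 𝕜) g p ∂(gridMeasure d) := by
  obtain ⟨C, hC⟩ := hw
  have t1 := integral_tsum_term hd hψ h ⟨C, hC⟩ hf hg
  have t2 := integral_tsum_term hd hψ (h.swap hψ) ⟨C, weakBound_swap h hC⟩ hg hf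
  have p1 := integral_tsum_paraTerm hd hb₁' hg hf
  have p2 := integral_tsum_paraTerm hd hb₂' hf hg
  have e : bform T g f = ∫ _ω, bform T g f ∂(gridMeasure d) := by simp
  have e2 := integral_congr_ae (μ := gridMeasure d) (Eventually.of_forall fun ω : Grid d =>
    bform_eq hd hψ h ⟨C, hC⟩ hb₁ hb₂ hf hg ω (p1.1 ω) (p2.1 ω))
  rw [e, ← t1.2, ← t2.2, e2]
  refine (integral_add (t1.1.add p2.2) (t2.1.add p1.2)).trans ?_
  refine (congrArg₂ (· + ·) (integral_add t1.1 p2.2) (integral_add t2.1 p1.2)).trans ?_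
  ring

end DyadicRep

end

noncomputable section

namespace DyadicRep

variable {d : ℕ} {𝕜 : Type*} [RCLike 𝕜]

/-! ### The distribution of the expansion over the dyadic shifts -/

/-- The martingale difference of `g` on the cube `L`. -/
def mdiff (ω : Grid d) (g : (Fin d → ℝ) → 𝕜) (L : Idx d) (x : Fin d → ℝ) : 𝕜 :=
  ∑ η, hcf ω g L η * haar 𝕜 ω L η x

/-- The factor one half occurs on the diagonal. -/
def half (i j : ℕ) : ℝ := if i = j then 1 / 2 else 1

lemma half_nonneg (i j : ℕ) : 0 ≤ half i j := by unfold half; split_ifs <;> norm_num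

lemma half_le_one (i j : ℕ) : half i j ≤ 1 := by unfold half; split_ifs <;> norm_num

/-- The linear combination with coefficients `c` of the matrix entries of the operator. -/
def comb (T : testSpace 𝕜 d →ₗ[𝕜] ((Fin d → ℝ) →ₘ[volume] 𝕜)) (ω : Grid d) (f : (Fin d → ℝ) → 𝕜)
    (q : QIdx d) (c : (Fin d → Bool) → 𝕜) : 𝕜 :=
  (∑ ε, c ε * bform T (cubeT 𝕜 ω (child ω (tr q.1.1 q.2) ε)) (haarT 𝕜 ω q.1.1 q.1.2)) *
    hcf ω f q.1.1 q.1.2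

/-- The part of the expansion from the cubes `tr I m` and their ancestors. -/
def splitJ (T : testSpace 𝕜 d →ₗ[𝕜] ((Fin d → ℝ) →ₘ[volume] 𝕜)) (ω : Grid d)
    (f g : (Fin d → ℝ) → 𝕜) (p : ℕ × ℕ) (q : QIdx d) : 𝕜 :=
  if p.1 = lev q.2 ∧ p.2 ≤ p.1 then ((half p.1 p.2 * weight q.1.1 q.2 ω : ℝ) : 𝕜) *
    comb T ω f q fun ε => mdiff ω g (anc ω (p.1 - p.2) (tr q.1.1 q.2))
      (corner ω (child ω (tr q.1.1 q.2) ε))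
  else 0

/-- The part of the expansion from the ancestors of the cubes `I`. -/
def splitI (T : testSpace 𝕜 d →ₗ[𝕜] ((Fin d → ℝ) →ₘ[volume] 𝕜)) (ω : Grid d)
    (f g : (Fin d → ℝ) → 𝕜) (p : ℕ × ℕ) (q : QIdx d) : 𝕜 :=
  if p.2 = 0 ∧ 1 ≤ p.1 ∧ p.1 ≤ lev q.2 then -((weight q.1.1 q.2 ω : ℝ) : 𝕜) *
    comb T ω f q fun _ => mdiff ω g (anc ω p.1 q.1.1) (corner ω q.1.1)
  else 0

lemma mdiff_eq (ω : Grid d) {g : (Fin d → ℝ) → 𝕜} {L : Idx d} (hg : IntegrableOn g (dcube ω L))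
    {ε : Fin d → Bool} {x : Fin d → ℝ} (hx : x ∈ dcube ω (child ω L ε)) :
    mdiff ω g L x = av ω g (child ω L ε) - av ω g L := by
  rw [mdiff, sum_hcf_mul, sum_pair_haar_mul ω L hg hx]

lemma av_sub_av_anc_eq (ω : Grid d) (J : Idx d) (k : ℕ) {g : (Fin d → ℝ) → 𝕜}
    (hg : LocallyIntegrable g volume) {x : Fin d → ℝ} (hx : x ∈ dcube ω J) :
    av ω g J - av ω g (anc ω k J) = ∑ r ∈ Finset.range k, mdiff ω g (anc ω (r + 1) J) x := by
  rw [av_sub_av_anc ω J k hg hx]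
  exact Finset.sum_congr rfl fun r _ => (sum_hcf_mul _ _ _ _).symm

section

variable {ψ : ℝ → ℝ} {K : (Fin d → ℝ) → (Fin d → ℝ) → 𝕜}
  {T Tt : testSpace 𝕜 d →ₗ[𝕜] ((Fin d → ℝ) →ₘ[volume] 𝕜)} {R : ℝ} {f g : (Fin d → ℝ) → 𝕜}

lemma Nice.norm_mdiff_le (hg : Nice R g) {ω : Grid d} {L : Idx d} {x : Fin d → ℝ}
    (hx : x ∈ dcube ω L) : ‖mdiff ω g L x‖ ≤ 2 * 2 ^ d * avB d R L.1 := by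
  obtain ⟨ε, hε⟩ := exists_mem_child hx
  rw [mdiff_eq ω hg.integrable.integrableOn hε]
  have h1 := hg.norm_av_child_le ω L ε
  have h2 := hg.norm_av_tr_le ω L 0
  rw [tr_zero] at h2
  linarith [norm_sub_le (av ω g (child ω L ε)) (av ω g L)]

lemma comb_sum (T : testSpace 𝕜 d →ₗ[𝕜] ((Fin d → ℝ) →ₘ[volume] 𝕜)) (ω : Grid d)
    (f : (Fin d → ℝ) → 𝕜) (q : QIdx d) {ι : Type*} (s : Finset ι) (c : ι → (Fin d → Bool) → 𝕜) :
    comb T ω f q (fun ε => ∑ r ∈ s, c r ε) = ∑ r ∈ s, comb T ω f q (c r) := by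
  simp only [comb, Finset.sum_mul]
  rw [Finset.sum_comm]

lemma comb_add (T : testSpace 𝕜 d →ₗ[𝕜] ((Fin d → ℝ) →ₘ[volume] 𝕜)) (ω : Grid d)
    (f : (Fin d → ℝ) → 𝕜) (q : QIdx d) (c c' : (Fin d → Bool) → 𝕜) :
    comb T ω f q (fun ε => c ε + c' ε) = comb T ω f q c + comb T ω f q c' := by
  simp only [comb, add_mul, Finset.sum_add_distrib]

lemma comb_sub (T : testSpace 𝕜 d →ₗ[𝕜] ((Fin d → ℝ) →ₘ[volume] 𝕜)) (ω : Grid d)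
    (f : (Fin d → ℝ) → 𝕜) (q : QIdx d) (c c' : (Fin d → Bool) → 𝕜) :
    comb T ω f q (fun ε => c ε - c' ε) = comb T ω f q c - comb T ω f q c' := by
  simp only [comb, sub_mul, Finset.sum_sub_distrib]

lemma comb_mul (T : testSpace 𝕜 d →ₗ[𝕜] ((Fin d → ℝ) →ₘ[volume] 𝕜)) (ω : Grid d)
    (f : (Fin d → ℝ) → 𝕜) (q : QIdx d) (a : 𝕜) (c : (Fin d → Bool) → 𝕜) :
    comb T ω f q (fun ε => a * c ε) = a * comb T ω f q c := by
  simp only [comb, mul_assoc, Finset.mul_sum, Finset.sum_mul]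

/-- For a good pair of scale k, the r-th ancestor of I+m lies k-r generations below the common
ancestor, so it belongs to the parameters (k, k-r). The case r = 0 carries the factor 1/2 that stems
from the mean of two successive averages. -/
lemma hasSum_splitJ (T : testSpace 𝕜 d →ₗ[𝕜] ((Fin d → ℝ) →ₘ[volume] 𝕜)) (ω : Grid d)
    (f g : (Fin d → ℝ) → 𝕜) (q : QIdx d) :
    HasSum (fun p => splitJ T ω f g p q) ((weight q.1.1 q.2 ω : 𝕜) *
      comb T ω f q fun ε => mdiff ω g (tr q.1.1 q.2) (corner ω (child ω (tr q.1.1 q.2) ε)) / 2 +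
        ∑ r ∈ Finset.range (lev q.2), mdiff ω g (anc ω (r + 1) (tr q.1.1 q.2))
          (corner ω (child ω (tr q.1.1 q.2) ε))) := by
  set k := lev q.2 with hk
  set J := tr q.1.1 q.2 with hJ
  set D : ℕ → 𝕜 := fun r => ((half k (k - r) * weight q.1.1 q.2 ω : ℝ) : 𝕜) * comb T ω f q fun ε =>
    mdiff ω g (anc ω r J) (corner ω (child ω J ε)) with hD
  have hi : Function.Injective (fun j : ℕ => (k, j)) := fun a b h => (Prod.ext_iff.1 h).2
  rw [← hi.hasSum_iff]
  · have h1 : HasSum ((fun p => splitJ T ω f g p q) ∘ fun j : ℕ => (k, j))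
        (∑ j ∈ Finset.range (k + 1), D (k - j)) := by
      rw [Finset.sum_congr rfl (g := fun j => splitJ T ω f g (k, j) q)]
      · refine hasSum_sum_of_ne_finset_zero fun j hj => ?_
        simp only [Function.comp, splitJ]
        rw [if_neg]
        intro h
        exact hj (Finset.mem_range.2 (by omega))
      · intro j hj
        have hj' := Finset.mem_range.1 hj
        have h2 : k - (k - j) = j := by omega
        simp only [splitJ, hD, h2]
        rw [if_pos ⟨hk, by omega⟩]
    rw [Finset.sum_flip, Finset.sum_range_succ'] at h1
    convert h1 using 1
    rw [comb_add, comb_sum, mul_add, Finset.mul_sum, add_comm]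
    congr 1
    · refine Finset.sum_congr rfl fun r hr => ?_
      have hr' := Finset.mem_range.1 hr
      simp only [hD, half]
      rw [if_neg (by omega), one_mul]
    · simp only [hD, half, Nat.sub_zero, if_true, anc]
      simp only [div_eq_inv_mul]
      rw [comb_mul]
      push_cast
      ring
  · rintro ⟨i, j⟩ h
    simp only [splitJ]
    rw [if_neg]
    rintro ⟨rfl, -⟩
    exact h ⟨j, rfl⟩

/-- The r-th ancestor of I is itself the top cube K of the shift, which gives the parameters (r, 0).
The scale of m only has to be at least r. -/
lemma hasSum_splitI (T : testSpace 𝕜 d →ₗ[𝕜] ((Fin d → ℝ) →ₘ[volume] 𝕜)) (ω : Grid d)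
    (f g : (Fin d → ℝ) → 𝕜) (q : QIdx d) :
    HasSum (fun p => splitI T ω f g p q) (-((weight q.1.1 q.2 ω : 𝕜) *
      comb T ω f q fun _ => ∑ r ∈ Finset.range (lev q.2),
        mdiff ω g (anc ω (r + 1) q.1.1) (corner ω q.1.1))) := by
  have hi : Function.Injective (fun r : ℕ => (r + 1, 0)) := fun a b h => by
    simpa using h
  rw [← hi.hasSum_iff]
  · rw [comb_sum, Finset.mul_sum, ← Finset.sum_neg_distrib,
      Finset.sum_congr rfl (g := fun r => splitI T ω f g (r + 1, 0) q)]
    · refine hasSum_sum_of_ne_finset_zero fun r hr => ?_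
      simp only [Function.comp, splitI]
      rw [if_neg]
      intro h
      exact hr (Finset.mem_range.2 (by omega))
    · intro r hr
      have hr' := Finset.mem_range.1 hr
      simp only [splitI]
      rw [if_pos ⟨trivial, by omega, by omega⟩, neg_mul]
  · rintro ⟨i, j⟩ h
    simp only [splitI]
    rw [if_neg]
    rintro ⟨rfl, h1, -⟩
    exact h ⟨i - 1, by simp; omega⟩

/-- For a good pair the averages over the common ancestor cancel, so the mean value on I+m minus
⟨g⟩_I is the difference of two telescoping sums up to that ancestor. For other pairs the weight
makes both sides zero. -/
lemma hasSum_split (T : testSpace 𝕜 d →ₗ[𝕜] ((Fin d → ℝ) →ₘ[volume] 𝕜)) (hg : Nice R g) (ω : Grid d)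
    (q : QIdx d) :
    HasSum (fun p => splitJ T ω f g p q + splitI T ω f g p q) (wTerm T f g q ω) := by
  convert (hasSum_splitJ T ω f g q).add (hasSum_splitI T ω f g q) using 1
  rw [← sub_eq_add_neg, ← mul_sub, ← comb_sub, wTerm]
  by_cases hgood : good q.1.1 q.2 ω
  · congr 1
    change comb T ω f q _ = _
    congr 1
    funext ε
    have hx := corner_mem ω (child ω (tr q.1.1 q.2) ε)
    rw [← av_sub_av_anc_eq ω _ _ hg.locallyIntegrable (dcube_child_subset ω _ ε hx),
      ← av_sub_av_anc_eq ω _ _ hg.locallyIntegrable (corner_mem ω q.1.1),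
      mdiff_eq ω hg.integrable.integrableOn hx]
    have h : anc ω (lev q.2) q.1.1 = anc ω (lev q.2) (tr q.1.1 q.2) := hgood
    rw [h]
    ring
  · rw [weight_of_not_good hgood, RCLike.ofReal_zero, zero_mul, zero_mul]

lemma avB_anc_le (hR : 1 ≤ R) (ω : Grid d) (i : ℕ) (I : Idx d) :
    avB d R (anc ω i I).1 ≤ avB d R I.1 := avB_mono hR (by rw [anc_fst]; omega)

/-- The common constant in the bounds for the parts of the expansion. -/
def splitC (hd : 0 < d) (ψ : ℝ → ℝ) (K : (Fin d → ℝ) → (Fin d → ℝ) → 𝕜)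
    (T : testSpace 𝕜 d →ₗ[𝕜] ((Fin d → ℝ) →ₘ[volume] 𝕜)) : ℝ :=
  2 ^ d * (2 ^ d * (2 * 2 ^ d) * kerC hd ψ K T)

lemma splitC_nonneg (hd : 0 < d) (hψ : IsModulus ψ) (h : IsCZOperator ψ K T Tt)
    (hw : ∃ C, WeakBound T C) : 0 ≤ splitC hd ψ K T := by
  have := kerC_nonneg hd hψ h hw
  unfold splitC; positivity

lemma norm_splitJ_le (hd : 0 < d) (hψ : IsModulus ψ) (h : IsCZOperator ψ K T Tt)
    (hw : ∃ C, WeakBound T C) (hf : Nice R f) (hg : Nice R g) (ω : Grid d) (p : ℕ × ℕ)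
    (q : QIdx d) : ‖splitJ T ω f g p q‖ ≤
      if p.1 = lev q.2 ∧ p.2 ≤ p.1 then splitC hd ψ K T * termB ψ R q else 0 := by
  unfold splitJ
  split_ifs
  · rw [norm_mul, RCLike.norm_ofReal, abs_of_nonneg (mul_nonneg (half_nonneg _ _)
      (weight_nonneg _ _ _)), splitC, mul_assoc (2 ^ d)]
    refine mul_le_mul ?_ ?_ (norm_nonneg _) (by positivity)
    · exact (mul_le_of_le_one_left (weight_nonneg _ _ _) (half_le_one _ _)).trans (weight_le _ _ _)
    · refine norm_sum_entry_mul_hcf_le hd hψ h hw hf ω q.1.1 q.1.2 q.2 (by positivity) fun ε => ?_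
      refine (hg.norm_mdiff_le (dcube_subset_anc ω _ _ (dcube_child_subset ω _ ε
        (corner_mem ω _)))).trans (mul_le_mul_of_nonneg_left ?_ (by positivity))
      exact avB_anc_le hf.one_le ω _ (tr q.1.1 q.2)
  · rw [norm_zero]

lemma norm_splitI_le (hd : 0 < d) (hψ : IsModulus ψ) (h : IsCZOperator ψ K T Tt)
    (hw : ∃ C, WeakBound T C) (hf : Nice R f) (hg : Nice R g) (ω : Grid d) (p : ℕ × ℕ)
    (q : QIdx d) : ‖splitI T ω f g p q‖ ≤
      if p.2 = 0 ∧ 1 ≤ p.1 ∧ p.1 ≤ lev q.2 then splitC hd ψ K T * termB ψ R q else 0 := by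
  unfold splitI
  split_ifs
  · rw [norm_mul, norm_neg, RCLike.norm_ofReal, abs_of_nonneg (weight_nonneg _ _ _), splitC,
      mul_assoc (2 ^ d)]
    refine mul_le_mul (weight_le _ _ _) ?_ (norm_nonneg _) (by positivity)
    refine norm_sum_entry_mul_hcf_le hd hψ h hw hf ω q.1.1 q.1.2 q.2 (by positivity) fun ε => ?_
    refine (hg.norm_mdiff_le (dcube_subset_anc ω _ _ (corner_mem ω _))).trans
      (mul_le_mul_of_nonneg_left ?_ (by positivity))
    exact avB_anc_le hf.one_le ω _ q.1.1
  · rw [norm_zero]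

lemma summable_lev_termB (hd : 0 < d) (hψ : IsModulus ψ) (hR : 1 ≤ R)
    (hs : Summable fun k : ℕ => (k : ℝ) * ψ ((1 / 2) ^ k)) :
    Summable fun q : QIdx d => ((lev q.2 : ℝ) + 1) * termB ψ R q := by
  have h0 : ∀ k : ℕ, 0 ≤ ψ ((1 / 2) ^ k) := fun k =>
    hψ.nonneg (half_pow_pos k).le (half_pow_le_one k)
  have h1 := summable_mul_domB hd hR (summable_lev (d := d)
    (a := fun k => ((k : ℝ) + 1) * ψ ((1 / 2) ^ k)) (fun k => mul_nonneg (by positivity) (h0 k))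
    ((hs.add (summable_psi hψ)).congr fun k => by ring)) fun m =>
      mul_nonneg (by positivity) (mul_nonneg (by positivity) (h0 _))
  refine h1.congr fun q => ?_
  rw [termB, wt]; ring

/-- A term of scale k is distributed over about k pairs of parameters. Summability of kψ(2^{-k}) is
therefore what permits the exchange of the sums. -/
lemma summable_split (hd : 0 < d) (hψ : IsModulus ψ) (h : IsCZOperator ψ K T Tt)
    (hw : ∃ C, WeakBound T C) (hs : Summable fun k : ℕ => (k : ℝ) * ψ ((1 / 2) ^ k))
    (hf : Nice R f) (hg : Nice R g) (ω : Grid d) :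
    Summable fun x : QIdx d × (ℕ × ℕ) => splitJ T ω f g x.2 x.1 + splitI T ω f g x.2 x.1 := by
  have hR := hf.one_le
  have hC := splitC_nonneg hd hψ h hw
  have hS := (summable_lev_termB (d := d) hd hψ hR hs).mul_left (splitC hd ψ K T)
  -- Both kinds of parts have one shape: for each q the parameters that occur are among the values
  -- of a function on 0, ..., `lev q.2`.
  have key : ∀ (P : QIdx d → ℕ × ℕ → Prop) [∀ q p, Decidable (P q p)] (ι : QIdx d → ℕ → ℕ × ℕ),
      (∀ q p, P q p → ∃ j ≤ lev q.2, ι q j = p) →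
      Summable fun x : QIdx d × (ℕ × ℕ) => if P x.1 x.2 then splitC hd ψ K T * termB ψ R x.1 else 0 := by
    intro P _ ι hP
    have h0 : ∀ q : QIdx d, 0 ≤ splitC hd ψ K T * termB ψ R q := fun q =>
      mul_nonneg hC (termB_nonneg hψ hR q)
    have hz : ∀ q, ∀ p ∉ (Finset.range (lev q.2 + 1)).image (ι q),
        (if P q p then splitC hd ψ K T * termB ψ R q else 0) = 0 := by
      intro q p hp
      rw [if_neg]
      intro h'
      obtain ⟨j, hj, rfl⟩ := hP q p h'
      exact hp (Finset.mem_image_of_mem _ (Finset.mem_range.2 (by omega)))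
    refine (summable_prod_of_nonneg fun x => ?_).2 ⟨fun q => ?_, ?_⟩
    · change 0 ≤ ite _ _ _
      split_ifs
      · exact h0 _
      · exact le_rfl
    · exact summable_of_ne_finset_zero (s := (Finset.range (lev q.2 + 1)).image (ι q)) (hz q)
    · refine hS.of_nonneg_of_le (fun q => tsum_nonneg fun p => ?_) fun q => ?_
      · split_ifs
        · exact h0 _
        · exact le_rfl
      · rw [tsum_eq_sum (hz q)]
        refine (Finset.sum_le_card_nsmul _ _ (splitC hd ψ K T * termB ψ R q) fun p _ => ?_).trans ?_
        · split_ifs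
          · exact le_rfl
          · exact h0 q
        · rw [nsmul_eq_mul, mul_left_comm]
          have hc : (((Finset.range (lev q.2 + 1)).image (ι q)).card : ℝ) ≤ (lev q.2 : ℝ) + 1 := by
            have := Finset.card_image_le (s := Finset.range (lev q.2 + 1)) (f := ι q)
            rw [Finset.card_range] at this
            exact_mod_cast this
          exact mul_le_mul_of_nonneg_left (mul_le_mul_of_nonneg_right hc (termB_nonneg hψ hR q)) hC
  have k1 := key (fun q p => p.1 = lev q.2 ∧ p.2 ≤ p.1) (fun q j => (lev q.2, j)) fun q p hp =>
      ⟨p.2, by omega, Prod.ext hp.1.symm rfl⟩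
  have k2 := key (fun q p => p.2 = 0 ∧ 1 ≤ p.1 ∧ p.1 ≤ lev q.2) (fun _ j => (j, 0)) fun q p hp =>
      ⟨p.1, by omega, Prod.ext rfl hp.1.symm⟩
  exact (k1.of_norm_bounded fun x => norm_splitJ_le hd hψ h hw hf hg ω x.2 x.1).add
    (k2.of_norm_bounded fun x => norm_splitI_le hd hψ h hw hf hg ω x.2 x.1)

/-- The part of the expansion that is to be represented by shifts with parameters `p`. -/
def shiftPart (T : testSpace 𝕜 d →ₗ[𝕜] ((Fin d → ℝ) →ₘ[volume] 𝕜)) (ω : Grid d)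
    (f g : (Fin d → ℝ) → 𝕜) (p : ℕ × ℕ) : 𝕜 :=
  ∑' q, (splitJ T ω f g p q + splitI T ω f g p q)

lemma hasSum_shiftPart (hd : 0 < d) (hψ : IsModulus ψ) (h : IsCZOperator ψ K T Tt)
    (hw : ∃ C, WeakBound T C) (hs : Summable fun k : ℕ => (k : ℝ) * ψ ((1 / 2) ^ k))
    (hf : Nice R f) (hg : Nice R g) (ω : Grid d) :
    HasSum (shiftPart T ω f g) (∑' q, wTerm T f g q ω) := by
  have h1 := summable_split hd hψ h hw hs hf hg ω
  have h2 := h1.hasSum.prod_fiberwise fun q => hasSum_split T hg ω q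
  have h3 := (Equiv.prodComm (ℕ × ℕ) (QIdx d)).hasSum_iff.2 h1.hasSum
  rw [h2.tsum_eq]
  exact h3.prod_fiberwise fun p => (h3.summable.prod_factor p).hasSum

lemma hasSum_split_fixed (hd : 0 < d) (hψ : IsModulus ψ) (h : IsCZOperator ψ K T Tt)
    (hw : ∃ C, WeakBound T C) (hs : Summable fun k : ℕ => (k : ℝ) * ψ ((1 / 2) ^ k))
    (hf : Nice R f) (hg : Nice R g) (ω : Grid d) (p : ℕ × ℕ) :
    HasSum (fun q => splitJ T ω f g p q + splitI T ω f g p q) (shiftPart T ω f g p) :=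
  (((Equiv.prodComm (ℕ × ℕ) (QIdx d)).summable_iff.2
    (summable_split hd hψ h hw hs hf hg ω)).prod_factor p).hasSum

/-- For the parameters (0,0) only the translation m = 0 survives. This form shows integrability in
ω, and that of the remaining sum then follows by subtraction. -/
lemma shiftPart_zero (T : testSpace 𝕜 d →ₗ[𝕜] ((Fin d → ℝ) →ₘ[volume] 𝕜)) (hg : Nice R g)
    (ω : Grid d) : shiftPart T ω f g (0, 0) = ∑' q, if q.2 = 0 then wTerm T f g q ω else 0 := by
  refine tsum_congr fun q => ?_
  split_ifs with hq
  · rw [← (hasSum_split T hg ω q).tsum_eq, tsum_eq_single (0, 0)]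
    rintro ⟨i, j⟩ hij
    simp only [splitJ, splitI, hq, lev_zero]
    rw [if_neg, if_neg, add_zero]
    · omega
    · rintro ⟨rfl, hj⟩
      exact hij (Prod.ext rfl (by simpa using hj))
  · have : 0 ≠ lev q.2 := fun h' => hq (lev_eq_zero.1 h'.symm)
    simp only [splitJ, splitI]
    rw [if_neg (fun h' => this h'.1), if_neg (by omega), add_zero]

end

end DyadicRep

end

noncomputable section

namespace DyadicRep

variable {d : ℕ} {𝕜 : Type*} [RCLike 𝕜]

/-! ### The coefficients of the shifts -/

/-- The sum of the matrix entries between a Haar function and the children of a cube. -/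
def entrySum (T : testSpace 𝕜 d →ₗ[𝕜] ((Fin d → ℝ) →ₘ[volume] 𝕜)) (ω : Grid d) (I : Idx d)
    (η : Fin d → Bool) (m : Fin d → ℤ) (c : (Fin d → Bool) → 𝕜) : 𝕜 :=
  ∑ ε, c ε * bform T (cubeT 𝕜 ω (child ω (tr I m) ε)) (haarT 𝕜 ω I η)

/-- The part of the coefficient from the cubes `tr I m`. -/
def coefJ (T : testSpace 𝕜 d →ₗ[𝕜] ((Fin d → ℝ) →ₘ[volume] 𝕜)) (ω : Grid d) (i j : ℕ) (I L : Idx d)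
    (η η' : Fin d → Bool) : 𝕜 :=
  if j ≤ i then ∑ m ∈ levSet d i with anc ω (i - j) (tr I m) = L,
    ((half i j * weight I m ω : ℝ) : 𝕜) * entrySum T ω I η m fun ε =>
      haar 𝕜 ω L η' (corner ω (child ω (tr I m) ε))
  else 0

/-- The part of the coefficient from the cube `I`. -/
def coefI (T : testSpace 𝕜 d →ₗ[𝕜] ((Fin d → ℝ) →ₘ[volume] 𝕜)) (ω : Grid d) (i j : ℕ) (I L : Idx d)
    (η η' : Fin d → Bool) : 𝕜 :=
  if j = 0 ∧ 1 ≤ i then -(haar 𝕜 ω L η' (corner ω I) *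
    ∑' m, if i ≤ lev m then (weight I m ω : 𝕜) * entrySum T ω I η m fun _ => 1 else 0)
  else 0

/-- One half of the coefficients of the shifts, up to normalization. -/
def coef (T : testSpace 𝕜 d →ₗ[𝕜] ((Fin d → ℝ) →ₘ[volume] 𝕜)) (ω : Grid d) (i j : ℕ) (I L : Idx d)
    (η η' : Fin d → Bool) : 𝕜 :=
  if η = zeroη d ∨ η' = zeroη d then 0 else coefJ T ω i j I L η η' + coefI T ω i j I L η η'

lemma coef_mul (T : testSpace 𝕜 d →ₗ[𝕜] ((Fin d → ℝ) →ₘ[volume] 𝕜)) (ω : Grid d) (i j : ℕ)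
    (I L : Idx d) (η η' : Fin d → Bool) (f g : (Fin d → ℝ) → 𝕜) :
    coef T ω i j I L η η' * pair f (haar 𝕜 ω I η) * pair g (haar 𝕜 ω L η') =
      coefJ T ω i j I L η η' * hcf ω f I η * hcf ω g L η' +
        coefI T ω i j I L η η' * hcf ω f I η * hcf ω g L η' := by
  unfold coef
  split_ifs with h
  · rcases h with h | h <;> simp [h, hcf_zero]
  · rw [not_or] at h
    rw [hcf_of_ne ω f I h.1, hcf_of_ne ω g L h.2]; ring

lemma entrySum_mul (T : testSpace 𝕜 d →ₗ[𝕜] ((Fin d → ℝ) →ₘ[volume] 𝕜)) (ω : Grid d) (I : Idx d)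
    (η : Fin d → Bool) (m : Fin d → ℤ) (f : (Fin d → ℝ) → 𝕜) (c : (Fin d → Bool) → 𝕜) :
    entrySum T ω I η m c * hcf ω f I η = comb T ω f ((I, η), m) c := rfl

lemma entrySum_const (T : testSpace 𝕜 d →ₗ[𝕜] ((Fin d → ℝ) →ₘ[volume] 𝕜)) (ω : Grid d) (I : Idx d)
    (η : Fin d → Bool) (m : Fin d → ℤ) (a : 𝕜) :
    entrySum T ω I η m (fun _ => a) = a * entrySum T ω I η m fun _ => 1 := by
  simp only [entrySum, Finset.mul_sum, one_mul]

lemma sum_entrySum_mul (T : testSpace 𝕜 d →ₗ[𝕜] ((Fin d → ℝ) →ₘ[volume] 𝕜)) (ω : Grid d) (I L : Idx d)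
    (η : Fin d → Bool) (m : Fin d → ℤ) (g : (Fin d → ℝ) → 𝕜) (x : (Fin d → Bool) → Fin d → ℝ) :
    ∑ η', entrySum T ω I η m (fun ε => haar 𝕜 ω L η' (x ε)) * hcf ω g L η' =
      entrySum T ω I η m fun ε => mdiff ω g L (x ε) := by
  simp only [entrySum, mdiff, Finset.sum_mul]
  rw [Finset.sum_comm]
  exact Finset.sum_congr rfl fun ε _ => Finset.sum_congr rfl fun η' _ => by ring

section

variable {ψ : ℝ → ℝ} {K : (Fin d → ℝ) → (Fin d → ℝ) → 𝕜}
  {T Tt : testSpace 𝕜 d →ₗ[𝕜] ((Fin d → ℝ) →ₘ[volume] 𝕜)} {R : ℝ} {f g : (Fin d → ℝ) → 𝕜}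

/-- For given I and m exactly one cube L qualifies, the ancestor of I+m that lies i-j generations
up; only L below the i-th ancestor of I are summed, and this loses nothing. -/
lemma sum_coefJ_mul (T : testSpace 𝕜 d →ₗ[𝕜] ((Fin d → ℝ) →ₘ[volume] 𝕜)) (ω : Grid d) (i j : ℕ)
    (I : Idx d) (η : Fin d → Bool) (f g : (Fin d → ℝ) → 𝕜) :
    ∑ L ∈ desc ω j (anc ω i I), ∑ η', coefJ T ω i j I L η η' * hcf ω f I η * hcf ω g L η' =
      ∑ m ∈ levSet d i, splitJ T ω f g (i, j) ((I, η), m) := by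
  by_cases hij : j ≤ i
  swap
  · rw [Finset.sum_eq_zero, Finset.sum_eq_zero]
    · intro m _
      simp only [splitJ]
      rw [if_neg fun h => hij h.2]
    · intro L _
      refine Finset.sum_eq_zero fun η' _ => ?_
      rw [coefJ, if_neg hij, zero_mul, zero_mul]
  set Z : (Fin d → ℤ) → Idx d → 𝕜 := fun m L => ((half i j * weight I m ω : ℝ) : 𝕜) *
    comb T ω f ((I, η), m) fun ε => mdiff ω g L (corner ω (child ω (tr I m) ε)) with hZ
  have h1 : ∀ L, ∑ η', coefJ T ω i j I L η η' * hcf ω f I η * hcf ω g L η' =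
      ∑ m ∈ levSet d i, if anc ω (i - j) (tr I m) = L then Z m L else 0 := by
    intro L
    simp only [coefJ, if_pos hij]
    rw [← Finset.sum_filter]
    simp only [Finset.sum_mul]
    rw [Finset.sum_comm]
    refine Finset.sum_congr rfl fun m _ => ?_
    rw [hZ]
    simp only
    rw [← entrySum_mul, ← sum_entrySum_mul, Finset.sum_mul, Finset.mul_sum]
    exact Finset.sum_congr rfl fun η' _ => by ring
  rw [Finset.sum_congr rfl fun L _ => h1 L, Finset.sum_comm]
  refine Finset.sum_congr rfl fun m hm => ?_
  have hl : i = lev m := (mem_levSet.1 hm).symm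
  have hS : splitJ T ω f g (i, j) ((I, η), m) = Z m (anc ω (i - j) (tr I m)) := by
    simp only [splitJ]
    rw [if_pos ⟨hl, hij⟩]
  rw [Finset.sum_ite_eq, hS]
  split_ifs with hd
  · rfl
  -- If that ancestor is not below the i-th ancestor of I, the pair is not good, and its weight is
  -- zero.
  · have hng : ¬ good I m ω := by
      intro hgood
      refine hd (mem_desc.2 ?_)
      rw [← anc_add, Nat.add_sub_cancel' hij, hl]
      exact hgood.symm
    simp only [hZ]
    rw [weight_of_not_good hng, mul_zero, RCLike.ofReal_zero, zero_mul]

lemma sum_coefI_mul (T : testSpace 𝕜 d →ₗ[𝕜] ((Fin d → ℝ) →ₘ[volume] 𝕜)) (ω : Grid d) (i j : ℕ)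
    (I : Idx d) (η : Fin d → Bool) (f g : (Fin d → ℝ) → 𝕜) :
    ∑ L ∈ desc ω j (anc ω i I), ∑ η', coefI T ω i j I L η η' * hcf ω f I η * hcf ω g L η' =
      ∑' m, splitI T ω f g (i, j) ((I, η), m) := by
  by_cases hij : j = 0 ∧ 1 ≤ i
  swap
  · rw [Finset.sum_eq_zero, ← tsum_zero]
    · refine tsum_congr fun m => ?_
      simp only [splitI]
      rw [if_neg fun h => hij ⟨h.1, h.2.1⟩]
    · intro L _
      refine Finset.sum_eq_zero fun η' _ => ?_
      rw [coefI, if_neg hij, zero_mul, zero_mul]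
  obtain ⟨rfl, hi⟩ := hij
  simp only [desc, Finset.sum_singleton, coefI, true_and, if_pos hi]
  set s := ∑' m, if i ≤ lev m then (weight I m ω : 𝕜) * entrySum T ω I η m fun _ => 1 else 0 with hs
  have h1 : ∑ η', -(haar 𝕜 ω (anc ω i I) η' (corner ω I) * s) * hcf ω f I η *
      hcf ω g (anc ω i I) η' = s * (-mdiff ω g (anc ω i I) (corner ω I) * hcf ω f I η) := by
    rw [mdiff, ← Finset.sum_neg_distrib, Finset.sum_mul, Finset.mul_sum]
    exact Finset.sum_congr rfl fun η' _ => by ring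
  rw [h1, hs, ← tsum_mul_right]
  refine tsum_congr fun m => ?_
  simp only [splitI]
  by_cases hm : i ≤ lev m
  · rw [if_pos hm, if_pos ⟨trivial, hi, hm⟩, ← entrySum_mul,
      entrySum_const T ω I η m (mdiff ω g _ _)]
    ring
  · rw [if_neg hm, if_neg fun h => hm h.2.2, zero_mul]

lemma hasSum_desc {E : Type*} [AddCommGroup E] [UniformSpace E] [IsUniformAddGroup E] [T2Space E]
    [CompleteSpace E] (ω : Grid d) (i : ℕ) {y : Idx d → E} {S : E} (hy : HasSum y S) :
    HasSum (fun K => ∑ I ∈ desc ω i K, y I) S := by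
  have h := hy.tsum_fiberwise (anc ω i)
  refine h.congr_fun fun K => ?_
  have hset : anc ω i ⁻¹' {K} = ↑(desc ω i K) := by
    ext I; simp [mem_desc]
  rw [hset, Finset.tsum_subtype']

/-- The absolutely convergent sum over all (I, η, m) is grouped by the cube K that is the i-th
ancestor of I. -/
theorem hasSum_coef (hd : 0 < d) (hψ : IsModulus ψ) (h : IsCZOperator ψ K T Tt)
    (hw : ∃ C, WeakBound T C) (hs : Summable fun k : ℕ => (k : ℝ) * ψ ((1 / 2) ^ k))
    (hf : Nice R f) (hg : Nice R g) (ω : Grid d) (i j : ℕ) :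
    HasSum (fun K => ∑ I ∈ desc ω i K, ∑ L ∈ desc ω j K, ∑ η, ∑ η',
      coef T ω i j I L η η' * pair f (haar 𝕜 ω I η) * pair g (haar 𝕜 ω L η'))
      (shiftPart T ω f g (i, j)) := by
  have h1 := hasSum_split_fixed hd hψ h hw hs hf hg ω (i, j)
  have h2 := h1.prod_fiberwise fun x => (h1.summable.prod_factor x).hasSum
  have h3 := h2.prod_fiberwise fun I => hasSum_fintype _
  refine (hasSum_desc ω i h3).congr_fun fun K => Finset.sum_congr rfl fun I hI => ?_
  have hK := mem_desc.1 hI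
  subst hK
  rw [Finset.sum_comm]
  refine Finset.sum_congr rfl fun η _ => ?_
  simp only [coef_mul, Finset.sum_add_distrib]
  rw [sum_coefJ_mul, sum_coefI_mul]
  have e : ∑ m ∈ levSet d i, splitJ T ω f g (i, j) ((I, η), m) =
      ∑' m, splitJ T ω f g (i, j) ((I, η), m) := by
    rw [tsum_eq_sum]
    intro m hm
    simp only [splitJ]
    rw [if_neg fun h' => hm (mem_levSet.2 h'.1.symm)]
  have hJ : Summable fun m => splitJ T ω f g (i, j) ((I, η), m) := by
    refine summable_of_ne_finset_zero (s := levSet d i) fun m hm => ?_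
    simp only [splitJ]
    rw [if_neg fun h' => hm (mem_levSet.2 h'.1.symm)]
  have hI' : Summable fun m => splitI T ω f g (i, j) ((I, η), m) := by
    have := (h1.summable.prod_factor (I, η)).sub hJ
    simpa using this
  rw [e, ← hJ.tsum_add hI']

end

end DyadicRep

end

noncomputable section

namespace DyadicRep

variable {d : ℕ} {𝕜 : Type*} [RCLike 𝕜]

/-! ### The size of the coefficients `τ(i,j)` -/

section

variable {φ ψ : ℝ → ℝ}

lemma IsModulus.le_div (hφ : IsModulus φ) {t : ℝ} (h0 : 0 < t) (h1 : t ≤ 1) :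
    t ≤ t / φ t ∧ t / φ t ≤ 1 := by
  have hp := hφ.pos h0 h1
  have h2 : φ t ≤ 1 := hφ.one ▸ hφ.mono h0.le h1 le_rfl
  exact ⟨le_div_self h0.le hp h2, (div_le_one hp).2 (hφ.self_le h0 h1)⟩

lemma le_two_mul_Psi (hψ : IsModulus ψ) {t : ℝ} (h0 : 0 < t) (h1 : t ≤ 1) :
    ψ t ≤ 2 * Psi ψ t := by
  have := Psi_half_add_le hψ h0 h1
  have := Psi_nonneg hψ (t := t / 2) (by linarith) (by linarith)
  linarith

lemma Psi_le_tau (hφ : IsModulus φ) (hψ : IsModulus ψ) (i : ℕ) :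
    Psi ψ ((1 / 2) ^ i) ≤ tau d φ ψ i 0 := by
  obtain ⟨h1, h2⟩ := hφ.le_div (half_pow_pos i) (half_pow_le_one i)
  simp only [tau, Nat.min_zero, lt_irrefl, if_false, Nat.max_zero]
  exact Psi_mono hψ (half_pow_pos i).le h1 h2

/-- The coefficients are naturally bounded by ψ(t) and Ψ(t). Since φ(t) ≤ 1 and t ≤ t/φ(t) ≤ 1, the
numbers τ dominate them by monotonicity. -/
lemma le_two_mul_tau (hφ : IsModulus φ) (hψ : IsModulus ψ) (i j : ℕ) :
    ψ ((1 / 2) ^ max i j) ≤ 2 * tau d φ ψ i j := by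
  have ht := half_pow_pos (max i j)
  have ht1 := half_pow_le_one (max i j)
  obtain ⟨h1, h2⟩ := hφ.le_div ht ht1
  have hp := hφ.pos ht ht1
  have h7 : φ ((1 / 2) ^ max i j) ≤ 1 := by
    have := hφ.mono ht.le ht1 le_rfl
    rwa [hφ.one] at this
  simp only [tau]
  split_ifs
  · have h3 := hψ.mono ht.le h1 h2
    have h4 : 1 ≤ ((φ ((1 / 2) ^ max i j)) ^ d)⁻¹ :=
      (one_le_inv₀ (by positivity)).2 (pow_le_one₀ hp.le h7)
    have h5 := hψ.pos ht ht1
    have h6 := le_mul_of_one_le_left (h5.le.trans h3) h4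
    linarith
  · exact (le_two_mul_Psi hψ ht ht1).trans
      (mul_le_mul_of_nonneg_left (Psi_mono hψ ht.le h1 h2) zero_le_two)

lemma tau_pos (hφ : IsModulus φ) (hψ : IsModulus ψ) (i j : ℕ) : 0 < tau d φ ψ i j := by
  have := le_two_mul_tau (d := d) hφ hψ i j
  have := hψ.pos (half_pow_pos (max i j)) (half_pow_le_one _)
  linarith

/-- In the row i = k there are k entries with j < k, each at least ψ(2^{-k})/2. -/
lemma summable_mul_psi (hφ : IsModulus φ) (hψ : IsModulus ψ)
    (h : Summable fun p : ℕ × ℕ => tau d φ ψ p.1 p.2) :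
    Summable fun k : ℕ => (k : ℝ) * ψ ((1 / 2) ^ k) := by
  refine (h.prod.mul_left 2).of_nonneg_of_le (fun k => mul_nonneg k.cast_nonneg
    (hψ.nonneg (half_pow_pos k).le (half_pow_le_one k))) fun k => ?_
  have h1 := (h.prod_factor k).sum_le_tsum (Finset.range k) fun j _ => (tau_pos hφ hψ k j).le
  have h2 : ∑ _j ∈ Finset.range k, ψ ((1 / 2) ^ k) ≤
      ∑ j ∈ Finset.range k, 2 * tau d φ ψ k j := by
    refine Finset.sum_le_sum fun j hj => ?_
    have := le_two_mul_tau (d := d) hφ hψ k j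
    rwa [max_eq_left (Finset.mem_range.1 hj).le] at this
  rw [Finset.sum_const, Finset.card_range, nsmul_eq_mul, ← Finset.mul_sum] at h2
  exact h2.trans (mul_le_mul_of_nonneg_left h1 zero_le_two)

/-- Grouping by scales leaves the tail of the series of ψ(2^{-k}) from k = i on, which the Dini
integral controls. -/
lemma tsum_wt_le (hψ : IsModulus ψ) (i : ℕ) :
    Summable (fun m : Fin d → ℤ => if i ≤ lev m then wt ψ m else 0) ∧
      ∑' m : Fin d → ℤ, (if i ≤ lev m then wt ψ m else 0) ≤ 2 * Psi ψ ((1 / 2) ^ i) := by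
  set a : ℕ → ℝ := fun k => if i ≤ k then ψ ((1 / 2) ^ k) else 0 with ha
  have ha0 : ∀ k, 0 ≤ a k := by
    intro k
    simp only [ha]
    split_ifs
    · exact hψ.nonneg (half_pow_pos k).le (half_pow_le_one k)
    · exact le_rfl
  have e : ∀ m : Fin d → ℤ, (if i ≤ lev m then wt ψ m else 0) =
      ((1 / 2 : ℝ) ^ lev m) ^ d * a (lev m) := by
    intro m
    simp only [ha, wt]
    split_ifs <;> simp
  have key : ∀ s : Finset (Fin d → ℤ), ∑ m ∈ s, (if i ≤ lev m then wt ψ m else 0) ≤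
      2 * Psi ψ ((1 / 2) ^ i) := by
    intro s
    rw [Finset.sum_congr rfl fun m _ => e m]
    refine (sum_lev_le ha0 s).trans ?_
    obtain ⟨N, hN⟩ := (s.image lev).exists_nat_subset_range
    refine (Finset.sum_le_sum_of_subset_of_nonneg (hN.trans (Finset.range_mono
      (Nat.le_add_left N i))) fun k _ _ => ha0 k).trans ?_
    rw [Finset.sum_range_add, Finset.sum_eq_zero, zero_add]
    · refine le_trans (le_of_eq (Finset.sum_congr rfl fun k _ => ?_)) (sum_psi_le hψ i N)
      exact if_pos (Nat.le_add_right i k)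
    · exact fun k hk => if_neg (not_le.2 (Finset.mem_range.1 hk))
  have h0 : ∀ m : Fin d → ℤ, 0 ≤ if i ≤ lev m then wt ψ m else 0 := fun m => by
    rw [e]; exact mul_nonneg (by positivity) (ha0 _)
  have hs := summable_of_sum_le h0 key
  exact ⟨hs, hs.tsum_le_of_sum_le key⟩

end

/-! ### Bounds for the coefficients of the shifts -/

section

variable {φ ψ : ℝ → ℝ} {K : (Fin d → ℝ) → (Fin d → ℝ) → 𝕜}
  {T Tt : testSpace 𝕜 d →ₗ[𝕜] ((Fin d → ℝ) →ₘ[volume] 𝕜)}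

lemma norm_entrySum_le (ω : Grid d) (I : Idx d) (η : Fin d → Bool) (m : Fin d → ℤ)
    {c : (Fin d → Bool) → 𝕜} {B E : ℝ} (hB : 0 ≤ B) (hc : ∀ ε, ‖c ε‖ ≤ B)
    (hE : ∀ ε, ‖bform T (cubeT 𝕜 ω (child ω (tr I m) ε)) (haarT 𝕜 ω I η)‖ ≤ E) :
    ‖entrySum T ω I η m c‖ ≤ 2 ^ d * (B * E) := by
  refine (norm_sum_le_of_le _ (f := fun ε => c ε * _) (n := fun _ => B * E) fun ε _ => ?_).trans ?_
  · rw [norm_mul]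
    exact mul_le_mul (hc ε) (hE ε) (norm_nonneg _) hB
  · rw [Finset.sum_const, nsmul_eq_mul, Finset.card_univ, Fintype.card_fun, Fintype.card_bool,
      Fintype.card_fin]
    push_cast
    exact le_rfl

lemma card_filter_anc_le (ω : Grid d) (s : Finset (Fin d → ℤ)) (k : ℕ) (I L : Idx d) :
    ({m ∈ s | anc ω k (tr I m) = L}.card : ℝ) ≤ (2 ^ k) ^ d := by
  have h1 : {m ∈ s | anc ω k (tr I m) = L}.card ≤ (desc ω k L).card := by
    refine Finset.card_le_card_of_injOn (tr I) (fun m hm => ?_) (tr_injective I).injOn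
    exact mem_desc.2 (Finset.mem_filter.1 hm).2
  rw [card_desc, pow_mul] at h1
  exact_mod_cast h1

lemma norm_coefJ_le (ω : Grid d) {i j : ℕ} (hij : j ≤ i) (I L : Idx d) (η η' : Fin d → Bool) {E : ℝ}
    (hE0 : 0 ≤ E) (hE : ∀ m, lev m = i → ∀ ε,
      ‖bform T (cubeT 𝕜 ω (child ω (tr I m) ε)) (haarT 𝕜 ω I η)‖ ≤ E) :
    ‖coefJ T ω i j I L η η'‖ ≤ (2 ^ (i - j)) ^ d * (4 ^ d * ((rt L)⁻¹ * E)) := by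
  have hr := (inv_pos.2 (rt_pos L)).le
  rw [coefJ, if_pos hij]
  refine (norm_sum_le_of_le _ (n := fun _ => 4 ^ d * ((rt L)⁻¹ * E)) fun m hm => ?_).trans ?_
  · have hl := mem_levSet.1 (Finset.mem_filter.1 hm).1
    rw [norm_mul, RCLike.norm_ofReal, abs_of_nonneg (mul_nonneg (half_nonneg _ _)
      (weight_nonneg _ _ _)), show (4 : ℝ) ^ d = 2 ^ d * 2 ^ d by rw [← mul_pow]; norm_num,
      mul_assoc (2 ^ d)]
    refine mul_le_mul ?_ ?_ (norm_nonneg _) (by positivity)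
    · exact (mul_le_of_le_one_left (weight_nonneg _ _ _) (half_le_one _ _)).trans (weight_le _ _ _)
    · exact norm_entrySum_le ω I η m hr (fun ε => norm_haar_le ω L η' _) (hE m hl)
  · rw [Finset.sum_const, nsmul_eq_mul]
    exact mul_le_mul_of_nonneg_right (card_filter_anc_le ω _ _ I L) (by positivity)

lemma rt_div_side (ω : Grid d) {j : ℕ} {L K : Idx d} (h : L ∈ desc ω j K) :
    rt L / side K ^ d = (rt L)⁻¹ * ((2 ^ j) ^ d)⁻¹ := by
  have := rt_pos L
  rw [side_of_mem_desc h, mul_pow, ← rt_sq]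
  field_simp

/-- At most 2^{(i-j)d} translates lie in L, each entry carries 2^{-id}ψ(2^{-i})|I|^{1/2}, and the
Haar function contributes |L|^{-1/2}. The product 2^{-jd}|L|^{-1/2} equals |L|^{1/2}/|K|, which is
the normalization of a shift. -/
lemma norm_coefJ_le_of_pos (hd : 0 < d) (hψ : IsModulus ψ) (h : IsCZOperator ψ K T Tt) (ω : Grid d)
    {i j : ℕ} (hi : 1 ≤ i) (hij : j ≤ i) {Q I L : Idx d} (hL : L ∈ desc ω j Q) {η : Fin d → Bool}
    (hη : η ≠ zeroη d) (η' : Fin d → Bool) :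
    ‖coefJ T ω i j I L η η'‖ ≤ 4 ^ d * offC hd * (czZeroNorm K + czNorm ψ K) * ψ ((1 / 2) ^ i) *
      (rt I * rt L / side Q ^ d) := by
  have h0 := hψ.nonneg (half_pow_pos i).le (half_pow_le_one i)
  have hN : 0 ≤ offC hd * (czZeroNorm K + czNorm ψ K) :=
    mul_nonneg (offC_pos hd).le (add_nonneg (sizeBound_czZeroNorm h.size).1
      (smoothBound_czNorm hψ h.smooth).1)
  have hr := rt_pos I
  refine (norm_coefJ_le ω hij I L η η' (E := offC hd * (czZeroNorm K + czNorm ψ K) * rt I *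
    (((1 / 2) ^ i) ^ d * ψ ((1 / 2) ^ i))) (by positivity) fun m hm ε => ?_).trans (le_of_eq ?_)
  · have hm0 : m ≠ 0 := fun h' => by rw [lev_eq_zero.2 h'] at hm; omega
    have := norm_entry_le hd hψ h ω I hη hm0 ε
    rwa [wt, hm] at this
  · rw [mul_div_assoc, rt_div_side ω hL]
    have e : ((2 : ℝ) ^ (i - j)) ^ d * ((1 / 2) ^ i) ^ d = ((2 ^ j) ^ d)⁻¹ := by
      rw [← mul_pow, ← inv_pow]
      congr 1
      obtain ⟨k, rfl⟩ := Nat.exists_eq_add_of_le hij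
      rw [Nat.add_sub_cancel_left, pow_add, one_div, inv_pow, inv_pow]
      field_simp
    rw [← e]; ring

/-- All translations of scale at least i contribute to the same coefficient, since only the ancestor
of I matters. Their sum is the tail that produces Ψ. -/
lemma norm_coefI_le (hd : 0 < d) (hψ : IsModulus ψ) (h : IsCZOperator ψ K T Tt) (ω : Grid d)
    {i : ℕ} (hi : 1 ≤ i) (I L : Idx d) {η : Fin d → Bool} (hη : η ≠ zeroη d) (η' : Fin d → Bool) :
    ‖coefI T ω i 0 I L η η'‖ ≤ 4 ^ d * offC hd * (czZeroNorm K + czNorm ψ K) *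
      (2 * Psi ψ ((1 / 2) ^ i)) * (rt I * rt L / side L ^ d) := by
  set A := offC hd * (czZeroNorm K + czNorm ψ K) with hA
  have hN : 0 ≤ A :=
    mul_nonneg (offC_pos hd).le (add_nonneg (sizeBound_czZeroNorm h.size).1
      (smoothBound_czNorm hψ h.smooth).1)
  have hr := rt_pos I
  have hL := rt_pos L
  obtain ⟨h1, h2⟩ := tsum_wt_le (d := d) hψ i
  rw [coefI, if_pos ⟨rfl, hi⟩, norm_neg, norm_mul]
  have h3 : ‖∑' m, if i ≤ lev m then (weight I m ω : 𝕜) * entrySum T ω I η m (fun _ => 1) else 0‖ ≤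
      4 ^ d * (A * rt I) * (2 * Psi ψ ((1 / 2) ^ i)) := by
    refine (tsum_of_norm_bounded (h1.hasSum.mul_left (4 ^ d * (A * rt I))) fun m => ?_).trans
      (mul_le_mul_of_nonneg_left h2 (by positivity))
    split_ifs with hm
    · have hm0 : m ≠ 0 := fun h' => by rw [lev_eq_zero.2 h'] at hm; omega
      rw [norm_mul, RCLike.norm_ofReal, abs_of_nonneg (weight_nonneg _ _ _),
        show (4 : ℝ) ^ d = 2 ^ d * 2 ^ d by rw [← mul_pow]; norm_num, mul_assoc, mul_assoc]
      refine mul_le_mul (weight_le _ _ _) ?_ (norm_nonneg _) (by positivity)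
      refine (norm_entrySum_le ω I η m zero_le_one (fun ε => norm_one.le)
        fun ε => norm_entry_le hd hψ h ω I hη hm0 ε).trans (le_of_eq ?_)
      rw [hA]; ring
    · simp
  refine (mul_le_mul (norm_haar_le ω L η' _) h3 (norm_nonneg _) (inv_pos.2 hL).le).trans
    (le_of_eq ?_)
  rw [← rt_sq, hA]
  field_simp

/-- The constant in the bounds for the coefficients. -/
def shiftC (hd : 0 < d) : ℝ := 4 ^ d * (4 * offC hd + (1 + 4 * singC hd))

lemma shiftC_pos (hd : 0 < d) : 0 < shiftC hd := by
  have := singC_pos hd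
  have := offC_pos hd
  unfold shiftC; positivity

lemma norm_coef_le (hd : 0 < d) (hφ : IsModulus φ) (hψ : IsModulus ψ) (h : IsCZOperator ψ K T Tt)
    (ω : Grid d) {i j : ℕ} (hij : 0 < max i j) {Q I L : Idx d} (hL : L ∈ desc ω j Q) (η η' : Fin d → Bool) :
    ‖coef T ω i j I L η η'‖ ≤ shiftC hd * ((czZeroNorm K + czNorm ψ K) * tau d φ ψ i j) *
      (rt I * rt L / side Q ^ d) := by
  have hN : 0 ≤ czZeroNorm K + czNorm ψ K := add_nonneg (sizeBound_czZeroNorm h.size).1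
      (smoothBound_czNorm hψ h.smooth).1
  have hτ := tau_pos (d := d) hφ hψ i j
  have hr := rt_pos I
  have hr' := rt_pos L
  have hQ := side_pos Q
  have hC := shiftC_pos hd
  have ho := offC_pos hd
  have hsing := singC_pos hd
  set ρ := rt I * rt L / side Q ^ d with hρ
  have hρ0 : 0 < ρ := by positivity
  unfold coef
  split_ifs with hz
  · rw [norm_zero]; positivity
  rw [not_or] at hz
  have hX : 0 ≤ 4 ^ d * offC hd * (czZeroNorm K + czNorm ψ K) := by positivity
  have hJ : ‖coefJ T ω i j I L η η'‖ ≤ 4 ^ d * offC hd * (czZeroNorm K + czNorm ψ K) *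
      (2 * tau d φ ψ i j) * ρ := by
    by_cases hji : j ≤ i
    · refine (norm_coefJ_le_of_pos hd hψ h ω (by omega) hji hL hz.1 η').trans ?_
      have := le_two_mul_tau (d := d) hφ hψ i j
      rw [max_eq_left hji] at this
      exact mul_le_mul_of_nonneg_right (mul_le_mul_of_nonneg_left this hX) hρ0.le
    · rw [coefJ, if_neg hji, norm_zero]; positivity
  have hI' : ‖coefI T ω i j I L η η'‖ ≤ 4 ^ d * offC hd * (czZeroNorm K + czNorm ψ K) *
      (2 * tau d φ ψ i j) * ρ := by
    by_cases hji : j = 0 ∧ 1 ≤ i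
    · obtain ⟨rfl, hi⟩ := hji
      have hLQ : L = Q := by simpa [desc] using hL
      subst hLQ
      refine (norm_coefI_le hd hψ h ω hi I L hz.1 η').trans ?_
      exact mul_le_mul_of_nonneg_right (mul_le_mul_of_nonneg_left
        (mul_le_mul_of_nonneg_left (Psi_le_tau hφ hψ i) zero_le_two) hX) hρ0.le
    · rw [coefI, if_neg hji, norm_zero]; positivity
  refine (norm_add_le _ _).trans ((add_le_add hJ hI').trans ?_)
  have : 0 ≤ 4 ^ d * (1 + 4 * singC hd) * ((czZeroNorm K + czNorm ψ K) * tau d φ ψ i j) * ρ := by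
    positivity
  unfold shiftC
  linarith

/-- Only the entries of a cube with itself occur, which explains why weak boundedness replaces the
smoothness constant here. -/
lemma norm_coef_zero_le (hd : 0 < d) (h : IsCZOperator ψ K T Tt) (hw : ∃ C, WeakBound T C)
    (ω : Grid d) {Q I L : Idx d} (hL : L ∈ desc ω 0 Q) (η η' : Fin d → Bool) :
    ‖coef T ω 0 0 I L η η'‖ ≤ shiftC hd * (czZeroNorm K + wbpNorm T) *
      (rt I * rt L / side Q ^ d) := by
  have hN : 0 ≤ czZeroNorm K + wbpNorm T := add_nonneg (sizeBound_czZeroNorm h.size).1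
      (weakBound_wbpNorm hw).1
  have hr := rt_pos I
  have hr' := rt_pos L
  have hQ := side_pos Q
  have hC := shiftC_pos hd
  have ho := offC_pos hd
  have hsing := singC_pos hd
  unfold coef
  split_ifs with hz
  · rw [norm_zero]; positivity
  rw [coefI, if_neg (by omega), add_zero]
  refine (norm_coefJ_le ω le_rfl I L η η' (E := (1 + 4 * singC hd) * (czZeroNorm K + wbpNorm T) *
    rt I) (by positivity) fun m hm ε => ?_).trans ?_
  · rw [lev_eq_zero.1 hm, tr_zero]
    exact norm_entry_self_le hd h hw ω I η ε
  · rw [mul_div_assoc, rt_div_side ω hL]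
    have : 0 ≤ 4 ^ d * (4 * offC hd) * (czZeroNorm K + wbpNorm T) * (rt I * (rt L)⁻¹) := by positivity
    simp only [Nat.sub_self, pow_zero, one_pow, inv_one, one_mul, mul_one]
    unfold shiftC
    linarith

end

end DyadicRep

end

noncomputable section

namespace DyadicRep

variable {d : ℕ} {𝕜 : Type*} [RCLike 𝕜]

/-! ### The shifts and paraproducts of the representation -/

section

variable {φ ψ : ℝ → ℝ} {K : (Fin d → ℝ) → (Fin d → ℝ) → 𝕜}
  {T Tt : testSpace 𝕜 d →ₗ[𝕜] ((Fin d → ℝ) →ₘ[volume] 𝕜)} {R : ℝ} {f g : (Fin d → ℝ) → 𝕜}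

/-- The constant of the representation theorem. -/
def repC (hd : 0 < d) : ℝ := 2 ^ d * (2 * shiftC hd)

lemma repC_pos (hd : 0 < d) : 0 < repC hd := by
  have := shiftC_pos hd
  unfold repC; positivity

/-- The coefficients of the shifts, up to normalization. -/
def totalCoef (T Tt : testSpace 𝕜 d →ₗ[𝕜] ((Fin d → ℝ) →ₘ[volume] 𝕜)) (ω : Grid d) (i j : ℕ) :
    Coeffs 𝕜 d :=
  fun I J _ η η' => coef T ω i j I J η η' + coef Tt ω j i J I η' η

lemma cancCoeffs_totalCoef (T Tt : testSpace 𝕜 d →ₗ[𝕜] ((Fin d → ℝ) →ₘ[volume] 𝕜)) (ω : Grid d)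
    (i j : ℕ) : CancCoeffs (totalCoef T Tt ω i j) := by
  intro I J Q η η' h
  rw [totalCoef, coef, if_pos h, coef, if_pos h.symm, add_zero]

/-- The part of the full expansion that is represented by shifts with parameters `p`. -/
def totalPart (T Tt : testSpace 𝕜 d →ₗ[𝕜] ((Fin d → ℝ) →ₘ[volume] 𝕜)) (ω : Grid d)
    (f g : (Fin d → ℝ) → 𝕜) (p : ℕ × ℕ) : 𝕜 :=
  shiftPart T ω f g p + shiftPart Tt ω g f p.swap

lemma hasSum_totalCoef (hd : 0 < d) (hψ : IsModulus ψ) (h : IsCZOperator ψ K T Tt)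
    (hw : ∃ C, WeakBound T C) (hs : Summable fun k : ℕ => (k : ℝ) * ψ ((1 / 2) ^ k))
    (hf : Nice R f) (hg : Nice R g) (ω : Grid d) (i j : ℕ) :
    HasSum (fun Q => ∑ I ∈ desc ω i Q, ∑ J ∈ desc ω j Q, ∑ η, ∑ η',
      totalCoef T Tt ω i j I J Q η η' * pair f (haar 𝕜 ω I η) * pair g (haar 𝕜 ω J η'))
      (totalPart T Tt ω f g (i, j)) := by
  obtain ⟨C, hC⟩ := hw
  have h1 := hasSum_coef hd hψ h ⟨C, hC⟩ hs hf hg ω i j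
  have h2 := hasSum_coef hd hψ (h.swap hψ) ⟨C, weakBound_swap h hC⟩ hs hg hf ω j i
  refine (h1.add h2).congr_fun fun Q => ?_
  rw [Finset.sum_comm (s := desc ω j Q)]
  simp only [← Finset.sum_add_distrib]
  refine Finset.sum_congr rfl fun I _ => Finset.sum_congr rfl fun J _ => ?_
  simp only [totalCoef, add_mul, Finset.sum_add_distrib]
  congr 1
  rw [Finset.sum_comm]
  exact Finset.sum_congr rfl fun η _ => Finset.sum_congr rfl fun η' _ => by ring

/-- The bound for the coefficients that makes the normalized ones admissible. -/
def TotalBound (hd : 0 < d) (T Tt : testSpace 𝕜 d →ₗ[𝕜] ((Fin d → ℝ) →ₘ[volume] 𝕜)) (ω : Grid d)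
    (i j : ℕ) (N : ℝ) : Prop :=
  ∀ Q, ∀ I ∈ desc ω i Q, ∀ J ∈ desc ω j Q, ∀ η η',
    ‖totalCoef T Tt ω i j I J Q η η'‖ ≤ 2 * shiftC hd * N * (rt I * rt J / side Q ^ d)

lemma totalBound_of_pos (hd : 0 < d) (hφ : IsModulus φ) (hψ : IsModulus ψ)
    (h : IsCZOperator ψ K T Tt) (ω : Grid d) {i j : ℕ} (hij : 0 < max i j) :
    TotalBound hd T Tt ω i j ((czZeroNorm K + czNorm ψ K) * tau d φ ψ i j) := by
  intro Q I hI J hJ η η'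
  have h1 := norm_coef_le hd hφ hψ h ω hij (I := I) hJ η η'
  have h2 := norm_coef_le hd hφ hψ (h.swap hψ) ω (by rwa [max_comm]) (I := J) hI η' η
  have e : tau d φ ψ j i = tau d φ ψ i j := by simp only [tau, max_comm, min_comm]
  rw [czZeroNorm_swap, czNorm_swap, e, mul_comm (rt J)] at h2
  refine (norm_add_le _ _).trans ((add_le_add h1 h2).trans (le_of_eq ?_))
  ring

lemma totalBound_zero (hd : 0 < d) (hψ : IsModulus ψ) (h : IsCZOperator ψ K T Tt)
    (hw : ∃ C, WeakBound T C) (ω : Grid d) :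
    TotalBound hd T Tt ω 0 0 (czZeroNorm K + wbpNorm T) := by
  obtain ⟨C, hC⟩ := hw
  intro Q I hI J hJ η η'
  have h1 := norm_coef_zero_le hd h ⟨C, hC⟩ ω (I := I) hJ η η'
  have h2 := norm_coef_zero_le hd (h.swap hψ) ⟨C, weakBound_swap h hC⟩ ω (I := J) hI η' η
  rw [czZeroNorm_swap, wbpNorm_swap hψ h, mul_comm (rt J)] at h2
  refine (norm_add_le _ _).trans ((add_le_add h1 h2).trans (le_of_eq ?_))
  ring

/-- The raw coefficients are divided by their bound. The first identity transfers summability and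
integrability to the shift; the second one recovers the expansion without a division. -/
lemma exists_shift (hd : 0 < d) {ω : Grid d} {i j : ℕ} {N : ℝ} (hN : 0 ≤ N)
    (hb : TotalBound hd T Tt ω i j N) :
    ∃ S : L2 𝕜 d →L[𝕜] L2 𝕜 d, IsCancellativeShift ω i j S ∧
      ∀ (F G : L2 𝕜 d) (s : 𝕜), HasSum (fun Q => ∑ I ∈ desc ω i Q, ∑ J ∈ desc ω j Q, ∑ η, ∑ η',
        totalCoef T Tt ω i j I J Q η η' * pair F (haar 𝕜 ω I η) * pair G (haar 𝕜 ω J η')) s →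
        pair G (S F) = ((repC hd * N : ℝ) : 𝕜)⁻¹ * s ∧ ((repC hd * N : ℝ) : 𝕜) * pair G (S F) = s := by
  have hC := shiftC_pos hd
  set z : 𝕜 := ((repC hd * N : ℝ) : 𝕜) with hz
  -- If N = 0, the inverse is 0 by convention and the shift is the zero operator.
  set a : Coeffs 𝕜 d := fun I J Q η η' => z⁻¹ * totalCoef T Tt ω i j I J Q η η' with ha
  have hcanc : CancCoeffs a := fun I J Q η η' h => by
    simp only [ha]
    rw [cancCoeffs_totalCoef T Tt ω i j I J Q η η' h, mul_zero]
  have hbd : CoeffBound ω i j a := by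
    intro Q I hI J hJ η η'
    have hρ : 0 ≤ rt I * rt J / side Q ^ d := by
      have := rt_pos I
      have := rt_pos J
      have := side_pos Q
      positivity
    simp only [ha]
    rw [norm_mul, norm_inv, hz, RCLike.norm_ofReal, abs_of_nonneg (mul_nonneg (repC_pos hd).le hN)]
    refine (mul_le_mul_of_nonneg_left (hb Q I hI J hJ η η')
      (inv_nonneg.2 (mul_nonneg (repC_pos hd).le hN))).trans ?_
    rw [← mul_assoc]
    refine mul_le_mul_of_nonneg_right ?_ hρ
    rcases hN.eq_or_lt with rfl | hN'
    · simp
    · unfold repC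
      refine le_of_eq ?_
      field_simp
  -- For N = 0 the bound forces the raw coefficients to vanish, so multiplication by z still
  -- recovers them.
  have hza : ∀ Q, ∀ I ∈ desc ω i Q, ∀ J ∈ desc ω j Q, ∀ η η',
      z * a I J Q η η' = totalCoef T Tt ω i j I J Q η η' := by
    intro Q I hI J hJ η η'
    simp only [ha]
    rcases hN.eq_or_lt with rfl | hN'
    · have := hb Q I hI J hJ η η'
      rw [mul_zero, zero_mul, norm_le_zero_iff] at this
      rw [this, mul_zero, mul_zero]
    · rw [mul_inv_cancel_left₀]
      rw [hz, RCLike.ofReal_ne_zero]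
      exact (mul_pos (repC_pos hd) hN').ne'
  obtain ⟨S, -, hSa⟩ := exists_isShiftWith ω i j hcanc hbd
  refine ⟨S, ⟨a, hcanc, hSa⟩, fun F G s hs => ?_⟩
  have h1 := (pairCLM G).hasSum (hSa.hasSum F)
  simp only [pairCLM_apply, pair_avgOp] at h1
  constructor
  · refine h1.unique ((hs.mul_left z⁻¹).congr_fun fun Q => ?_)
    simp only [Finset.mul_sum, ha, mul_assoc]
  · refine (h1.mul_left z).unique (hs.congr_fun fun Q => ?_)
    simp only [Finset.mul_sum]
    refine Finset.sum_congr rfl fun I hI => Finset.sum_congr rfl fun J hJ =>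
      Finset.sum_congr rfl fun η _ => Finset.sum_congr rfl fun η' _ => ?_
    rw [← hza Q I hI J hJ η η']; ring

lemma pair_paraproduct {b : (Fin d → ℝ) → 𝕜} {ω : Grid d} {P : L2 𝕜 d →L[𝕜] L2 𝕜 d}
    (hP : IsParaproduct ω b P) (hf : ContDiff ℝ 1 f) (hf' : HasCompactSupport f)
    (hg : ContDiff ℝ 1 g) (hg' : HasCompactSupport g) (hs : Summable (paraTerm b ω f g)) :
    pair (c1L2 f hf hf') (P (c1L2 g hg hg')) = ∑' p, paraTerm b ω f g p := by
  have h1 := (pairCLM (c1L2 f hf hf')).hasSum (hP (c1L2 g hg hg'))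
  rw [pairCLM_apply] at h1
  refine h1.unique ((hs.hasSum.prod_fiberwise fun Q => hasSum_fintype _).congr_fun fun Q => ?_)
  simp only [map_sum, map_smul, pairCLM_apply, pair_haarL2, pair_c1L2_haar,
    smul_eq_mul, paraTerm]
  rw [Finset.sum_filter]
  refine Finset.sum_congr rfl fun η _ => ?_
  split_ifs with hη
  · rw [hcf_of_ne ω f Q hη, ← av_c1L2 ω hg hg' Q, av]
  · rw [not_not] at hη
    rw [hη, hcf_zero, mul_zero]

lemma integrable_shiftPart_zero (hd : 0 < d) (hψ : IsModulus ψ) (h : IsCZOperator ψ K T Tt)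
    (hw : ∃ C, WeakBound T C) (hf : Nice R f) (hg : Nice R g) :
    Integrable (fun ω => shiftPart T ω f g (0, 0)) (gridMeasure d) := by
  simp only [shiftPart_zero T hg]
  refine (integral_tsum_of_bound (F := fun q ω => if q.2 = 0 then wTerm T f g q ω else 0)
    (c := fun q => 2 ^ d * (2 ^ d * (2 * 2 ^ d) * kerC hd ψ K T) * termB ψ R q)
    (fun q => ?_) (fun q ω => ?_) ((summable_termB hd hψ hf.one_le).mul_left _)).1
  · by_cases hq : q.2 = 0
    · simp only [if_pos hq]
      exact measurable_wTerm h hf hg q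
    · simp only [if_neg hq]
      exact measurable_const
  · split_ifs
    · exact norm_wTerm_le hd hψ h hw hf hg q ω
    · rw [norm_zero]
      exact (norm_nonneg _).trans (norm_wTerm_le hd hψ h hw hf hg q ω)

lemma integrable_tsum_wTerm (hd : 0 < d) (hψ : IsModulus ψ) (h : IsCZOperator ψ K T Tt)
    (hw : ∃ C, WeakBound T C) (hf : Nice R f) (hg : Nice R g) :
    Integrable (fun ω => ∑' q, wTerm T f g q ω) (gridMeasure d) :=
  (integral_tsum_of_bound (measurable_wTerm h hf hg) (norm_wTerm_le hd hψ h hw hf hg)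
    ((summable_termB hd hψ hf.one_le).mul_left _)).1

lemma hasSum_of_max_pos {Y : ℕ × ℕ → 𝕜} {s : 𝕜} (h : HasSum Y s) :
    HasSum (fun p : {p : ℕ × ℕ // 0 < max p.1 p.2} => Y p.1) (s - Y (0, 0)) := by
  refine (hasSum_subtype_iff_indicator (f := Y) (s := {p : ℕ × ℕ | 0 < max p.1 p.2})).2
    ((hasSum_ite_sub_hasSum h (0, 0)).congr_fun ?_)
  rintro ⟨i, j⟩
  by_cases hij : 0 < max i j
  · rw [indicator_of_mem (by exact hij), if_neg]
    intro h0
    rw [Prod.mk.injEq] at h0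
    omega
  · rw [indicator_of_notMem (by exact hij), if_pos]
    rw [Prod.mk.injEq]
    omega

lemma hasSum_totalPart (hd : 0 < d) (hψ : IsModulus ψ) (h : IsCZOperator ψ K T Tt)
    (hw : ∃ C, WeakBound T C) (hs : Summable fun k : ℕ => (k : ℝ) * ψ ((1 / 2) ^ k))
    (hf : Nice R f) (hg : Nice R g) (ω : Grid d) :
    HasSum (totalPart T Tt ω f g) (∑' q, wTerm T f g q ω + ∑' q, wTerm Tt g f q ω) := by
  obtain ⟨C, hC⟩ := hw
  exact (hasSum_shiftPart hd hψ h ⟨C, hC⟩ hs hf hg ω).add ((Equiv.prodComm ℕ ℕ).hasSum_iff.2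
    (hasSum_shiftPart hd hψ (h.swap hψ) ⟨C, weakBound_swap h hC⟩ hs hg hf ω))

end

end DyadicRep

end

/-! ### The representation theorem. -/

theorem mainTheorem2 (d : ℕ) (hd : 0 < d) :
    ∃ c : ℝ, 0 < c ∧ ∀ (𝕜 : Type) [RCLike 𝕜] (φ ψ : ℝ → ℝ),
      DyadicRep.IsModulus φ → Tendsto (fun t => φ t / t) (𝓝[>] 0) atTop →
      DyadicRep.IsModulus ψ →
      Summable (fun p : ℕ × ℕ => DyadicRep.tau d φ ψ p.1 p.2) →
      ∀ (K : (Fin d → ℝ) → (Fin d → ℝ) → 𝕜)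
        (T Tt : DyadicRep.testSpace 𝕜 d →ₗ[𝕜] ((Fin d → ℝ) →ₘ[volume] 𝕜)),
      DyadicRep.IsCZOperator ψ K T Tt →
      (∃ C, DyadicRep.WeakBound T C) →
      ∀ b₁ b₂ : (Fin d → ℝ) → 𝕜,
      DyadicRep.IsBMO b₁ → DyadicRep.IsImageOfOne Tt b₁ →
      DyadicRep.IsBMO b₂ → DyadicRep.IsImageOfOne T b₂ →
      ∃ (S : DyadicRep.Grid d → ℕ → ℕ → DyadicRep.L2 𝕜 d →L[𝕜] DyadicRep.L2 𝕜 d)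
        (P₁ P₂ : DyadicRep.Grid d → DyadicRep.L2 𝕜 d →L[𝕜] DyadicRep.L2 𝕜 d),
        (∀ ω i j, DyadicRep.IsCancellativeShift ω i j (S ω i j)) ∧
        (∀ ω, DyadicRep.IsParaproduct ω b₁ (P₁ ω)) ∧
        (∀ ω, DyadicRep.IsParaproduct ω b₂ (P₂ ω)) ∧
        ∀ (f g : (Fin d → ℝ) → 𝕜) (hf : ContDiff ℝ 1 f) (hf' : HasCompactSupport f)
          (hg : ContDiff ℝ 1 g) (hg' : HasCompactSupport g),
          let F := DyadicRep.c1L2 f hf hf'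
          let G := DyadicRep.c1L2 g hg hg'
          let X : DyadicRep.Grid d → {p : ℕ × ℕ // 0 < max p.1 p.2} → 𝕜 := fun ω p =>
            (DyadicRep.tau d φ ψ p.1.1 p.1.2 : 𝕜) *
              DyadicRep.pair G (S ω p.1.1 p.1.2 F)
          (∀ ω, Summable (X ω)) ∧
          Integrable (fun ω => ∑' p, X ω p) (DyadicRep.gridMeasure d) ∧
          Integrable (fun ω => DyadicRep.pair G (S ω 0 0 F)) (DyadicRep.gridMeasure d) ∧
          Integrable (fun ω => DyadicRep.pair G (P₁ ω F)) (DyadicRep.gridMeasure d) ∧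
          Integrable (fun ω => DyadicRep.pair (P₂ ω G) F) (DyadicRep.gridMeasure d) ∧
          DyadicRep.pair g (T (DyadicRep.ofC1 f hf hf')) =
            ((c * (DyadicRep.czZeroNorm K + DyadicRep.czNorm ψ K) : ℝ) : 𝕜) *
                ∫ ω, ∑' p, X ω p ∂(DyadicRep.gridMeasure d) +
              ((c * (DyadicRep.czZeroNorm K + DyadicRep.wbpNorm T) : ℝ) : 𝕜) *
                ∫ ω, DyadicRep.pair G (S ω 0 0 F) ∂(DyadicRep.gridMeasure d) +
              ∫ ω, DyadicRep.pair G (P₁ ω F) ∂(DyadicRep.gridMeasure d) +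
              ∫ ω, DyadicRep.pair (P₂ ω G) F ∂(DyadicRep.gridMeasure d) := by
  refine ⟨DyadicRep.repC hd, DyadicRep.repC_pos hd, ?_⟩
  intro 𝕜 _ φ ψ hφ _ hψ hτ K T Tt h hw b₁ b₂ hb₁ hi₁ hb₂ hi₂
  have hw' : ∃ C, DyadicRep.WeakBound Tt C := hw.imp fun C hC => DyadicRep.weakBound_swap h hC
  have h' := h.swap hψ
  set N := DyadicRep.czZeroNorm K + DyadicRep.czNorm ψ K with hN
  set N₀ := DyadicRep.czZeroNorm K + DyadicRep.wbpNorm T with hN₀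
  have hN0 : 0 ≤ N := add_nonneg (DyadicRep.sizeBound_czZeroNorm h.size).1
    (DyadicRep.smoothBound_czNorm hψ h.smooth).1
  have hN₀0 : 0 ≤ N₀ := add_nonneg (DyadicRep.sizeBound_czZeroNorm h.size).1
    (DyadicRep.weakBound_wbpNorm hw).1
  have hτ0 : ∀ i j, 0 < DyadicRep.tau d φ ψ i j := DyadicRep.tau_pos hφ hψ
  have hs := DyadicRep.summable_mul_psi hφ hψ hτ
  -- The normalization of the shifts. Only the parameters (0,0) involve the weak boundedness
  -- constant.
  set M : ℕ → ℕ → ℝ := fun i j => if 0 < max i j then N * DyadicRep.tau d φ ψ i j else N₀ with hM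
  have hM0 : ∀ i j, 0 ≤ M i j := fun i j => by
    simp only [hM]
    split_ifs
    · exact mul_nonneg hN0 (hτ0 i j).le
    · exact hN₀0
  have hb : ∀ ω i j, DyadicRep.TotalBound hd T Tt ω i j (M i j) := fun ω i j => by
    simp only [hM]
    split_ifs with hij
    · exact DyadicRep.totalBound_of_pos hd hφ hψ h ω hij
    · obtain ⟨rfl, rfl⟩ : i = 0 ∧ j = 0 := by omega
      exact DyadicRep.totalBound_zero hd hψ h hw ω
  choose S hSc hS using fun ω i j => DyadicRep.exists_shift hd (hM0 i j) (hb ω i j)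
  choose P₁ hP₁ using DyadicRep.exists_isParaproduct hb₁
  choose P₂ hP₂ using DyadicRep.exists_isParaproduct hb₂
  refine ⟨S, P₁, P₂, hSc, hP₁, hP₂, ?_⟩
  intro f g hf hf' hg hg' F G X
  obtain ⟨R, hnf, hng⟩ := DyadicRep.exists_nice hf hf' hg hg'
  set Y := fun ω => DyadicRep.totalPart T Tt ω f g
  have hpair : ∀ ω i j, DyadicRep.pair G (S ω i j F) =
      ((DyadicRep.repC hd * M i j : ℝ) : 𝕜)⁻¹ * Y ω (i, j) ∧
      ((DyadicRep.repC hd * M i j : ℝ) : 𝕜) * DyadicRep.pair G (S ω i j F) = Y ω (i, j) := by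
    intro ω i j
    refine hS ω i j F G _ ?_
    simp only [F, G, DyadicRep.pair_c1L2_haar]
    exact DyadicRep.hasSum_totalCoef hd hψ h hw hs hnf hng ω i j
  have hYpos : ∀ ω, HasSum (fun p : {p : ℕ × ℕ // 0 < max p.1 p.2} => Y ω p.1)
      (∑' q, DyadicRep.wTerm T f g q ω + ∑' q, DyadicRep.wTerm Tt g f q ω - Y ω (0, 0)) := by
    exact fun ω => DyadicRep.hasSum_of_max_pos (DyadicRep.hasSum_totalPart hd hψ h hw hs hnf hng ω)
  -- The positive factor τ cancels, so summability of `X` is inherited from the expansion. This also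
  -- holds for N = 0, where both sides vanish.
  have hX1 : ∀ ω p, X ω p = ((DyadicRep.repC hd * N : ℝ) : 𝕜)⁻¹ * Y ω p.1 := by
    rintro ω ⟨⟨i, j⟩, hij⟩
    have hne : (DyadicRep.tau d φ ψ i j : 𝕜) ≠ 0 := RCLike.ofReal_ne_zero.2 (hτ0 i j).ne'
    simp only [X]
    rw [(hpair ω i j).1]
    simp only [hM, if_pos (show 0 < max i j from hij)]
    push_cast
    rw [mul_inv, mul_inv, mul_inv]
    field_simp
  have hX2 : ∀ ω p, ((DyadicRep.repC hd * N : ℝ) : 𝕜) * X ω p = Y ω p.1 := by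
    rintro ω ⟨⟨i, j⟩, hij⟩
    rw [← (hpair ω i j).2]
    simp only [hM, X, if_pos (show 0 < max i j from hij)]
    push_cast
    ring
  have hWT := DyadicRep.integrable_tsum_wTerm hd hψ h hw hnf hng
  have hWTt := DyadicRep.integrable_tsum_wTerm hd hψ h' hw' hng hnf
  have hY0 : Integrable (fun ω => Y ω (0, 0)) (DyadicRep.gridMeasure d) :=
    (DyadicRep.integrable_shiftPart_zero hd hψ h hw hnf hng).add
      (DyadicRep.integrable_shiftPart_zero hd hψ h' hw' hng hnf)
  have hM00 : M 0 0 = N₀ := if_neg (by simp)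
  obtain ⟨p1s, p1i⟩ := DyadicRep.integral_tsum_paraTerm hd hb₁ hng hnf
  obtain ⟨p2s, p2i⟩ := DyadicRep.integral_tsum_paraTerm hd hb₂ hnf hng
  have hp1 : ∀ ω, DyadicRep.pair G (P₁ ω F) = ∑' p, DyadicRep.paraTerm b₁ ω g f p := fun ω =>
    DyadicRep.pair_paraproduct (hP₁ ω) hg hg' hf hf' (p1s ω)
  have hp2 : ∀ ω, DyadicRep.pair (P₂ ω G) F = ∑' p, DyadicRep.paraTerm b₂ ω f g p := fun ω => by
    rw [DyadicRep.pair_comm]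
    exact DyadicRep.pair_paraproduct (hP₂ ω) hf hf' hg hg' (p2s ω)
  -- The closed form gives integrability in ω of the whole series: it is the full weighted expansion
  -- minus its (0,0) part, so the individual shifts need not be examined.
  have hXsum : ∀ ω, ∑' p, X ω p = ((DyadicRep.repC hd * N : ℝ) : 𝕜)⁻¹ *
      (∑' q, DyadicRep.wTerm T f g q ω + ∑' q, DyadicRep.wTerm Tt g f q ω - Y ω (0, 0)) := fun ω => by
    rw [tsum_congr (hX1 ω), tsum_mul_left, (hYpos ω).tsum_eq]
  refine ⟨fun ω => ((hYpos ω).summable.mul_left _).congr fun p => (hX1 ω p).symm, ?_, ?_, ?_, ?_, ?_⟩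
  · simp only [hXsum]
    exact ((hWT.add hWTt).sub hY0).const_mul _
  · simp only [fun ω => (hpair ω 0 0).1]
    exact hY0.const_mul _
  · simp only [hp1]
    exact p1i
  · simp only [hp2]
    exact p2i
  have e1 : ((DyadicRep.repC hd * N : ℝ) : 𝕜) * ∫ ω, ∑' p, X ω p ∂(DyadicRep.gridMeasure d) =
      ∫ ω, ∑' q, DyadicRep.wTerm T f g q ω ∂(DyadicRep.gridMeasure d) +
        ∫ ω, ∑' q, DyadicRep.wTerm Tt g f q ω ∂(DyadicRep.gridMeasure d) -
        ∫ ω, Y ω (0, 0) ∂(DyadicRep.gridMeasure d) := by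
    rw [← integral_const_mul, ← integral_add hWT hWTt]
    refine Eq.trans (integral_congr_ae (Eventually.of_forall fun ω => ?_))
      (integral_sub (hWT.add hWTt) hY0)
    simp only
    rw [← tsum_mul_left, tsum_congr (hX2 ω), (hYpos ω).tsum_eq]
  have e2 : ((DyadicRep.repC hd * N₀ : ℝ) : 𝕜) *
      ∫ ω, DyadicRep.pair G (S ω 0 0 F) ∂(DyadicRep.gridMeasure d) =
        ∫ ω, Y ω (0, 0) ∂(DyadicRep.gridMeasure d) := by
    rw [← integral_const_mul, ← hM00]
    exact integral_congr_ae (Eventually.of_forall fun ω => (hpair ω 0 0).2)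
  rw [e1, e2]
  simp only [hp1, hp2]
  have main := DyadicRep.bform_eq_integral (f := DyadicRep.ofC1 f hf hf')
    (g := DyadicRep.ofC1 g hg hg') hd hψ h hw hi₁ hi₂ hb₁ hb₂ hnf hng
  rw [sub_add_cancel]
  exact main
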